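/- Let $\Bbbk$ be a field of characteristic different from $2$ containing a square root $\sqrt{-1}$ of $-1$, which we fix. **Data.** Let $A=(a_{ij})_{i,j\in I}$ be a generalized Cartan matrix ($a_{ii}=2$; $a_{ij}\in\mathbb Z_{\le 0}$ for $i\neq j$; $a_{ij}=0\Leftrightarrow a_{ji}=0$) with symmetrizer $(d_i)_{i\in I}$, $d_i\in\mathbb Z_{>0}$, $d_ia_{ij}=d_ja_{ji}$, and let $I=I_{\mathsf{even}}\sqcup I_{\mathsf{odd}}$ be a decomposition with $a_{ij}\in 2\mathbb Z$ for $i\in I_{\mathsf{odd}}$, $j\in I$ (a Cartan superdatum). Let $\mathsf Q^+=\bigoplus_{i\in I}\mathbb Z_{\ge0}\alpha_i$ be the positive cone of the root lattice, $|\sum m_i\alpha_i|=\sum m_i$, and let $(\cdot,\cdot)$ be the symmetric bilinear form with $(\alpha_i,\alpha_j)=d_ia_{ij}$. For $i\ne j$ let $S_{ij}$ be the set of $(r,s)\in\mathbb Z^2$ with $0\le r\le -a_{ij}$, $0\le s\le -a_{ji}$, $a_{ji}r+a_{ij}s=-a_{ij}a_{ji}$, $r$ even if $i\in I_{\mathsf{odd}}$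 and $s$ even if $j\in I_{\mathsf{odd}}$; let $t_{i,j;r,s}\in\Bbbk$ ($(r,s)\in S_{ij}$) satisfy $t_{i,j;r,s}=t_{j,i;s,r}$ and $t_{i,j;-a_{ij},0}\ne0$; put $\mathcal Q_{ij}(w,z)=\sum_{(r,s)\in S_{ij}}t_{i,j;r,s}w^rz^s$ for $i\neq j$ and $\mathcal Q_{ii}=0$. Let $J=I_{\mathsf{even}}\times\{0,1\}\sqcup I_{\mathsf{odd}}\times\{0\}$ with projections $\pi_1,\pi_2$ and with the involution $c(i,\varepsilon)=(i,1-\varepsilon)$ for $i\in I_{\mathsf{even}}$, $c(i,0)=(i,0)$ for $i\in I_{\mathsf{odd}}$, and put $\tilde{\mathcal Q}_{i,j}(u,v)=\mathcal Q_{\pi_1(i),\pi_1(j)}((-1)^{\pi_2(i)}u,(-1)^{\pi_2(j)}v)$ for $i,j\in J$. For $\beta\in\mathsf Q^+$ with $|\beta|=n$ let $J^\beta=\{\nu\in J^n:\sum_p\alpha_{\pi_1(\nu_p)}=\beta\}$, let $c_p(\nu)$ be $\nu$ with $\nu_p$ replaced by $c(\nu_p)$, and let $s_a(\nu)$ be $\nu$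 with $\nu_a,\nu_{a+1}$ interchanged. **The algebra.** The quiver Hecke–Clifford superalgebra $RC_\beta$ is the $\Bbbk$-superalgebra generated by even elements $e(\nu)$ ($\nu\in J^\beta$), $x_p$ ($1\le p\le n$), $\sigma_a$ ($1\le a<n$) and odd elements $\mathsf c_p$ ($1\le p\le n$), with relations - $e(\mu)e(\nu)=\delta_{\mu\nu}e(\mu)$, $\sum_\nu e(\nu)=1$, $x_pe(\nu)=e(\nu)x_p$, $\mathsf c_pe(\nu)=e(c_p(\nu))\mathsf c_p$; - $x_px_qe(\nu)=x_qx_pe(\nu)$, $\mathsf c_p\mathsf c_q+\mathsf c_q\mathsf c_p=2\delta_{pq}$, $\mathsf c_px_q=(-1)^{\delta_{pq}}x_q\mathsf c_p$; - $\sigma_ae(\nu)=e(s_a(\nu))\sigma_a$, $\sigma_a\mathsf c_p=\mathsf c_{s_a(p)}\sigma_a$, $\sigma_ax_pe(\nu)=x_p\sigma_ae(\nu)$ for $p\ne a,a+1$; - $(\sigma_ax_{a+1}-x_a\sigma_a)e(\nu)=\delta_{\nu_a,\nu_{a+1}}e(\nu)-\delta_{\nu_a,c(\nu_{a+1})}\mathsf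 c_a\mathsf c_{a+1}e(\nu)$; - $(x_{a+1}\sigma_a-\sigma_ax_a)e(\nu)=\delta_{\nu_a,\nu_{a+1}}e(\nu)+\delta_{\nu_a,c(\nu_{a+1})}\mathsf c_a\mathsf c_{a+1}e(\nu)$; - $\sigma_a^2e(\nu)=\tilde{\mathcal Q}_{\nu_a,\nu_{a+1}}(x_a,x_{a+1})e(\nu)$, and $\sigma_a\sigma_b=\sigma_b\sigma_a$ for $|a-b|>1$; - $(\sigma_{a+1}\sigma_a\sigma_{a+1}-\sigma_a\sigma_{a+1}\sigma_a)e(\nu)=\delta_{\nu_a,\nu_{a+2}}\frac{\tilde{\mathcal Q}_{\nu_a,\nu_{a+1}}(x_{a+2},x_{a+1})-\tilde{\mathcal Q}_{\nu_a,\nu_{a+1}}(x_a,x_{a+1})}{x_{a+2}-x_a}e(\nu)+\delta_{\nu_a,c(\nu_{a+2})}\frac{\tilde{\mathcal Q}_{\nu_a,\nu_{a+1}}(x_{a+2},x_{a+1})-\tilde{\mathcal Q}_{\nu_a,\nu_{a+1}}(-x_a,x_{a+1})}{x_{a+2}+x_a}\mathsf c_a\mathsf c_{a+2}e(\nu)$,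 the quotients being divided differences of polynomials. It is $\mathbb Z$-graded by $\deg e(\nu)=\deg\mathsf c_p=0$, $\deg x_pe(\nu)=2d_{\pi_1(\nu_p)}$, $\deg\sigma_ae(\nu)=-(\alpha_{\pi_1(\nu_a)},\alpha_{\pi_1(\nu_{a+1})})$. Let $\psi$ be the even linear bijection of $RC_\beta$ with $\psi(ab)=(-1)^{|a||b|}\psi(b)\psi(a)$ for homogeneous $a,b$ (where $|\cdot|$ is the parity) that fixes $e(\nu),x_p,\sigma_a$ and maps $\mathsf c_p$ to $-\sqrt{-1}\,\mathsf c_p$. **Modules.** A graded $RC_\beta$-supermodule is an $RC_\beta$-module $M=\bigoplus_{d\in\mathbb Z}\bigoplus_{p\in\mathbb Z/2}M_{d,p}$ on which $RC_\beta$ acts homogeneously for degree and parity; $M_d=M_{d,0}\oplus M_{d,1}$, and $q^rM$ is the shift, $(q^rM)_d=M_{d-r}$. Let $RC_\beta\text{-}\mathsf{sgMod}_{\mathsf L}$ be the class of those $M$ for which every $M_d$ is finite-dimensional and $M_d=0$ for $d\ll0$. The graded dual is $M^*=\bigoplus_{d}\operatorname{Hom}_\Bbbk(M_d,\Bbbk)$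 with $(M^*)_d=\operatorname{Hom}_\Bbbk(M_{-d},\Bbbk)$ and the natural parity; it is a left module by $(a\cdot f)(m)=(-1)^{|a||f|}f(\psi(a)m)$ for homogeneous $a,f$. For $\beta_1,\beta_2\in\mathsf Q^+$ with $n_1=|\beta_1|$ let $e(\beta_1,\beta_2)\in RC_{\beta_1+\beta_2}$ be the sum of the $e(\nu)$ with $(\nu_1,\dots,\nu_{n_1})\in J^{\beta_1}$. Let $RC_{\beta_1}\otimes RC_{\beta_2}\to e(\beta_1,\beta_2)RC_{\beta_1+\beta_2}e(\beta_1,\beta_2)$ be the homomorphism of superalgebras with $e(\nu)\otimes e(\eta)\mapsto e(\nu*\eta)$ (concatenation), which maps $x_p,\sigma_a,\mathsf c_p$ of the first factor to $x_p,\sigma_a,\mathsf c_p$, and those of the second factor to $x_{n_1+p},\sigma_{n_1+a},\mathsf c_{n_1+p}$, multiplied by $e(\beta_1,\beta_2)$. For graded supermodules $M_1$, $M_2$ over $RC_{\beta_1}$, $RC_{\beta_2}$ the convolution product is $$M_1\circ M_2=RC_{\beta_1+\beta_2}e(\beta_1,\beta_2)\otimes_{RC_{\beta_1}\otimes RC_{\beta_2}}(M_1\otimes_\Bbbk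 M_2),$$ where $(a\otimes b)(m_1\otimes m_2)=(-1)^{|b||m_1|}am_1\otimes bm_2$ for homogeneous $b$, $m_1$, with the total degree and parity. **Corollary.** For $M_i\in RC_{\beta_i}\text{-}\mathsf{sgMod}_{\mathsf L}$ ($i=1,2$) there is an isomorphism of graded $RC_{\beta_1+\beta_2}$-supermodules (even and preserving the $\mathbb Z$-degree) $$(M_1\circ M_2)^*\;\cong\;q^{(\beta_1,\beta_2)}\,M_2^*\circ M_1^*.$$ -/

import Mathlib

namespace QuiverHeckeClifford

noncomputable section

/-- The sign `(-1)^p` for `p : ZMod 2`. -/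
def sgn (R : Type*) [Ring R] (p : ZMod 2) : R := if p = 0 then 1 else -1

theorem sgn_zero (R : Type*) [Ring R] : sgn R 0 = 1 := rfl

theorem sgn_one (R : Type*) [Ring R] : sgn R 1 = -1 := rfl

theorem sgn_add (R : Type*) [Ring R] (p q : ZMod 2) : sgn R (p + q) = sgn R p * sgn R q := by
  have h : ∀ p : ZMod 2, p = 0 ∨ p = 1 := by decide
  have h1 : (1 : ZMod 2) + 1 = 0 := rfl
  rcases h p with rfl | rfl <;> rcases h q with rfl | rfl <;> simp [sgn_zero, sgn_one, h1]

theorem sgn_mul_self (R : Type*) [Ring R] (p : ZMod 2) : sgn R p * sgn R p = 1 := by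
  have h : ∀ p : ZMod 2, p = 0 ∨ p = 1 := by decide
  rcases h p with rfl | rfl <;> simp [sgn_zero, sgn_one]

/-- A Cartan superdatum: a generalized Cartan matrix `A` with a symmetrizer `diag (d i)` and a
parity function `par` on the index set (`par i = 1` means that `i` is odd) such that the rows of
odd indices are even; together with the scalars `t i j r s` that are the coefficients of the
polynomials `Q i j`. -/
structure Datum (k I : Type*) [Field k] where
  /-- the generalized Cartan matrix -/
  A : I → I → ℤ
  /-- the diagonal entries of the symmetrizer -/
  d : I → ℤ
  /-- the parity of an index -/
  par : I → ZMod 2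
  /-- the scalars `t_{i,j;r,s}` -/
  t : I → I → ℕ → ℕ → k
  A_diag : ∀ i, A i i = 2
  A_nonpos : ∀ i j, i ≠ j → A i j ≤ 0
  A_zero : ∀ i j, A i j = 0 ↔ A j i = 0
  d_pos : ∀ i, 0 < d i
  symm : ∀ i j, d i * A i j = d j * A j i
  A_even : ∀ i j, par i = 1 → Even (A i j)
  t_symm : ∀ i j, i ≠ j → ∀ r s : ℕ,
    ((r : ℤ) ≤ -A i j ∧ (s : ℤ) ≤ -A j i ∧ A j i * r + A i j * s = -(A i j * A j i) ∧
      (par i = 1 → Even r) ∧ (par j = 1 → Even s)) → t i j r s = t j i s r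
  t_ne_zero : ∀ i j, i ≠ j → t i j (-A i j).toNat 0 ≠ 0

/-- The height of `β = ∑ mᵢ αᵢ`, where the element `β` of the positive cone of the root lattice is
recorded by its coordinates with respect to the (linearly independent) simple roots. -/
abbrev ht {I : Type*} (β : I →₀ ℕ) : ℕ := β.degree

namespace Datum

variable {k I : Type*} [Field k] (D : Datum k I)

/-- The symmetric bilinear form on the root lattice, `(αᵢ, αⱼ) = dᵢ aᵢⱼ`. -/
def form (β γ : I →₀ ℕ) : ℤ := β.sum fun i m => γ.sum fun j l => (m : ℤ) * (l : ℤ) * (D.d i * D.A i j)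

/-- The index set `S i j`. -/
def S (i j : I) : Finset (ℕ × ℕ) :=
  (Finset.range ((-D.A i j).toNat + 1) ×ˢ Finset.range ((-D.A j i).toNat + 1)).filter fun p =>
    D.A j i * p.1 + D.A i j * p.2 = -(D.A i j * D.A j i) ∧
      (D.par i = 1 → Even p.1) ∧ (D.par j = 1 → Even p.2)

/-- The set `J`: pairs `(i, ε)` with `ε ∈ {0, 1}`, where `ε = 0` if `i` is odd. -/
abbrev J : Type _ := {p : I × ZMod 2 // D.par p.1 = 1 → p.2 = 0}

variable {D} in
/-- First projection `J → I`. -/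
abbrev J.fst (i : D.J) : I := i.1.1

variable {D} in
/-- Second projection `J → {0, 1}`. -/
abbrev J.snd (i : D.J) : ZMod 2 := i.1.2

variable {D} in
/-- The involution `c` of `J`. -/
def J.c (i : D.J) : D.J :=
  ⟨(i.fst, if D.par i.fst = 1 then i.snd else i.snd + 1), fun h => by
    have h' : D.par i.fst = 1 := h
    simp only [h', if_true]; exact i.2 h'⟩

section Polynomials

variable [DecidableEq I] {B : Type*} [Ring B] [Algebra k B]

/-- The value of the polynomial `Q i j` at a pair of elements of a `k`-algebra. -/
def Q (i j : I) (u v : B) : B :=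
  if i = j then 0 else ∑ p ∈ D.S i j, D.t i j p.1 p.2 • (u ^ p.1 * v ^ p.2)

/-- The value of the divided difference `(Q i j (u', v) - Q i j (u, v)) / (u' - u)`; the quotient of
`u' ^ r - u ^ r` by `u' - u` is written out as a sum. -/
def divQ (i j : I) (u' u v : B) : B :=
  if i = j then 0 else ∑ p ∈ D.S i j,
    D.t i j p.1 p.2 • ((∑ m ∈ Finset.range p.1, u' ^ m * u ^ (p.1 - 1 - m)) * v ^ p.2)

/-- The value of the polynomial `Q̃ i j`, for `i j` in `J`. -/
def Qt (i j : D.J) (u v : B) : B := D.Q i.fst j.fst (sgn k i.snd • u) (sgn k j.snd • v)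

/-- The value of the divided difference `(Q̃ i j (u', v) - Q̃ i j (u, v)) / (u' - u)`. -/
def divQt (i j : D.J) (u' u v : B) : B :=
  sgn k i.snd • D.divQ i.fst j.fst (sgn k i.snd • u') (sgn k i.snd • u) (sgn k j.snd • v)

theorem sub_mul_divQ (i j : I) (u' u v : B) (h : Commute u' u) :
    (u' - u) * D.divQ i j u' u v = D.Q i j u' v - D.Q i j u v := by
  unfold divQ Q
  split_ifs
  · simp
  · rw [Finset.mul_sum, ← Finset.sum_sub_distrib]
    refine Finset.sum_congr rfl fun p _ => ?_
    rw [mul_smul_comm, ← mul_assoc, h.mul_geom_sum₂, sub_mul, smul_sub]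

theorem sub_mul_divQt (i j : D.J) (u' u v : B) (h : Commute u' u) :
    (u' - u) * D.divQt i j u' u v = D.Qt i j u' v - D.Qt i j u v := by
  unfold divQt Qt
  rw [← D.sub_mul_divQ _ _ _ _ _ ((h.smul_left _).smul_right _), ← smul_sub, smul_mul_assoc,
    mul_smul_comm]

end Polynomials

/-- The weight `∑ α_{π₁(νᵢ)}` of a sequence in `J`. -/
def wt {n : ℕ} (ν : Fin n → D.J) : I →₀ ℕ := ∑ i, Finsupp.single (ν i).fst 1

/-- The set `J^β`. -/
abbrev Seq (β : I →₀ ℕ) : Type _ := {ν : Fin (ht β) → D.J // D.wt ν = β}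

end Datum

/-- The index set `{1, …, n - 1}` of the elements `σ_k`, shifted by one. -/
abbrev Adj (n : ℕ) : Type := {a : ℕ // a + 1 < n}

namespace Adj

variable {n : ℕ} (a : Adj n)

/-- The position `a`. -/
def lo : Fin n := ⟨a.1, Nat.lt_of_succ_lt a.2⟩

/-- The position `a + 1`. -/
def hi : Fin n := ⟨a.1 + 1, a.2⟩

/-- The simple transposition `s_a`. -/
def s : Equiv.Perm (Fin n) := Equiv.swap a.lo a.hi

theorem lo_ne_hi : a.lo ≠ a.hi := by simp [lo, hi, Fin.ext_iff]

end Adj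

namespace Datum

variable {k I : Type*} [Field k] (D : Datum k I)

theorem J.c_fst {D : Datum k I} (i : D.J) : i.c.fst = i.fst := rfl

theorem J.c_c {D : Datum k I} (i : D.J) : i.c.c = i := by
  apply Subtype.ext
  apply Prod.ext
  · rfl
  · change (if D.par i.fst = 1 then (if D.par i.fst = 1 then i.snd else i.snd + 1) else
      (if D.par i.fst = 1 then i.snd else i.snd + 1) + 1) = i.snd
    split_ifs
    · rfl
    · rw [add_assoc, show (1 : ZMod 2) + 1 = 0 from rfl, add_zero]

variable {D}

/-- `c_p(ν)`. -/
def Seq.c {β : I →₀ ℕ} (p : Fin (ht β)) (ν : D.Seq β) : D.Seq β :=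
  ⟨Function.update ν.1 p (ν.1 p).c, by
    conv_rhs => rw [← ν.2]
    refine Finset.sum_congr rfl fun i _ => ?_
    by_cases h : i = p
    · subst h; simp [J.c_fst]
    · simp [h]⟩

/-- `s_a(ν)`. -/
def Seq.s {β : I →₀ ℕ} (a : Adj (ht β)) (ν : D.Seq β) : D.Seq β :=
  ⟨ν.1 ∘ a.s, by
    conv_rhs => rw [← ν.2]
    exact Equiv.sum_comp a.s fun i => Finsupp.single (ν.1 i).fst 1⟩

theorem Seq.mem_support {β : I →₀ ℕ} (ν : D.Seq β) (i : Fin (ht β)) : (ν.1 i).fst ∈ β.support := by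
  rw [Finsupp.mem_support_iff]
  have h := DFunLike.congr_fun ν.2 (ν.1 i).fst
  intro h0
  rw [h0, wt, Finsupp.finsetSum_apply, Finset.sum_eq_zero_iff] at h
  simpa using h i (Finset.mem_univ i)

instance Seq.finite (β : I →₀ ℕ) : Finite (D.Seq β) := by
  refine Finite.of_injective
    (fun (ν : D.Seq β) (i : Fin (ht β)) =>
      ((⟨(ν.1 i).fst, ν.mem_support i⟩ : β.support), (ν.1 i).snd)) ?_
  intro ν μ h
  apply Subtype.ext
  funext i
  have := congrFun h i
  simp only [Prod.mk.injEq, Subtype.mk.injEq] at this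
  exact Subtype.ext (Prod.ext this.1 this.2)

instance Seq.fintype (β : I →₀ ℕ) : Fintype (D.Seq β) := Fintype.ofFinite _

section Relations

variable [DecidableEq I] {β : I →₀ ℕ} {B : Type*} [Ring B] [Algebra k B]

/-- The defining relations of the quiver Hecke–Clifford superalgebra for elements `E ν` (the
idempotents), `X p`, `Y a` (the elements `σ_a`) and `C p` of a `k`-algebra. If `ν_a` is fixed by
`c`, then `ν_a = ν_b` and `ν_a = c(ν_b)` can hold together, and both terms are present. -/
inductive Rel (E : D.Seq β → B) (X : Fin (ht β) → B) (Y : Adj (ht β) → B) (C : Fin (ht β) → B) :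
    B → B → Prop
  | e_e (μ ν : D.Seq β) : Rel E X Y C (E μ * E ν) (if μ = ν then E μ else 0)
  | e_sum : Rel E X Y C (∑ ν, E ν) 1
  | x_e (p : Fin (ht β)) (ν : D.Seq β) : Rel E X Y C (X p * E ν) (E ν * X p)
  | c_e (p : Fin (ht β)) (ν : D.Seq β) : Rel E X Y C (C p * E ν) (E (ν.c p) * C p)
  | x_x (p q : Fin (ht β)) (ν : D.Seq β) : Rel E X Y C (X p * X q * E ν) (X q * X p * E ν)
  | c_c (p q : Fin (ht β)) : Rel E X Y C (C p * C q + C q * C p) (if p = q then 2 else 0)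
  | c_x (p q : Fin (ht β)) : Rel E X Y C (C p * X q) ((if p = q then -1 else 1) * (X q * C p))
  | s_e (a : Adj (ht β)) (ν : D.Seq β) : Rel E X Y C (Y a * E ν) (E (ν.s a) * Y a)
  | s_c (a : Adj (ht β)) (p : Fin (ht β)) : Rel E X Y C (Y a * C p) (C (a.s p) * Y a)
  | s_x (a : Adj (ht β)) (p : Fin (ht β)) (ν : D.Seq β) (h : p ≠ a.lo) (h' : p ≠ a.hi) :
      Rel E X Y C (Y a * X p * E ν) (X p * Y a * E ν)
  | s_x_hi (a : Adj (ht β)) (ν : D.Seq β) :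
      Rel E X Y C ((Y a * X a.hi - X a.lo * Y a) * E ν)
        ((if ν.1 a.lo = ν.1 a.hi then E ν else 0) -
          (if ν.1 a.lo = (ν.1 a.hi).c then C a.lo * C a.hi * E ν else 0))
  | s_x_lo (a : Adj (ht β)) (ν : D.Seq β) :
      Rel E X Y C ((X a.hi * Y a - Y a * X a.lo) * E ν)
        ((if ν.1 a.lo = ν.1 a.hi then E ν else 0) +
          (if ν.1 a.lo = (ν.1 a.hi).c then C a.lo * C a.hi * E ν else 0))
  | s_s (a : Adj (ht β)) (ν : D.Seq β) :
      Rel E X Y C (Y a * Y a * E ν) (D.Qt (ν.1 a.lo) (ν.1 a.hi) (X a.lo) (X a.hi) * E ν)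
  | s_comm (a b : Adj (ht β)) (h : a.1 + 1 < b.1) : Rel E X Y C (Y a * Y b) (Y b * Y a)
  | braid (a b : Adj (ht β)) (h : b.1 = a.1 + 1) (ν : D.Seq β) :
      Rel E X Y C ((Y b * Y a * Y b - Y a * Y b * Y a) * E ν)
        ((if ν.1 a.lo = ν.1 b.hi then
            D.divQt (ν.1 a.lo) (ν.1 a.hi) (X b.hi) (X a.lo) (X a.hi) * E ν else 0) +
          (if ν.1 a.lo = (ν.1 b.hi).c then
            D.divQt (ν.1 a.lo) (ν.1 a.hi) (X b.hi) (-X a.lo) (X a.hi) * C a.lo * C b.hi * E ν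
            else 0))

end Relations

/-- The generators of the quiver Hecke–Clifford superalgebra. -/
inductive Gen (D : Datum k I) (β : I →₀ ℕ)
  | e (ν : D.Seq β)
  | x (p : Fin (ht β))
  | s (a : Adj (ht β))
  | c (p : Fin (ht β))

variable (D) [DecidableEq I]

/-- The defining relations in the free algebra on the generators. -/
abbrev FreeRel (β : I →₀ ℕ) : FreeAlgebra k (Gen D β) → FreeAlgebra k (Gen D β) → Prop :=
  Rel (fun ν => FreeAlgebra.ι k (Gen.e ν)) (fun p => FreeAlgebra.ι k (Gen.x p))
    (fun a => FreeAlgebra.ι k (Gen.s a)) (fun p => FreeAlgebra.ι k (Gen.c p))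

/-- The quiver Hecke–Clifford superalgebra `RC_β`. -/
def RC (β : I →₀ ℕ) : Type _ := RingQuot (D.FreeRel β)

instance (β : I →₀ ℕ) : Ring (D.RC β) := inferInstanceAs (Ring (RingQuot (D.FreeRel β)))

instance (β : I →₀ ℕ) : Algebra k (D.RC β) := inferInstanceAs (Algebra k (RingQuot (D.FreeRel β)))

/-- The projection from the free algebra on the generators. -/
def mkRC (β : I →₀ ℕ) : FreeAlgebra k (Gen D β) →ₐ[k] D.RC β := RingQuot.mkAlgHom k (D.FreeRel β)

variable {D} {β : I →₀ ℕ}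

/-- The image of a generator in `RC_β`. -/
def Gen.val (g : Gen D β) : D.RC β := D.mkRC β (FreeAlgebra.ι k g)

/-- The idempotent `e(ν)`. -/
abbrev eRC (ν : D.Seq β) : D.RC β := (Gen.e ν).val

/-- The element `x_p`. -/
abbrev xRC (p : Fin (ht β)) : D.RC β := (Gen.x p : Gen D β).val

/-- The element `σ_a`. -/
abbrev sRC (a : Adj (ht β)) : D.RC β := (Gen.s a : Gen D β).val

/-- The element `c_p`. -/
abbrev cRC (p : Fin (ht β)) : D.RC β := (Gen.c p : Gen D β).val

section Lift

variable {B B' : Type*} [Ring B] [Algebra k B] [Ring B'] [Algebra k B']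

theorem map_Q (f : B →ₐ[k] B') (i j : I) (u v : B) : f (D.Q i j u v) = D.Q i j (f u) (f v) := by
  unfold Q; split_ifs <;> simp

theorem map_divQ (f : B →ₐ[k] B') (i j : I) (u' u v : B) :
    f (D.divQ i j u' u v) = D.divQ i j (f u') (f u) (f v) := by
  unfold divQ; split_ifs <;> simp

theorem map_Qt (f : B →ₐ[k] B') (i j : D.J) (u v : B) : f (D.Qt i j u v) = D.Qt i j (f u) (f v) := by
  simp [Qt, map_Q]

theorem map_divQt (f : B →ₐ[k] B') (i j : D.J) (u' u v : B) :
    f (D.divQt i j u' u v) = D.divQt i j (f u') (f u) (f v) := by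
  simp [divQt, map_divQ]

theorem Rel.map {E : D.Seq β → B} {X : Fin (ht β) → B} {Y : Adj (ht β) → B} {C : Fin (ht β) → B}
    {x y : B} (h : Rel E X Y C x y) (f : B →ₐ[k] B') :
    Rel (fun ν => f (E ν)) (fun p => f (X p)) (fun a => f (Y a)) (fun p => f (C p)) (f x) (f y) := by
  cases h with
  | e_e μ ν =>
    rw [map_mul, apply_ite f, map_zero]
    exact Rel.e_e (E := fun ν => f (E ν)) μ ν
  | e_sum => rw [map_sum, map_one]; exact Rel.e_sum
  | x_e p ν =>
    rw [map_mul, map_mul]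
    exact Rel.x_e (E := fun ν => f (E ν)) (X := fun p => f (X p)) p ν
  | c_e p ν =>
    rw [map_mul, map_mul]
    exact Rel.c_e (E := fun ν => f (E ν)) (C := fun p => f (C p)) p ν
  | x_x p q ν =>
    simp only [map_mul]
    exact Rel.x_x (E := fun ν => f (E ν)) (X := fun p => f (X p)) p q ν
  | c_c p q =>
    rw [map_add, map_mul, map_mul, apply_ite f, map_zero, map_ofNat]
    exact Rel.c_c (C := fun p => f (C p)) p q
  | c_x p q =>
    simp only [map_mul, apply_ite f, map_neg, map_one]
    exact Rel.c_x (X := fun p => f (X p)) (C := fun p => f (C p)) p q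
  | s_e a ν =>
    rw [map_mul, map_mul]
    exact Rel.s_e (E := fun ν => f (E ν)) (Y := fun p => f (Y p)) a ν
  | s_c a p =>
    rw [map_mul, map_mul]
    exact Rel.s_c (Y := fun p => f (Y p)) (C := fun p => f (C p)) a p
  | s_x a p ν h h' =>
    simp only [map_mul]
    exact Rel.s_x (E := fun ν => f (E ν)) (X := fun p => f (X p)) (Y := fun p => f (Y p)) a p ν h h'
  | s_x_hi a ν =>
    simp only [map_mul, map_sub, apply_ite f, map_zero]
    exact Rel.s_x_hi (E := fun ν => f (E ν)) (X := fun p => f (X p)) (Y := fun p => f (Y p))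
      (C := fun p => f (C p)) a ν
  | s_x_lo a ν =>
    simp only [map_mul, map_sub, map_add, apply_ite f, map_zero]
    exact Rel.s_x_lo (E := fun ν => f (E ν)) (X := fun p => f (X p)) (Y := fun p => f (Y p))
      (C := fun p => f (C p)) a ν
  | s_s a ν =>
    simp only [map_mul, map_Qt]
    exact Rel.s_s (E := fun ν => f (E ν)) (X := fun p => f (X p)) (Y := fun p => f (Y p)) a ν
  | s_comm a b h =>
    rw [map_mul, map_mul]
    exact Rel.s_comm (Y := fun p => f (Y p)) a b h
  | braid a b h ν =>
    simp only [map_mul, map_sub, map_add, apply_ite f, map_zero, map_divQt, map_neg]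
    exact Rel.braid (E := fun ν => f (E ν)) (X := fun p => f (X p)) (Y := fun p => f (Y p))
      (C := fun p => f (C p)) a b h ν

theorem Rel.exists_lift {E : D.Seq β → B} {X : Fin (ht β) → B} {Y : Adj (ht β) → B}
    {C : Fin (ht β) → B} (f : B →ₐ[k] B') {x y : B'}
    (h : Rel (fun ν => f (E ν)) (fun p => f (X p)) (fun a => f (Y a)) (fun p => f (C p)) x y) :
    ∃ x' y', Rel E X Y C x' y' ∧ f x' = x ∧ f y' = y := by
  cases h with
  | e_e μ ν => exact ⟨_, _, Rel.e_e μ ν, by simp, by simp [apply_ite f]⟩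
  | e_sum => exact ⟨_, _, Rel.e_sum, by simp, by simp⟩
  | x_e p ν => exact ⟨_, _, Rel.x_e p ν, by simp, by simp⟩
  | c_e p ν => exact ⟨_, _, Rel.c_e p ν, by simp, by simp⟩
  | x_x p q ν => exact ⟨_, _, Rel.x_x p q ν, by simp, by simp⟩
  | c_c p q => exact ⟨_, _, Rel.c_c p q, by simp, by by_cases h : p = q <;> simp [h, map_ofNat f]⟩
  | c_x p q => exact ⟨_, _, Rel.c_x p q, by simp, by rw [map_mul, map_mul]; simp [apply_ite f]⟩
  | s_e a ν => exact ⟨_, _, Rel.s_e a ν, by simp, by simp⟩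
  | s_c a p => exact ⟨_, _, Rel.s_c a p, by simp, by simp⟩
  | s_x a p ν h h' => exact ⟨_, _, Rel.s_x a p ν h h', by simp, by simp⟩
  | s_x_hi a ν => exact ⟨_, _, Rel.s_x_hi a ν, by simp, by simp [apply_ite f]⟩
  | s_x_lo a ν => exact ⟨_, _, Rel.s_x_lo a ν, by simp, by simp [apply_ite f]⟩
  | s_s a ν => exact ⟨_, _, Rel.s_s a ν, by simp, by simp [map_Qt]⟩
  | s_comm a b h => exact ⟨_, _, Rel.s_comm a b h, by simp, by simp⟩
  | braid a b h ν =>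
    exact ⟨_, _, Rel.braid a b h ν, by simp, by simp [apply_ite f, map_divQt]⟩

/-- The defining relations hold in `RC_β`. -/
theorem rel_RC {x y : D.RC β} (h : Rel eRC xRC sRC cRC x y) : x = y := by
  obtain ⟨x', y', h', rfl, rfl⟩ := Rel.exists_lift (D.mkRC β) h
  exact RingQuot.mkAlgHom_rel k h'

/-- The universal property of `RC_β`. -/
def liftRC (g : Gen D β → B)
    (hg : ∀ x y, Rel (fun ν => g (.e ν)) (fun p => g (.x p)) (fun a => g (.s a))
      (fun p => g (.c p)) x y → x = y) : D.RC β →ₐ[k] B :=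
  RingQuot.liftAlgHom k ⟨FreeAlgebra.lift k g, fun x y h => by
    have := Rel.map h (FreeAlgebra.lift k g)
    simp only [FreeAlgebra.lift_ι_apply] at this
    exact hg _ _ this⟩

theorem liftRC_val (g : Gen D β → B) (hg) (a : Gen D β) : liftRC g hg a.val = g a := by
  exact (RingQuot.liftAlgHom_mkAlgHom_apply k _ _ _).trans (by simp)

theorem RC_induction {P : D.RC β → Prop} (hgen : ∀ g : Gen D β, P g.val)
    (hmap : ∀ r : k, P (algebraMap k _ r)) (hadd : ∀ a b, P a → P b → P (a + b))
    (hmul : ∀ a b, P a → P b → P (a * b)) (a : D.RC β) : P a := by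
  obtain ⟨a, rfl⟩ := RingQuot.mkAlgHom_surjective k (D.FreeRel β) a
  induction a using FreeAlgebra.induction with
  | grade0 r => rw [AlgHom.commutes]; exact hmap r
  | grade1 g => exact hgen g
  | mul a b ha hb => rw [map_mul]; exact hmul _ _ ha hb
  | add a b ha hb => rw [map_add]; exact hadd _ _ ha hb

end Lift

/-! ### Consequences of the relations -/

section Basic

theorem e_e (μ ν : D.Seq β) : eRC μ * eRC ν = if μ = ν then eRC μ else 0 := rel_RC (.e_e μ ν)

theorem e_e_self (μ : D.Seq β) : eRC μ * eRC μ = eRC μ := by rw [e_e, if_pos rfl]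

theorem e_sum : ∑ ν : D.Seq β, eRC ν = 1 := rel_RC .e_sum

theorem x_e (p : Fin (ht β)) (ν : D.Seq β) : xRC p * eRC ν = eRC ν * xRC p := rel_RC (.x_e p ν)

theorem c_e (p : Fin (ht β)) (ν : D.Seq β) : cRC p * eRC ν = eRC (ν.c p) * cRC p :=
  rel_RC (.c_e p ν)

theorem s_e (a : Adj (ht β)) (ν : D.Seq β) : sRC a * eRC ν = eRC (ν.s a) * sRC a :=
  rel_RC (.s_e a ν)

theorem eq_of_mul_e {x y : D.RC β} (h : ∀ ν, x * eRC ν = y * eRC ν) : x = y := by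
  rw [← mul_one x, ← mul_one y, ← e_sum, Finset.mul_sum, Finset.mul_sum]
  exact Finset.sum_congr rfl fun ν _ => h ν

theorem x_x (p q : Fin (ht β)) : (xRC p * xRC q : D.RC β) = xRC q * xRC p :=
  eq_of_mul_e fun ν => rel_RC (.x_x p q ν)

theorem c_c (p q : Fin (ht β)) : (cRC p * cRC q + cRC q * cRC p : D.RC β) = if p = q then 2 else 0 :=
  rel_RC (.c_c p q)

theorem c_c_ne {p q : Fin (ht β)} (h : p ≠ q) : (cRC p * cRC q : D.RC β) = -(cRC q * cRC p) := by
  have := c_c (D := D) p q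
  rw [if_neg h] at this
  exact eq_neg_of_add_eq_zero_left this

theorem c_x (p q : Fin (ht β)) :
    (cRC p * xRC q : D.RC β) = (if p = q then -1 else 1) * (xRC q * cRC p) := rel_RC (.c_x p q)

theorem c_x_self (p : Fin (ht β)) : (cRC p * xRC p : D.RC β) = -(xRC p * cRC p) := by
  rw [c_x, if_pos rfl, neg_one_mul]

theorem c_x_ne {p q : Fin (ht β)} (h : p ≠ q) : (cRC p * xRC q : D.RC β) = xRC q * cRC p := by
  rw [c_x, if_neg h, one_mul]

theorem s_c (a : Adj (ht β)) (p : Fin (ht β)) : (sRC a * cRC p : D.RC β) = cRC (a.s p) * sRC a :=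
  rel_RC (.s_c a p)

theorem s_x (a : Adj (ht β)) (p : Fin (ht β)) (h : p ≠ a.lo) (h' : p ≠ a.hi) :
    (sRC a * xRC p : D.RC β) = xRC p * sRC a :=
  eq_of_mul_e fun ν => rel_RC (.s_x a p ν h h')

theorem s_comm (a b : Adj (ht β)) (h : a.1 + 1 < b.1) : (sRC a * sRC b : D.RC β) = sRC b * sRC a :=
  rel_RC (.s_comm a b h)

end Basic

end Datum

end

end QuiverHeckeClifford

namespace QuiverHeckeClifford

noncomputable section

/-! ### Graded vector spaces -/

section Graded

variable {k M : Type*} [Field k] [AddCommGroup M] [Module k M] {ι : Type*} [DecidableEq ι]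
  {V : ι → Submodule k M}

theorem isInternal_of_proj (P : ι → M →ₗ[k] M) (h1 : ∀ i, ∀ v ∈ V i, P i v = v)
    (h2 : ∀ i j, i ≠ j → ∀ v ∈ V j, P i v = 0) (top : iSup V = ⊤) : DirectSum.IsInternal V := by
  refine DirectSum.isInternal_submodule_of_iSupIndep_of_iSup_eq_top ?_ top
  intro i
  rw [Submodule.disjoint_def]
  intro x hx hx'
  have hle : (⨆ j, ⨆ (_ : j ≠ i), V j) ≤ LinearMap.ker (P i) := by
    refine iSup_le fun j => iSup_le fun hj v hv => ?_
    exact h2 i j hj.symm v hv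
  rw [← h1 i x hx]
  exact hle hx'

/-- The decomposition of a vector into homogeneous components. -/
def degMap (h : DirectSum.IsInternal V) : M →ₗ[k] (ι →₀ M) :=
  (DirectSum.toModule k ι (ι →₀ M) fun i => Finsupp.lsingle i ∘ₗ (V i).subtype) ∘ₗ
    (LinearEquiv.ofBijective (DirectSum.coeLinearMap V) h).symm.toLinearMap

theorem degMap_of_mem (h : DirectSum.IsInternal V) {i : ι} {v : M} (hv : v ∈ V i) :
    degMap h v = Finsupp.single i v := by
  have : (LinearEquiv.ofBijective (DirectSum.coeLinearMap V) h).symm v =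
      DirectSum.lof k ι (fun i => V i) i ⟨v, hv⟩ := by
    rw [LinearEquiv.symm_apply_eq]
    exact (DirectSum.coeLinearMap_lof V i ⟨v, hv⟩).symm
  simp [degMap, this]

theorem graded_induction (h : DirectSum.IsInternal V) {P : M → Prop}
    (hV : ∀ i, ∀ v ∈ V i, P v) (h0 : P 0) (hadd : ∀ v w, P v → P w → P (v + w)) (v : M) : P v := by
  have : v ∈ iSup V := by rw [h.submodule_iSup_eq_top]; trivial
  exact Submodule.iSup_induction V (motive := P) this hV h0 hadd

/-- The projection to a homogeneous component. -/
def comp (h : DirectSum.IsInternal V) (i : ι) : M →ₗ[k] M := Finsupp.lapply i ∘ₗ degMap h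

theorem comp_of_mem (h : DirectSum.IsInternal V) {i : ι} {v : M} (hv : v ∈ V i) :
    comp h i v = v := by
  simp [comp, degMap_of_mem h hv]

theorem comp_of_ne (h : DirectSum.IsInternal V) {i j : ι} (hij : i ≠ j) {v : M} (hv : v ∈ V j) :
    comp h i v = 0 := by
  simp [comp, degMap_of_mem h hv, Finsupp.single_eq_of_ne hij]

theorem comp_mem (h : DirectSum.IsInternal V) (i : ι) (v : M) : comp h i v ∈ V i := by
  induction v using graded_induction h with
  | hV j v hv =>
    by_cases hij : i = j
    · subst hij; rwa [comp_of_mem h hv]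
    · rw [comp_of_ne h hij hv]; exact zero_mem _
  | h0 => rw [map_zero]; exact zero_mem _
  | hadd v w hv hw => rw [map_add]; exact add_mem hv hw

theorem degMap_sum (h : DirectSum.IsInternal V) (v : M) :
    (degMap h v).sum (fun _ w => w) = v := by
  induction v using graded_induction h with
  | hV j v hv => rw [degMap_of_mem h hv]; simp
  | h0 => simp
  | hadd v w hv hw => rw [map_add, Finsupp.sum_add_index' (by simp) (by simp), hv, hw]

end Graded

section Convolution

variable {k M N P ι : Type*} [Field k] [AddCommGroup M] [Module k M] [AddCommGroup N] [Module k N]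
  [AddCommGroup P] [Module k P] [Add ι]

/-- The convolution of finitely supported families along a bilinear map. -/
def conv₂ (B : M →ₗ[k] N →ₗ[k] P) : (ι →₀ M) →ₗ[k] (ι →₀ N) →ₗ[k] (ι →₀ P) :=
  Finsupp.lsum k fun g => LinearMap.flip (Finsupp.lsum k fun h =>
    LinearMap.flip (B.compr₂ (Finsupp.lsingle (g + h))))

theorem conv₂_single (B : M →ₗ[k] N →ₗ[k] P) (g h : ι) (m : M) (n : N) :
    conv₂ B (Finsupp.single g m) (Finsupp.single h n) = Finsupp.single (g + h) (B m n) := by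
  simp [conv₂]

end Convolution

namespace Datum

variable {k I : Type*} [Field k] {D : Datum k I} [DecidableEq I] {β : I →₀ ℕ}

/-! ### The grading of `RC_β` -/

/-- The `ℤ`-degree and the parity of `g e(ν)`, for a generator `g`. -/
def Gen.deg : Gen D β → D.Seq β → ℤ × ZMod 2
  | .e _, _ => 0
  | .x p, ν => (2 * D.d (ν.1 p).fst, 0)
  | .s a, ν => (-(D.d (ν.1 a.lo).fst * D.A (ν.1 a.lo).fst (ν.1 a.hi).fst), 0)
  | .c _, _ => (0, 1)

/-- The product of the elements `g e(ν)`, for `(g, ν)` in a list. -/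
def monomial (l : List (Gen D β × D.Seq β)) : D.RC β := (l.map fun y => y.1.val * eRC y.2).prod

/-- The degree of the product of the elements `g e(ν)`, for `(g, ν)` in a list. -/
def monDeg (l : List (Gen D β × D.Seq β)) : ℤ × ZMod 2 := (l.map fun y => y.1.deg y.2).sum

variable (D β) in
/-- The component of `RC_β` of a given `ℤ`-degree and parity. -/
def piece (g : ℤ × ZMod 2) : Submodule k (D.RC β) :=
  Submodule.span k {y | ∃ l, monDeg l = g ∧ monomial l = y}

theorem monomial_mem (l : List (Gen D β × D.Seq β)) : monomial l ∈ D.piece β (monDeg l) :=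
  Submodule.subset_span ⟨l, rfl, rfl⟩

theorem one_mem : (1 : D.RC β) ∈ D.piece β 0 := Submodule.subset_span ⟨[], rfl, rfl⟩

theorem gen_e_mem (g : Gen D β) (ν : D.Seq β) : g.val * eRC ν ∈ D.piece β (g.deg ν) :=
  Submodule.subset_span ⟨[(g, ν)], by simp [monDeg], by simp [monomial]⟩

theorem mul_mem {g h : ℤ × ZMod 2} {y z : D.RC β} (hy : y ∈ D.piece β g) (hz : z ∈ D.piece β h) :
    y * z ∈ D.piece β (g + h) := by
  have := Submodule.mul_mem_mul hy hz
  rw [piece, piece, Submodule.span_mul_span] at this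
  refine Submodule.span_mono ?_ this
  rintro _ ⟨_, ⟨l, rfl, rfl⟩, _, ⟨l', rfl, rfl⟩, rfl⟩
  exact ⟨l ++ l', by simp [monDeg], by simp [monomial]⟩

theorem e_mem (ν : D.Seq β) : eRC ν ∈ D.piece β 0 := by
  have := gen_e_mem (.e ν) ν
  rwa [show ((.e ν : Gen D β)).val * eRC ν = eRC ν from e_e_self ν] at this

theorem c_mem (p : Fin (ht β)) : (cRC p : D.RC β) ∈ D.piece β (0, 1) := by
  rw [← mul_one (cRC p), ← e_sum, Finset.mul_sum]
  exact Submodule.sum_mem _ fun ν _ => gen_e_mem (.c p) ν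

theorem iSup_piece : iSup (D.piece β) = ⊤ := by
  rw [eq_top_iff]
  have key : ∀ y : D.RC β, ∀ z ∈ iSup (D.piece β), y * z ∈ iSup (D.piece β) := by
    intro y
    induction y using RC_induction with
    | hgen g =>
      intro z hz
      induction hz using Submodule.iSup_induction' with
      | mem i z hz =>
        rw [← mul_one g.val, ← e_sum, Finset.mul_sum, Finset.sum_mul]
        exact Submodule.sum_mem _ fun ν _ =>
          Submodule.mem_iSup_of_mem _ (mul_mem (gen_e_mem g ν) hz)
      | zero => rw [mul_zero]; exact zero_mem _
      | add z w _ _ hz hw => rw [mul_add]; exact add_mem hz hw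
    | hmap r => intro z hz; rw [← Algebra.smul_def]; exact Submodule.smul_mem _ _ hz
    | hadd a b ha hb => intro z hz; rw [add_mul]; exact add_mem (ha z hz) (hb z hz)
    | hmul a b ha hb => intro z hz; rw [mul_assoc]; exact ha _ (hb z hz)
  intro y _
  rw [← mul_one y]
  exact key y 1 (Submodule.mem_iSup_of_mem _ one_mem)

section Coaction

open AddMonoidAlgebra (single)

/-- The group algebra over `RC_β` of the group of degrees. -/
abbrev RG (D : Datum k I) (β : I →₀ ℕ) : Type _ := AddMonoidAlgebra (D.RC β) (ℤ × ZMod 2)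

/-- The image of a generator under the map that records degrees. -/
def genG : Gen D β → RG D β
  | .e μ => single 0 (eRC μ)
  | .x p => ∑ ν, single ((Gen.x p : Gen D β).deg ν) (xRC p * eRC ν)
  | .s a => ∑ ν, single ((Gen.s a : Gen D β).deg ν) (sRC a * eRC ν)
  | .c p => single (0, 1) (cRC p)

/-- `y e(ν)` is homogeneous of degree `g` and lifts to `y' e(ν)`, and `y e(ν) = e(μ) y`. -/
def Hom (y' : RG D β) (y : D.RC β) (ν μ : D.Seq β) (g : ℤ × ZMod 2) : Prop :=
  y' * single 0 (eRC ν) = single g (y * eRC ν) ∧ y * eRC ν = eRC μ * y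

theorem Hom.mul {y' z' : RG D β} {y z : D.RC β} {ν μ ρ : D.Seq β} {g h : ℤ × ZMod 2}
    (hy : Hom y' y μ ρ g) (hz : Hom z' z ν μ h) : Hom (y' * z') (y * z) ν ρ (g + h) := by
  constructor
  · rw [mul_assoc, hz.1, hz.2, ← zero_add h, ← AddMonoidAlgebra.single_mul_single, ← mul_assoc, hy.1,
      AddMonoidAlgebra.single_mul_single, zero_add, mul_assoc, mul_assoc, hz.2]
  · rw [mul_assoc, hz.2, ← mul_assoc, hy.2, mul_assoc]

theorem Hom.add {y' z' : RG D β} {y z : D.RC β} {ν μ : D.Seq β} {g : ℤ × ZMod 2}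
    (hy : Hom y' y ν μ g) (hz : Hom z' z ν μ g) : Hom (y' + z') (y + z) ν μ g := by
  constructor
  · rw [add_mul, add_mul, hy.1, hz.1, AddMonoidAlgebra.single_add]
  · rw [add_mul, mul_add, hy.2, hz.2]

theorem Hom.neg {y' : RG D β} {y : D.RC β} {ν μ : D.Seq β} {g : ℤ × ZMod 2}
    (hy : Hom y' y ν μ g) : Hom (-y') (-y) ν μ g := by
  constructor
  · rw [neg_mul, neg_mul, hy.1, AddMonoidAlgebra.single_neg]
  · rw [neg_mul, mul_neg, hy.2]

theorem Hom.sub {y' z' : RG D β} {y z : D.RC β} {ν μ : D.Seq β} {g : ℤ × ZMod 2}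
    (hy : Hom y' y ν μ g) (hz : Hom z' z ν μ g) : Hom (y' - z') (y - z) ν μ g := by
  rw [sub_eq_add_neg, sub_eq_add_neg]; exact hy.add hz.neg

theorem Hom.smul (r : k) {y' : RG D β} {y : D.RC β} {ν μ : D.Seq β} {g : ℤ × ZMod 2}
    (hy : Hom y' y ν μ g) : Hom (r • y') (r • y) ν μ g := by
  constructor
  · rw [smul_mul_assoc, smul_mul_assoc, hy.1, AddMonoidAlgebra.smul_single]
  · rw [smul_mul_assoc, mul_smul_comm, hy.2]

theorem Hom.zero (ν μ : D.Seq β) (g : ℤ × ZMod 2) : Hom 0 0 ν μ g := by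
  constructor <;> simp

theorem Hom.one (ν : D.Seq β) : Hom 1 1 ν ν 0 := by
  constructor <;> simp

theorem Hom.sum {ι : Type*} (s : Finset ι) {y' : ι → RG D β} {y : ι → D.RC β} {ν μ : D.Seq β}
    {g : ℤ × ZMod 2} (h : ∀ i ∈ s, Hom (y' i) (y i) ν μ g) :
    Hom (∑ i ∈ s, y' i) (∑ i ∈ s, y i) ν μ g := by
  classical
  induction s using Finset.induction_on with
  | empty => simpa using Hom.zero ν μ g
  | insert a s ha ih =>
    rw [Finset.sum_insert ha, Finset.sum_insert ha]
    exact (h a (by simp)).add (ih fun i hi => h i (by simp [hi]))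

theorem Hom.pow {y' : RG D β} {y : D.RC β} {ν : D.Seq β} {g : ℤ × ZMod 2}
    (hy : Hom y' y ν ν g) (n : ℕ) : Hom (y' ^ n) (y ^ n) ν ν (n • g) := by
  induction n with
  | zero => simpa using Hom.one ν
  | succ n ih => rw [pow_succ, pow_succ, succ_nsmul]; exact ih.mul hy

theorem Hom.congr {y' : RG D β} {y : D.RC β} {ν μ μ' : D.Seq β} {g g' : ℤ × ZMod 2}
    (hy : Hom y' y ν μ g) (hμ : μ = μ') (hg : g = g') : Hom y' y ν μ' g' := by
  subst hμ; subst hg; exact hy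

theorem Hom.eq {y' z' : RG D β} {y z : D.RC β} {ν μ μ' : D.Seq β} {g g' : ℤ × ZMod 2}
    (hy : Hom y' y ν μ g) (hz : Hom z' z ν μ' g') (h : y * eRC ν = z * eRC ν) (hg : g = g') :
    y' * single 0 (eRC ν) = z' * single 0 (eRC ν) := by
  rw [hy.1, hz.1, h, hg]

theorem Hom.e (μ ν : D.Seq β) : Hom (genG (.e μ)) (eRC μ) ν ν 0 := by
  constructor
  · simp [genG, AddMonoidAlgebra.single_mul_single]
  · rw [e_e, e_e]
    by_cases h : μ = ν
    · subst h; simp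
    · simp [h, Ne.symm h]

theorem sum_single_mul (f : D.Seq β → ℤ × ZMod 2) (y : D.RC β) (ν : D.Seq β) :
    (∑ μ, single (f μ) (y * eRC μ) : RG D β) * single 0 (eRC ν) = single (f ν) (y * eRC ν) := by
  rw [Finset.sum_mul, Finset.sum_eq_single ν]
  · rw [AddMonoidAlgebra.single_mul_single, mul_assoc, e_e_self, add_zero]
  · intro μ _ h
    rw [AddMonoidAlgebra.single_mul_single, mul_assoc, e_e, if_neg h, mul_zero,
      AddMonoidAlgebra.single_zero]
  · simp

theorem Hom.x (p : Fin (ht β)) (ν : D.Seq β) :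
    Hom (genG (.x p)) (xRC p) ν ν (2 * D.d (ν.1 p).fst, 0) :=
  ⟨sum_single_mul _ _ _, x_e p ν⟩

theorem Hom.s (a : Adj (ht β)) (ν : D.Seq β) : Hom (genG (.s a)) (sRC a) ν (ν.s a)
    (-(D.d (ν.1 a.lo).fst * D.A (ν.1 a.lo).fst (ν.1 a.hi).fst), 0) :=
  ⟨sum_single_mul _ _ _, s_e a ν⟩

theorem Hom.c (p : Fin (ht β)) (ν : D.Seq β) : Hom (genG (.c p)) (cRC p) ν (ν.c p) (0, 1) := by
  refine ⟨?_, c_e p ν⟩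
  simp [genG, AddMonoidAlgebra.single_mul_single]

end Coaction

end Datum

end

end QuiverHeckeClifford

namespace QuiverHeckeClifford

set_option linter.unusedSimpArgs false

noncomputable section

namespace Adj

variable {n : ℕ} (a : Adj n)

theorem s_lo : a.s a.lo = a.hi := Equiv.swap_apply_left _ _

theorem s_hi : a.s a.hi = a.lo := Equiv.swap_apply_right _ _

theorem s_of_ne {p : Fin n} (h : p ≠ a.lo) (h' : p ≠ a.hi) : a.s p = p :=
  Equiv.swap_apply_of_ne_of_ne h h'

theorem s_s (p : Fin n) : a.s (a.s p) = p := Equiv.swap_apply_self _ _ _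

end Adj

namespace Datum

variable {k I : Type*} [Field k] {D : Datum k I} {β : I →₀ ℕ}

theorem Seq.s_apply (a : Adj (ht β)) (ν : D.Seq β) (p : Fin (ht β)) : (ν.s a).1 p = ν.1 (a.s p) := rfl

theorem Seq.c_same (p : Fin (ht β)) (ν : D.Seq β) : (ν.c p).1 p = (ν.1 p).c :=
  Function.update_self _ _ _

theorem Seq.c_ne {p q : Fin (ht β)} (h : q ≠ p) (ν : D.Seq β) : (ν.c p).1 q = ν.1 q :=
  Function.update_of_ne h _ _

theorem Seq.c_fst (p q : Fin (ht β)) (ν : D.Seq β) : ((ν.c p).1 q).fst = (ν.1 q).fst := by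
  by_cases h : q = p
  · subst h; rw [Seq.c_same]; rfl
  · rw [Seq.c_ne h]

theorem fst_eq_of_c {i j : D.J} (h : i = j.c) : i.fst = j.fst := by rw [h]; rfl

theorem deg_of_mem_S {i j : I} {p : ℕ × ℕ} (hp : p ∈ D.S i j) :
    D.d i * p.1 + D.d j * p.2 = -(D.d i * D.A i j) := by
  simp only [S, Finset.mem_filter, Finset.mem_product, Finset.mem_range] at hp
  obtain ⟨⟨h1, h2⟩, h3, -⟩ := hp
  by_cases h0 : D.A i j = 0
  · have h0' := (D.A_zero i j).1 h0
    rw [h0] at h1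
    rw [h0'] at h2
    have e1 : p.1 = 0 := by simpa using h1
    have e2 : p.2 = 0 := by simpa using h2
    simp [e1, e2, h0]
  · have hs := D.symm i j
    have hb : D.d i * D.A i j ≠ 0 := mul_ne_zero (D.d_pos i).ne' h0
    apply mul_left_cancel₀ hb
    linear_combination (D.d i * D.d j) * h3 + (D.d i * p.1 + D.d i * D.A i j) * hs

variable [DecidableEq I]

section Coaction

open AddMonoidAlgebra (single)

/-- `y e(ν)` is homogeneous of degree `g` and lifts to `y' e(ν)`. -/
def Lft (y' : RG D β) (y : D.RC β) (ν : D.Seq β) (g : ℤ × ZMod 2) : Prop :=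
  y' * single 0 (eRC ν) = single g (y * eRC ν)

theorem Lft.add {y' z' : RG D β} {y z : D.RC β} {ν : D.Seq β} {g : ℤ × ZMod 2}
    (hy : Lft y' y ν g) (hz : Lft z' z ν g) : Lft (y' + z') (y + z) ν g := by
  unfold Lft at *
  rw [add_mul, add_mul, hy, hz, AddMonoidAlgebra.single_add]

theorem Lft.sub {y' z' : RG D β} {y z : D.RC β} {ν : D.Seq β} {g : ℤ × ZMod 2}
    (hy : Lft y' y ν g) (hz : Lft z' z ν g) : Lft (y' - z') (y - z) ν g := by
  unfold Lft at *
  rw [sub_mul, sub_mul, hy, hz, AddMonoidAlgebra.single_sub]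

theorem Lft.congr {y' : RG D β} {y : D.RC β} {ν : D.Seq β} {g g' : ℤ × ZMod 2}
    (hy : Lft y' y ν g) (hg : g = g') : Lft y' y ν g' := by subst hg; exact hy

theorem Lft.ite {c : Prop} [Decidable c] {y' : RG D β} {y : D.RC β} {ν : D.Seq β} {g : ℤ × ZMod 2}
    (hy : c → Lft y' y ν g) : Lft (if c then y' else 0) (if c then y else 0) ν g := by
  split_ifs with h
  · exact hy h
  · exact (Hom.zero ν ν g).1

theorem Hom.lft {y' : RG D β} {y : D.RC β} {ν μ : D.Seq β} {g : ℤ × ZMod 2}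
    (hy : Hom y' y ν μ g) : Lft y' y ν g := hy.1

theorem Lft.eq {y' z' : RG D β} {y z : D.RC β} {ν : D.Seq β} {g : ℤ × ZMod 2}
    (hy : Lft y' y ν g) (hz : Lft z' z ν g) (h : y * eRC ν = z * eRC ν) :
    y' * single 0 (eRC ν) = z' * single 0 (eRC ν) := by
  rw [hy, hz, h]

theorem sum_single_e : ∑ ν, (single 0 (eRC ν) : RG D β) = 1 := by
  rw [AddMonoidAlgebra.one_def, ← e_sum]
  exact (map_sum (AddMonoidAlgebra.singleAddHom (R := D.RC β) (0 : ℤ × ZMod 2)) _ _).symm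

theorem RG_ext {y z : RG D β} (h : ∀ ν, y * single 0 (eRC ν) = z * single 0 (eRC ν)) : y = z := by
  rw [← mul_one y, ← mul_one z, ← sum_single_e, Finset.mul_sum, Finset.mul_sum]
  exact Finset.sum_congr rfl fun ν _ => h ν

theorem Hom.Q {i j : I} {u' v' : RG D β} {u v : D.RC β} {ν : D.Seq β}
    (hu : Hom u' u ν ν (2 * D.d i, 0)) (hv : Hom v' v ν ν (2 * D.d j, 0)) :
    Hom (D.Q i j u' v') (D.Q i j u v) ν ν (-2 * (D.d i * D.A i j), 0) := by
  unfold Datum.Q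
  split_ifs with h
  · exact Hom.zero _ _ _
  · refine Hom.sum _ fun p hp => Hom.smul _ (((hu.pow p.1).mul (hv.pow p.2)).congr rfl ?_)
    have := deg_of_mem_S hp
    refine Prod.ext ?_ (by simp)
    simp
    linear_combination 2 * this

theorem Hom.divQ {i j : I} {w' u' v' : RG D β} {w u v : D.RC β} {ν : D.Seq β}
    (hw : Hom w' w ν ν (2 * D.d i, 0))
    (hu : Hom u' u ν ν (2 * D.d i, 0)) (hv : Hom v' v ν ν (2 * D.d j, 0)) :
    Hom (D.divQ i j w' u' v') (D.divQ i j w u v) ν ν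
      (-2 * (D.d i * D.A i j) - 2 * D.d i, 0) := by
  unfold Datum.divQ
  split_ifs with h
  · exact Hom.zero _ _ _
  · refine Hom.sum _ fun p hp => Hom.smul _ ?_
    have key : Hom (∑ m ∈ Finset.range p.1, w' ^ m * u' ^ (p.1 - 1 - m))
        (∑ m ∈ Finset.range p.1, w ^ m * u ^ (p.1 - 1 - m)) ν ν
        ((p.1 - 1 : ℤ) * (2 * D.d i), 0) := by
      refine Hom.sum _ fun m hm => ((hw.pow m).mul (hu.pow _)).congr rfl ?_
      refine Prod.ext ?_ (by simp)
      rw [Finset.mem_range] at hm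
      have : ((p.1 - 1 - m : ℕ) : ℤ) = p.1 - 1 - m := by omega
      simp [this]
      ring
    refine (key.mul (hv.pow p.2)).congr rfl ?_
    have := deg_of_mem_S hp
    refine Prod.ext ?_ (by simp)
    simp
    linear_combination 2 * this

theorem Hom.Qt {i j : D.J} {u' v' : RG D β} {u v : D.RC β} {ν : D.Seq β}
    (hu : Hom u' u ν ν (2 * D.d i.fst, 0)) (hv : Hom v' v ν ν (2 * D.d j.fst, 0)) :
    Hom (D.Qt i j u' v') (D.Qt i j u v) ν ν (-2 * (D.d i.fst * D.A i.fst j.fst), 0) :=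
  Hom.Q (hu.smul _) (hv.smul _)

theorem Hom.divQt {i j : D.J} {w' u' v' : RG D β} {w u v : D.RC β} {ν : D.Seq β}
    (hw : Hom w' w ν ν (2 * D.d i.fst, 0))
    (hu : Hom u' u ν ν (2 * D.d i.fst, 0)) (hv : Hom v' v ν ν (2 * D.d j.fst, 0)) :
    Hom (D.divQt i j w' u' v') (D.divQt i j w u v) ν ν
      (-2 * (D.d i.fst * D.A i.fst j.fst) - 2 * D.d i.fst, 0) :=
  Hom.smul _ (Hom.divQ (hw.smul _) (hu.smul _) (hv.smul _))

theorem genG_rel (x y : RG D β)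
    (h : Rel (fun ν => genG (.e ν)) (fun p => genG (.x p)) (fun a => genG (.s a))
      (fun p => genG (.c p)) x y) : x = y := by
  cases h with
  | e_e μ ν =>
    split_ifs with h
    · simp [genG, AddMonoidAlgebra.single_mul_single, h, e_e_self]
    · simp [genG, AddMonoidAlgebra.single_mul_single, h, e_e]
  | e_sum => exact sum_single_e
  | x_e p μ =>
    refine RG_ext fun ν => Hom.eq ((Hom.x p ν).mul (Hom.e μ ν)) ((Hom.e μ ν).mul (Hom.x p ν)) ?_ ?_
    · rw [x_e]
    · simp
  | c_e p μ =>
    refine RG_ext fun ν => Hom.eq ((Hom.c p ν).mul (Hom.e μ ν))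
      ((Hom.e (μ.c p) (ν.c p)).mul (Hom.c p ν)) ?_ ?_
    · rw [c_e]
    · simp
  | x_x p q ν =>
    refine Hom.eq ((Hom.x p ν).mul (Hom.x q ν)) ((Hom.x q ν).mul (Hom.x p ν)) ?_ ?_
    · rw [x_x]
    · rw [add_comm]
  | c_c p q =>
    have := c_c (D := D) p q
    simp only [genG, AddMonoidAlgebra.single_mul_single, ← AddMonoidAlgebra.single_add, this]
    split_ifs with h
    · rfl
    · exact AddMonoidAlgebra.single_zero _
  | c_x p q =>
    refine RG_ext fun ν => ?_
    split_ifs with h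
    · subst h
      rw [neg_one_mul]
      refine Hom.eq ((Hom.c p ν).mul (Hom.x p ν)) ((Hom.x p _).mul (Hom.c p ν)).neg ?_ ?_
      · rw [c_x_self]
      · rw [Seq.c_fst, add_comm]
    · rw [one_mul]
      refine Hom.eq ((Hom.c p ν).mul (Hom.x q ν)) ((Hom.x q _).mul (Hom.c p ν)) ?_ ?_
      · rw [c_x_ne h]
      · rw [Seq.c_fst, add_comm]
  | s_e a μ =>
    refine RG_ext fun ν => Hom.eq ((Hom.s a ν).mul (Hom.e μ ν))
      ((Hom.e (μ.s a) (ν.s a)).mul (Hom.s a ν)) ?_ ?_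
    · rw [s_e]
    · simp
  | s_c a p =>
    refine RG_ext fun ν => Hom.eq ((Hom.s a _).mul (Hom.c p ν)) ((Hom.c _ _).mul (Hom.s a ν)) ?_ ?_
    · rw [s_c]
    · simp only [Seq.c_fst, add_comm]
  | s_x a p ν h h' =>
    refine Hom.eq ((Hom.s a _).mul (Hom.x p ν)) ((Hom.x _ _).mul (Hom.s a ν)) ?_ ?_
    · rw [s_x a p h h']
    · simp only [Seq.s_apply, a.s_of_ne h h', add_comm]
  | s_x_hi a ν =>
    have hr := rel_RC (D := D) (.s_x_hi a ν)
    have h1 : Lft (genG (.s a) * genG (.x a.hi) - genG (.x a.lo) * genG (.s a))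
        (sRC a * xRC a.hi - xRC a.lo * sRC a) ν (2 * D.d (ν.1 a.hi).fst -
          D.d (ν.1 a.lo).fst * D.A (ν.1 a.lo).fst (ν.1 a.hi).fst, 0) := by
      refine Lft.sub (((Hom.s a ν).mul (Hom.x a.hi ν)).lft.congr ?_)
        (((Hom.x a.lo _).mul (Hom.s a ν)).lft.congr ?_)
      · refine Prod.ext ?_ (by simp)
        simp [Seq.s_apply, a.s_lo, a.s_hi]
        try ring
      · refine Prod.ext ?_ (by simp)
        simp [Seq.s_apply, a.s_lo, a.s_hi]
        try ring
    have h2 : Lft ((if ν.1 a.lo = ν.1 a.hi then 1 else 0) -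
          (if ν.1 a.lo = (ν.1 a.hi).c then genG (.c a.lo) * genG (.c a.hi) else 0))
        ((if ν.1 a.lo = ν.1 a.hi then 1 else 0) -
          (if ν.1 a.lo = (ν.1 a.hi).c then cRC a.lo * cRC a.hi else 0)) ν
        (2 * D.d (ν.1 a.hi).fst -
          D.d (ν.1 a.lo).fst * D.A (ν.1 a.lo).fst (ν.1 a.hi).fst, 0) := by
      refine Lft.sub (Lft.ite fun h => (Hom.one ν).lft.congr ?_)
        (Lft.ite fun h => ((Hom.c a.lo _).mul (Hom.c a.hi _)).lft.congr ?_)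
      · refine Prod.ext ?_ rfl
        simp only [h, D.A_diag, Prod.fst_zero]
        ring
      · refine Prod.ext ?_ rfl
        simp only [fst_eq_of_c h, D.A_diag, Prod.fst_add]
        ring
    have h3 := Lft.eq h1 h2 (by
      rw [hr, sub_mul, ite_mul, ite_mul, one_mul, zero_mul])
    exact h3.trans (by rw [sub_mul, ite_mul, ite_mul, one_mul, zero_mul]; rfl)
  | s_x_lo a ν =>
    have hr := rel_RC (D := D) (.s_x_lo a ν)
    have h1 : Lft (genG (.x a.hi) * genG (.s a) - genG (.s a) * genG (.x a.lo))
        (xRC a.hi * sRC a - sRC a * xRC a.lo) ν (2 * D.d (ν.1 a.lo).fst -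
          D.d (ν.1 a.lo).fst * D.A (ν.1 a.lo).fst (ν.1 a.hi).fst, 0) := by
      refine Lft.sub (((Hom.x a.hi _).mul (Hom.s a ν)).lft.congr ?_)
        (((Hom.s a ν).mul (Hom.x a.lo ν)).lft.congr ?_)
      · refine Prod.ext ?_ (by simp)
        simp [Seq.s_apply, a.s_lo, a.s_hi]
        try ring
      · refine Prod.ext ?_ (by simp)
        simp [Seq.s_apply, a.s_lo, a.s_hi]
        try ring
    have h2 : Lft ((if ν.1 a.lo = ν.1 a.hi then 1 else 0) +
          (if ν.1 a.lo = (ν.1 a.hi).c then genG (.c a.lo) * genG (.c a.hi) else 0))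
        ((if ν.1 a.lo = ν.1 a.hi then 1 else 0) +
          (if ν.1 a.lo = (ν.1 a.hi).c then cRC a.lo * cRC a.hi else 0)) ν
        (2 * D.d (ν.1 a.lo).fst -
          D.d (ν.1 a.lo).fst * D.A (ν.1 a.lo).fst (ν.1 a.hi).fst, 0) := by
      refine Lft.add (Lft.ite fun h => (Hom.one ν).lft.congr ?_)
        (Lft.ite fun h => ((Hom.c a.lo _).mul (Hom.c a.hi _)).lft.congr ?_)
      · refine Prod.ext ?_ rfl
        simp only [h, D.A_diag, Prod.fst_zero]
        ring
      · refine Prod.ext ?_ rfl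
        simp only [fst_eq_of_c h, D.A_diag, Prod.fst_add]
        ring
    have h3 := Lft.eq h1 h2 (by
      rw [hr, add_mul, ite_mul, ite_mul, one_mul, zero_mul])
    exact h3.trans (by rw [add_mul, ite_mul, ite_mul, one_mul, zero_mul]; rfl)
  | s_s a ν =>
    refine Hom.eq ((Hom.s a _).mul (Hom.s a ν)) (Hom.Qt (Hom.x _ _) (Hom.x _ _)) ?_ ?_
    · exact rel_RC (.s_s a ν)
    · simp only [Seq.s_apply, a.s_lo, a.s_hi]
      refine Prod.ext ?_ (by simp)
      simp only [Prod.fst_add]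
      linear_combination D.symm (ν.1 a.lo).fst (ν.1 a.hi).fst
  | s_comm a b h =>
    refine RG_ext fun ν => Hom.eq ((Hom.s a _).mul (Hom.s b ν)) ((Hom.s b _).mul (Hom.s a ν)) ?_ ?_
    · rw [s_comm a b h]
    · have h1 : a.lo ≠ b.lo := by simp [Adj.lo, Fin.ext_iff]; omega
      have h2 : a.lo ≠ b.hi := by simp [Adj.lo, Adj.hi, Fin.ext_iff]; omega
      have h3 : a.hi ≠ b.lo := by simp [Adj.lo, Adj.hi, Fin.ext_iff]; omega
      have h4 : a.hi ≠ b.hi := by simp [Adj.hi, Fin.ext_iff]; omega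
      simp only [Seq.s_apply, b.s_of_ne h1 h2, b.s_of_ne h3 h4, a.s_of_ne h1.symm h3.symm,
        a.s_of_ne h2.symm h4.symm, add_comm]
  | braid a b h ν =>
    have hr := rel_RC (D := D) (.braid a b h ν)
    have hab : a.hi = b.lo := by simp [Adj.lo, Adj.hi, Fin.ext_iff, h]
    have n1 : a.lo ≠ b.lo := by simp [Adj.lo, Fin.ext_iff]; omega
    have n2 : a.lo ≠ b.hi := by simp [Adj.lo, Adj.hi, Fin.ext_iff]; omega
    have n3 : b.hi ≠ b.lo := b.lo_ne_hi.symm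
    have b1 : b.s a.lo = a.lo := b.s_of_ne n1 n2
    have b2 : b.s b.lo = b.hi := b.s_lo
    have b3 : b.s b.hi = b.lo := b.s_hi
    have a1 : a.s a.lo = b.lo := by rw [a.s_lo, hab]
    have a2 : a.s b.lo = a.lo := by rw [← hab, a.s_hi]
    have a3 : a.s b.hi = b.hi := a.s_of_ne n2.symm (by rw [hab]; exact n3)
    have h1 : Lft (genG (.s b) * genG (.s a) * genG (.s b) - genG (.s a) * genG (.s b) * genG (.s a))
        (sRC b * sRC a * sRC b - sRC a * sRC b * sRC a) ν
        (-(D.d (ν.1 a.lo).fst * D.A (ν.1 a.lo).fst (ν.1 b.lo).fst +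
          D.d (ν.1 a.lo).fst * D.A (ν.1 a.lo).fst (ν.1 b.hi).fst +
          D.d (ν.1 b.lo).fst * D.A (ν.1 b.lo).fst (ν.1 b.hi).fst), 0) := by
      refine Lft.sub ((((Hom.s b _).mul (Hom.s a _)).mul (Hom.s b ν)).lft.congr ?_)
        ((((Hom.s a _).mul (Hom.s b _)).mul (Hom.s a ν)).lft.congr ?_)
      · refine Prod.ext ?_ (by simp)
        simp only [Seq.s_apply, hab, a1, a2, a3, b1, b2, b3, Prod.fst_add]
        ring
      · refine Prod.ext ?_ (by simp)
        simp only [Seq.s_apply, hab, a1, a2, a3, b1, b2, b3, Prod.fst_add]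
        ring
    have h2 : Lft ((if ν.1 a.lo = ν.1 b.hi then
            D.divQt (ν.1 a.lo) (ν.1 a.hi) (genG (.x b.hi)) (genG (.x a.lo)) (genG (.x a.hi)) else 0) +
          (if ν.1 a.lo = (ν.1 b.hi).c then
            D.divQt (ν.1 a.lo) (ν.1 a.hi) (genG (.x b.hi)) (-genG (.x a.lo)) (genG (.x a.hi)) *
              genG (.c a.lo) * genG (.c b.hi) else 0))
        ((if ν.1 a.lo = ν.1 b.hi then
            D.divQt (ν.1 a.lo) (ν.1 a.hi) (xRC b.hi) (xRC a.lo) (xRC a.hi) else 0) +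
          (if ν.1 a.lo = (ν.1 b.hi).c then
            D.divQt (ν.1 a.lo) (ν.1 a.hi) (xRC b.hi) (-xRC a.lo) (xRC a.hi) *
              cRC a.lo * cRC b.hi else 0)) ν
        (-(D.d (ν.1 a.lo).fst * D.A (ν.1 a.lo).fst (ν.1 b.lo).fst +
          D.d (ν.1 a.lo).fst * D.A (ν.1 a.lo).fst (ν.1 b.hi).fst +
          D.d (ν.1 b.lo).fst * D.A (ν.1 b.lo).fst (ν.1 b.hi).fst), 0) := by
      refine Lft.add (Lft.ite fun h => ?_) (Lft.ite fun h => ?_)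
      · refine (Hom.divQt ((Hom.x _ ν).congr rfl ?_) (Hom.x _ ν) (Hom.x _ ν)).lft.congr ?_
        · rw [h]
        · refine Prod.ext ?_ rfl
          simp only [← h, hab]
          linear_combination (-1 : ℤ) * D.symm (ν.1 a.lo).fst (ν.1 b.lo).fst +
            D.d (ν.1 a.lo).fst * D.A_diag (ν.1 a.lo).fst
      · have h' := fst_eq_of_c h
        refine (((Hom.divQt ((Hom.x _ _).congr rfl ?_) ((Hom.x _ _).congr rfl ?_).neg
          ((Hom.x _ _).congr rfl ?_)).mul (Hom.c _ _)).mul (Hom.c _ ν)).lft.congr ?_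
        · simp only [Seq.c_fst, h']
        · simp only [Seq.c_fst]
        · simp only [Seq.c_fst]
        · refine Prod.ext ?_ rfl
          simp only [← h', hab, Prod.fst_add]
          linear_combination (-1 : ℤ) * D.symm (ν.1 a.lo).fst (ν.1 b.lo).fst +
            D.d (ν.1 a.lo).fst * D.A_diag (ν.1 a.lo).fst
    have h3 := Lft.eq h1 h2 (by rw [hr, add_mul, ite_mul, ite_mul, zero_mul])
    rw [add_mul _ _ (single 0 (eRC ν)), ite_mul, ite_mul, zero_mul] at h3
    exact h3

/-- The algebra homomorphism that records degrees. -/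
def coact : D.RC β →ₐ[k] RG D β := liftRC genG genG_rel

theorem coact_monomial (l : List (Gen D β × D.Seq β)) :
    coact (monomial l) = single (monDeg l) (monomial l) := by
  induction l with
  | nil => simp [monomial, monDeg, AddMonoidAlgebra.one_def]
  | cons y l ih =>
    have h1 : monomial (y :: l) = y.1.val * eRC y.2 * monomial l := by simp [monomial]
    have h2 : monDeg (y :: l) = y.1.deg y.2 + monDeg l := by simp [monDeg]
    have h3 : genG y.1 * single 0 (eRC y.2) = single (y.1.deg y.2) (y.1.val * eRC y.2) := by
      obtain ⟨g, ν⟩ := y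
      cases g with
      | e μ => exact (Hom.e μ ν).1
      | x p => exact (Hom.x p ν).1
      | s a => exact (Hom.s a ν).1
      | c p => exact (Hom.c p ν).1
    have h4 : coact (eRC y.2) = single 0 (eRC y.2) := liftRC_val _ _ _
    rw [h1, h2, map_mul, map_mul, ih, h4, coact, liftRC_val, h3, AddMonoidAlgebra.single_mul_single]

theorem coact_of_mem {g : ℤ × ZMod 2} {y : D.RC β} (hy : y ∈ D.piece β g) :
    coact y = single g y := by
  induction hy using Submodule.span_induction with
  | mem y hy => obtain ⟨l, rfl, rfl⟩ := hy; exact coact_monomial l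
  | zero => rw [map_zero, AddMonoidAlgebra.single_zero]
  | add y z _ _ hy hz => rw [map_add, AddMonoidAlgebra.single_add, hy, hz]
  | smul r y _ hy => rw [map_smul, hy, AddMonoidAlgebra.smul_single]

/-- `RC_β` is the direct sum of its homogeneous components. -/
theorem isInternal_RC : DirectSum.IsInternal (D.piece β) := by
  refine isInternal_of_proj
    (fun g => { toFun := fun y => (coact y).coeff g
                map_add' := fun y z => by simp
                map_smul' := fun r y => by simp }) ?_ ?_ iSup_piece
  · intro g y hy
    simp [coact_of_mem hy]
  · intro g h hgh y hy
    simp [coact_of_mem hy, Finsupp.single_eq_of_ne hgh]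

end Coaction

end Datum

end

end QuiverHeckeClifford

namespace QuiverHeckeClifford

set_option linter.unusedSimpArgs false

noncomputable section

namespace Datum

open MulOpposite

variable {k I : Type*} [Field k] {D : Datum k I} {β : I →₀ ℕ}

theorem Seq.c_c (p : Fin (ht β)) (ν : D.Seq β) : (ν.c p).c p = ν := by
  apply Subtype.ext
  funext q
  by_cases h : q = p
  · subst h; rw [Seq.c_same, Seq.c_same, J.c_c]
  · rw [Seq.c_ne h, Seq.c_ne h]

theorem Seq.s_s (a : Adj (ht β)) (ν : D.Seq β) : (ν.s a).s a = ν := by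
  apply Subtype.ext
  funext q
  rw [Seq.s_apply, Seq.s_apply, a.s_s]

/-- If `ν_a = c(ν_b)` then exchanging the two entries amounts to applying `c` to both. -/
theorem Seq.c_c_eq {p q : Fin (ht β)} {ν μ : D.Seq β} (hpq : p ≠ q) (h : ν.1 p = (ν.1 q).c)
    (h1 : μ.1 p = ν.1 q) (h2 : μ.1 q = ν.1 p) (h3 : ∀ r, r ≠ p → r ≠ q → μ.1 r = ν.1 r) :
    (μ.c q).c p = ν := by
  apply Subtype.ext
  funext r
  by_cases hr : r = p
  · subst hr; rw [Seq.c_same, Seq.c_ne hpq, h1, h]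
  · rw [Seq.c_ne hr]
    by_cases hr' : r = q
    · subst hr'; rw [Seq.c_same, h2, h, J.c_c]
    · rw [Seq.c_ne hr', h3 r hr hr']

theorem Seq.s_eq {a : Adj (ht β)} {ν : D.Seq β} (h : ν.1 a.lo = ν.1 a.hi) : ν.s a = ν := by
  apply Subtype.ext
  funext q
  rw [Seq.s_apply]
  by_cases h1 : q = a.lo
  · subst h1; rw [a.s_lo, h]
  · by_cases h2 : q = a.hi
    · subst h2; rw [a.s_hi, h]
    · rw [a.s_of_ne h1 h2]

variable [DecidableEq I]

section Poly

variable {B : Type*} [Ring B] [Algebra k B]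

theorem semiconj_divQ (i j : I) {c u' u v w' w z : B} (h1 : SemiconjBy c u' w')
    (h2 : SemiconjBy c u w) (h3 : SemiconjBy c v z) :
    SemiconjBy c (D.divQ i j u' u v) (D.divQ i j w' w z) := by
  unfold divQ
  split_ifs
  · exact SemiconjBy.zero_right c
  · rw [SemiconjBy, Finset.mul_sum, Finset.sum_mul]
    refine Finset.sum_congr rfl fun p _ => ?_
    rw [mul_smul_comm, smul_mul_assoc]
    congr 1
    refine SemiconjBy.mul_right ?_ (h3.pow_right _)
    rw [SemiconjBy, Finset.mul_sum, Finset.sum_mul]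
    exact Finset.sum_congr rfl fun m _ => (h1.pow_right _).mul_right (h2.pow_right _)

theorem semiconj_smul {c u w : B} (r : k) (h : SemiconjBy c u w) : SemiconjBy c (r • u) (r • w) := by
  rw [SemiconjBy, mul_smul_comm, smul_mul_assoc, h.eq]

theorem semiconj_divQt (i j : D.J) {c u' u v w' w z : B} (h1 : SemiconjBy c u' w')
    (h2 : SemiconjBy c u w) (h3 : SemiconjBy c v z) :
    SemiconjBy c (D.divQt i j u' u v) (D.divQt i j w' w z) :=
  semiconj_smul _ (semiconj_divQ _ _ (semiconj_smul _ h1) (semiconj_smul _ h2) (semiconj_smul _ h3))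

theorem semiconj_Qt (i j : D.J) {c u v w z : B}
    (h2 : SemiconjBy c u w) (h3 : SemiconjBy c v z) :
    SemiconjBy c (D.Qt i j u v) (D.Qt i j w z) := by
  unfold Qt Q
  split_ifs
  · exact SemiconjBy.zero_right c
  · rw [SemiconjBy, Finset.mul_sum, Finset.sum_mul]
    refine Finset.sum_congr rfl fun p _ => ?_
    rw [mul_smul_comm, smul_mul_assoc]
    congr 1
    exact ((semiconj_smul _ h2).pow_right _).mul_right ((semiconj_smul _ h3).pow_right _)

theorem op_Q (i j : I) {u v : B} (h : Commute u v) : D.Q i j (op u) (op v) = op (D.Q i j u v) := by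
  unfold Q
  split_ifs
  · rfl
  · rw [Finset.op_sum]
    refine Finset.sum_congr rfl fun p _ => ?_
    rw [op_smul, op_mul, op_pow, op_pow]
    congr 1
    apply unop_injective
    simp only [unop_mul, unop_pow, unop_op]
    exact (h.pow_pow _ _).symm.eq

theorem op_divQ (i j : I) {u' u v : B} (h : Commute u' u) (h1 : Commute u' v) (h2 : Commute u v) :
    D.divQ i j (op u') (op u) (op v) = op (D.divQ i j u' u v) := by
  unfold divQ
  split_ifs
  · rfl
  · rw [Finset.op_sum]
    refine Finset.sum_congr rfl fun p _ => ?_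
    rw [op_smul]
    congr 1
    apply unop_injective
    simp only [unop_mul, unop_pow, unop_op, Finset.unop_sum]
    rw [Finset.sum_mul, Finset.mul_sum]
    refine Finset.sum_congr rfl fun m _ => ?_
    rw [(h.pow_pow _ _).eq, ← mul_assoc]
    rw [(h2.pow_pow (p.1 - 1 - m) p.2).symm.eq, mul_assoc, (h1.pow_pow m p.2).symm.eq, mul_assoc]

theorem op_Qt (i j : D.J) {u v : B} (h : Commute u v) :
    D.Qt i j (op u) (op v) = op (D.Qt i j u v) := by
  unfold Qt
  rw [← op_smul, ← op_smul, op_Q _ _ ((h.smul_left _).smul_right _)]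

theorem op_divQt (i j : D.J) {u' u v : B} (h : Commute u' u) (h1 : Commute u' v)
    (h2 : Commute u v) : D.divQt i j (op u') (op u) (op v) = op (D.divQt i j u' u v) := by
  unfold divQt
  rw [← op_smul, ← op_smul, ← op_smul, op_divQ _ _ ((h.smul_left _).smul_right _)
    ((h1.smul_left _).smul_right _) ((h2.smul_left _).smul_right _), ← op_smul]

theorem divQ_neg_of_odd (i j : I) (hi : D.par i = 1) (u' u v : B) :
    D.divQ i j (-u') (-u) v = -D.divQ i j u' u v := by
  unfold divQ
  split_ifs
  · simp
  · rw [← Finset.sum_neg_distrib]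
    refine Finset.sum_congr rfl fun p hp => ?_
    rw [← smul_neg]
    congr 1
    rw [← neg_mul, ← Finset.sum_neg_distrib]
    congr 1
    refine Finset.sum_congr rfl fun m hm => ?_
    simp only [S, Finset.mem_filter] at hp
    obtain ⟨r, hr⟩ := hp.2.2.1 hi
    rw [Finset.mem_range] at hm
    rw [neg_pow u', neg_pow u, mul_assoc, ← mul_assoc (u' ^ m), ← ((Commute.neg_one_left _).pow_left _).eq,
      mul_assoc, ← mul_assoc, ← pow_add, show m + (p.1 - 1 - m) = 2 * (r - 1) + 1 by omega, pow_succ,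
      pow_mul]
    simp

theorem divQt_c (i j : D.J) (u' u v : B) :
    D.divQt i.c j u' u v = -D.divQt i j (-u') (-u) v := by
  unfold divQt
  rw [J.c_fst]
  by_cases h : D.par i.fst = 1
  · have e : i.c.snd = i.snd := if_pos h
    rw [e, smul_neg, smul_neg, divQ_neg_of_odd _ _ h, smul_neg, neg_neg]
  · have e : i.c.snd = i.snd + 1 := if_neg h
    rw [e, sgn_add, sgn_one, mul_neg_one, neg_smul, neg_smul, neg_smul, smul_neg, smul_neg]

end Poly

theorem c_c_e {p q : Fin (ht β)} {ν μ : D.Seq β} (hpq : p ≠ q) (h : ν.1 p = (ν.1 q).c)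
    (h1 : μ.1 p = ν.1 q) (h2 : μ.1 q = ν.1 p) (h3 : ∀ r, r ≠ p → r ≠ q → μ.1 r = ν.1 r) :
    cRC p * cRC q * eRC μ = -(eRC ν * (cRC q * cRC p)) := by
  rw [mul_assoc, c_e, ← mul_assoc, c_e, Seq.c_c_eq hpq h h1 h2 h3, mul_assoc, c_c_ne hpq, mul_neg]

theorem op_rel (x y : (D.RC β)ᵐᵒᵖ)
    (h : Rel (fun ν => op (eRC ν)) (fun p => op (xRC p)) (fun a => op (sRC a))
      (fun p => op (cRC p)) x y) : x = y := by
  have hxx : ∀ p q : Fin (ht β), Commute (xRC p : D.RC β) (xRC q) := fun p q => x_x p q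
  cases h with
  | e_e μ ν =>
    apply unop_injective
    rw [unop_mul, unop_op, unop_op, e_e, apply_ite unop]
    by_cases h : μ = ν
    · subst h; simp
    · simp [h, Ne.symm h]
  | e_sum => apply unop_injective; rw [Finset.unop_sum]; exact e_sum
  | x_e p ν => apply unop_injective; exact (x_e p ν).symm
  | c_e p ν =>
    apply unop_injective
    have := c_e p (ν.c p)
    rw [Seq.c_c] at this
    exact this.symm
  | x_x p q ν => apply unop_injective; simp only [unop_mul, unop_op]; rw [x_x]
  | c_c p q =>
    apply unop_injective
    rw [unop_add, unop_mul, unop_mul, unop_op, unop_op, add_comm, c_c]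
    split_ifs <;> rfl
  | c_x p q =>
    apply unop_injective
    split_ifs with h
    · subst h; simp [c_x_self]
    · simp [c_x_ne h]
  | s_e a ν =>
    apply unop_injective
    have := s_e a (ν.s a)
    rw [Seq.s_s] at this
    exact this.symm
  | s_c a p =>
    apply unop_injective
    have := s_c (D := D) a (a.s p)
    rw [a.s_s] at this
    exact this.symm
  | s_x a p ν h h' =>
    apply unop_injective
    simp only [unop_mul, unop_op]
    rw [s_x a p h h']
  | s_x_hi a ν =>
    apply unop_injective
    have h1 := rel_RC (D := D) (.s_x_lo a (ν.s a))
    have h2 : eRC ν * (xRC a.hi * sRC a - sRC a * xRC a.lo) = (xRC a.hi * sRC a - sRC a * xRC a.lo) * eRC (ν.s a) := by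
      simp only [mul_sub, sub_mul, mul_assoc, x_e, s_e, Seq.s_s]
      simp only [← mul_assoc, x_e, s_e, Seq.s_s]
    simp only [unop_mul, unop_sub, unop_add, unop_op, apply_ite unop, unop_zero]
    rw [h2, h1, Seq.s_apply, Seq.s_apply, a.s_lo, a.s_hi, sub_eq_add_neg]
    congr 1
    · by_cases h : ν.1 a.lo = ν.1 a.hi
      · rw [if_pos h.symm, if_pos h, Seq.s_eq h]
      · rw [if_neg (Ne.symm h), if_neg h]
    · by_cases h : ν.1 a.lo = (ν.1 a.hi).c
      · have h' : ν.1 a.hi = (ν.1 a.lo).c := by rw [h, J.c_c]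
        rw [if_pos h, if_pos h', c_c_e a.lo_ne_hi h (by rw [Seq.s_apply, a.s_lo])
          (by rw [Seq.s_apply, a.s_hi]) fun r hr hr' => by rw [Seq.s_apply, a.s_of_ne hr hr']]
        
      · have h' : ν.1 a.hi ≠ (ν.1 a.lo).c := fun h' => h (by rw [h', J.c_c])
        rw [if_neg h, if_neg h', neg_zero]
  | s_x_lo a ν =>
    apply unop_injective
    have h1 := rel_RC (D := D) (.s_x_hi a (ν.s a))
    have h2 : eRC ν * (sRC a * xRC a.hi - xRC a.lo * sRC a) = (sRC a * xRC a.hi - xRC a.lo * sRC a) * eRC (ν.s a) := by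
      simp only [mul_sub, sub_mul, mul_assoc, x_e, s_e, Seq.s_s]
      simp only [← mul_assoc, x_e, s_e, Seq.s_s]
    simp only [unop_mul, unop_sub, unop_add, unop_op, apply_ite unop, unop_zero]
    rw [h2, h1, Seq.s_apply, Seq.s_apply, a.s_lo, a.s_hi, sub_eq_add_neg]
    congr 1
    · by_cases h : ν.1 a.lo = ν.1 a.hi
      · rw [if_pos h.symm, if_pos h, Seq.s_eq h]
      · rw [if_neg (Ne.symm h), if_neg h]
    · by_cases h : ν.1 a.lo = (ν.1 a.hi).c
      · have h' : ν.1 a.hi = (ν.1 a.lo).c := by rw [h, J.c_c]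
        rw [if_pos h, if_pos h', c_c_e a.lo_ne_hi h (by rw [Seq.s_apply, a.s_lo])
          (by rw [Seq.s_apply, a.s_hi]) fun r hr hr' => by rw [Seq.s_apply, a.s_of_ne hr hr']]
        rw [neg_neg]
      · have h' : ν.1 a.hi ≠ (ν.1 a.lo).c := fun h' => h (by rw [h', J.c_c])
        rw [if_neg h, if_neg h', neg_zero]
  | s_s a ν =>
    apply unop_injective
    have h1 := rel_RC (D := D) (.s_s a ν)
    have h2 : eRC ν * (sRC a * sRC a) = sRC a * sRC a * eRC ν := by
      rw [mul_assoc (sRC a) (sRC a), s_e, ← mul_assoc (sRC a), s_e, Seq.s_s, mul_assoc]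
    rw [op_Qt _ _ (hxx _ _)]
    simp only [unop_mul, unop_op]
    rw [h2, h1]
    have h3 : SemiconjBy (eRC ν : D.RC β) (D.Qt (ν.1 a.lo) (ν.1 a.hi) (xRC a.lo) (xRC a.hi))
        (D.Qt (ν.1 a.lo) (ν.1 a.hi) (xRC a.lo) (xRC a.hi)) :=
      semiconj_Qt _ _ (x_e _ _).symm (x_e _ _).symm
    exact h3.symm
  | s_comm a b h => apply unop_injective; exact (s_comm a b h).symm
  | braid a b h ν =>
    apply unop_injective
    have hab : a.hi = b.lo := by simp [Adj.lo, Adj.hi, Fin.ext_iff, h]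
    have n1 : a.lo ≠ b.lo := by simp [Adj.lo, Fin.ext_iff]; omega
    have n2 : a.lo ≠ b.hi := by simp [Adj.lo, Adj.hi, Fin.ext_iff]; omega
    have n3 : b.hi ≠ b.lo := b.lo_ne_hi.symm
    have b1 : b.s a.lo = a.lo := b.s_of_ne n1 n2
    have b2 : b.s b.lo = b.hi := b.s_lo
    have b3 : b.s b.hi = b.lo := b.s_hi
    have a1 : a.s a.lo = b.lo := by rw [a.s_lo, hab]
    have a2 : a.s b.lo = a.lo := by rw [← hab, a.s_hi]
    have a3 : a.s b.hi = b.hi := a.s_of_ne n2.symm (by rw [hab]; exact n3)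
    set μ := ((ν.s b).s a).s b with hμ
    have m1 : μ.1 a.lo = ν.1 b.hi := by simp only [hμ, Seq.s_apply, a1, a2, a3, b1, b2, b3]
    have m2 : μ.1 b.lo = ν.1 b.lo := by simp only [hμ, Seq.s_apply, a1, a2, a3, b1, b2, b3]
    have m3 : μ.1 b.hi = ν.1 a.lo := by simp only [hμ, Seq.s_apply, a1, a2, a3, b1, b2, b3]
    have m4 : ∀ r, r ≠ a.lo → r ≠ b.hi → μ.1 r = ν.1 r := by
      intro r h1 h2
      by_cases h3 : r = b.lo
      · rw [h3, m2]
      · have e1 : a.s r = r := a.s_of_ne h1 (by rwa [hab])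
        have e2 : b.s r = r := b.s_of_ne h3 h2
        simp only [hμ, Seq.s_apply, e1, e2]
    have hμ' : ((ν.s a).s b).s a = μ := by
      apply Subtype.ext
      funext r
      by_cases h1 : r = a.lo
      · subst h1; simp only [hμ, Seq.s_apply, a1, a2, a3, b1, b2, b3]
      · by_cases h2 : r = b.hi
        · subst h2; simp only [hμ, Seq.s_apply, a1, a2, a3, b1, b2, b3]
        · by_cases h3 : r = b.lo
          · subst h3; simp only [hμ, Seq.s_apply, a1, a2, a3, b1, b2, b3]
          · rw [m4 r h1 h2]
            have e1 : a.s r = r := a.s_of_ne h1 (by rwa [hab])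
            have e2 : b.s r = r := b.s_of_ne h3 h2
            simp only [Seq.s_apply, e1, e2]
    have hx := rel_RC (D := D) (.braid a b h μ)
    have hb : sRC b * sRC a * sRC b * eRC μ = eRC ν * (sRC b * (sRC a * sRC b)) := by
      rw [mul_assoc, s_e, ← mul_assoc, mul_assoc (sRC b), s_e, ← mul_assoc, s_e, hμ, Seq.s_s,
        Seq.s_s, Seq.s_s]
      simp only [mul_assoc]
    have ha : sRC a * sRC b * sRC a * eRC μ = eRC ν * (sRC a * (sRC b * sRC a)) := by
      rw [mul_assoc, s_e, ← mul_assoc, mul_assoc (sRC a), s_e, ← mul_assoc, s_e, ← hμ', Seq.s_s,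
        Seq.s_s, Seq.s_s]
      simp only [mul_assoc]
    rw [sub_mul, hb, ha, ← mul_sub, hab, m1, m2, m3] at hx
    have hn : ∀ p q : Fin (ht β), Commute (-xRC p : D.RC β) (xRC q) := fun p q => (hxx p q).neg_left
    rw [← op_neg, hab, op_divQt _ _ (hxx _ _) (hxx _ _) (hxx _ _),
      op_divQt _ _ (hn _ _).symm (hxx _ _) (hn _ _)]
    simp only [unop_mul, unop_sub, unop_add, unop_op, apply_ite unop, unop_zero]
    rw [hx]
    congr 1
    · by_cases h1 : ν.1 a.lo = ν.1 b.hi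
      · have hμν : μ = ν := by
          apply Subtype.ext
          funext r
          by_cases h2 : r = a.lo
          · rw [h2, m1, h1]
          · by_cases h3 : r = b.hi
            · rw [h3, m3, h1]
            · exact m4 r h2 h3
        rw [if_pos h1, if_pos h1.symm, hμν, ← h1]
        have h3 : SemiconjBy (eRC ν : D.RC β)
            (D.divQt (ν.1 a.lo) (ν.1 b.lo) (xRC b.hi) (xRC a.lo) (xRC b.lo))
            (D.divQt (ν.1 a.lo) (ν.1 b.lo) (xRC b.hi) (xRC a.lo) (xRC b.lo)) :=
          semiconj_divQt _ _ (x_e _ _).symm (x_e _ _).symm (x_e _ _).symm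
        exact h3.symm
      · rw [if_neg h1, if_neg (Ne.symm h1)]
    · by_cases h1 : ν.1 a.lo = (ν.1 b.hi).c
      · have h1' : ν.1 b.hi = (ν.1 a.lo).c := by rw [h1, J.c_c]
        rw [if_pos h1, if_pos h1', mul_assoc, mul_assoc, ← mul_assoc (cRC a.lo),
          c_c_e n2 h1 m1 m3 m4, h1', divQt_c, neg_neg, mul_neg, neg_mul, neg_neg]
        have h3 : SemiconjBy (eRC ν : D.RC β)
            (D.divQt (ν.1 a.lo) (ν.1 b.lo) (-xRC b.hi) (xRC a.lo) (xRC b.lo))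
            (D.divQt (ν.1 a.lo) (ν.1 b.lo) (-xRC b.hi) (xRC a.lo) (xRC b.lo)) :=
          semiconj_divQt _ _ (SemiconjBy.neg_right (x_e _ _).symm) (x_e _ _).symm (x_e _ _).symm
        have h4 : SemiconjBy (cRC a.lo : D.RC β)
            (D.divQt (ν.1 a.lo) (ν.1 b.lo) (xRC b.hi) (-xRC a.lo) (xRC b.lo))
            (D.divQt (ν.1 a.lo) (ν.1 b.lo) (xRC b.hi) (xRC a.lo) (xRC b.lo)) :=
          semiconj_divQt _ _ (c_x_ne n2)
            (by rw [SemiconjBy, mul_neg, c_x_self, neg_neg]) (c_x_ne n1)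
        have h5 : SemiconjBy (cRC b.hi : D.RC β)
            (D.divQt (ν.1 a.lo) (ν.1 b.lo) (xRC b.hi) (xRC a.lo) (xRC b.lo))
            (D.divQt (ν.1 a.lo) (ν.1 b.lo) (-xRC b.hi) (xRC a.lo) (xRC b.lo)) :=
          semiconj_divQt _ _ (by rw [SemiconjBy, neg_mul, c_x_self])
            (c_x_ne n2.symm) (c_x_ne n3)
        rw [← mul_assoc, ← h3.eq, mul_assoc, ← mul_assoc _ (cRC b.hi), ← h5.eq, mul_assoc, ← h4.eq]
      · have h' : ν.1 b.hi ≠ (ν.1 a.lo).c := fun h' => h1 (by rw [h', J.c_c])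
        rw [if_neg h1, if_neg h']

/-! ### The antiautomorphism `ψ` -/

/-- The antiautomorphism of the underlying ungraded algebra that fixes all generators. -/
def transp : D.RC β →ₐ[k] (D.RC β)ᵐᵒᵖ := liftRC (fun g => op g.val) op_rel

theorem transp_val (g : Gen D β) : transp g.val = op g.val := liftRC_val _ _ _

theorem unop_transp_mul (a b : D.RC β) :
    unop (transp (a * b)) = unop (transp b) * unop (transp a) := by
  rw [map_mul, unop_mul]

theorem transp_gen_e_mem (g : Gen D β) (ν : D.Seq β) :
    unop (transp (g.val * eRC ν)) ∈ D.piece β (g.deg ν) := by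
  rw [unop_transp_mul, transp_val, transp_val, unop_op, unop_op]
  cases g with
  | e μ =>
    have := mul_mem (e_mem ν) (e_mem μ)
    rw [add_zero] at this
    exact this
  | x p =>
    change eRC ν * xRC p ∈ _
    rw [← x_e]
    exact gen_e_mem (.x p) ν
  | s a =>
    change eRC ν * sRC a ∈ _
    have h := s_e a (ν.s a)
    rw [Seq.s_s] at h
    rw [← h]
    have h1 := gen_e_mem (.s a) (ν.s a)
    have h2 : (Gen.s a : Gen D β).deg (ν.s a) = (Gen.s a : Gen D β).deg ν := by
      simp only [Gen.deg, Seq.s_apply, a.s_lo, a.s_hi]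
      rw [D.symm]
    rwa [h2] at h1
  | c p =>
    change eRC ν * cRC p ∈ _
    have := mul_mem (e_mem ν) (c_mem p)
    rwa [zero_add] at this

theorem transp_mem {g : ℤ × ZMod 2} {a : D.RC β} (ha : a ∈ D.piece β g) :
    unop (transp a) ∈ D.piece β g := by
  induction ha using Submodule.span_induction with
  | mem y hy =>
    obtain ⟨l, rfl, rfl⟩ := hy
    induction l with
    | nil => simpa [monomial, monDeg] using one_mem
    | cons y l ih =>
      have h1 : monomial (y :: l) = y.1.val * eRC y.2 * monomial l := by simp [monomial]
      have h2 : monDeg (y :: l) = monDeg l + y.1.deg y.2 := by simp [monDeg, add_comm]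
      rw [h1, h2, unop_transp_mul]
      exact mul_mem ih (transp_gen_e_mem _ _)
  | zero => simp
  | add y z _ _ hy hz => rw [map_add, unop_add]; exact add_mem hy hz
  | smul r y _ hy => rw [map_smul, unop_smul]; exact Submodule.smul_mem _ _ hy

end Datum

/-- The component of parity `q` of a vector in a bigraded space. -/
def parComp {k M : Type*} [Field k] [AddCommGroup M] [Module k M]
    {V : ℤ × ZMod 2 → Submodule k M} (h : DirectSum.IsInternal V) (q : ZMod 2) : M →ₗ[k] M :=
  (Finsupp.lsum k fun g : ℤ × ZMod 2 => if g.2 = q then LinearMap.id else 0) ∘ₗ degMap h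

theorem parComp_of_mem {k M : Type*} [Field k] [AddCommGroup M] [Module k M]
    {V : ℤ × ZMod 2 → Submodule k M} (h : DirectSum.IsInternal V) (q : ZMod 2) {g : ℤ × ZMod 2}
    {v : M} (hv : v ∈ V g) : parComp h q v = if g.2 = q then v else 0 := by
  simp only [parComp, LinearMap.comp_apply, degMap_of_mem h hv, Finsupp.lsum_apply]
  refine (Finsupp.sum_single_index
    (h := fun b : ℤ × ZMod 2 => ⇑(if b.2 = q then LinearMap.id else 0 : M →ₗ[k] M))
    (map_zero (if g.2 = q then LinearMap.id else 0 : M →ₗ[k] M))).trans ?_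
  split_ifs <;> rfl

theorem parComp_sum {k M : Type*} [Field k] [AddCommGroup M] [Module k M]
    {V : ℤ × ZMod 2 → Submodule k M} (h : DirectSum.IsInternal V) (v : M) :
    parComp h 0 v + parComp h 1 v = v := by
  induction v using graded_induction h with
  | hV g v hv =>
    have h2 : ∀ p : ZMod 2, p = 0 ∨ p = 1 := by decide
    rw [parComp_of_mem h _ hv, parComp_of_mem h _ hv]
    rcases h2 g.2 with h3 | h3 <;> simp [h3]
  | h0 => simp
  | hadd v w hv hw =>
    rw [map_add, map_add, add_add_add_comm, hv, hw]

namespace Datum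

variable {k I : Type*} [Field k] {D : Datum k I} {β : I →₀ ℕ} [DecidableEq I]

open MulOpposite

/-- The antiautomorphism `ψ` of the superalgebra `RC_β`, where `im` is a square root of `-1`: it is
the identity on `e(ν)`, `x_p`, `σ_a`, multiplies `c_p` by `-im`, and
`ψ(ab) = (-1)^{|a||b|} ψ(b) ψ(a)`; see `psi_e`, `psi_x`, `psi_s`, `psi_c` and `psi_mul`. -/
def psi (im : k) : D.RC β →ₗ[k] D.RC β :=
  ((MulOpposite.opLinearEquiv k).symm.toLinearMap ∘ₗ transp.toLinearMap) ∘ₗ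
    (parComp isInternal_RC 0 - im • parComp isInternal_RC 1)

theorem psi_of_mem (im : k) {g : ℤ × ZMod 2} {a : D.RC β} (ha : a ∈ D.piece β g) :
    psi im a = (if g.2 = 0 then 1 else -im) • unop (transp a) := by
  have h2 : ∀ p : ZMod 2, p = 0 ∨ p = 1 := by decide
  simp only [psi, LinearMap.comp_apply, LinearMap.sub_apply, LinearMap.smul_apply,
    parComp_of_mem isInternal_RC _ ha]
  rcases h2 g.2 with h3 | h3 <;> simp [h3]

theorem psi_mem (im : k) {g : ℤ × ZMod 2} {a : D.RC β} (ha : a ∈ D.piece β g) :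
    psi im a ∈ D.piece β g := by
  rw [psi_of_mem im ha]
  exact Submodule.smul_mem _ _ (transp_mem ha)

theorem psi_e (im : k) (ν : D.Seq β) : psi im (eRC ν) = eRC ν := by
  rw [psi_of_mem im (e_mem ν), transp_val]; simp

theorem psi_x (im : k) (p : Fin (ht β)) : psi im (xRC p : D.RC β) = xRC p := by
  conv_lhs => rw [← mul_one (xRC p), ← e_sum, Finset.mul_sum, map_sum]
  conv_rhs => rw [← one_mul (xRC p), ← e_sum, Finset.sum_mul]
  refine Finset.sum_congr rfl fun ν _ => ?_
  rw [psi_of_mem im (gen_e_mem (.x p) ν), unop_transp_mul, transp_val, transp_val]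
  simp [Gen.deg]

theorem psi_s (im : k) (a : Adj (ht β)) : psi im (sRC a : D.RC β) = sRC a := by
  conv_lhs => rw [← mul_one (sRC a), ← e_sum, Finset.mul_sum, map_sum]
  conv_rhs => rw [← one_mul (sRC a), ← e_sum, Finset.sum_mul]
  refine Finset.sum_congr rfl fun ν _ => ?_
  rw [psi_of_mem im (gen_e_mem (.s a) ν), unop_transp_mul, transp_val, transp_val]
  simp [Gen.deg]

theorem psi_c (im : k) (p : Fin (ht β)) : psi im (cRC p : D.RC β) = -im • cRC p := by
  rw [psi_of_mem im (c_mem p), transp_val]; simp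

theorem psi_mul {im : k} (him : im * im = -1) {g h : ℤ × ZMod 2} {a b : D.RC β}
    (ha : a ∈ D.piece β g) (hb : b ∈ D.piece β h) :
    psi im (a * b) = sgn k (g.2 * h.2) • (psi im b * psi im a) := by
  have h2 : ∀ p : ZMod 2, p = 0 ∨ p = 1 := by decide
  have h3 : (1 : ZMod 2) + 1 = 0 := rfl
  rw [psi_of_mem im (mul_mem ha hb), psi_of_mem im ha, psi_of_mem im hb, unop_transp_mul,
    smul_mul_smul_comm, smul_smul]
  congr 1
  rcases h2 g.2 with hg | hg <;> rcases h2 h.2 with hh | hh <;>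
    simp [hg, hh, h3, sgn_zero, sgn_one, him]

end Datum

end

end QuiverHeckeClifford

namespace QuiverHeckeClifford

set_option linter.unusedSimpArgs false

noncomputable section

section Corner

variable {k B : Type*} [Field k] [Ring B] [Algebra k B] {e : B}

/-- The algebra `e B e`, with unit `e`, for an idempotent `e`. -/
instance cornerAlgebra (he : IsIdempotentElem e) : Algebra k he.Corner :=
  RingHom.toAlgebra'
    { toFun := fun r => ⟨r • e, r • e, by simp [he.eq]⟩
      map_one' := Subtype.ext (one_smul k e)
      map_mul' := fun r r' => Subtype.ext (by
        change (r * r') • e = (r • e) * (r' • e)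
        rw [smul_mul_smul_comm, he.eq])
      map_zero' := Subtype.ext (zero_smul k e)
      map_add' := fun r r' => Subtype.ext (add_smul r r' e) }
    (fun r y => Subtype.ext (by
      have h := (Subsemigroup.mem_corner_iff he).1 y.2
      change (r • e) * y.1 = y.1 * (r • e)
      rw [smul_mul_assoc, mul_smul_comm, h.1, h.2]))

/-- The homomorphism `y ↦ y e` from the centralizer of an idempotent `e` to `e B e`. -/
def toCorner (he : IsIdempotentElem e) : Subalgebra.centralizer k {e} →ₐ[k] he.Corner where
  toFun y := ⟨y.1 * e, y.1, by
    have h : e * y.1 = y.1 * e := (Subalgebra.mem_centralizer_iff k).1 y.2 e rfl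
    change e * y.1 * e = y.1 * e
    rw [h, mul_assoc, he.eq]⟩
  map_one' := Subtype.ext (one_mul e)
  map_mul' y z := Subtype.ext (by
    have h : e * z.1 = z.1 * e := (Subalgebra.mem_centralizer_iff k).1 z.2 e rfl
    change y.1 * z.1 * e = (y.1 * e) * (z.1 * e)
    rw [mul_assoc y.1 e, ← mul_assoc e, h, mul_assoc z.1, he.eq, mul_assoc])
  map_zero' := Subtype.ext (zero_mul e)
  map_add' y z := Subtype.ext (add_mul y.1 z.1 e)
  commutes' r := Subtype.ext (by
    change algebraMap k B r * e = r • e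
    rw [Algebra.smul_def])

theorem toCorner_val (he : IsIdempotentElem e) (y : Subalgebra.centralizer k {e}) :
    (toCorner he y).1 = y.1 * e := rfl

end Corner

namespace Datum

variable {k I : Type*} [Field k] {D : Datum k I} {β' β : I →₀ ℕ}

/-- The position `s + p`, for a position `p` in a block of length `|β'|` that starts after `s`. -/
def blk {s : ℕ} (hs : s + ht β' ≤ ht β) (p : Fin (ht β')) : Fin (ht β) := ⟨s + p.1, by omega⟩

/-- The index `s + a`, for `a` in a block of length `|β'|` that starts after `s`. -/
def blkA {s : ℕ} (hs : s + ht β' ≤ ht β) (a : Adj (ht β')) : Adj (ht β) :=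
  ⟨s + a.1, by have := a.2; omega⟩

section

variable {s : ℕ} (hs : s + ht β' ≤ ht β)

theorem blk_inj {p q : Fin (ht β')} : blk hs p = blk hs q ↔ p = q := by
  simp [blk, Fin.ext_iff]

theorem blkA_lo (a : Adj (ht β')) : (blkA hs a).lo = blk hs a.lo := rfl

theorem blkA_hi (a : Adj (ht β')) : (blkA hs a).hi = blk hs a.hi := rfl

theorem blkA_s (a : Adj (ht β')) (p : Fin (ht β')) : (blkA hs a).s (blk hs p) = blk hs (a.s p) := by
  by_cases h1 : p = a.lo
  · subst h1; rw [a.s_lo, ← blkA_lo, Adj.s_lo, blkA_hi]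
  · by_cases h2 : p = a.hi
    · subst h2; rw [a.s_hi, ← blkA_hi, Adj.s_hi, blkA_lo]
    · rw [a.s_of_ne h1 h2, Adj.s_of_ne]
      · rw [blkA_lo]; exact fun h => h1 ((blk_inj hs).1 h)
      · rw [blkA_hi]; exact fun h => h2 ((blk_inj hs).1 h)

/-- The subsequence of `μ` in the block. -/
def res (μ : D.Seq β) : Fin (ht β') → D.J := fun p => μ.1 (blk hs p)

theorem res_c (p : Fin (ht β')) (μ : D.Seq β) :
    res hs (μ.c (blk hs p)) = Function.update (res hs μ) p (res hs μ p).c := by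
  funext q
  by_cases h : q = p
  · subst h; rw [Function.update_self]; exact Seq.c_same _ _
  · rw [Function.update_of_ne h]; exact Seq.c_ne (fun h' => h ((blk_inj hs).1 h')) _

theorem res_s (a : Adj (ht β')) (μ : D.Seq β) : res hs (μ.s (blkA hs a)) = res hs μ ∘ a.s := by
  funext q
  simp [res, Seq.s_apply, blkA_s]

theorem wt_res_c (p : Fin (ht β')) (μ : D.Seq β) :
    D.wt (res hs (μ.c (blk hs p))) = D.wt (res hs μ) := by
  refine Finset.sum_congr rfl fun q _ => ?_
  rw [res, Seq.c_fst]; rfl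

theorem wt_res_s (a : Adj (ht β')) (μ : D.Seq β) :
    D.wt (res hs (μ.s (blkA hs a))) = D.wt (res hs μ) := by
  rw [res_s]
  exact Equiv.sum_comp a.s fun i => Finsupp.single (res hs μ i).fst 1

theorem res_c_iff (p : Fin (ht β')) (μ : D.Seq β) (ν : D.Seq β') :
    res hs (μ.c (blk hs p)) = (ν.c p).1 ↔ res hs μ = ν.1 := by
  constructor
  · intro h
    have h1 : ∀ q, res hs (μ.c (blk hs p)) q = (ν.c p).1 q := congrFun h
    funext q
    have h2 := h1 q
    rw [res_c] at h2
    by_cases h : q = p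
    · subst h
      rw [Function.update_self, Seq.c_same] at h2
      rw [← J.c_c (res hs μ q), h2, J.c_c]
    · rwa [Function.update_of_ne h, Seq.c_ne h] at h2
  · intro h
    rw [res_c, h]; rfl

theorem res_s_iff (a : Adj (ht β')) (μ : D.Seq β) (ν : D.Seq β') :
    res hs (μ.s (blkA hs a)) = (ν.s a).1 ↔ res hs μ = ν.1 := by
  rw [res_s]
  constructor
  · intro h
    funext q
    have := congrFun h (a.s q)
    simpa [Seq.s_apply, a.s_s] using this
  · intro h
    rw [h]; rfl

end

variable [DecidableEq I] {s : ℕ} (hs : s + ht β' ≤ ht β)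

/-- The sum of all `e(μ)` such that the subsequence of `μ` in the block is `ν`. -/
def blockE (ν : D.Seq β') : D.RC β := ∑ μ, if res hs μ = ν.1 then eRC μ else 0

variable (D) in
/-- The sum of all `e(μ)` such that the subsequence of `μ` in the block lies in `J^β'`. -/
def blockIdem : D.RC β := ∑ μ : D.Seq β, if D.wt (res hs μ) = β' then eRC μ else 0

theorem sum_ite_mul_e (c : D.Seq β → Prop) [DecidablePred c] (ν : D.Seq β) :
    (∑ μ, if c μ then eRC μ else 0) * eRC ν = if c ν then eRC ν else 0 := by
  rw [Finset.sum_mul, Finset.sum_eq_single ν]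
  · split_ifs
    · exact e_e_self ν
    · exact zero_mul _
  · intro μ _ h
    split_ifs
    · rw [e_e, if_neg h]
    · exact zero_mul _
  · simp

theorem blockE_mul_e (ν : D.Seq β') (μ : D.Seq β) :
    blockE hs ν * eRC μ = if res hs μ = ν.1 then eRC μ else 0 := sum_ite_mul_e _ _

theorem blockIdem_mul_e (μ : D.Seq β) :
    D.blockIdem hs * eRC μ = if D.wt (res hs μ) = β' then eRC μ else 0 := sum_ite_mul_e _ _

theorem blockIdem_idem : IsIdempotentElem (D.blockIdem hs) := by
  refine eq_of_mul_e fun μ => ?_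
  rw [mul_assoc, blockIdem_mul_e]
  split_ifs with h
  · rw [blockIdem_mul_e, if_pos h]
  · rw [mul_zero]

theorem sum_blockE : ∑ ν : D.Seq β', blockE hs ν = D.blockIdem hs := by
  refine eq_of_mul_e fun μ => ?_
  rw [blockIdem_mul_e, Finset.sum_mul]
  simp only [blockE_mul_e]
  split_ifs with h
  · rw [Finset.sum_eq_single ⟨res hs μ, h⟩]
    · simp
    · intro ν _ hν
      rw [if_neg]
      intro h'
      exact hν (Subtype.ext h'.symm)
    · simp
  · refine Finset.sum_eq_zero fun ν _ => ?_
    rw [if_neg]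
    intro h'
    exact h (h' ▸ ν.2)

theorem mul_blockE_congr {y z : D.RC β} {ν : D.Seq β'}
    (h : ∀ μ, res hs μ = ν.1 → y * eRC μ = z * eRC μ) : y * blockE hs ν = z * blockE hs ν := by
  rw [blockE, Finset.mul_sum, Finset.mul_sum]
  refine Finset.sum_congr rfl fun μ _ => ?_
  split_ifs with h'
  · exact h μ h'
  · rw [mul_zero, mul_zero]

theorem block_rel (x y : D.RC β)
    (h : Rel (blockE hs) (fun p => xRC (blk hs p)) (fun a => sRC (blkA hs a))
      (fun p => cRC (blk hs p)) x y) : x = y ∨ x = D.blockIdem hs ∧ y = 1 := by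
  cases h with
  | e_sum => exact Or.inr ⟨sum_blockE hs, rfl⟩
  | e_e μ ν =>
    left
    refine eq_of_mul_e fun ρ => ?_
    rw [mul_assoc, blockE_mul_e, mul_ite, mul_zero, blockE_mul_e]
    by_cases h : μ = ν
    · subst h
      simp only [if_true, blockE_mul_e]
      split_ifs <;> rfl
    · rw [if_neg h, zero_mul]
      split_ifs with h1 h2
      · exact absurd (Subtype.ext (h2.symm.trans h1)) h
      · rfl
      · rfl
  | x_e p ν =>
    left
    rw [blockE, Finset.mul_sum, Finset.sum_mul]
    refine Finset.sum_congr rfl fun μ _ => ?_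
    rw [mul_ite, ite_mul, x_e, mul_zero, zero_mul]
  | c_e p ν =>
    left
    refine eq_of_mul_e fun μ => ?_
    rw [mul_assoc, blockE_mul_e, mul_assoc, c_e, ← mul_assoc, blockE_mul_e]
    simp only [res_c_iff]
    split_ifs
    · rw [c_e]
    · rw [mul_zero, zero_mul]
  | x_x p q ν => left; rw [x_x]
  | c_c p q =>
    left
    rw [c_c]
    simp only [blk_inj]
  | c_x p q =>
    left
    rw [c_x]
    simp only [blk_inj]
  | s_e a ν =>
    left
    refine eq_of_mul_e fun μ => ?_
    rw [mul_assoc, blockE_mul_e, mul_assoc, s_e, ← mul_assoc, blockE_mul_e]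
    simp only [res_s_iff]
    split_ifs
    · rw [s_e]
    · rw [mul_zero, zero_mul]
  | s_c a p => left; rw [s_c, blkA_s]
  | s_x a p ν h h' =>
    left
    rw [s_x]
    · rw [blkA_lo]; exact fun h1 => h ((blk_inj hs).1 h1)
    · rw [blkA_hi]; exact fun h1 => h' ((blk_inj hs).1 h1)
  | s_x_hi a ν =>
    left
    refine (mul_blockE_congr hs (z := (if ν.1 a.lo = ν.1 a.hi then 1 else 0) -
      (if ν.1 a.lo = (ν.1 a.hi).c then cRC (blk hs a.lo) * cRC (blk hs a.hi) else 0)) ?_).trans ?_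
    · intro μ hμ
      have := rel_RC (D := D) (.s_x_hi (blkA hs a) μ)
      rw [blkA_lo, blkA_hi, show μ.1 (blk hs a.lo) = ν.1 a.lo from congrFun hμ a.lo,
        show μ.1 (blk hs a.hi) = ν.1 a.hi from congrFun hμ a.hi] at this
      rw [this, sub_mul, ite_mul, ite_mul, one_mul, zero_mul]
    · rw [sub_mul, ite_mul, ite_mul, one_mul, zero_mul]
  | s_x_lo a ν =>
    left
    refine (mul_blockE_congr hs (z := (if ν.1 a.lo = ν.1 a.hi then 1 else 0) +
      (if ν.1 a.lo = (ν.1 a.hi).c then cRC (blk hs a.lo) * cRC (blk hs a.hi) else 0)) ?_).trans ?_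
    · intro μ hμ
      have := rel_RC (D := D) (.s_x_lo (blkA hs a) μ)
      rw [blkA_lo, blkA_hi, show μ.1 (blk hs a.lo) = ν.1 a.lo from congrFun hμ a.lo,
        show μ.1 (blk hs a.hi) = ν.1 a.hi from congrFun hμ a.hi] at this
      rw [this, add_mul, ite_mul, ite_mul, one_mul, zero_mul]
    · rw [add_mul, ite_mul, ite_mul, one_mul, zero_mul]
  | s_s a ν =>
    left
    refine mul_blockE_congr hs fun μ hμ => ?_
    have := rel_RC (D := D) (.s_s (blkA hs a) μ)
    rw [blkA_lo, blkA_hi, show μ.1 (blk hs a.lo) = ν.1 a.lo from congrFun hμ a.lo,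
      show μ.1 (blk hs a.hi) = ν.1 a.hi from congrFun hμ a.hi] at this
    exact this
  | s_comm a b h =>
    left
    refine s_comm _ _ ?_
    simp only [blkA]; omega
  | braid a b h ν =>
    left
    refine (mul_blockE_congr hs (z := (if ν.1 a.lo = ν.1 b.hi then
        D.divQt (ν.1 a.lo) (ν.1 a.hi) (xRC (blk hs b.hi)) (xRC (blk hs a.lo)) (xRC (blk hs a.hi))
        else 0) + (if ν.1 a.lo = (ν.1 b.hi).c then
        D.divQt (ν.1 a.lo) (ν.1 a.hi) (xRC (blk hs b.hi)) (-xRC (blk hs a.lo)) (xRC (blk hs a.hi)) *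
          cRC (blk hs a.lo) * cRC (blk hs b.hi) else 0)) ?_).trans ?_
    · intro μ hμ
      have := rel_RC (D := D) (.braid (blkA hs a) (blkA hs b) (by simp only [blkA]; omega) μ)
      rw [blkA_lo, blkA_hi, blkA_hi, show μ.1 (blk hs a.lo) = ν.1 a.lo from congrFun hμ a.lo,
        show μ.1 (blk hs a.hi) = ν.1 a.hi from congrFun hμ a.hi,
        show μ.1 (blk hs b.hi) = ν.1 b.hi from congrFun hμ b.hi] at this
      rw [this, add_mul, ite_mul, ite_mul, zero_mul]
    · rw [add_mul, ite_mul, ite_mul, zero_mul]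

theorem x_blockIdem (p : Fin (ht β')) :
    D.blockIdem hs * xRC (blk hs p) = xRC (blk hs p) * D.blockIdem hs := by
  refine eq_of_mul_e fun μ => ?_
  rw [mul_assoc, mul_assoc, x_e, ← mul_assoc, blockIdem_mul_e]
  split_ifs
  · rw [x_e]
  · rw [mul_zero, zero_mul]

theorem c_blockIdem (p : Fin (ht β')) :
    D.blockIdem hs * cRC (blk hs p) = cRC (blk hs p) * D.blockIdem hs := by
  refine eq_of_mul_e fun μ => ?_
  rw [mul_assoc, mul_assoc, c_e, ← mul_assoc, blockIdem_mul_e, blockIdem_mul_e, wt_res_c]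
  split_ifs
  · rw [c_e]
  · rw [mul_zero, zero_mul]

theorem s_blockIdem (a : Adj (ht β')) :
    D.blockIdem hs * sRC (blkA hs a) = sRC (blkA hs a) * D.blockIdem hs := by
  refine eq_of_mul_e fun μ => ?_
  rw [mul_assoc, mul_assoc, s_e, ← mul_assoc, blockIdem_mul_e, blockIdem_mul_e, wt_res_s]
  split_ifs
  · rw [s_e]
  · rw [mul_zero, zero_mul]

theorem e_blockIdem (μ : D.Seq β) : D.blockIdem hs * eRC μ = eRC μ * D.blockIdem hs := by
  rw [blockIdem, Finset.mul_sum, Finset.sum_mul]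
  refine Finset.sum_congr rfl fun ρ _ => ?_
  split_ifs
  · rw [e_e, e_e]
    by_cases h : ρ = μ
    · subst h; rfl
    · rw [if_neg h, if_neg (Ne.symm h)]
  · rw [mul_zero, zero_mul]

theorem blockE_blockIdem (ν : D.Seq β') :
    D.blockIdem hs * blockE hs ν = blockE hs ν * D.blockIdem hs := by
  rw [blockE, Finset.mul_sum, Finset.sum_mul]
  refine Finset.sum_congr rfl fun ρ _ => ?_
  split_ifs
  · exact e_blockIdem hs ρ
  · rw [mul_zero, zero_mul]

theorem blockE_mul_blockIdem (ν : D.Seq β') : blockE hs ν * D.blockIdem hs = blockE hs ν := by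
  rw [← blockE_blockIdem]
  refine eq_of_mul_e fun μ => ?_
  rw [mul_assoc, blockE_mul_e]
  split_ifs with h
  · rw [blockIdem_mul_e, if_pos (h ▸ ν.2)]
  · rw [mul_zero]

/-- The images of the generators of `RC_β'` in the centralizer of the idempotent of the block. -/
def blockGen : Gen D β' → Subalgebra.centralizer k {D.blockIdem hs}
  | .e ν => ⟨blockE hs ν, (Subalgebra.mem_centralizer_iff k).2 fun _ h => h ▸ blockE_blockIdem hs ν⟩
  | .x p => ⟨xRC (blk hs p), (Subalgebra.mem_centralizer_iff k).2 fun _ h => h ▸ x_blockIdem hs p⟩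
  | .s a => ⟨sRC (blkA hs a), (Subalgebra.mem_centralizer_iff k).2 fun _ h => h ▸ s_blockIdem hs a⟩
  | .c p => ⟨cRC (blk hs p), (Subalgebra.mem_centralizer_iff k).2 fun _ h => h ▸ c_blockIdem hs p⟩

/-- The algebra homomorphism from `RC_β'` to `ε RC_β ε`, where `ε` is the idempotent of the block,
with `e(ν) ↦ ∑ e(μ)` (the sum over all `μ` that restrict to `ν`), `x_p ↦ x_{s+p} ε`,
`σ_a ↦ σ_{s+a} ε` and `c_p ↦ c_{s+p} ε`. -/
def blockHom : D.RC β' →ₐ[k] (blockIdem_idem (D := D) hs).Corner :=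
  liftRC (fun g => toCorner (blockIdem_idem hs) (blockGen hs g)) (by
    intro x y h
    obtain ⟨x', y', h', rfl, rfl⟩ := Rel.exists_lift (toCorner (blockIdem_idem hs)) h
    apply Subtype.ext
    rw [toCorner_val, toCorner_val]
    rcases block_rel hs _ _ (h'.map (Subalgebra.val _)) with h1 | ⟨h1, h2⟩
    · exact congrArg (· * D.blockIdem hs) h1
    · refine (congrArg (· * D.blockIdem hs) h1).trans
        (Eq.trans ?_ (congrArg (· * D.blockIdem hs) h2).symm)
      rw [(blockIdem_idem hs).eq, one_mul])

theorem blockHom_e (ν : D.Seq β') : (blockHom hs (eRC ν)).1 = blockE hs ν := by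
  rw [blockHom, liftRC_val]
  exact blockE_mul_blockIdem hs ν

theorem blockHom_x (p : Fin (ht β')) :
    (blockHom (D := D) hs (xRC p)).1 = xRC (blk hs p) * D.blockIdem hs := by
  rw [blockHom, liftRC_val]; rfl

theorem blockHom_s (a : Adj (ht β')) :
    (blockHom (D := D) hs (sRC a)).1 = sRC (blkA hs a) * D.blockIdem hs := by
  rw [blockHom, liftRC_val]; rfl

theorem blockHom_c (p : Fin (ht β')) :
    (blockHom (D := D) hs (cRC p)).1 = cRC (blk hs p) * D.blockIdem hs := by
  rw [blockHom, liftRC_val]; rfl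

end Datum

end

end QuiverHeckeClifford

namespace QuiverHeckeClifford

noncomputable section

open TensorProduct

/-! ### Graded supermodules -/

/-- A `ℤ`-graded supermodule over `RC_β`: an `RC_β`-module with a `ℤ`-grading and a compatible
`ℤ/2ℤ`-grading, i.e. a decomposition into the bihomogeneous components `piece (d, p)`, such that the
action is homogeneous for both gradings. -/
structure SGMod {k I : Type*} [Field k] [DecidableEq I] (D : Datum k I) (β : I →₀ ℕ) where
  /-- the underlying set -/
  carrier : Type*
  [addCommGroup : AddCommGroup carrier]
  [moduleBase : Module k carrier]
  [module : Module (D.RC β) carrier]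
  [tower : IsScalarTower k (D.RC β) carrier]
  /-- the component of given `ℤ`-degree and parity -/
  piece : ℤ × ZMod 2 → Submodule k carrier
  internal : DirectSum.IsInternal piece
  smul_mem : ∀ g h, ∀ a ∈ D.piece β g, ∀ m ∈ piece h, a • m ∈ piece (g + h)

attribute [instance] SGMod.addCommGroup SGMod.moduleBase SGMod.module SGMod.tower

namespace SGMod

variable {k I : Type*} [Field k] [DecidableEq I] {D : Datum k I} {β : I →₀ ℕ}

/-- The component `M_d` of `ℤ`-degree `d`. -/
def degPiece (M : SGMod D β) (d : ℤ) : Submodule k M.carrier := M.piece (d, 0) ⊔ M.piece (d, 1)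

/-- Every component `M_d` is finite-dimensional, and `M_d = 0` for all sufficiently small `d`. -/
def IsL (M : SGMod D β) : Prop :=
  (∀ d, FiniteDimensional k (M.degPiece d)) ∧ ∃ N : ℤ, ∀ d < N, M.degPiece d = ⊥

/-- An even isomorphism of modules that preserves the `ℤ`-degree. -/
structure Iso (M N : SGMod D β) where
  /-- the underlying isomorphism of modules -/
  toEquiv : M.carrier ≃ₗ[D.RC β] N.carrier
  map_mem : ∀ g, ∀ m ∈ M.piece g, toEquiv m ∈ N.piece g

/-- The grading shift `q^r M`, with `(q^r M)_d = M_{d - r}`. -/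
def shift (r : ℤ) (M : SGMod D β) : SGMod D β where
  carrier := M.carrier
  piece g := M.piece (g.1 - r, g.2)
  internal := by
    refine isInternal_of_proj (fun g => comp M.internal (g.1 - r, g.2)) ?_ ?_ ?_
    · intro g v hv
      exact comp_of_mem M.internal hv
    · intro g h hgh v hv
      refine comp_of_ne M.internal ?_ hv
      intro h'
      apply hgh
      rw [Prod.mk.injEq] at h'
      exact Prod.ext (by omega) h'.2
    · rw [eq_top_iff, ← M.internal.submodule_iSup_eq_top]
      refine iSup_le fun g => ?_
      refine le_trans (le_of_eq ?_) (le_iSup _ (g.1 + r, g.2))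
      simp
  smul_mem g h a ha m hm := by
    have := M.smul_mem _ _ a ha m hm
    convert this using 2
    refine Prod.ext ?_ rfl
    simp only [Prod.fst_add]
    ring

/-! ### The graded dual -/

section Dual

variable (im : k) (M : SGMod D β)

/-- The graded dual `⨁_d Hom(M_d, k)`, realized as the space of all linear forms that vanish on all
but finitely many of the homogeneous components. -/
def gdual : Submodule k (Module.Dual k M.carrier) where
  carrier := {f | {g | ∃ m ∈ M.piece g, f m ≠ 0}.Finite}
  zero_mem' := by simp
  add_mem' {f f'} hf hf' := by
    refine (hf.union hf').subset ?_
    rintro g ⟨m, hm, hne⟩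
    by_cases h : f m = 0
    · right; exact ⟨m, hm, by simpa [h] using hne⟩
    · left; exact ⟨m, hm, h⟩
  smul_mem' r f hf := by
    refine hf.subset ?_
    rintro g ⟨m, hm, hne⟩
    exact ⟨m, hm, fun h => hne (by simp [h])⟩

/-- The graded dual as a type. -/
def GDual : Type _ := M.gdual

instance : AddCommGroup M.GDual := inferInstanceAs (AddCommGroup M.gdual)

instance : Module k M.GDual := inferInstanceAs (Module k M.gdual)

variable {M} in
/-- The linear form underlying an element of the graded dual. -/
def GDual.form : M.GDual →ₗ[k] Module.Dual k M.carrier := M.gdual.subtype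

variable {M} in
theorem GDual.ext {f f' : M.GDual} (h : f.form = f'.form) : f = f' := Subtype.ext h

/-- The left action of `RC_β` on linear forms, obtained from the right action `(f.a)(m) = f(a m)` and
the antiautomorphism `ψ`: for homogeneous `a` and `f` it is
`(a • f)(m) = (-1)^{|a||f|} f(ψ(a) m)`; see `dualAct_apply`. -/
def dualAct (a : D.RC β) (f : Module.Dual k M.carrier) : Module.Dual k M.carrier :=
  ∑ p : ZMod 2, ∑ q : ZMod 2, sgn k (p * q) •
    ((f ∘ₗ parComp M.internal q) ∘ₗ
      Algebra.lsmul k k M.carrier (Datum.psi im (parComp Datum.isInternal_RC p a)))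

variable {M} in
theorem dualAct_of_mem {g h : ℤ × ZMod 2} {a : D.RC β} (ha : a ∈ D.piece β g) {m : M.carrier}
    (hm : m ∈ M.piece h) (f : Module.Dual k M.carrier) :
    M.dualAct im a f m = sgn k (g.2 * (g.2 + h.2)) * f (Datum.psi im a • m) := by
  have h1 := M.smul_mem _ _ _ (Datum.psi_mem im ha) _ hm
  simp only [dualAct, LinearMap.sum_apply, LinearMap.smul_apply, LinearMap.comp_apply,
    Algebra.lsmul_coe, smul_eq_mul]
  rw [Finset.sum_eq_single g.2]
  · rw [Finset.sum_eq_single (g.2 + h.2)]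
    · rw [parComp_of_mem _ _ ha, if_pos rfl, parComp_of_mem _ _ h1, Prod.snd_add,
        if_pos rfl]
    · intro q _ hq
      rw [parComp_of_mem _ _ ha, if_pos rfl, parComp_of_mem _ _ h1, Prod.snd_add,
        if_neg (Ne.symm hq), map_zero, mul_zero]
    · simp
  · intro p _ hp
    refine Finset.sum_eq_zero fun q _ => ?_
    rw [parComp_of_mem _ _ ha, if_neg (Ne.symm hp)]
    simp
  · simp

/-- The component of the graded dual of degree `d` and parity `p`: the linear forms that vanish on
all components of `M` but the one of degree `-d` and parity `p`. -/
def dualPiece (g : ℤ × ZMod 2) : Submodule k M.GDual where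
  carrier := {f | ∀ h ≠ -g, ∀ m ∈ M.piece h, f.form m = 0}
  zero_mem' := by intro h _ m _; rfl
  add_mem' {f f'} hf hf' := by
    intro h hh m hm
    rw [map_add, LinearMap.add_apply, hf h hh m hm, hf' h hh m hm, add_zero]
  smul_mem' r f hf := by
    intro h hh m hm
    rw [map_smul, LinearMap.smul_apply, hf h hh m hm, smul_zero]

variable {M} in
theorem dualAct_apply {g h : ℤ × ZMod 2} {a : D.RC β} (ha : a ∈ D.piece β g) {f : M.GDual}
    (hf : f ∈ M.dualPiece h) (m : M.carrier) :
    M.dualAct im a f.form m = sgn k (g.2 * h.2) * f.form (Datum.psi im a • m) := by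
  induction m using graded_induction M.internal with
  | hV l m hm =>
    rw [dualAct_of_mem im ha hm]
    by_cases hl : g + l = -h
    · have h2 : g.2 + l.2 = h.2 := by
        have := congrArg Prod.snd hl
        have h3 : ∀ p : ZMod 2, -p = p := by decide
        simpa [h3] using this
      rw [h2]
    · rw [hf _ hl _ (M.smul_mem _ _ _ (Datum.psi_mem im ha) _ hm), mul_zero, mul_zero]
  | h0 => simp
  | hadd m m' hm hm' => rw [map_add, smul_add, map_add, hm, hm', mul_add]

variable {M} in
theorem dual_ext {f f' : Module.Dual k M.carrier} (h : ∀ g, ∀ m ∈ M.piece g, f m = f' m) : f = f' := by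
  ext m
  induction m using graded_induction M.internal with
  | hV g m hm => exact h g m hm
  | h0 => simp
  | hadd m m' hm hm' => rw [map_add, map_add, hm, hm']

theorem dualAct_add (a b : D.RC β) (f : Module.Dual k M.carrier) :
    M.dualAct im (a + b) f = M.dualAct im a f + M.dualAct im b f := by
  simp only [dualAct, map_add, LinearMap.comp_add, smul_add, Finset.sum_add_distrib]

theorem dualAct_smul (r : k) (a : D.RC β) (f : Module.Dual k M.carrier) :
    M.dualAct im (r • a) f = r • M.dualAct im a f := by
  simp only [dualAct, map_smul, LinearMap.comp_smul, Finset.smul_sum]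
  refine Finset.sum_congr rfl fun p _ => Finset.sum_congr rfl fun q _ => ?_
  rw [smul_comm]

theorem dualAct_zero (f : Module.Dual k M.carrier) : M.dualAct im 0 f = 0 := by
  have := M.dualAct_smul im 0 0 f
  rwa [zero_smul, zero_smul] at this

theorem dualAct_add_right (a : D.RC β) (f f' : Module.Dual k M.carrier) :
    M.dualAct im a (f + f') = M.dualAct im a f + M.dualAct im a f' := by
  simp only [dualAct, LinearMap.add_comp, smul_add, Finset.sum_add_distrib]

theorem dualAct_zero_right (a : D.RC β) : M.dualAct im a 0 = 0 := by
  have := M.dualAct_add_right im a 0 0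
  rwa [add_zero, left_eq_add] at this

theorem dualAct_one (f : Module.Dual k M.carrier) : M.dualAct im 1 f = f := by
  refine dual_ext fun g m hm => ?_
  have h : Datum.psi im (1 : D.RC β) = 1 := by
    rw [Datum.psi_of_mem im Datum.one_mem]; simp
  rw [dualAct_of_mem im Datum.one_mem hm, h, one_smul]
  simp [sgn_zero]

theorem dualAct_mul {im : k} (him : im * im = -1) (a b : D.RC β) (f : Module.Dual k M.carrier) :
    M.dualAct im (a * b) f = M.dualAct im a (M.dualAct im b f) := by
  induction a using graded_induction Datum.isInternal_RC with
  | h0 => simp [dualAct_zero]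
  | hadd a a' ha ha' => rw [add_mul, dualAct_add, ha, ha', dualAct_add]
  | hV g a ha =>
    induction b using graded_induction Datum.isInternal_RC with
    | h0 => simp [dualAct_zero, dualAct_zero_right]
    | hadd b b' hb hb' => rw [mul_add, dualAct_add, hb, hb', dualAct_add, dualAct_add_right]
    | hV h b hb =>
      refine dual_ext fun l m hm => ?_
      rw [dualAct_of_mem im (Datum.mul_mem ha hb) hm, dualAct_of_mem im ha hm,
        dualAct_of_mem im hb (M.smul_mem _ _ _ (Datum.psi_mem im ha) _ hm),
        Datum.psi_mul him ha hb, smul_assoc, map_smul, mul_smul, smul_eq_mul, ← mul_assoc, ← mul_assoc,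
        ← sgn_add, ← sgn_add]
      congr 2
      have key : ∀ x y z : ZMod 2, (x + y) * (x + y + z) + x * y = x * (x + z) + y * (y + (x + z)) := by
        decide
      exact key g.2 h.2 l.2

variable {M} in
theorem dualAct_mem (a : D.RC β) {f : Module.Dual k M.carrier} (hf : f ∈ M.gdual) :
    M.dualAct im a f ∈ M.gdual := by
  induction a using graded_induction Datum.isInternal_RC with
  | h0 => rw [dualAct_zero]; exact zero_mem _
  | hadd a a' ha ha' => rw [dualAct_add]; exact add_mem ha ha'
  | hV g a ha =>
    have h1 : {l | ∃ m ∈ M.piece l, f m ≠ 0}.Finite := hf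
    refine (h1.preimage (f := fun l => g + l) (fun _ _ _ _ h => add_left_cancel h)).subset ?_
    rintro l ⟨m, hm, hne⟩
    refine ⟨_, M.smul_mem _ _ _ (Datum.psi_mem im ha) _ hm, fun h0 => hne ?_⟩
    rw [dualAct_of_mem im ha hm, h0, mul_zero]

/-- The `RC_β`-module structure on the graded dual. -/
abbrev dualModule {im : k} (him : im * im = -1) : Module (D.RC β) M.GDual where
  smul a f := ⟨M.dualAct im a f.form, dualAct_mem im a f.2⟩
  one_smul f := GDual.ext (M.dualAct_one im f.form)
  mul_smul a b f := GDual.ext (M.dualAct_mul him a b f.form)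
  smul_zero a := GDual.ext (M.dualAct_zero_right im a)
  smul_add a f f' := GDual.ext (M.dualAct_add_right im a f.form f'.form)
  add_smul a b f := GDual.ext (M.dualAct_add im a b f.form)
  zero_smul f := GDual.ext (M.dualAct_zero im f.form)

/-- The restriction of a linear form to a homogeneous component, extended by zero. -/
def dualProj (g : ℤ × ZMod 2) : M.GDual →ₗ[k] M.GDual :=
  LinearMap.codRestrict M.gdual ((LinearMap.lcomp k k (comp M.internal (-g))) ∘ₗ GDual.form) (by
    intro f
    refine (Set.finite_singleton (-g)).subset ?_
    rintro h ⟨m, hm, hne⟩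
    by_contra hh
    refine hne ?_
    change f.form (comp M.internal (-g) m) = 0
    rw [comp_of_ne M.internal (Ne.symm hh) hm, map_zero])

theorem dualProj_form (g : ℤ × ZMod 2) (f : M.GDual) (m : M.carrier) :
    (M.dualProj g f).form m = f.form (comp M.internal (-g) m) := rfl

theorem dualProj_mem (g : ℤ × ZMod 2) (f : M.GDual) : M.dualProj g f ∈ M.dualPiece g := by
  intro h hh m hm
  rw [dualProj_form, comp_of_ne M.internal (Ne.symm hh) hm, map_zero]

theorem dual_internal : DirectSum.IsInternal M.dualPiece := by
  refine isInternal_of_proj M.dualProj ?_ ?_ ?_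
  · intro g f hf
    refine GDual.ext (dual_ext fun h m hm => ?_)
    rw [dualProj_form]
    by_cases hh : h = -g
    · subst hh; rw [comp_of_mem M.internal hm]
    · rw [comp_of_ne M.internal (Ne.symm hh) hm, map_zero, hf h hh m hm]
  · intro g h hgh f hf
    refine GDual.ext (dual_ext fun l m hm => ?_)
    rw [dualProj_form, map_zero, LinearMap.zero_apply]
    refine hf (-g) (fun h' => hgh (neg_injective h')) _ (comp_mem M.internal _ _)
  · rw [eq_top_iff]
    intro f _
    have hfin : {g | ∃ m ∈ M.piece g, f.form m ≠ 0}.Finite := f.2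
    have hf : f = ∑ g ∈ hfin.toFinset, M.dualProj (-g) f := by
      refine GDual.ext (dual_ext fun l m hm => ?_)
      rw [map_sum, LinearMap.sum_apply]
      simp only [dualProj_form]
      by_cases hl : l ∈ hfin.toFinset
      · rw [Finset.sum_eq_single_of_mem l hl]
        · rw [neg_neg, comp_of_mem M.internal hm]
        · intro g _ hg
          rw [neg_neg, comp_of_ne M.internal hg hm, map_zero]
      · rw [Finset.sum_eq_zero]
        · by_contra hne
          exact hl (hfin.mem_toFinset.2 ⟨m, hm, hne⟩)
        · intro g hg
          have : g ≠ l := fun h => hl (h ▸ hg)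
          rw [neg_neg, comp_of_ne M.internal this hm, map_zero]
    rw [hf]
    exact Submodule.sum_mem _ fun g _ => Submodule.mem_iSup_of_mem _ (M.dualProj_mem _ _)

/-- The graded dual `M^*` of a graded supermodule; `im` is the square root of `-1` that is used in the
antiautomorphism `ψ`. -/
def dual {im : k} (him : im * im = -1) : SGMod D β :=
  letI := M.dualModule him
  { carrier := M.GDual
    piece := M.dualPiece
    internal := M.dual_internal
    tower := ⟨fun r a f => GDual.ext (M.dualAct_smul im r a f.form)⟩
    smul_mem := by
      intro g h a ha f hf l hl m hm
      change M.dualAct im a f.form m = 0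
      rw [dualAct_of_mem im ha hm, hf _ _ _ (M.smul_mem _ _ _ (Datum.psi_mem im ha) _ hm), mul_zero]
      intro h'
      apply hl
      rw [neg_add_rev, ← h']
      abel }

end Dual

end SGMod

end

end QuiverHeckeClifford

namespace QuiverHeckeClifford

noncomputable section

open TensorProduct

namespace Datum

variable {k I : Type*} [Field k] {D : Datum k I} [DecidableEq I]

section Block

variable {β' β : I →₀ ℕ} {s : ℕ} (hs : s + ht β' ≤ ht β)

theorem sum_e_mem (c : D.Seq β → Prop) [DecidablePred c] :
    (∑ μ, if c μ then eRC μ else 0) ∈ D.piece β 0 :=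
  Submodule.sum_mem _ fun μ _ => by
    split_ifs
    · exact e_mem μ
    · exact zero_mem _

theorem blockIdem_mem : D.blockIdem hs ∈ D.piece β 0 := sum_e_mem _

theorem blockE_mem (ν : D.Seq β') : blockE hs ν ∈ D.piece β 0 := sum_e_mem _

theorem mul_blockE_mem {y : D.RC β} {g : ℤ × ZMod 2} {ν : D.Seq β'}
    (h : ∀ μ, res hs μ = ν.1 → y * eRC μ ∈ D.piece β g) : y * blockE hs ν ∈ D.piece β g := by
  rw [blockE, Finset.mul_sum]
  refine Submodule.sum_mem _ fun μ _ => ?_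
  split_ifs with h'
  · exact h μ h'
  · rw [mul_zero]; exact zero_mem _

theorem blockHom_coe_mul (y z : D.RC β') :
    (blockHom hs (y * z)).1 = (blockHom hs y).1 * (blockHom hs z).1 := by
  rw [map_mul]; rfl

theorem blockHom_coe_add (y z : D.RC β') :
    (blockHom hs (y + z)).1 = (blockHom hs y).1 + (blockHom hs z).1 := by
  rw [map_add]; rfl

theorem blockHom_coe_zero : (blockHom hs (0 : D.RC β')).1 = 0 := by
  rw [map_zero]; rfl

theorem blockHom_coe_one : (blockHom hs (1 : D.RC β')).1 = D.blockIdem hs := by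
  rw [map_one]; rfl

theorem blockHom_coe_smul (r : k) (y : D.RC β') :
    (blockHom hs (r • y)).1 = r • (blockHom hs y).1 := by
  rw [Algebra.smul_def, map_mul, AlgHom.commutes]
  have h := (Subsemigroup.mem_corner_iff (blockIdem_idem (D := D) hs)).1 (blockHom hs y).2
  change (r • D.blockIdem hs) * (blockHom hs y).1 = _
  rw [smul_mul_assoc, h.1]

theorem blockHom_mul_idem (y : D.RC β') :
    (blockHom hs y).1 * D.blockIdem hs = (blockHom hs y).1 :=
  ((Subsemigroup.mem_corner_iff (blockIdem_idem (D := D) hs)).1 (blockHom hs y).2).2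

theorem idem_mul_blockE (ν : D.Seq β') : D.blockIdem hs * blockE hs ν = blockE hs ν := by
  rw [blockE_blockIdem, blockE_mul_blockIdem]

/-- The homomorphism from a block preserves degrees and parities. -/
theorem blockHom_mem {y : D.RC β'} {g : ℤ × ZMod 2} (hy : y ∈ D.piece β' g) :
    (blockHom hs y).1 ∈ D.piece β g := by
  have key : ∀ l : List (Gen D β' × D.Seq β'),
      (blockHom hs (monomial l)).1 ∈ D.piece β (monDeg l) := by
    intro l
    induction l with
    | nil => exact (blockHom_coe_one (D := D) hs).symm ▸ blockIdem_mem hs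
    | cons y l ih =>
      rw [show monomial (y :: l) = y.1.val * eRC y.2 * monomial l by simp [monomial],
        show monDeg (y :: l) = y.1.deg y.2 + monDeg l by simp [monDeg], blockHom_coe_mul]
      refine mul_mem ?_ ih
      rw [blockHom_coe_mul, blockHom_e]
      obtain ⟨y, ν⟩ := y
      cases y with
      | e ρ =>
        have := mul_mem (blockE_mem hs ρ) (blockE_mem hs ν)
        rw [add_zero] at this
        rw [show (Gen.e ρ).val = eRC ρ from rfl, blockHom_e]
        exact this
      | x p =>
        rw [show (Gen.x p).val = xRC p from rfl, blockHom_x, mul_assoc, idem_mul_blockE]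
        refine mul_blockE_mem hs fun μ hμ => ?_
        have := gen_e_mem (.x (blk hs p)) μ
        rwa [Gen.deg, show μ.1 (blk hs p) = ν.1 p from congrFun hμ p] at this
      | s a =>
        rw [show (Gen.s a).val = sRC a from rfl, blockHom_s, mul_assoc, idem_mul_blockE]
        refine mul_blockE_mem hs fun μ hμ => ?_
        have := gen_e_mem (.s (blkA hs a)) μ
        rwa [Gen.deg, blkA_lo, blkA_hi, show μ.1 (blk hs a.lo) = ν.1 a.lo from congrFun hμ a.lo,
          show μ.1 (blk hs a.hi) = ν.1 a.hi from congrFun hμ a.hi] at this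
      | c p =>
        rw [show (Gen.c p).val = cRC p from rfl, blockHom_c, mul_assoc, idem_mul_blockE]
        exact mul_blockE_mem hs fun μ hμ => gen_e_mem (.c (blk hs p)) μ
  induction hy using Submodule.span_induction with
  | mem y h => obtain ⟨l, rfl, rfl⟩ := h; exact key l
  | zero => rw [blockHom_coe_zero]; exact zero_mem _
  | add y z _ _ hy hz => rw [blockHom_coe_add]; exact add_mem hy hz
  | smul r y _ hy => rw [blockHom_coe_smul]; exact Submodule.smul_mem _ _ hy

end Block

section Par

variable {β₁ β₂ β : I →₀ ℕ}

theorem _root_.QuiverHeckeClifford.ht_add {I : Type*} {β₁ β₂ β : I →₀ ℕ} (h : β₁ + β₂ = β) :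
    ht β₁ + ht β₂ = ht β := by
  rw [← h]; exact (map_add Finsupp.degree β₁ β₂).symm

theorem _root_.QuiverHeckeClifford.left_le {I : Type*} {β₁ β₂ β : I →₀ ℕ} (h : β₁ + β₂ = β) :
    0 + ht β₁ ≤ ht β := by have := ht_add h; omega

theorem _root_.QuiverHeckeClifford.right_le {I : Type*} {β₁ β₂ β : I →₀ ℕ} (h : β₁ + β₂ = β) :
    ht β₁ + ht β₂ ≤ ht β := (ht_add h).le

variable (D) in
/-- The idempotent `e(β₁, β₂)`: the sum of all `e(μ)` such that the first `|β₁|` entries of `μ` form an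
element of `J^β₁` (and hence the last `|β₂|` entries an element of `J^β₂`). -/
def parE (h : β₁ + β₂ = β) : D.RC β := D.blockIdem (left_le h)

theorem _root_.QuiverHeckeClifford.Datum.wt_left_add_right {k I : Type*} [Field k] {D : Datum k I}
    {β₁ β₂ β : I →₀ ℕ} (h : β₁ + β₂ = β) (μ : D.Seq β) :
    D.wt (res (left_le h) μ) + D.wt (res (right_le h) μ) = β := by
  conv_rhs => rw [← μ.2]
  unfold wt
  rw [← (finCongr (ht_add h)).sum_comp, Fin.sum_univ_add]
  congr 1
  refine Finset.sum_congr rfl fun p _ => ?_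
  have : blk (left_le h) p = finCongr (ht_add h) (Fin.castAdd _ p) := by ext; simp [blk]
  rw [← this]; rfl

theorem blockIdem_right (h : β₁ + β₂ = β) : D.blockIdem (right_le h) = D.parE h := by
  unfold parE blockIdem
  refine Finset.sum_congr rfl fun μ _ => ?_
  have h1 := wt_left_add_right h μ
  have h2 : D.wt (res (right_le h) μ) = β₂ ↔ D.wt (res (left_le h) μ) = β₁ := by
    constructor
    · intro h3
      rw [h3] at h1
      exact add_right_cancel (h1.trans h.symm)
    · intro h3
      rw [h3] at h1
      exact add_left_cancel (h1.trans h.symm)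
  simp only [h2]

/-- The image of `a ⊗ b` under the homomorphism from `RC_β₁ ⊗ RC_β₂` to
`e(β₁, β₂) RC_β e(β₁, β₂)` that sends the generators of the first factor to those with the same index
and the generators of the second factor to those with index shifted by `|β₁|`. -/
def phi (h : β₁ + β₂ = β) (a : D.RC β₁) (b : D.RC β₂) : D.RC β :=
  (blockHom (left_le h) a).1 * (blockHom (right_le h) b).1

theorem phi_mul_parE (h : β₁ + β₂ = β) (a : D.RC β₁) (b : D.RC β₂) :
    phi h a b * D.parE h = phi h a b := by
  rw [phi, mul_assoc, ← blockIdem_right, blockHom_mul_idem]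

theorem phi_mem (h : β₁ + β₂ = β) {a : D.RC β₁} {b : D.RC β₂} {g g' : ℤ × ZMod 2}
    (ha : a ∈ D.piece β₁ g) (hb : b ∈ D.piece β₂ g') : phi h a b ∈ D.piece β (g + g') :=
  mul_mem (blockHom_mem _ ha) (blockHom_mem _ hb)

/-- The left ideal `RC_β e(β₁, β₂)`. -/
abbrev parIdeal (D : Datum k I) (h : β₁ + β₂ = β) : Ideal (D.RC β) := Ideal.span {D.parE h}

/-- The right action of `a ⊗ b` on `RC_β e(β₁, β₂)`. -/
def parMul (h : β₁ + β₂ = β) (r : D.parIdeal h) (a : D.RC β₁) (b : D.RC β₂) : D.parIdeal h :=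
  ⟨r.1 * phi h a b, Ideal.mem_span_singleton'.2 ⟨r.1 * phi h a b, by rw [mul_assoc, phi_mul_parE]⟩⟩

/-- The map `r ↦ r e(β₁, β₂)`. -/
def toParIdeal (D : Datum k I) (h : β₁ + β₂ = β) : D.RC β →ₗ[D.RC β] D.parIdeal h where
  toFun r := ⟨r * D.parE h, Ideal.mem_span_singleton'.2 ⟨r, rfl⟩⟩
  map_add' r r' := Subtype.ext (add_mul r r' _)
  map_smul' r r' := Subtype.ext (mul_assoc r r' _)

theorem toParIdeal_coe (h : β₁ + β₂ = β) (r : D.parIdeal h) : toParIdeal D h r.1 = r := by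
  obtain ⟨r, hr⟩ := r
  obtain ⟨y, rfl⟩ := Ideal.mem_span_singleton'.1 hr
  apply Subtype.ext
  change y * D.parE h * D.parE h = y * D.parE h
  rw [mul_assoc, parE, (blockIdem_idem _).eq]

end Par

end Datum

namespace SGMod

variable {k I : Type*} [Field k] [DecidableEq I] {D : Datum k I} {β₁ β₂ β : I →₀ ℕ}

section

variable (h : β₁ + β₂ = β) (M₁ : SGMod D β₁) (M₂ : SGMod D β₂)

/-- The tensor product of `RC_β e(β₁, β₂)` and `M₁ ⊗ M₂` over the field. -/
abbrev ConvPre : Type _ := D.parIdeal h ⊗[k] (M₁.carrier ⊗[k] M₂.carrier)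

/-- The relations `r (a ⊗ b) ⊗ (m₁ ⊗ m₂) = r ⊗ (a ⊗ b) (m₁ ⊗ m₂)`, where
`(a ⊗ b) (m₁ ⊗ m₂) = (-1)^{|b||m₁|} a m₁ ⊗ b m₂` for homogeneous `b` and `m₁`. -/
def convRel : Submodule (D.RC β) (ConvPre h M₁ M₂) :=
  Submodule.span (D.RC β) {z | ∃ (r : D.parIdeal h) (a : D.RC β₁) (b : D.RC β₂)
    (m₁ : M₁.carrier) (m₂ : M₂.carrier) (g g' : ℤ × ZMod 2),
    b ∈ D.piece β₂ g ∧ m₁ ∈ M₁.piece g' ∧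
      z = Datum.parMul h r a b ⊗ₜ[k] (m₁ ⊗ₜ[k] m₂) -
        r ⊗ₜ[k] (sgn k (g.2 * g'.2) • (a • m₁) ⊗ₜ[k] (b • m₂))}

/-- The space `RC_β e(β₁, β₂) ⊗_{RC_β₁ ⊗ RC_β₂} (M₁ ⊗ M₂)`. -/
def Conv : Type _ := ConvPre h M₁ M₂ ⧸ convRel h M₁ M₂

instance : AddCommGroup (Conv h M₁ M₂) :=
  inferInstanceAs (AddCommGroup (ConvPre h M₁ M₂ ⧸ convRel h M₁ M₂))

instance : Module (D.RC β) (Conv h M₁ M₂) :=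
  inferInstanceAs (Module (D.RC β) (ConvPre h M₁ M₂ ⧸ convRel h M₁ M₂))

instance : Module k (Conv h M₁ M₂) :=
  inferInstanceAs (Module k (ConvPre h M₁ M₂ ⧸ convRel h M₁ M₂))

instance : IsScalarTower k (D.RC β) (Conv h M₁ M₂) :=
  inferInstanceAs (IsScalarTower k (D.RC β) (ConvPre h M₁ M₂ ⧸ convRel h M₁ M₂))

/-- The projection to the convolution. -/
def mkConv : ConvPre h M₁ M₂ →ₗ[D.RC β] Conv h M₁ M₂ := (convRel h M₁ M₂).mkQ

theorem mkConv_surjective : Function.Surjective (mkConv h M₁ M₂) := Submodule.mkQ_surjective _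

variable {M₁ M₂} in
theorem mkConv_phi (r : D.parIdeal h) (a : D.RC β₁) {b : D.RC β₂} {m₁ : M₁.carrier} (m₂ : M₂.carrier)
    {g g' : ℤ × ZMod 2} (hb : b ∈ D.piece β₂ g) (hm : m₁ ∈ M₁.piece g') :
    mkConv h M₁ M₂ (Datum.parMul h r a b ⊗ₜ[k] (m₁ ⊗ₜ[k] m₂)) =
      mkConv h M₁ M₂ (r ⊗ₜ[k] (sgn k (g.2 * g'.2) • (a • m₁) ⊗ₜ[k] (b • m₂))) := by
  rw [← sub_eq_zero, ← map_sub]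
  exact (Submodule.Quotient.mk_eq_zero _).2
    (Submodule.subset_span ⟨r, a, b, m₁, m₂, g, g', hb, hm, rfl⟩)

/-- The component of the convolution of given degree and parity, spanned by the `r ⊗ (m₁ ⊗ m₂)` with
`r`, `m₁`, `m₂` homogeneous whose degrees and parities add up to the given ones. -/
def convPiece (g : ℤ × ZMod 2) : Submodule k (Conv h M₁ M₂) :=
  Submodule.span k {z | ∃ (r : D.parIdeal h) (m₁ : M₁.carrier) (m₂ : M₂.carrier)
    (g₀ g₁ g₂ : ℤ × ZMod 2), r.1 ∈ D.piece β g₀ ∧ m₁ ∈ M₁.piece g₁ ∧ m₂ ∈ M₂.piece g₂ ∧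
      g₀ + (g₁ + g₂) = g ∧ z = mkConv h M₁ M₂ (r ⊗ₜ[k] (m₁ ⊗ₜ[k] m₂))}

/-- The bilinear map `(r, v) ↦ r e(β₁, β₂) ⊗ v`. -/
def convBil : D.RC β →ₗ[k] (M₁.carrier ⊗[k] M₂.carrier) →ₗ[k] Conv h M₁ M₂ :=
  ((TensorProduct.mk k (D.parIdeal h) (M₁.carrier ⊗[k] M₂.carrier)).compr₂
    ((mkConv h M₁ M₂).restrictScalars k)) ∘ₗ (Datum.toParIdeal D h).restrictScalars k

theorem convBil_apply (r : D.RC β) (v : M₁.carrier ⊗[k] M₂.carrier) :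
    convBil h M₁ M₂ r v = mkConv h M₁ M₂ (Datum.toParIdeal D h r ⊗ₜ[k] v) := rfl

/-- The decomposition of an element of `M₁ ⊗ M₂` into homogeneous components. -/
def degT : M₁.carrier ⊗[k] M₂.carrier →ₗ[k] (ℤ × ZMod 2 →₀ M₁.carrier ⊗[k] M₂.carrier) :=
  TensorProduct.lift ((conv₂ (TensorProduct.mk k M₁.carrier M₂.carrier)).compl₁₂
    (degMap M₁.internal) (degMap M₂.internal))

variable {M₁ M₂} in
theorem degT_of_mem {g g' : ℤ × ZMod 2} {m₁ : M₁.carrier} {m₂ : M₂.carrier} (h₁ : m₁ ∈ M₁.piece g)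
    (h₂ : m₂ ∈ M₂.piece g') :
    degT M₁ M₂ (m₁ ⊗ₜ m₂) = Finsupp.single (g + g') (m₁ ⊗ₜ m₂) := by
  rw [degT, TensorProduct.lift.tmul, LinearMap.compl₁₂_apply, degMap_of_mem _ h₁, degMap_of_mem _ h₂,
    conv₂_single]
  rfl

/-- The map that records the degree, before passing to the quotient. -/
def convDeg₀ : ConvPre h M₁ M₂ →ₗ[k] (ℤ × ZMod 2 →₀ Conv h M₁ M₂) :=
  TensorProduct.lift ((conv₂ (convBil h M₁ M₂)).compl₁₂
    (degMap Datum.isInternal_RC ∘ₗ (D.parIdeal h).subtype.restrictScalars k) (degT M₁ M₂))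

variable {M₁ M₂} in
theorem convDeg₀_of_mem {r : D.parIdeal h} {m₁ : M₁.carrier} {m₂ : M₂.carrier}
    {g₀ g₁ g₂ : ℤ × ZMod 2} (hr : r.1 ∈ D.piece β g₀) (h₁ : m₁ ∈ M₁.piece g₁)
    (h₂ : m₂ ∈ M₂.piece g₂) :
    convDeg₀ h M₁ M₂ (r ⊗ₜ (m₁ ⊗ₜ m₂)) =
      Finsupp.single (g₀ + (g₁ + g₂)) (mkConv h M₁ M₂ (r ⊗ₜ (m₁ ⊗ₜ m₂))) := by
  rw [convDeg₀, TensorProduct.lift.tmul, LinearMap.compl₁₂_apply, degT_of_mem h₁ h₂,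
    LinearMap.comp_apply]
  change conv₂ (convBil h M₁ M₂) (degMap Datum.isInternal_RC r.1) _ = _
  rw [degMap_of_mem _ hr, conv₂_single, convBil_apply, Datum.toParIdeal_coe]

theorem toParIdeal_mem {r : D.RC β} {g : ℤ × ZMod 2} (hr : r ∈ D.piece β g) :
    (Datum.toParIdeal D h r).1 ∈ D.piece β g := by
  have := Datum.mul_mem hr (Datum.blockIdem_mem (D := D) (left_le h))
  rwa [add_zero] at this

theorem parMul_toParIdeal (r : D.RC β) (a : D.RC β₁) (b : D.RC β₂) :
    (Datum.parMul h (Datum.toParIdeal D h r) a b).1 = r * (D.parE h * Datum.phi h a b) :=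
  mul_assoc _ _ _

variable {M₁ M₂} in
theorem convDeg₀_rel (r : D.parIdeal h) (a : D.RC β₁) {b : D.RC β₂} {m₁ : M₁.carrier}
    (m₂ : M₂.carrier) {g g' : ℤ × ZMod 2} (hb : b ∈ D.piece β₂ g) (hm : m₁ ∈ M₁.piece g') :
    convDeg₀ h M₁ M₂ (Datum.parMul h r a b ⊗ₜ[k] (m₁ ⊗ₜ[k] m₂)) =
      convDeg₀ h M₁ M₂ (r ⊗ₜ[k] (sgn k (g.2 * g'.2) • (a • m₁) ⊗ₜ[k] (b • m₂))) := by
  rw [← Datum.toParIdeal_coe h r]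
  generalize r.1 = r
  induction m₂ using graded_induction M₂.internal with
  | h0 => simp
  | hadd m m' h1 h2 => simp only [smul_add, TensorProduct.tmul_add, map_add, h1, h2]
  | hV g₂ m₂ hm₂ =>
  induction a using graded_induction Datum.isInternal_RC with
  | h0 =>
    have : Datum.parMul h (Datum.toParIdeal D h r) 0 b = 0 := Subtype.ext (by
      rw [parMul_toParIdeal, Datum.phi, Datum.blockHom_coe_zero]; simp)
    rw [this]; simp
  | hadd a a' h1 h2 =>
    have : Datum.parMul h (Datum.toParIdeal D h r) (a + a') b =
        Datum.parMul h (Datum.toParIdeal D h r) a b + Datum.parMul h (Datum.toParIdeal D h r) a' b :=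
      Subtype.ext (by
        change _ = (Datum.parMul h _ a b).1 + (Datum.parMul h _ a' b).1
        rw [parMul_toParIdeal, parMul_toParIdeal, parMul_toParIdeal, Datum.phi,
          Datum.blockHom_coe_add, add_mul, mul_add, mul_add]
        rfl)
    rw [this, TensorProduct.add_tmul, map_add, h1, h2, add_smul, TensorProduct.add_tmul, smul_add,
      TensorProduct.tmul_add, map_add]
  | hV g₁ a ha =>
  induction r using graded_induction Datum.isInternal_RC with
  | h0 =>
    have : Datum.parMul h (Datum.toParIdeal D h 0) a b = 0 := Subtype.ext (by
      rw [parMul_toParIdeal, zero_mul]; rfl)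
    rw [this]; simp
  | hadd r r' h1 h2 =>
    have : Datum.parMul h (Datum.toParIdeal D h (r + r')) a b =
        Datum.parMul h (Datum.toParIdeal D h r) a b + Datum.parMul h (Datum.toParIdeal D h r') a b :=
      Subtype.ext (by
        change _ = (Datum.parMul h _ a b).1 + (Datum.parMul h _ a b).1
        rw [parMul_toParIdeal, parMul_toParIdeal, parMul_toParIdeal, add_mul])
    rw [this, TensorProduct.add_tmul, map_add, h1, h2, map_add, TensorProduct.add_tmul, map_add]
  | hV g₀ r hr =>
  have hr' := toParIdeal_mem h hr
  rw [TensorProduct.tmul_smul, map_smul, convDeg₀_of_mem h (g₀ := g₀ + (g₁ + g)) _ hm hm₂,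
    convDeg₀_of_mem h hr' (M₁.smul_mem _ _ _ ha _ hm) (M₂.smul_mem _ _ _ hb _ hm₂),
    mkConv_phi h _ a _ hb hm, TensorProduct.tmul_smul, LinearMap.map_smul_of_tower,
    Finsupp.smul_single]
  · congr 1
    abel
  · exact Datum.mul_mem hr' (Datum.phi_mem h ha hb)

theorem convRel_le : (convRel h M₁ M₂).restrictScalars k ≤ LinearMap.ker (convDeg₀ h M₁ M₂) := by
  intro z hz
  have key : ∀ z ∈ convRel h M₁ M₂, ∀ y : D.RC β, convDeg₀ h M₁ M₂ (y • z) = 0 := by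
    intro z hz
    induction hz using Submodule.span_induction with
    | mem z hz =>
      obtain ⟨r, a, b, m₁, m₂, g, g', hb, hm, rfl⟩ := hz
      intro y
      have h1 : y • Datum.parMul h r a b = Datum.parMul h (y • r) a b :=
        Subtype.ext (mul_assoc _ _ _).symm
      rw [smul_sub, TensorProduct.smul_tmul', TensorProduct.smul_tmul', map_sub, h1,
        convDeg₀_rel h _ a m₂ hb hm, sub_self]
    | zero => intro y; rw [smul_zero, map_zero]
    | add z w _ _ hz hw => intro y; rw [smul_add, map_add, hz, hw, add_zero]
    | smul r z _ hz => intro y; rw [← mul_smul]; exact hz _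
  have := key z hz 1
  rwa [one_smul] at this

/-- The map that records the degree. -/
def convDeg : Conv h M₁ M₂ →ₗ[k] (ℤ × ZMod 2 →₀ Conv h M₁ M₂) :=
  ((convRel h M₁ M₂).restrictScalars k).liftQ (convDeg₀ h M₁ M₂) (convRel_le h M₁ M₂)

theorem convDeg_mk (z : ConvPre h M₁ M₂) :
    convDeg h M₁ M₂ (mkConv h M₁ M₂ z) = convDeg₀ h M₁ M₂ z := rfl

variable {M₁ M₂} in
theorem convDeg_of_mem {g : ℤ × ZMod 2} {z : Conv h M₁ M₂} (hz : z ∈ convPiece h M₁ M₂ g) :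
    convDeg h M₁ M₂ z = Finsupp.single g z := by
  induction hz using Submodule.span_induction with
  | mem z hz =>
    obtain ⟨r, m₁, m₂, g₀, g₁, g₂, hr, h₁, h₂, rfl, rfl⟩ := hz
    rw [convDeg_mk, convDeg₀_of_mem h hr h₁ h₂]
  | zero => rw [map_zero, Finsupp.single_zero]
  | add z w _ _ hz hw => rw [map_add, hz, hw, Finsupp.single_add]
  | smul r z _ hz => rw [map_smul, hz, Finsupp.smul_single]

theorem conv_mem_iSup (z : Conv h M₁ M₂) : z ∈ iSup (convPiece h M₁ M₂) := by
  obtain ⟨z, rfl⟩ := mkConv_surjective h M₁ M₂ z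
  induction z using TensorProduct.induction_on with
  | zero => rw [map_zero]; exact zero_mem _
  | add z w hz hw => rw [map_add]; exact add_mem hz hw
  | tmul r v =>
  induction v using TensorProduct.induction_on with
  | zero => rw [TensorProduct.tmul_zero, map_zero]; exact zero_mem _
  | add z w hz hw => rw [TensorProduct.tmul_add, map_add]; exact add_mem hz hw
  | tmul m₁ m₂ =>
  induction m₁ using graded_induction M₁.internal with
  | h0 => rw [TensorProduct.zero_tmul, TensorProduct.tmul_zero, map_zero]; exact zero_mem _
  | hadd m m' hm hm' =>
    rw [TensorProduct.add_tmul, TensorProduct.tmul_add, map_add]; exact add_mem hm hm'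
  | hV g₁ m₁ h₁ =>
  induction m₂ using graded_induction M₂.internal with
  | h0 => rw [TensorProduct.tmul_zero, TensorProduct.tmul_zero, map_zero]; exact zero_mem _
  | hadd m m' hm hm' =>
    rw [TensorProduct.tmul_add, TensorProduct.tmul_add, map_add]; exact add_mem hm hm'
  | hV g₂ m₂ h₂ =>
  rw [← Datum.toParIdeal_coe h r]
  generalize r.1 = r
  induction r using graded_induction Datum.isInternal_RC with
  | h0 => rw [map_zero, TensorProduct.zero_tmul, map_zero]; exact zero_mem _
  | hadd r r' hr hr' => rw [map_add, TensorProduct.add_tmul, map_add]; exact add_mem hr hr'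
  | hV g₀ r hr =>
    exact Submodule.mem_iSup_of_mem (g₀ + (g₁ + g₂))
      (Submodule.subset_span ⟨_, m₁, m₂, g₀, g₁, g₂, toParIdeal_mem h hr, h₁, h₂, rfl, rfl⟩)

theorem conv_internal : DirectSum.IsInternal (convPiece h M₁ M₂) := by
  refine isInternal_of_proj (fun g => Finsupp.lapply g ∘ₗ convDeg h M₁ M₂) ?_ ?_ ?_
  · intro g v hv
    rw [LinearMap.comp_apply, convDeg_of_mem h hv, Finsupp.lapply_apply, Finsupp.single_eq_same]
  · intro g g' hg v hv
    rw [LinearMap.comp_apply, convDeg_of_mem h hv, Finsupp.lapply_apply,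
      Finsupp.single_eq_of_ne hg]
  · exact eq_top_iff.2 fun z _ => conv_mem_iSup h M₁ M₂ z

theorem conv_smul_mem (g g' : ℤ × ZMod 2) (a : D.RC β) (ha : a ∈ D.piece β g) (z : Conv h M₁ M₂)
    (hz : z ∈ convPiece h M₁ M₂ g') : a • z ∈ convPiece h M₁ M₂ (g + g') := by
  induction hz using Submodule.span_induction with
  | mem z hz =>
    obtain ⟨r, m₁, m₂, g₀, g₁, g₂, hr, h₁, h₂, rfl, rfl⟩ := hz
    rw [← map_smul, TensorProduct.smul_tmul']
    exact Submodule.subset_span ⟨a • r, m₁, m₂, g + g₀, g₁, g₂, Datum.mul_mem ha hr, h₁, h₂,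
      add_assoc _ _ _, rfl⟩
  | zero => rw [smul_zero]; exact zero_mem _
  | add z w _ _ hz hw => rw [smul_add]; exact add_mem hz hw
  | smul r z _ hz => rw [smul_algebra_smul_comm]; exact Submodule.smul_mem _ _ hz

/-- The convolution product `M₁ ∘ M₂ = RC_β e(β₁, β₂) ⊗_{RC_β₁ ⊗ RC_β₂} (M₁ ⊗ M₂)`, where
`β = β₁ + β₂`. -/
def conv : SGMod D β where
  carrier := Conv h M₁ M₂
  piece := convPiece h M₁ M₂
  internal := conv_internal h M₁ M₂
  smul_mem := conv_smul_mem h M₁ M₂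

end

end SGMod

end

end QuiverHeckeClifford

namespace QuiverHeckeClifford

noncomputable section

/-! ### Reduced words -/

section Words

variable {n : ℕ} {Λ : Type*} [LinearOrder Λ]

/-- The sum of the weights `c p q` over all inversions `p < q`, `ω q < ω p`. -/
def winv (ω : Fin n → Λ) (c : Fin n → Fin n → ℤ) : ℤ :=
  ∑ p, ∑ q, if p < q ∧ ω q < ω p then c p q else 0

theorem Adj.s_lt_iff (a : Adj n) {p q : Fin n} (h : ¬(p = a.lo ∧ q = a.hi))
    (h' : ¬(p = a.hi ∧ q = a.lo)) : a.s p < a.s q ↔ p < q := by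
  have hlo : a.lo.1 = a.1 := rfl
  have hhi : a.hi.1 = a.1 + 1 := rfl
  have key : ∀ r : Fin n, (r = a.lo ∧ a.s r = a.hi) ∨ (r = a.hi ∧ a.s r = a.lo) ∨
      (r ≠ a.lo ∧ r ≠ a.hi ∧ a.s r = r) := by
    intro r
    by_cases h1 : r = a.lo
    · subst h1; exact Or.inl ⟨rfl, a.s_lo⟩
    · by_cases h2 : r = a.hi
      · subst h2; exact Or.inr (Or.inl ⟨rfl, a.s_hi⟩)
      · exact Or.inr (Or.inr ⟨h1, h2, a.s_of_ne h1 h2⟩)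
  rcases key p with ⟨p1, p2⟩ | ⟨p1, p2⟩ | ⟨p1, p1', p2⟩ <;>
  rcases key q with ⟨q1, q2⟩ | ⟨q1, q2⟩ | ⟨q1, q1', q2⟩ <;> rw [p2, q2] <;>
  simp only [Fin.ext_iff, Fin.lt_def, ne_eq] at * <;> omega

theorem winv_swap (ω : Fin n → Λ) (c : Fin n → Fin n → ℤ) (hc : ∀ p q, c p q = c q p) (a : Adj n)
    (h : ω a.lo < ω a.hi) :
    winv (ω ∘ a.s) (fun p q => c (a.s p) (a.s q)) = winv ω c + c a.lo a.hi := by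
  have e1 : winv (ω ∘ a.s) (fun p q => c (a.s p) (a.s q)) =
      ∑ p, ∑ q, if a.s p < a.s q ∧ ω q < ω p then c p q else 0 := by
    rw [← Equiv.sum_comp a.s]
    refine Finset.sum_congr rfl fun p _ => ?_
    rw [← Equiv.sum_comp a.s]
    simp [Adj.s_s]
  have e2 : ∀ p q, (if a.s p < a.s q ∧ ω q < ω p then c p q else 0) =
      (if p < q ∧ ω q < ω p then c p q else 0) +
        if q = a.lo then (if p = a.hi then c a.lo a.hi else 0) else 0 := by
    intro p q
    have hlt : a.lo < a.hi := Nat.lt_succ_self _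
    by_cases h1 : p = a.lo ∧ q = a.hi
    · obtain ⟨rfl, rfl⟩ := h1
      simp [h.not_gt, a.lo_ne_hi.symm]
    · by_cases h2 : p = a.hi ∧ q = a.lo
      · obtain ⟨rfl, rfl⟩ := h2
        simp [a.s_lo, a.s_hi, h, hlt, hlt.not_gt, hc a.hi a.lo]
      · simp only [a.s_lt_iff h1 h2]
        by_cases h3 : q = a.lo
        · have h4 : p ≠ a.hi := fun h4 => h2 ⟨h4, h3⟩
          simp [h4]
        · simp [h3]
  rw [e1, winv]
  simp only [e2, Finset.sum_add_distrib]
  congr 1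
  simp

theorem monotone_of_adj {ω : Fin n → Λ} (h : ∀ a : Adj n, ω a.lo ≤ ω a.hi) : Monotone ω := by
  have key : ∀ (m : ℕ) (p q : Fin n), p.1 + m = q.1 → ω p ≤ ω q := by
    intro m
    induction m with
    | zero => intro p q hpq; rw [show p = q from Fin.ext (by simpa using hpq)]
    | succ m ih =>
      intro p q hpq
      have hq := q.2
      refine (ih p ⟨p.1 + m, by omega⟩ rfl).trans ?_
      have e : q = Adj.hi ⟨p.1 + m, by omega⟩ := Fin.ext (by
        change q.1 = p.1 + m + 1
        omega)
      exact (h ⟨p.1 + m, by omega⟩).trans_eq (congrArg ω e.symm)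
  intro p q hpq
  have : p.1 ≤ q.1 := hpq
  exact key (q.1 - p.1) p q (by omega)

/-- The permutation of a word. -/
def wordPerm : List (Adj n) → Equiv.Perm (Fin n)
  | [] => 1
  | a :: l => wordPerm l * a.s

theorem wordPerm_cons (a : Adj n) (l : List (Adj n)) (p : Fin n) :
    wordPerm (a :: l) p = wordPerm l (a.s p) := rfl

/-- A word is reduced for `ω₀` if each of its letters, read from the right, exchanges two entries that
are in increasing order. -/
def Red (ω₀ : Fin n → Λ) : List (Adj n) → Prop
  | [] => True
  | a :: l => Red ω₀ l ∧ ω₀ (wordPerm l a.lo) < ω₀ (wordPerm l a.hi)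

/-- The sum of the weights of the pairs that are exchanged by the letters of a word. -/
def wordSum (c : Fin n → Fin n → ℤ) : List (Adj n) → ℤ
  | [] => 0
  | a :: l => wordSum c l + c (wordPerm l a.lo) (wordPerm l a.hi)

theorem winv_of_monotone {ω : Fin n → Λ} (h : Monotone ω) (c : Fin n → Fin n → ℤ) :
    winv ω c = 0 := by
  refine Finset.sum_eq_zero fun p _ => Finset.sum_eq_zero fun q _ => if_neg ?_
  rintro ⟨h1, h2⟩
  exact h2.not_ge (h h1.le)

theorem winv_word {ω₀ : Fin n → Λ} (hω : Monotone ω₀) {c : Fin n → Fin n → ℤ}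
    (hc : ∀ p q, c p q = c q p) {l : List (Adj n)} (hl : Red ω₀ l) :
    winv (ω₀ ∘ wordPerm l) (fun p q => c (wordPerm l p) (wordPerm l q)) = wordSum c l := by
  induction l with
  | nil => exact winv_of_monotone hω _
  | cons a l ih =>
    have := winv_swap (ω₀ ∘ wordPerm l) (fun p q => c (wordPerm l p) (wordPerm l q))
      (fun p q => hc _ _) a hl.2
    rw [ih hl.1] at this
    exact this

theorem wordSum_one (l : List (Adj n)) : wordSum (fun _ _ => 1) l = l.length := by
  induction l with
  | nil => rfl
  | cons a l ih => rw [wordSum, ih]; simp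

theorem winv_one {ω₀ : Fin n → Λ} (hω : Monotone ω₀) {l : List (Adj n)} (hl : Red ω₀ l) :
    winv (ω₀ ∘ wordPerm l) (fun _ _ => 1) = l.length := by
  rw [← wordSum_one]; exact winv_word (c := fun _ _ => 1) hω (fun _ _ => rfl) hl

theorem length_eq_of_red {ω₀ : Fin n → Λ} (hω : Monotone ω₀) {l l' : List (Adj n)}
    (hl : Red ω₀ l) (hl' : Red ω₀ l') (h : ω₀ ∘ wordPerm l = ω₀ ∘ wordPerm l') :
    l.length = l'.length := by
  have h1 := winv_one hω hl
  rw [h, winv_one hω hl'] at h1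
  exact_mod_cast h1.symm

theorem winv_one_nonneg (ω : Fin n → Λ) : 0 ≤ winv ω (fun _ _ => 1) :=
  Finset.sum_nonneg fun p _ => Finset.sum_nonneg fun q _ => by split_ifs <;> norm_num

theorem exists_red {ω₀ : Fin n → Λ} (hω : Monotone ω₀) (π : Equiv.Perm (Fin n)) :
    ∃ l, Red ω₀ l ∧ ω₀ ∘ wordPerm l = ω₀ ∘ π := by
  suffices H : ∀ (m : ℕ) (π : Equiv.Perm (Fin n)), winv (ω₀ ∘ π) (fun _ _ => 1) = m →
      ∃ l, Red ω₀ l ∧ ω₀ ∘ wordPerm l = ω₀ ∘ π from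
    H _ π (Int.toNat_of_nonneg (winv_one_nonneg _)).symm
  intro m
  induction m with
  | zero =>
    intro π hm
    refine ⟨[], trivial, Tuple.unique_monotone (σ := 1) hω (monotone_of_adj fun a => ?_)⟩
    by_contra h
    rw [not_le] at h
    have h1 := winv_swap (ω₀ ∘ π ∘ a.s) (fun _ _ => 1) (fun _ _ => rfl) a
      (by simpa [a.s_lo, a.s_hi] using h)
    have h2 : (ω₀ ∘ π ∘ a.s) ∘ a.s = ω₀ ∘ π := by funext p; simp [a.s_s]
    rw [h2, hm] at h1
    have := winv_one_nonneg (ω₀ ∘ π ∘ a.s)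
    simp at h1
    omega
  | succ m ih =>
    intro π hm
    by_cases h : ∀ a : Adj n, ω₀ (π a.lo) ≤ ω₀ (π a.hi)
    · have := winv_of_monotone (monotone_of_adj (ω := ω₀ ∘ π) h) (fun _ _ => 1)
      omega
    · push Not at h
      obtain ⟨a, ha⟩ := h
      have h1 := winv_swap (ω₀ ∘ π ∘ a.s) (fun _ _ => 1) (fun _ _ => rfl) a
        (by simpa [a.s_lo, a.s_hi] using ha)
      have h2 : (ω₀ ∘ π ∘ a.s) ∘ a.s = ω₀ ∘ π := by funext p; simp [a.s_s]
      rw [h2, hm] at h1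
      obtain ⟨l, hl, hl'⟩ := ih (π * a.s) (by
        change winv (ω₀ ∘ π ∘ a.s) _ = _
        push_cast at h1
        omega)
      have h3 : ∀ p, ω₀ (wordPerm l p) = ω₀ (π (a.s p)) := congrFun hl'
      refine ⟨a :: l, ⟨hl, ?_⟩, ?_⟩
      · rw [h3, h3, a.s_lo, a.s_hi]; exact ha
      · funext p
        simp [wordPerm_cons, h3, a.s_s]

theorem wordPerm_append (l l' : List (Adj n)) : wordPerm (l ++ l') = wordPerm l' * wordPerm l := by
  induction l with
  | nil => simp [wordPerm]
  | cons a l ih => rw [List.cons_append, wordPerm, wordPerm, ih, mul_assoc]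

theorem red_descent {ω₀ : Fin n → Λ} (hω : Monotone ω₀) (π : Equiv.Perm (Fin n)) (a : Adj n)
    (h : ω₀ (π a.hi) < ω₀ (π a.lo)) :
    ∃ l, Red ω₀ (a :: l) ∧ ω₀ ∘ wordPerm (a :: l) = ω₀ ∘ π := by
  obtain ⟨l, hl, hl'⟩ := exists_red hω (π * a.s)
  have h3 : ∀ p, ω₀ (wordPerm l p) = ω₀ (π (a.s p)) := congrFun hl'
  refine ⟨l, ⟨hl, ?_⟩, ?_⟩
  · rw [h3, h3, a.s_lo, a.s_hi]; exact h
  · funext p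
    simp [wordPerm_cons, h3, a.s_s]

end Words

end

end QuiverHeckeClifford

namespace QuiverHeckeClifford

set_option linter.unusedSectionVars false

noncomputable section

namespace Adj

variable {n : ℕ}

theorem s_val (a : Adj n) (p : Fin n) :
    (a.s p).1 = if p.1 = a.1 then a.1 + 1 else if p.1 = a.1 + 1 then a.1 else p.1 := by
  by_cases h1 : p = a.lo
  · subst h1; rw [a.s_lo]; simp [lo, hi]
  · by_cases h2 : p = a.hi
    · subst h2; rw [a.s_hi]; simp [lo, hi]
    · rw [a.s_of_ne h1 h2]
      have h1' : p.1 ≠ a.1 := fun h => h1 (Fin.ext h)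
      have h2' : p.1 ≠ a.1 + 1 := fun h => h2 (Fin.ext h)
      rw [if_neg h1', if_neg h2']

theorem s_comm_far (a b : Adj n) (h : a.1 + 1 < b.1) : a.s * b.s = b.s * a.s := by
  ext p
  simp only [Equiv.Perm.mul_apply, s_val]
  split_ifs <;> omega

theorem s_far {a b : Adj n} (h : a.1 + 1 < b.1) :
    (a.s b.lo = b.lo ∧ a.s b.hi = b.hi) ∧ (b.s a.lo = a.lo ∧ b.s a.hi = a.hi) := by
  refine ⟨⟨?_, ?_⟩, ?_, ?_⟩ <;> ext <;> simp only [s_val, lo, hi] <;> split_ifs <;> omega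

theorem s_adj {a b : Adj n} (h : b.1 = a.1 + 1) :
    b.lo = a.hi ∧ a.s b.hi = b.hi ∧ b.s a.lo = a.lo := by
  refine ⟨?_, ?_, ?_⟩ <;> ext <;> simp only [s_val, lo, hi] <;> (try split_ifs) <;> omega

theorem s_braid (a b : Adj n) (h : b.1 = a.1 + 1) : a.s * b.s * a.s = b.s * a.s * b.s := by
  obtain ⟨h1, h2, h3⟩ := s_adj h
  have h4 : b.s a.hi = b.hi := by rw [← h1, b.s_lo]
  have h5 : b.s b.hi = a.hi := by rw [b.s_hi, h1]
  refine Equiv.ext fun p => ?_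
  simp only [Equiv.Perm.mul_apply]
  by_cases p1 : p = a.lo
  · subst p1; rw [a.s_lo, h4, h2, h3, a.s_lo, h4]
  · by_cases p2 : p = a.hi
    · subst p2; rw [a.s_hi, h3, a.s_lo, h4, h2, h5]
    · by_cases p3 : p = b.hi
      · subst p3; rw [h2, h5, a.s_hi, h3]
      · rw [a.s_of_ne p1 p2, b.s_of_ne (by rwa [h1]) p3, a.s_of_ne p1 p2,
          b.s_of_ne (by rwa [h1]) p3]

end Adj

namespace Datum

variable {k I : Type*} [Field k] [DecidableEq I] {D : Datum k I} {β : I →₀ ℕ}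

variable (D β) in
/-- The subalgebra generated by the `e(ν)`, `x_p` and `c_p`. -/
def polyCliff : Subalgebra k (D.RC β) :=
  Algebra.adjoin k {y | (∃ ν, y = eRC ν) ∨ (∃ p, y = xRC p) ∨ ∃ p, y = cRC p}

theorem e_mem_polyCliff (ν : D.Seq β) : eRC ν ∈ D.polyCliff β :=
  Algebra.subset_adjoin (Or.inl ⟨ν, rfl⟩)

theorem x_mem_polyCliff (p : Fin (ht β)) : xRC p ∈ D.polyCliff β :=
  Algebra.subset_adjoin (Or.inr (Or.inl ⟨p, rfl⟩))

theorem c_mem_polyCliff (p : Fin (ht β)) : cRC p ∈ D.polyCliff β :=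
  Algebra.subset_adjoin (Or.inr (Or.inr ⟨p, rfl⟩))

section

variable {B : Type*} [Ring B] [Algebra k B] (S : Subalgebra k B)

theorem Q_mem_subalgebra (i j : I) {u v : B} (hu : u ∈ S) (hv : v ∈ S) : D.Q i j u v ∈ S := by
  unfold Q
  split_ifs
  · exact S.zero_mem
  · exact S.sum_mem fun p _ => S.smul_mem (S.mul_mem (S.pow_mem hu _) (S.pow_mem hv _)) _

theorem divQ_mem_subalgebra (i j : I) {u' u v : B} (hu' : u' ∈ S) (hu : u ∈ S) (hv : v ∈ S) :
    D.divQ i j u' u v ∈ S := by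
  unfold divQ
  split_ifs
  · exact S.zero_mem
  · exact S.sum_mem fun p _ => S.smul_mem (S.mul_mem (S.sum_mem fun m _ =>
      S.mul_mem (S.pow_mem hu' _) (S.pow_mem hu _)) (S.pow_mem hv _)) _

theorem Qt_mem_subalgebra (i j : D.J) {u v : B} (hu : u ∈ S) (hv : v ∈ S) : D.Qt i j u v ∈ S :=
  Q_mem_subalgebra S _ _ (S.smul_mem hu _) (S.smul_mem hv _)

theorem divQt_mem_subalgebra (i j : D.J) {u' u v : B} (hu' : u' ∈ S) (hu : u ∈ S) (hv : v ∈ S) :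
    D.divQt i j u' u v ∈ S :=
  S.smul_mem (divQ_mem_subalgebra S _ _ (S.smul_mem hu' _) (S.smul_mem hu _) (S.smul_mem hv _)) _

end

theorem mem_polyCliff_of_mul_e {y : D.RC β} (h : ∀ ν, y * eRC ν ∈ D.polyCliff β) :
    y ∈ D.polyCliff β := by
  rw [← mul_one y, ← e_sum, Finset.mul_sum]
  exact Subalgebra.sum_mem _ fun ν _ => h ν

theorem ite_mem_polyCliff {p : Prop} [Decidable p] {y : D.RC β} (h : y ∈ D.polyCliff β) :
    (if p then y else 0) ∈ D.polyCliff β := by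
  split_ifs
  · exact h
  · exact zero_mem _

theorem s_mul_s_mem (a : Adj (ht β)) : (sRC a * sRC a : D.RC β) ∈ D.polyCliff β :=
  mem_polyCliff_of_mul_e fun ν => by
    rw [rel_RC (.s_s a ν)]
    exact MulMemClass.mul_mem (Qt_mem_subalgebra _ _ _ (x_mem_polyCliff _) (x_mem_polyCliff _))
      (e_mem_polyCliff ν)

theorem braid_mem (a b : Adj (ht β)) (h : b.1 = a.1 + 1) :
    (sRC b * sRC a * sRC b - sRC a * sRC b * sRC a : D.RC β) ∈ D.polyCliff β :=
  mem_polyCliff_of_mul_e fun ν => by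
    rw [rel_RC (.braid a b h ν)]
    refine add_mem (ite_mem_polyCliff (MulMemClass.mul_mem ?_ (e_mem_polyCliff ν)))
      (ite_mem_polyCliff (MulMemClass.mul_mem (MulMemClass.mul_mem (MulMemClass.mul_mem ?_ (c_mem_polyCliff _)) (c_mem_polyCliff _))
        (e_mem_polyCliff ν)))
    · exact divQt_mem_subalgebra _ _ _ (x_mem_polyCliff _) (x_mem_polyCliff _) (x_mem_polyCliff _)
    · exact divQt_mem_subalgebra _ _ _ (x_mem_polyCliff _) (neg_mem (x_mem_polyCliff _))
        (x_mem_polyCliff _)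

theorem x_mul_s (a : Adj (ht β)) (p : Fin (ht β)) :
    (xRC p * sRC a - sRC a * xRC (a.s p) : D.RC β) ∈ D.polyCliff β := by
  have hcc : ∀ ν : D.Seq β, cRC a.lo * cRC a.hi * eRC ν ∈ D.polyCliff β := fun ν =>
    MulMemClass.mul_mem (MulMemClass.mul_mem (c_mem_polyCliff _) (c_mem_polyCliff _)) (e_mem_polyCliff ν)
  by_cases h1 : p = a.lo
  · subst h1
    rw [← neg_sub, a.s_lo]
    refine neg_mem (mem_polyCliff_of_mul_e fun ν => ?_)
    rw [rel_RC (.s_x_hi a ν)]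
    exact sub_mem (ite_mem_polyCliff (e_mem_polyCliff ν)) (ite_mem_polyCliff (hcc ν))
  · by_cases h2 : p = a.hi
    · subst h2
      rw [a.s_hi]
      refine mem_polyCliff_of_mul_e fun ν => ?_
      rw [rel_RC (.s_x_lo a ν)]
      exact add_mem (ite_mem_polyCliff (e_mem_polyCliff ν)) (ite_mem_polyCliff (hcc ν))
    · rw [a.s_of_ne h1 h2, s_x a p h1 h2, sub_self]
      exact zero_mem _

theorem c_mul_s (a : Adj (ht β)) (p : Fin (ht β)) :
    (cRC p * sRC a : D.RC β) = sRC a * cRC (a.s p) := by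
  rw [s_c, a.s_s]

theorem e_mul_s (a : Adj (ht β)) (ν : D.Seq β) : eRC ν * sRC a = sRC a * eRC (ν.s a) := by
  rw [s_e, Seq.s_s]

theorem polyCliff_mul_s (a : Adj (ht β)) {y : D.RC β} (hy : y ∈ D.polyCliff β) :
    ∃ y' ∈ D.polyCliff β, ∃ z ∈ D.polyCliff β, y * sRC a = sRC a * y' + z := by
  induction hy using Algebra.adjoin_induction with
  | mem y hy =>
    rcases hy with ⟨ν, rfl⟩ | ⟨p, rfl⟩ | ⟨p, rfl⟩
    · exact ⟨_, e_mem_polyCliff _, 0, zero_mem _, by rw [e_mul_s, add_zero]⟩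
    · exact ⟨_, x_mem_polyCliff _, _, x_mul_s a p, by rw [add_sub_cancel]⟩
    · exact ⟨_, c_mem_polyCliff _, 0, zero_mem _, by rw [c_mul_s, add_zero]⟩
  | algebraMap r =>
    exact ⟨_, Subalgebra.algebraMap_mem _ r, 0, zero_mem _, by rw [Algebra.commutes, add_zero]⟩
  | add y y' _ _ hy hy' =>
    obtain ⟨u, hu, v, hv, e⟩ := hy
    obtain ⟨u', hu', v', hv', e'⟩ := hy'
    exact ⟨u + u', add_mem hu hu', v + v', add_mem hv hv', by rw [add_mul, e, e', mul_add]; abel⟩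
  | mul y y' hyK hyK' hy hy' =>
    obtain ⟨u, hu, v, hv, e⟩ := hy
    obtain ⟨u', hu', v', hv', e'⟩ := hy'
    refine ⟨u * u', MulMemClass.mul_mem hu hu', v * u' + y * v', add_mem (MulMemClass.mul_mem hv hu') (MulMemClass.mul_mem hyK hv'), ?_⟩
    rw [mul_assoc, e', mul_add, ← mul_assoc, e]
    noncomm_ring

/-- The product of the `σ_a` for `a` in a word. -/
def sWord (l : List (Adj (ht β))) : D.RC β := (l.map sRC).prod

theorem sWord_nil : (sWord [] : D.RC β) = 1 := rfl

theorem sWord_cons (a : Adj (ht β)) (l : List (Adj (ht β))) :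
    (sWord (a :: l) : D.RC β) = sRC a * sWord l := List.prod_cons

theorem sWord_append (l l' : List (Adj (ht β))) :
    (sWord (l ++ l') : D.RC β) = sWord l * sWord l' := by
  rw [sWord, List.map_append, List.prod_append]; rfl

theorem sWord_cons_smul {Z : Type*} [AddCommGroup Z] [Module (D.RC β) Z] (a : Adj (ht β))
    (l : List (Adj (ht β))) (v : Z) :
    (sWord (a :: l) : D.RC β) • v = (sRC a : D.RC β) • (sWord l : D.RC β) • v := by
  rw [sWord_cons, mul_smul]

/-! ### The filtration by the length of words -/

section Filtration

variable {Z Λ : Type*} [AddCommGroup Z] [Module k Z] [Module (D.RC β) Z]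
  [IsScalarTower k (D.RC β) Z] [LinearOrder Λ]

variable (D) in
/-- The span of all `σ_l v`, for `v` in `V` and reduced words `l` of length less than `m`. -/
def fil (ω₀ : Fin (ht β) → Λ) (V : Submodule k Z) (m : ℤ) : Submodule k Z :=
  Submodule.span k {z | ∃ (l : List (Adj (ht β))) (v : Z), Red ω₀ l ∧ (l.length : ℤ) < m ∧ v ∈ V ∧
    z = (sWord l : D.RC β) • v}

variable (D) in
/-- A subspace that is stable under the `e(ν)`, `x_p`, `c_p` and those `σ_b` that exchange equal
entries. -/
structure IsStable (ω₀ : Fin (ht β) → Λ) (V : Submodule k Z) : Prop where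
  smul_mem : ∀ y ∈ D.polyCliff β, ∀ v ∈ V, y • v ∈ V
  s_smul_mem : ∀ b : Adj (ht β), ω₀ b.lo = ω₀ b.hi → ∀ v ∈ V, (sRC b : D.RC β) • v ∈ V

variable (D) in
/-- The compatibility of a step of the filtration with the action of the generators. -/
structure FilGood (ω₀ : Fin (ht β) → Λ) (V : Submodule k Z) (m : ℤ) : Prop where
  smul_mem : ∀ y ∈ D.polyCliff β, ∀ z ∈ D.fil ω₀ V m, y • z ∈ D.fil ω₀ V m
  s_smul_mem : ∀ b : Adj (ht β), ∀ z ∈ D.fil ω₀ V m, (sRC b : D.RC β) • z ∈ D.fil ω₀ V (m + 1)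

variable {ω₀ : Fin (ht β) → Λ} {V : Submodule k Z}

theorem sWord_mem_fil {l : List (Adj (ht β))} (hl : Red ω₀ l) {m : ℤ} (hm : (l.length : ℤ) < m)
    {v : Z} (hv : v ∈ V) : (sWord l : D.RC β) • v ∈ D.fil ω₀ V m :=
  Submodule.subset_span ⟨l, v, hl, hm, hv, rfl⟩

theorem fil_mono {m m' : ℤ} (h : m ≤ m') : D.fil ω₀ V m ≤ D.fil ω₀ V m' :=
  Submodule.span_mono fun _ ⟨l, v, hl, hm, hv, e⟩ => ⟨l, v, hl, hm.trans_le h, hv, e⟩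

theorem fil_nonpos {m : ℤ} (h : m ≤ 0) : D.fil ω₀ V m = ⊥ := by
  rw [fil, Submodule.span_eq_bot]
  rintro _ ⟨l, v, hl, hm, -⟩
  omega

theorem s_smul_s_smul (a b : Adj (ht β)) (h : a.1 + 1 < b.1) (z : Z) :
    (sRC a : D.RC β) • (sRC b : D.RC β) • z = (sRC b : D.RC β) • (sRC a : D.RC β) • z := by
  rw [← mul_smul, s_comm a b h, mul_smul]

/-- Two reduced words with the same result act in the same way up to shorter words. -/
theorem red_unique (hω : Monotone ω₀) (m : ℕ)
    (hG : ∀ j : ℤ, j < m → D.FilGood ω₀ V j) :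
    ∀ l l' : List (Adj (ht β)), Red ω₀ l → Red ω₀ l' → ω₀ ∘ wordPerm l = ω₀ ∘ wordPerm l' →
      l.length = m → wordPerm l = wordPerm l' ∧
        ∀ v ∈ V, (sWord l : D.RC β) • v - (sWord l' : D.RC β) • v ∈ D.fil ω₀ V (m - 2) := by
  induction m using Nat.strong_induction_on with
  | _ m ih =>
  suffices H : ∀ (a b : Adj (ht β)) (l l' : List (Adj (ht β))), a.1 ≤ b.1 → Red ω₀ (a :: l) →
      Red ω₀ (b :: l') → ω₀ ∘ wordPerm (a :: l) = ω₀ ∘ wordPerm (b :: l') →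
      l.length + 1 = m → wordPerm (a :: l) = wordPerm (b :: l') ∧
        ∀ v ∈ V, (sWord (a :: l) : D.RC β) • v - (sWord (b :: l') : D.RC β) • v
          ∈ D.fil ω₀ V (m - 2) by
    intro l l' hl hl' h hm
    have hlen := length_eq_of_red hω hl hl' h
    match l, l' with
    | [], [] => exact ⟨rfl, fun v _ => by rw [sub_self]; exact zero_mem _⟩
    | [], _ :: _ => simp at hlen
    | _ :: _, [] => simp at hlen
    | a :: l, b :: l' =>
      rcases le_total a.1 b.1 with hab | hab
      · exact H a b l l' hab hl hl' h hm
      · obtain ⟨h1, h2⟩ := H b a l' l hab hl' hl h.symm (by simpa using hlen.symm.trans hm)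
        refine ⟨h1.symm, fun v hv => ?_⟩
        have := neg_mem (h2 v hv)
        rwa [neg_sub] at this
  intro a b l l' hab hl hl' h hm
  have hlen : (a :: l).length = (b :: l').length := length_eq_of_red hω hl hl' h
  simp only [List.length_cons, add_left_inj] at hlen
  have ih' : ∀ l₁ l₂ : List (Adj (ht β)), Red ω₀ l₁ → Red ω₀ l₂ →
      ω₀ ∘ wordPerm l₁ = ω₀ ∘ wordPerm l₂ → l₁.length + 1 = m → wordPerm l₁ = wordPerm l₂ ∧
        ∀ v ∈ V, (sWord l₁ : D.RC β) • v - (sWord l₂ : D.RC β) • v ∈ D.fil ω₀ V (m - 3) := by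
    intro l₁ l₂ h1 h2 h12 hl₁
    have := ih l₁.length (by omega) (fun j hj => hG j (by omega)) l₁ l₂ h1 h2 h12 rfl
    rwa [show (l₁.length : ℤ) - 2 = m - 3 by omega] at this
  have hs : ∀ (a : Adj (ht β)) (z z' : Z), z - z' ∈ D.fil ω₀ V (m - 3) →
      (sRC a : D.RC β) • z - (sRC a : D.RC β) • z' ∈ D.fil ω₀ V (m - 2) := by
    intro a z z' hz
    rw [← smul_sub, show (m : ℤ) - 2 = (m - 3) + 1 by omega]
    exact (hG _ (by omega)).s_smul_mem a _ hz
  have happ : ∀ p, ω₀ (wordPerm l (a.s p)) = ω₀ (wordPerm l' (b.s p)) := congrFun h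
  have happ' : ∀ p, ω₀ (wordPerm l p) = ω₀ (wordPerm l' (b.s (a.s p))) := fun p => by
    rw [← happ, a.s_s]
  have happ'' : ∀ p, ω₀ (wordPerm l' p) = ω₀ (wordPerm l (a.s (b.s p))) := fun p => by
    rw [happ, b.s_s]
  rcases lt_trichotomy (a.1 + 1) b.1 with hfar | hadj | hfar
  · obtain ⟨⟨h1, h2⟩, h3, h4⟩ := Adj.s_far hfar
    have d1 : ω₀ (wordPerm l b.hi) < ω₀ (wordPerm l b.lo) := by
      rw [happ', happ', h1, h2, b.s_lo, b.s_hi]; exact hl'.2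
    obtain ⟨l₂, hl₂, e₂⟩ := red_descent hω _ b d1
    have e₂' : ∀ p, ω₀ (wordPerm l₂ (b.s p)) = ω₀ (wordPerm l p) := congrFun e₂
    have hl₃ : Red ω₀ (a :: l₂) := by
      refine ⟨hl₂.1, ?_⟩
      have := hl.2
      rwa [← e₂', ← e₂', h3, h4] at this
    have e₃ : ω₀ ∘ wordPerm (a :: l₂) = ω₀ ∘ wordPerm l' := by
      funext p
      change ω₀ (wordPerm l₂ (a.s p)) = _
      rw [← b.s_s (a.s p), e₂', Function.comp_apply, happ'']
      have := congrFun (congrArg DFunLike.coe (Adj.s_comm_far a b hfar)) p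
      simp only [Equiv.Perm.mul_apply] at this
      rw [this]
    obtain ⟨i1, i2⟩ := ih' _ _ hl₂ hl.1 e₂ (by
      rw [length_eq_of_red hω hl₂ hl.1 e₂]; exact hm)
    obtain ⟨i3, i4⟩ := ih' _ _ hl₃ hl'.1 e₃ (by
      rw [length_eq_of_red hω hl₃ hl'.1 e₃]; omega)
    constructor
    · rw [wordPerm, wordPerm, ← i1, ← i3, wordPerm, wordPerm, mul_assoc, mul_assoc,
        Adj.s_comm_far a b hfar]
    · intro v hv
      have j1 := hs a _ _ (i2 v hv)
      have j2 := hs b _ _ (i4 v hv)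
      rw [sWord_cons_smul] at j1 j2
      rw [← s_smul_s_smul a b hfar] at j2
      rw [sWord_cons_smul, sWord_cons_smul]
      have := sub_mem j2 j1
      rwa [sub_sub_sub_cancel_left] at this
  · obtain ⟨h1, h2, h3⟩ := Adj.s_adj hadj.symm
    have h4 : b.s a.hi = b.hi := by rw [← h1, b.s_lo]
    have h5 : b.s b.hi = a.hi := by rw [b.s_hi, h1]
    have d1 := hl.2
    have d2 := hl'.2
    rw [happ'', happ'', b.s_lo, b.s_hi, h2, h1, a.s_hi] at d2
    obtain ⟨l₃, hl₃, e₃⟩ := exists_red hω (wordPerm l * b.s * a.s)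
    have e₃' : ∀ p, ω₀ (wordPerm l₃ p) = ω₀ (wordPerm l (b.s (a.s p))) := congrFun e₃
    have f0 := e₃' a.lo
    have f1 := e₃' a.hi
    have f2 := e₃' b.hi
    rw [a.s_lo, h4] at f0
    rw [a.s_hi, h3] at f1
    rw [h2, h5] at f2
    have r1 : Red ω₀ (b :: a :: l₃) := by
      refine ⟨⟨hl₃, by rw [f0, f1]; exact d2⟩, ?_⟩
      rw [wordPerm_cons, wordPerm_cons, h1, a.s_hi, h2, f0, f2]
      exact d2.trans d1
    have r2 : Red ω₀ (a :: b :: l₃) := by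
      refine ⟨⟨hl₃, by rw [h1, f1, f2]; exact d1⟩, ?_⟩
      rw [wordPerm_cons, wordPerm_cons, h3, h4, f0, f2]
      exact d2.trans d1
    have s1 : ω₀ ∘ wordPerm l = ω₀ ∘ wordPerm (b :: a :: l₃) := by
      funext p
      change _ = ω₀ (wordPerm l₃ (a.s (b.s p)))
      rw [e₃', a.s_s, b.s_s]; rfl
    have s2 : ω₀ ∘ wordPerm l' = ω₀ ∘ wordPerm (a :: b :: l₃) := by
      funext p
      change _ = ω₀ (wordPerm l₃ (b.s (a.s p)))
      have := congrFun (congrArg DFunLike.coe (Adj.s_braid a b hadj.symm)) (b.s (a.s p))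
      simp only [Equiv.Perm.mul_apply, a.s_s, b.s_s] at this
      have h6 := congrArg a.s this
      rw [a.s_s] at h6
      rw [e₃', h6, Function.comp_apply, happ'']
    obtain ⟨i1, i2⟩ := ih' _ _ hl.1 r1 s1 hm
    obtain ⟨i3, i4⟩ := ih' _ _ hl'.1 r2 s2 (by omega)
    constructor
    · rw [wordPerm, wordPerm, i1, i3]
      simp only [wordPerm, mul_assoc]
      rw [← mul_assoc a.s, Adj.s_braid a b hadj.symm]
      simp only [mul_assoc]
    · intro v hv
      have j1 := hs a _ _ (i2 v hv)
      have j2 := hs b _ _ (i4 v hv)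
      have len3 : l.length = l₃.length + 2 := length_eq_of_red hω hl.1 r1 s1
      have j3 := (hG (m - 2) (by omega)).smul_mem _ (braid_mem a b hadj.symm) _
        (sWord_mem_fil (D := D) hl₃ (m := m - 2) (by omega) hv)
      simp only [sWord_cons_smul, sub_smul, mul_smul] at j1 j2 j3 ⊢
      have := sub_mem (sub_mem j1 j3) j2
      convert this using 1
      abel
  · have : a = b := Subtype.ext (by omega)
    subst this
    obtain ⟨i1, i2⟩ := ih' l l' hl.1 hl'.1 (by
      funext p
      have := happ (a.s p)
      rwa [a.s_s] at this) hm
    exact ⟨by rw [wordPerm, wordPerm, i1], fun v hv => by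
      rw [sWord_cons_smul, sWord_cons_smul]; exact hs a _ _ (i2 v hv)⟩

/-- A letter that exchanges equal entries can be moved to the right, up to shorter words. -/
theorem red_flat (hω : Monotone ω₀) (hV : D.IsStable ω₀ V) (m : ℕ)
    (hG : ∀ j : ℤ, j < m → D.FilGood ω₀ V j) :
    ∀ (l : List (Adj (ht β))) (a : Adj (ht β)), Red ω₀ l →
      ω₀ (wordPerm l a.lo) = ω₀ (wordPerm l a.hi) → l.length = m →
      ∃ b : Adj (ht β), b.lo = wordPerm l a.lo ∧ b.hi = wordPerm l a.hi ∧ ∀ v ∈ V,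
        (sRC a : D.RC β) • (sWord l : D.RC β) • v - (sWord l : D.RC β) • (sRC b : D.RC β) • v
          ∈ D.fil ω₀ V m := by
  induction m using Nat.strong_induction_on with
  | _ m ih =>
  intro l a hl ha hm
  match l with
  | [] => exact ⟨a, rfl, rfl, fun v _ => by simp only [sWord_nil, one_smul, sub_self, zero_mem]⟩
  | b :: l =>
  have hm' : l.length + 1 = m := hm
  simp only [wordPerm_cons] at ha ⊢
  have hs : ∀ (j : ℤ) (a : Adj (ht β)) (z z' : Z), j < m → z - z' ∈ D.fil ω₀ V j →
      (sRC a : D.RC β) • z - (sRC a : D.RC β) • z' ∈ D.fil ω₀ V (j + 1) := by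
    intro j a z z' hj hz
    rw [← smul_sub]
    exact (hG _ hj).s_smul_mem a _ hz
  have far : ((b.s a.lo = a.lo ∧ b.s a.hi = a.hi) ∧ ∀ z : Z,
      (sRC a : D.RC β) • (sRC b : D.RC β) • z = (sRC b : D.RC β) • (sRC a : D.RC β) • z) →
      ∃ d : Adj (ht β), d.lo = wordPerm l (b.s a.lo) ∧ d.hi = wordPerm l (b.s a.hi) ∧ ∀ v ∈ V,
        (sRC a : D.RC β) • (sWord (b :: l) : D.RC β) • v -
          (sWord (b :: l) : D.RC β) • (sRC d : D.RC β) • v ∈ D.fil ω₀ V m := by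
    rintro ⟨⟨h1, h2⟩, hc⟩
    rw [h1, h2] at ha ⊢
    obtain ⟨d, d1, d2, hd⟩ := ih l.length (by omega) (fun j hj => hG j (by omega)) l a hl.1 ha rfl
    refine ⟨d, d1, d2, fun v hv => ?_⟩
    have := hs _ b _ _ (by omega) (hd v hv)
    rw [show (l.length : ℤ) + 1 = m by omega] at this
    rwa [sWord_cons_smul, sWord_cons_smul, hc]
  have near : ((sRC b * sRC a * sRC b - sRC a * sRC b * sRC a : D.RC β) ∈ D.polyCliff β) →
      ω₀ (wordPerm l a.hi) < ω₀ (wordPerm l a.lo) →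
      ω₀ (wordPerm l (a.s b.lo)) = ω₀ (wordPerm l (a.s b.hi)) →
      (a.s b.lo = b.s a.lo ∧ a.s b.hi = b.s a.hi) →
      ∃ d : Adj (ht β), d.lo = wordPerm l (b.s a.lo) ∧ d.hi = wordPerm l (b.s a.hi) ∧ ∀ v ∈ V,
        (sRC a : D.RC β) • (sWord (b :: l) : D.RC β) • v -
          (sWord (b :: l) : D.RC β) • (sRC d : D.RC β) • v ∈ D.fil ω₀ V m := by
    rintro hbr hdes heq ⟨e1, e2⟩
    obtain ⟨l', hl', hs'⟩ := red_descent hω (wordPerm l) a hdes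
    obtain ⟨u1, u2⟩ := red_unique hω l.length (fun j hj => hG j (by omega)) l (a :: l') hl.1 hl'
      hs'.symm rfl
    have len : l.length = l'.length + 1 := length_eq_of_red hω hl.1 hl' hs'.symm
    obtain ⟨d, d1, d2, hd⟩ := ih l'.length (by omega) (fun j hj => hG j (by omega)) l' b hl'.1
      (by simpa only [u1, wordPerm_cons, a.s_s] using heq) rfl
    refine ⟨d, ?_, ?_, fun v hv => ?_⟩
    · rw [d1, ← e1, u1, wordPerm_cons, a.s_s]
    · rw [d2, ← e2, u1, wordPerm_cons, a.s_s]
    have hdv : (sRC d : D.RC β) • v ∈ V := hV.s_smul_mem d (by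
      rw [d1, d2]
      simpa only [u1, wordPerm_cons, a.s_s] using heq) v hv
    have j1 := hs _ a _ _ (by omega) (hs _ b _ _ (by omega) (u2 v hv))
    have j2 := hs _ b _ _ (by omega) (hs _ a _ _ (by omega) (hd v hv))
    have j3 := hs _ b _ _ (by omega) (u2 _ hdv)
    have j4 := (hG (m - 1) (by omega)).smul_mem _ hbr _
        (sWord_mem_fil (D := D) hl'.1 (m := m - 1) (by omega) hv)
    have k1 := fil_mono (m' := m) (by omega) j1
    have k2 := fil_mono (m' := m) (by omega) j2
    have k3 := fil_mono (m' := m) (by omega) j3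
    have k4 := fil_mono (m' := m) (by omega) j4
    simp only [sWord_cons_smul, sub_smul, mul_smul] at k1 k2 k3 k4 ⊢
    have := sub_mem (add_mem k1 k2) (add_mem k3 k4)
    convert this using 1
    abel
  rcases lt_trichotomy a.1 b.1 with h | h | h
  · rcases lt_or_eq_of_le (Nat.succ_le_of_lt h) with h | h
    · exact far ⟨(Adj.s_far h).2, fun z => s_smul_s_smul a b h z⟩
    · obtain ⟨h1, h2, h3⟩ := Adj.s_adj (a := a) (b := b) h.symm
      have h4 : b.s a.hi = b.hi := by rw [← h1, b.s_lo]
      have hd := hl.2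
      rw [h3, h4] at ha
      refine near (braid_mem a b h.symm) ?_ ?_ ?_
      · rw [ha, ← h1]; exact hd
      · rw [h1, a.s_hi, h2]; exact ha
      · rw [h1, a.s_hi, h2, h3, h4]; exact ⟨rfl, rfl⟩
  · have : a = b := Subtype.ext h
    subst this
    have hd := hl.2
    rw [a.s_lo, a.s_hi] at ha
    exact absurd ha hd.ne'
  · rcases lt_or_eq_of_le (Nat.succ_le_of_lt h) with h | h
    · exact far ⟨(Adj.s_far h).1, fun z => (s_smul_s_smul b a h z).symm⟩
    · obtain ⟨h1, h2, h3⟩ := Adj.s_adj (a := b) (b := a) h.symm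
      have h4 : a.s b.hi = a.hi := by rw [← h1, a.s_lo]
      have hd := hl.2
      rw [h1, b.s_hi, h2] at ha
      refine near ?_ ?_ ?_ ?_
      · rw [← neg_sub]; exact neg_mem (braid_mem b a h.symm)
      · rw [← ha, h1]; exact hd
      · rw [h3, h4]; exact ha
      · rw [h3, h4, h1, b.s_hi, h2]; exact ⟨rfl, rfl⟩

theorem red_nonup (hω : Monotone ω₀) (hV : D.IsStable ω₀ V) (m : ℕ)
    (hG : ∀ j : ℤ, j ≤ m → D.FilGood ω₀ V j) (l : List (Adj (ht β))) (a : Adj (ht β))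
    (hl : Red ω₀ l) (ha : ¬ω₀ (wordPerm l a.lo) < ω₀ (wordPerm l a.hi)) (hm : l.length = m) {v : Z}
    (hv : v ∈ V) : (sRC a : D.RC β) • (sWord l : D.RC β) • v ∈ D.fil ω₀ V (m + 1) := by
  rcases lt_or_eq_of_le (not_lt.1 ha) with h | h
  · obtain ⟨l', hl', hs'⟩ := red_descent hω (wordPerm l) a h
    obtain ⟨-, u⟩ := red_unique hω m (fun j hj => hG j hj.le) l (a :: l') hl hl' hs'.symm hm
    have len : l.length = l'.length + 1 := length_eq_of_red hω hl hl' hs'.symm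
    have h1 := (hG (m - 2) (by omega)).s_smul_mem a _ (u v hv)
    have h2 := (hG m le_rfl).smul_mem _ (s_mul_s_mem a) _
      (sWord_mem_fil (D := D) hl'.1 (m := m) (by omega) hv)
    have h3 := add_mem (fil_mono (m' := m + 1) (by omega) h1) (fil_mono (m' := m + 1) (by omega) h2)
    rwa [sWord_cons_smul, smul_sub, mul_smul, sub_add_cancel] at h3
  · obtain ⟨b, b1, b2, hb⟩ := red_flat hω hV m (fun j hj => hG j hj.le) l a hl h.symm hm
    have hbv := hV.s_smul_mem b (by rw [b1, b2, h]) v hv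
    have h3 := add_mem (fil_mono (m' := m + 1) (by omega) (hb v hv))
      (sWord_mem_fil (D := D) hl (m := m + 1) (by omega) hbv)
    rwa [sub_add_cancel] at h3

theorem filGood (hω : Monotone ω₀) (hV : D.IsStable ω₀ V) (m : ℤ) : D.FilGood ω₀ V m := by
  have key : ∀ N : ℕ, ∀ m : ℤ, m ≤ N → D.FilGood ω₀ V m := by
    intro N
    induction N with
    | zero =>
      intro m hm
      constructor
      · intro y _ z hz
        rw [fil_nonpos (by simpa using hm), Submodule.mem_bot] at hz
        rw [hz, smul_zero]; exact zero_mem _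
      · intro b z hz
        rw [fil_nonpos (by simpa using hm), Submodule.mem_bot] at hz
        rw [hz, smul_zero]; exact zero_mem _
    | succ N ih =>
      intro m hm
      rcases lt_or_eq_of_le hm with h | rfl
      · exact ih m (by push_cast at h; omega)
      constructor
      · intro y hy z hz
        induction hz using Submodule.span_induction with
        | zero => rw [smul_zero]; exact zero_mem _
        | add z z' _ _ h h' => rw [smul_add]; exact add_mem h h'
        | smul r z _ h => rw [smul_algebra_smul_comm]; exact Submodule.smul_mem _ _ h
        | mem z h =>
          obtain ⟨l, v, hl, hlen, hv, rfl⟩ := h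
          match l with
          | [] =>
            have := sWord_mem_fil (D := D) (ω₀ := ω₀) (l := []) trivial hlen (hV.smul_mem y hy v hv)
            rwa [sWord_nil, one_smul] at this ⊢
          | a :: l =>
            obtain ⟨y', hy', u, hu, e⟩ := polyCliff_mul_s a hy
            rw [sWord_cons_smul, ← mul_smul, e, add_smul, mul_smul]
            have hm' : (l.length : ℤ) < N := by push_cast at hlen; simp at hlen; omega
            have h1 := sWord_mem_fil (D := D) hl.1 hm' hv
            refine add_mem ?_ (fil_mono (by push_cast; omega) ((ih N le_rfl).smul_mem u hu _ h1))
            have := (ih N le_rfl).s_smul_mem a _ ((ih N le_rfl).smul_mem y' hy' _ h1)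
            exact_mod_cast this
      · intro b z hz
        induction hz using Submodule.span_induction with
        | zero => rw [smul_zero]; exact zero_mem _
        | add z z' _ _ h h' => rw [smul_add]; exact add_mem h h'
        | smul r z _ h => rw [smul_algebra_smul_comm]; exact Submodule.smul_mem _ _ h
        | mem z h =>
          obtain ⟨l, v, hl, hlen, hv, rfl⟩ := h
          by_cases hb : ω₀ (wordPerm l b.lo) < ω₀ (wordPerm l b.hi)
          · rw [← sWord_cons_smul]
            exact sWord_mem_fil (D := D) (l := b :: l) (ω₀ := ω₀) ⟨hl, hb⟩ (by rw [List.length_cons]; push_cast at hlen ⊢; omega) hv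
          · refine fil_mono (by push_cast at hlen ⊢; omega)
              (red_nonup hω hV l.length (fun j hj => ih j ?_) l b hl hb rfl hv)
            push_cast at hlen; omega
  exact key m.toNat m (Int.self_le_toNat m)

theorem sWord_append_mem_fil (hω : Monotone ω₀) (hV : D.IsStable ω₀ V) {l : List (Adj (ht β))}
    (hl : Red ω₀ l) (l' : List (Adj (ht β))) :
    Red ω₀ (l' ++ l) ∨ ∀ v ∈ V, (sWord (l' ++ l) : D.RC β) • v ∈ D.fil ω₀ V (l'.length + l.length) := by
  induction l' with
  | nil => exact Or.inl hl
  | cons a l' ih =>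
    rcases ih with h | h
    · by_cases ha : ω₀ (wordPerm (l' ++ l) a.lo) < ω₀ (wordPerm (l' ++ l) a.hi)
      · exact Or.inl ⟨h, ha⟩
      · refine Or.inr fun v hv => ?_
        have := red_nonup hω hV _ (fun j _ => filGood hω hV j) _ a h ha rfl hv
        rw [List.cons_append, sWord_cons_smul]
        refine fil_mono ?_ this
        simp [add_comm, add_left_comm]
    · refine Or.inr fun v hv => ?_
      rw [List.cons_append, sWord_cons_smul]
      refine fil_mono ?_ ((filGood hω hV _).s_smul_mem a _ (h v hv))
      simp [add_comm, add_left_comm]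

theorem polyCliff_smul_mem_iSup (hω : Monotone ω₀) (hV : D.IsStable ω₀ V) (y : D.RC β) {z : Z}
    (hz : z ∈ ⨆ m, D.fil ω₀ V m) : y • z ∈ ⨆ m, D.fil ω₀ V m := by
  have hdir : Directed (· ≤ ·) (D.fil (β := β) ω₀ V) :=
    (show Monotone (D.fil ω₀ V) from fun _ _ h => fil_mono h).directed_le
  induction y using RC_induction generalizing z with
  | hgen g =>
    rw [Submodule.mem_iSup_of_directed _ hdir] at hz ⊢
    obtain ⟨m, hz⟩ := hz
    have := filGood (D := D) hω hV m
    cases g with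
    | e ν => exact ⟨m, this.smul_mem _ (e_mem_polyCliff ν) _ hz⟩
    | x p => exact ⟨m, this.smul_mem _ (x_mem_polyCliff p) _ hz⟩
    | c p => exact ⟨m, this.smul_mem _ (c_mem_polyCliff p) _ hz⟩
    | s a => exact ⟨m + 1, this.s_smul_mem a _ hz⟩
  | hmap r => rw [algebraMap_smul]; exact Submodule.smul_mem _ _ hz
  | hadd a b ha hb => rw [add_smul]; exact add_mem (ha hz) (hb hz)
  | hmul a b ha hb => rw [mul_smul]; exact ha (hb hz)

end Filtration

end Datum

end

end QuiverHeckeClifford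

namespace QuiverHeckeClifford

set_option linter.unusedSectionVars false

noncomputable section

namespace Datum

variable {k I : Type*} [Field k] [DecidableEq I] {D : Datum k I} {β : I →₀ ℕ}

/-! ### The localized polynomial representation -/

section Strand

variable {F : Type*} [Field F] [Algebra k F]

variable (D F) in
/-- A strand: its colour and the value of its variable. -/
abbrev Strand : Type _ := D.J × F

/-- The effect of a Clifford generator on a strand. -/
def Strand.c (α : D.Strand F) : D.Strand F := (α.1.c, -α.2)

/-- The elementary rational function of two strands. -/
def Strand.h (α α' : D.Strand F) : F := if α.1 = α'.1 then (α'.2 - α.2)⁻¹ else 0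

/-- The square of the intertwiner of two strands. -/
def Strand.N (α α' : D.Strand F) : F :=
  D.Qt α.1 α'.1 α.2 α'.2 - α.h α' ^ 2 - α.c.h α' ^ 2

open Strand

theorem Strand.c_c (α : D.Strand F) : α.c.c = α := Prod.ext (J.c_c _) (neg_neg _)

theorem J.c_inj {i j : D.J} : i.c = j.c ↔ i = j :=
  ⟨fun h => by rw [← J.c_c i, h, J.c_c], fun h => by rw [h]⟩

theorem J.c_eq_iff {i j : D.J} : i.c = j ↔ i = j.c :=
  ⟨fun h => by rw [← h, J.c_c], fun h => by rw [h, J.c_c]⟩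

theorem Strand.h_symm (α α' : D.Strand F) : α'.h α = -α.h α' := by
  unfold h
  by_cases e : α.1 = α'.1
  · rw [if_pos e, if_pos e.symm, ← neg_sub, inv_neg]
  · rw [if_neg e, if_neg (Ne.symm e), neg_zero]

theorem Strand.h_c_c (α α' : D.Strand F) : α.c.h α'.c = -α.h α' := by
  unfold h c
  simp only [J.c_inj]
  split_ifs
  · rw [← inv_neg]; congr 1; ring
  · rw [neg_zero]

theorem Strand.h_c_right (α α' : D.Strand F) : α.h α'.c = -α.c.h α' := by
  rw [← h_c_c, c_c]

theorem Strand.h_c_left_symm (α α' : D.Strand F) : α'.c.h α = α.c.h α' := by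
  rw [h_symm, h_c_right, neg_neg]

theorem Strand.h_mul (α₁ α₂ α₃ : D.Strand F) (h12 : α₁.2 ≠ α₂.2) (h13 : α₁.2 ≠ α₃.2)
    (h23 : α₂.2 ≠ α₃.2) : α₁.h α₂ * α₁.h α₃ + α₁.h α₃ * α₂.h α₃ = α₂.h α₃ * α₁.h α₂ := by
  unfold h
  have a := sub_ne_zero.2 h12.symm
  have b := sub_ne_zero.2 h13.symm
  have c := sub_ne_zero.2 h23.symm
  by_cases e1 : α₁.1 = α₂.1 <;> by_cases e2 : α₂.1 = α₃.1 <;> by_cases e3 : α₁.1 = α₃.1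
  · simp only [e1, e2, if_true]
    field_simp
    ring
  · exact absurd (e1.trans e2) e3
  · exact absurd (e1.symm.trans e3) e2
  · simp [e1, e2, e3]
  · exact absurd (e3.trans e2.symm) e1
  · simp [e1, e2, e3]
  · simp [e1, e3, Ne.symm e2, e2]
  · simp [e1, e2, e3]

theorem mem_S_symm {i j : I} {r s : ℕ} : (r, s) ∈ D.S i j ↔ (s, r) ∈ D.S j i := by
  simp only [S, Finset.mem_filter, Finset.mem_product, Finset.mem_range]
  constructor <;> rintro ⟨⟨h1, h2⟩, h3, h4, h5⟩ <;> refine ⟨⟨h2, h1⟩, ?_, h5, h4⟩ <;>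
    linear_combination h3

theorem Q_symm (i j : I) (u v : F) : D.Q i j u v = D.Q j i v u := by
  unfold Q
  by_cases h : i = j
  · rw [if_pos h, if_pos h.symm]
  · rw [if_neg h, if_neg (Ne.symm h)]
    refine Finset.sum_nbij' Prod.swap Prod.swap ?_ ?_ ?_ ?_ ?_
    · rintro ⟨r, s⟩ hp; exact mem_S_symm.1 hp
    · rintro ⟨r, s⟩ hp; exact mem_S_symm.1 hp
    · intro p _; rfl
    · intro p _; rfl
    · rintro ⟨r, s⟩ hp
      simp only [S, Finset.mem_filter, Finset.mem_product, Finset.mem_range] at hp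
      obtain ⟨⟨h1, h2⟩, h3, h4, h5⟩ := hp
      have n1 := D.A_nonpos i j h
      have n2 := D.A_nonpos j i (Ne.symm h)
      simp only [Prod.swap]
      rw [D.t_symm i j h r s ⟨by omega, by omega, h3, h4, h5⟩, mul_comm]

theorem Qt_symm (i j : D.J) (u v : F) : D.Qt i j u v = D.Qt j i v u := Q_symm _ _ _ _

theorem Q_neg_of_odd (i j : I) (hi : D.par i = 1) (u v : F) : D.Q i j (-u) v = D.Q i j u v := by
  unfold Q
  split_ifs
  · rfl
  · refine Finset.sum_congr rfl fun p hp => ?_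
    simp only [S, Finset.mem_filter] at hp
    rw [(hp.2.2.1 hi).neg_pow]

theorem Qt_c (i j : D.J) (u v : F) : D.Qt i.c j (-u) v = D.Qt i j u v := by
  unfold Qt
  rw [J.c_fst]
  by_cases h : D.par i.fst = 1
  · have e : i.c.snd = i.snd := if_pos h
    rw [e, smul_neg, Q_neg_of_odd _ _ h]
  · have e : i.c.snd = i.snd + 1 := if_neg h
    rw [e, sgn_add, sgn_one, mul_neg_one, neg_smul, smul_neg, neg_neg]

theorem Strand.N_symm (α α' : D.Strand F) : α'.N α = α.N α' := by
  rw [N, N, Qt_symm, h_symm, h_c_left_symm, neg_sq]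

theorem Strand.N_c_left (α α' : D.Strand F) : α.c.N α' = α.N α' := by
  rw [N, N, c_c]
  change D.Qt α.1.c α'.1 (-α.2) α'.2 - _ - _ = _
  rw [Qt_c]
  ring

theorem Strand.N_c_right (α α' : D.Strand F) : α.N α'.c = α.N α' := by
  rw [← N_symm, N_c_left, N_symm]

end Strand

section Config

variable {n : ℕ}

variable (D β) in
/-- A configuration of labelled strands. -/
@[ext]
structure Config where
  /-- the labels -/
  w : Equiv.Perm (Fin (ht β))
  /-- the colours -/
  ν : D.Seq β
  /-- the signs -/
  ε : Fin (ht β) → ZMod 2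

namespace Config

variable (ω : D.Config β)

/-- The effect of `c_p`. -/
def c (p : Fin (ht β)) : D.Config β := ⟨ω.w, ω.ν.c p, ω.ε + Pi.single p 1⟩

/-- The effect of the exchange of two neighbours. -/
def sw (a : Adj (ht β)) : D.Config β := ⟨ω.w * a.s, ω.ν.s a, ω.ε ∘ a.s⟩

theorem c_w (p : Fin (ht β)) : (ω.c p).w = ω.w := rfl

theorem c_ν (p : Fin (ht β)) : (ω.c p).ν = ω.ν.c p := rfl

theorem c_ε (p q : Fin (ht β)) : (ω.c p).ε q = ω.ε q + (Pi.single p 1 : Fin (ht β) → ZMod 2) q := rfl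

theorem sw_w (a : Adj (ht β)) (p : Fin (ht β)) : (ω.sw a).w p = ω.w (a.s p) := rfl

theorem sw_ν (a : Adj (ht β)) : (ω.sw a).ν = ω.ν.s a := rfl

theorem sw_ε (a : Adj (ht β)) (p : Fin (ht β)) : (ω.sw a).ε p = ω.ε (a.s p) := rfl

theorem zmod_add_self (x : ZMod 2) : x + x = 0 := by revert x; decide

theorem c_c (p : Fin (ht β)) : (ω.c p).c p = ω := by
  refine Config.ext rfl (Seq.c_c p ω.ν) ?_
  funext q
  rw [c_ε, c_ε, add_assoc, zmod_add_self, add_zero]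

theorem _root_.QuiverHeckeClifford.Datum.Seq.c_comm (p q : Fin (ht β)) (ν : D.Seq β) :
    (ν.c p).c q = (ν.c q).c p := by
  by_cases h : p = q
  · subst h; rfl
  apply Subtype.ext
  funext r
  by_cases h1 : r = p
  · subst h1; rw [Seq.c_same, Seq.c_ne h, Seq.c_ne h, Seq.c_same]
  · by_cases h2 : r = q
    · subst h2; rw [Seq.c_same, Seq.c_ne h1, Seq.c_ne h1, Seq.c_same]
    · rw [Seq.c_ne h2, Seq.c_ne h1, Seq.c_ne h1, Seq.c_ne h2]

theorem c_comm (p q : Fin (ht β)) : (ω.c p).c q = (ω.c q).c p :=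
  Config.ext rfl (Seq.c_comm p q ω.ν) (add_right_comm _ _ _)

theorem sw_sw (a : Adj (ht β)) : (ω.sw a).sw a = ω := by
  refine Config.ext ?_ (Seq.s_s a ω.ν) ?_
  · refine Equiv.ext fun p => ?_
    rw [sw_w, sw_w, a.s_s]
  · funext q
    rw [sw_ε, sw_ε, a.s_s]

theorem _root_.QuiverHeckeClifford.Datum.Seq.c_s (a : Adj (ht β)) (p : Fin (ht β)) (ν : D.Seq β) :
    (ν.s a).c p = (ν.c (a.s p)).s a := by
  apply Subtype.ext
  funext r
  rw [Seq.s_apply]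
  by_cases h : r = p
  · subst h; rw [Seq.c_same, Seq.c_same, Seq.s_apply]
  · rw [Seq.c_ne h, Seq.c_ne (fun h' => h (a.s.injective h')), Seq.s_apply]

theorem sw_c (a : Adj (ht β)) (p : Fin (ht β)) : (ω.sw a).c p = (ω.c (a.s p)).sw a := by
  refine Config.ext rfl (Seq.c_s a p ω.ν) ?_
  funext q
  rw [c_ε, sw_ε, sw_ε, c_ε, Pi.single_apply, Pi.single_apply]
  congr 1
  exact if_congr (a.s.injective.eq_iff.symm) rfl rfl

variable (k β) in
/-- The field of rational functions. -/
def Fr : Type _ := FractionRing (MvPolynomial (Fin (ht β)) k)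

instance : Field (Fr k β) := inferInstanceAs (Field (FractionRing (MvPolynomial (Fin (ht β)) k)))

instance : Algebra k (Fr k β) :=
  inferInstanceAs (Algebra k (FractionRing (MvPolynomial (Fin (ht β)) k)))

variable (k β) in
/-- The embedding of the polynomials in the rational functions. -/
def toFr : MvPolynomial (Fin (ht β)) k →ₐ[k] Fr k β :=
  IsScalarTower.toAlgHom k (MvPolynomial (Fin (ht β)) k)
    (FractionRing (MvPolynomial (Fin (ht β)) k))

theorem toFr_injective : Function.Injective (toFr k β) :=
  IsFractionRing.injective (MvPolynomial (Fin (ht β)) k)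
    (FractionRing (MvPolynomial (Fin (ht β)) k))

/-- The variable of the strand with a given label. -/
def y (p : Fin (ht β)) : Fr k β := toFr k β (MvPolynomial.X p)

/-- The value of the variable at a position. -/
def x (p : Fin (ht β)) : Fr k β := sgn _ (ω.ε p) * y (ω.w p)

/-- The strand at a position. -/
def st (p : Fin (ht β)) : D.Strand (Fr k β) := (ω.ν.1 p, ω.x p)

theorem sgn_add_one (R : Type*) [Ring R] (e : ZMod 2) : sgn R (e + 1) = -sgn R e := by
  rw [sgn_add, sgn_one, mul_neg_one]

theorem st_c_same (p : Fin (ht β)) : (ω.c p).st p = (ω.st p).c := by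
  refine Prod.ext (Seq.c_same p ω.ν) ?_
  simp only [st, x, c_w, c_ε, Pi.single_eq_same, sgn_add_one, Strand.c, neg_mul]

theorem st_c_ne {p q : Fin (ht β)} (h : q ≠ p) : (ω.c p).st q = ω.st q := by
  refine Prod.ext (Seq.c_ne h ω.ν) ?_
  simp only [st, x, c_w, c_ε, Pi.single_eq_of_ne h, add_zero]

theorem st_sw (a : Adj (ht β)) (p : Fin (ht β)) : (ω.sw a).st p = ω.st (a.s p) := rfl

theorem y_ne {p q : Fin (ht β)} (h : p ≠ q) : (y p : Fr k β) ≠ y q := fun e =>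
  h (MvPolynomial.X_injective (toFr_injective e))

theorem y_ne_neg {p q : Fin (ht β)} (h : p ≠ q) : (y p : Fr k β) ≠ -y q := fun e => by
  rw [y, y, ← map_neg] at e
  have := toFr_injective e
  have h1 := congrArg (MvPolynomial.coeff (Finsupp.single p 1)) this
  simp [MvPolynomial.coeff_X, Finsupp.single_left_inj, h.symm] at h1

theorem x_ne {p q : Fin (ht β)} (h : p ≠ q) : ω.x p ≠ ω.x q := by
  have h2 : ∀ e : ZMod 2, e = 0 ∨ e = 1 := by decide
  have h' : ω.w p ≠ ω.w q := fun e => h (ω.w.injective e)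
  unfold x
  rcases h2 (ω.ε p) with e | e <;> rcases h2 (ω.ε q) with e' | e' <;>
    rw [e, e'] <;> simp only [sgn_zero, sgn_one, one_mul, neg_mul, ne_eq, neg_inj]
  · exact y_ne h'
  · exact y_ne_neg h'
  · rw [neg_eq_iff_eq_neg]; exact y_ne_neg h'
  · exact y_ne h'

theorem x_ne_neg {p q : Fin (ht β)} (h : p ≠ q) : ω.x p ≠ -ω.x q := by
  have := x_ne (ω.c q) h
  have e1 := congrArg Prod.snd (ω.st_c_ne h)
  have e2 := congrArg Prod.snd (ω.st_c_same q)
  change (ω.c q).x p = ω.x p at e1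
  change (ω.c q).x q = -ω.x q at e2
  rwa [e1, e2] at this

/-- The sign of `c_p`. -/
def κ (p : Fin (ht β)) : Fr k β :=
  ∏ q : Fin (ht β), if ω.w q < ω.w p then sgn _ (ω.ε q) else 1

theorem κ_sw (a : Adj (ht β)) (p : Fin (ht β)) : (ω.sw a).κ p = ω.κ (a.s p) := by
  unfold κ
  rw [← Equiv.prod_comp a.s]
  simp only [sw_w, sw_ε, a.s_s]

theorem κ_mul_self (p : Fin (ht β)) : ω.κ p * ω.κ p = 1 := by
  rw [κ, ← Finset.prod_mul_distrib]
  refine Finset.prod_eq_one fun q _ => ?_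
  split_ifs
  · exact sgn_mul_self _ _
  · exact one_mul 1

theorem κ_c (p q : Fin (ht β)) : (ω.c q).κ p = if ω.w q < ω.w p then -ω.κ p else ω.κ p := by
  have key : ∀ r, (if (ω.c q).w r < (ω.c q).w p then sgn (Fr k β) ((ω.c q).ε r) else 1) =
      (if ω.w r < ω.w p then sgn (Fr k β) (ω.ε r) else 1) *
        (if r = q then (if ω.w q < ω.w p then -1 else 1) else 1) := by
    intro r
    by_cases h : r = q
    · subst h
      simp only [c_w, c_ε, Pi.single_eq_same, sgn_add_one, if_true]
      split_ifs <;> simp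
    · simp [c_w, c_ε, h]
  rw [κ]
  simp only [key, Finset.prod_mul_distrib, Finset.prod_ite_eq', Finset.mem_univ, if_true]
  rw [← κ]
  split_ifs <;> simp

theorem κ_c_same (p : Fin (ht β)) : (ω.c p).κ p = ω.κ p := by rw [κ_c, if_neg (lt_irrefl _)]

/-- The weight of the intertwiner. -/
def g (a : Adj (ht β)) : Fr k β :=
  if ω.w a.hi < ω.w a.lo then 1 else (ω.st a.lo).N (ω.st a.hi)

theorem N_c (p : Fin (ht β)) (q r : Fin (ht β)) :
    ((ω.c p).st q).N ((ω.c p).st r) = (ω.st q).N (ω.st r) := by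
  by_cases h : q = p
  · subst h
    rw [st_c_same, Strand.N_c_left]
    by_cases h' : r = q
    · subst h'; rw [st_c_same, Strand.N_c_right]
    · rw [st_c_ne _ h']
  · rw [st_c_ne _ h]
    by_cases h' : r = p
    · subst h'; rw [st_c_same, Strand.N_c_right]
    · rw [st_c_ne _ h']

theorem g_c (a : Adj (ht β)) (p : Fin (ht β)) : (ω.c p).g a = ω.g a := by
  unfold g
  rw [N_c]; rfl

theorem g_mul_g (a : Adj (ht β)) : ω.g a * (ω.sw a).g a = (ω.st a.lo).N (ω.st a.hi) := by
  unfold g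
  rw [st_sw, st_sw, a.s_lo, a.s_hi]
  change _ * (if ω.w (a.s a.hi) < ω.w (a.s a.lo) then _ else _) = _
  rw [a.s_lo, a.s_hi]
  by_cases h : ω.w a.hi < ω.w a.lo
  · rw [if_pos h, if_neg h.not_gt, Strand.N_symm, one_mul]
  · have h' : ω.w a.lo < ω.w a.hi := lt_of_le_of_ne (not_lt.1 h) fun e =>
      a.lo_ne_hi (ω.w.injective e)
    rw [if_neg h, if_pos h', mul_one]

end Config

end Config

end Datum

end

end QuiverHeckeClifford

namespace QuiverHeckeClifford

set_option linter.unusedSectionVars false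

noncomputable section

namespace Datum

variable {k I : Type*} [Field k] [DecidableEq I] {D : Datum k I} {β : I →₀ ℕ}

open Strand Config

/-! ### The action on functions of configurations -/

variable (D β) in
/-- The functions on configurations. -/
abbrev Fun : Type _ := D.Config β → Fr k β

variable (D β) in
/-- The functions on configurations as a vector space. -/
def FunM : Type _ := D.Fun β

instance : AddCommGroup (D.FunM β) := inferInstanceAs (AddCommGroup (D.Fun β))

instance : Module k (D.FunM β) := inferInstanceAs (Module k (D.Fun β))

theorem end_ext {a b : Module.End k (D.FunM β)} (h : ∀ (f : D.FunM β) (ω : D.Config β), a f ω = b f ω) :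
    a = b := LinearMap.ext fun f => funext fun ω => h f ω

theorem neg_app (f : D.FunM β) (ω : D.Config β) : (-f) ω = -f ω := rfl

theorem add_app (f f' : D.FunM β) (ω : D.Config β) : (f + f') ω = f ω + f' ω := rfl

/-- The multiplication by a function. -/
def dg : D.Fun β →ₐ[k] Module.End k (D.FunM β) where
  toFun d :=
    { toFun := fun f ω => d ω * f ω
      map_add' := fun _ _ => funext fun _ => mul_add _ _ _
      map_smul' := fun r f => funext fun ω => mul_smul_comm r (d ω) (f ω) }
  map_one' := end_ext fun _ _ => one_mul _
  map_mul' _ _ := end_ext fun _ _ => mul_assoc _ _ _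
  map_zero' := end_ext fun _ _ => zero_mul _
  map_add' _ _ := end_ext fun _ _ => add_mul _ _ _
  commutes' r := end_ext fun f ω => (Algebra.smul_def r (f ω)).symm

theorem dg_apply (d : D.Fun β) (f : D.FunM β) (ω : D.Config β) : dg d f ω = d ω * f ω := rfl

/-- The action of `c_p`. -/
def opC (p : Fin (ht β)) : Module.End k (D.FunM β) where
  toFun f ω := ω.κ p * f (ω.c p)
  map_add' f f' := funext fun ω => mul_add _ _ _
  map_smul' r f := funext fun ω => mul_smul_comm r (ω.κ p) (f (ω.c p))

theorem opC_apply (p : Fin (ht β)) (f : D.FunM β) (ω : D.Config β) :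
    opC p f ω = ω.κ p * f (ω.c p) := rfl

/-- The intertwiner. -/
def opP (a : Adj (ht β)) : Module.End k (D.FunM β) where
  toFun f ω := ω.g a * f (ω.sw a)
  map_add' f f' := funext fun ω => mul_add _ _ _
  map_smul' r f := funext fun ω => mul_smul_comm r (ω.g a) (f (ω.sw a))

theorem opP_apply (a : Adj (ht β)) (f : D.FunM β) (ω : D.Config β) :
    opP a f ω = ω.g a * f (ω.sw a) := rfl

/-- The product of `c_p` and `c_q`. -/
def opT (p q : Fin (ht β)) : Module.End k (D.FunM β) := opC p * opC q

theorem opC_dg (p : Fin (ht β)) (d : D.Fun β) : opC p * dg d = dg (fun ω => d (ω.c p)) * opC p := by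
  refine end_ext fun f ω => ?_
  simp only [Module.End.mul_apply, opC_apply, dg_apply]
  ring

theorem opP_dg (a : Adj (ht β)) (d : D.Fun β) : opP a * dg d = dg (fun ω => d (ω.sw a)) * opP a := by
  refine end_ext fun f ω => ?_
  simp only [Module.End.mul_apply, opP_apply, dg_apply]
  ring

theorem opC_sq (p : Fin (ht β)) : (opC p * opC p : Module.End k (D.FunM β)) = 1 := by
  refine end_ext fun f ω => ?_
  simp only [Module.End.mul_apply, opC_apply, κ_c_same, Config.c_c, ← mul_assoc, κ_mul_self, one_mul,
    Module.End.one_apply]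

theorem opC_opC {p q : Fin (ht β)} (h : p ≠ q) :
    (opC p * opC q : Module.End k (D.FunM β)) = -(opC q * opC p) := by
  refine end_ext fun f ω => ?_
  simp only [Module.End.mul_apply, opC_apply, LinearMap.neg_apply, neg_app, κ_c,
    c_comm ω p q]
  rcases lt_or_gt_of_ne (fun e => h (ω.w.injective e)) with h | h
  · rw [if_neg h.not_gt, if_pos h]; ring
  · rw [if_neg h.not_gt, if_pos h]; ring

theorem opP_opC (a : Adj (ht β)) (p : Fin (ht β)) :
    (opP a * opC p : Module.End k (D.FunM β)) = opC (a.s p) * opP a := by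
  refine end_ext fun f ω => ?_
  simp only [Module.End.mul_apply, opC_apply, opP_apply, κ_sw, sw_c, g_c]
  ring

theorem opP_sq (a : Adj (ht β)) :
    (opP a * opP a : Module.End k (D.FunM β)) = dg fun ω => (ω.st a.lo).N (ω.st a.hi) := by
  refine end_ext fun f ω => ?_
  simp only [Module.End.mul_apply, opP_apply, dg_apply, sw_sw, ← mul_assoc, g_mul_g]

/-- The factor of the intertwiners at a pair of positions. -/
def Config.G (ω : D.Config β) (p q : Fin (ht β)) : Fr k β :=
  if ω.w q < ω.w p then 1 else (ω.st p).N (ω.st q)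

theorem Config.G_sw (ω : D.Config β) (a : Adj (ht β)) (p q : Fin (ht β)) :
    (ω.sw a).G p q = ω.G (a.s p) (a.s q) := rfl

theorem Config.g_eq (ω : D.Config β) (a : Adj (ht β)) : ω.g a = ω.G a.lo a.hi := rfl

theorem Config.ext_perm {ω ω' : D.Config β} (π : Equiv.Perm (Fin (ht β))) {ω₀ : D.Config β}
    (h : ω.w = ω₀.w * π) (hν : ω.ν.1 = ω₀.ν.1 ∘ π) (hε : ω.ε = ω₀.ε ∘ π)
    (h' : ω'.w = ω₀.w * π) (hν' : ω'.ν.1 = ω₀.ν.1 ∘ π) (hε' : ω'.ε = ω₀.ε ∘ π) : ω = ω' :=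
  Config.ext (h.trans h'.symm) (Subtype.ext (hν.trans hν'.symm)) (hε.trans hε'.symm)

theorem opP_comm (a b : Adj (ht β)) (h : a.1 + 1 < b.1) :
    (opP a * opP b : Module.End k (D.FunM β)) = opP b * opP a := by
  obtain ⟨⟨h1, h2⟩, h3, h4⟩ := Adj.s_far h
  have e : ∀ ω : D.Config β, (ω.sw a).sw b = (ω.sw b).sw a := fun ω =>
    Config.ext_perm (a.s * b.s) (ω₀ := ω) (mul_assoc _ _ _) rfl rfl
      ((mul_assoc _ _ _).trans (by rw [Adj.s_comm_far a b h])) (by rw [Adj.s_comm_far a b h]; rfl)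
      (by rw [Adj.s_comm_far a b h]; rfl)
  refine end_ext fun f ω => ?_
  simp only [Module.End.mul_apply, opP_apply, g_eq, G_sw, h1, h2, h3, h4, e]
  ring

theorem opP_braid (a b : Adj (ht β)) (h : b.1 = a.1 + 1) :
    (opP b * opP a * opP b : Module.End k (D.FunM β)) = opP a * opP b * opP a := by
  obtain ⟨h1, h2, h3⟩ := Adj.s_adj h
  have e : ∀ ω : D.Config β, ((ω.sw a).sw b).sw a = ((ω.sw b).sw a).sw b := fun ω =>
    Config.ext_perm (a.s * b.s * a.s) (ω₀ := ω) rfl rfl rfl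
      (by rw [Adj.s_braid a b h]; rfl) (by rw [Adj.s_braid a b h]; rfl)
      (by rw [Adj.s_braid a b h]; rfl)
  have h4 : b.s a.hi = b.hi := by rw [← h1, b.s_lo]
  refine end_ext fun f ω => ?_
  simp only [Module.End.mul_apply, opP_apply, g_eq, G_sw, h1, h2, h3, h4, e, a.s_lo, a.s_hi,
    b.s_hi]
  ring

/-- The first coefficient of the correction of the intertwiner. -/
def hh (p q : Fin (ht β)) : D.Fun β := fun ω => (ω.st p).h (ω.st q)

/-- The second coefficient of the correction of the intertwiner. -/
def hc (p q : Fin (ht β)) : D.Fun β := fun ω => (ω.st p).c.h (ω.st q)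

/-- The correction of the intertwiner. -/
def opU (p q : Fin (ht β)) : Module.End k (D.FunM β) := dg (hh p q) + dg (hc p q) * opT p q

/-- The function obtained by the substitution of `c_p`. -/
def tw (p : Fin (ht β)) (d : D.Fun β) : D.Fun β := fun ω => d (ω.c p)

section Twist

variable {p q r : Fin (ht β)}

theorem tw_hh_left (h : p ≠ q) : tw p (hh p q : D.Fun β) = hc p q := by
  funext ω
  simp only [tw, hh, hc, st_c_same, st_c_ne _ h.symm]

theorem tw_hh_right (h : p ≠ q) : tw q (hh p q : D.Fun β) = -hc p q := by
  funext ω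
  simp only [tw, hh, hc, st_c_same, st_c_ne _ h, h_c_right, Pi.neg_apply]

theorem tw_hh_ne (h : r ≠ p) (h' : r ≠ q) : tw r (hh p q : D.Fun β) = hh p q := by
  funext ω
  simp only [tw, hh, st_c_ne _ h.symm, st_c_ne _ h'.symm]

theorem tw_hc_left (h : p ≠ q) : tw p (hc p q : D.Fun β) = hh p q := by
  funext ω
  simp only [tw, hh, hc, st_c_same, st_c_ne _ h.symm, Strand.c_c]

theorem tw_hc_right (h : p ≠ q) : tw q (hc p q : D.Fun β) = -hh p q := by
  funext ω
  simp only [tw, hh, hc, st_c_same, st_c_ne _ h, h_c_c, Pi.neg_apply]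

theorem tw_hc_ne (h : r ≠ p) (h' : r ≠ q) : tw r (hc p q : D.Fun β) = hc p q := by
  funext ω
  simp only [tw, hc, st_c_ne _ h.symm, st_c_ne _ h'.symm]

theorem tw_neg (d : D.Fun β) : tw p (-d) = -tw p d := rfl

theorem opC_dg' (p : Fin (ht β)) (d : D.Fun β) : opC p * dg d = dg (tw p d) * opC p := opC_dg p d

theorem opT_dg (p q : Fin (ht β)) (d : D.Fun β) :
    opT p q * dg d = dg (tw p (tw q d)) * opT p q := by
  rw [opT, mul_assoc, opC_dg', ← mul_assoc, opC_dg', mul_assoc]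

theorem opT_swap (h : p ≠ q) : (opT q p : Module.End k (D.FunM β)) = -opT p q := by
  rw [opT, opT, opC_opC h.symm]

theorem opT_opT_self (h : p ≠ q) : (opT p q * opT p q : Module.End k (D.FunM β)) = -1 := by
  rw [← neg_eq_iff_eq_neg, ← mul_neg, ← opT_swap h, opT, opT, mul_assoc, ← mul_assoc (opC q),
    opC_sq, one_mul, opC_sq]

theorem opT_opT_mid (p q r : Fin (ht β)) : (opT p q * opT q r : Module.End k (D.FunM β)) = opT p r := by
  rw [opT, opT, mul_assoc, ← mul_assoc (opC q), opC_sq, one_mul, opT]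

theorem dg_T_mul (p q r s : Fin (ht β)) (d d' : D.Fun β) :
    dg d * opT p q * (dg d' * opT r s) = dg (d * tw p (tw q d')) * (opT p q * opT r s) := by
  rw [mul_assoc, ← mul_assoc (opT p q), opT_dg, map_mul]
  simp only [mul_assoc]

theorem dg_mul_T (p q : Fin (ht β)) (d d' : D.Fun β) :
    dg d * opT p q * dg d' = dg (d * tw p (tw q d')) * opT p q := by
  rw [mul_assoc, opT_dg, map_mul, mul_assoc]

theorem opU_swap (h : p ≠ q) : (opU q p : Module.End k (D.FunM β)) = -opU p q := by
  have e1 : (hh q p : D.Fun β) = -hh p q := funext fun ω => h_symm _ _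
  have e2 : (hc q p : D.Fun β) = hc p q := funext fun ω => h_c_left_symm _ _
  rw [opU, opU, e1, e2, opT_swap h, map_neg, mul_neg]
  abel

theorem opU_sq (h : p ≠ q) :
    (opU p q * opU p q : Module.End k (D.FunM β)) = dg (hh p q ^ 2 + hc p q ^ 2) := by
  rw [opU, add_mul, mul_add, mul_add, dg_T_mul, dg_mul_T, opT_opT_self h, tw_hc_right h,
    tw_hh_right h, tw_neg, tw_neg, tw_hc_left h, tw_hh_left h, ← mul_assoc, ← map_mul, ← map_mul]
  simp only [mul_neg, map_neg, neg_neg, mul_one, neg_mul]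
  rw [mul_comm (hc p q) (hh p q), add_assoc, ← add_assoc (_ * _) (-_), add_neg_cancel, zero_add,
    ← map_add, sq, sq]

theorem h_mul_fun (hpq : p ≠ q) (hpr : p ≠ r) (hqr : q ≠ r) :
    (hh p q * hh p r + hh p r * hh q r : D.Fun β) = hh q r * hh p q :=
  funext fun ω => Strand.h_mul _ _ _ (ω.x_ne hpq) (ω.x_ne hpr) (ω.x_ne hqr)

theorem opU_mul (hpq : p ≠ q) (hpr : p ≠ r) (hqr : q ≠ r) :
    (opU p q * opU p r + opU p r * opU q r : Module.End k (D.FunM β)) = opU q r * opU p q := by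
  have r0 := h_mul_fun (D := D) hpq hpr hqr
  have rp := congrArg (tw p) r0
  have rq := congrArg (tw q) r0
  have rr := congrArg (tw r) r0
  have tmul : ∀ (s : Fin (ht β)) (d d' : D.Fun β), tw s (d * d') = tw s d * tw s d' :=
    fun _ _ _ => rfl
  have tadd : ∀ (s : Fin (ht β)) (d d' : D.Fun β), tw s (d + d') = tw s d + tw s d' :=
    fun _ _ _ => rfl
  have t1 : (opT p q * opT p r : Module.End k (D.FunM β)) = -opT q r := by
    rw [opT_swap hpq.symm, neg_mul, opT_opT_mid]
  have t2 : (opT p r * opT q r : Module.End k (D.FunM β)) = -opT p q := by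
    rw [opT_swap hqr.symm, mul_neg, opT_opT_mid]
  have t3 : (opT q r * opT p q : Module.End k (D.FunM β)) = -opT p r := by
    rw [opT_swap hqr.symm, opT_swap hpq.symm, neg_mul_neg, opT_opT_mid, opT_swap hpr]
  simp only [tmul, tadd, tw_hh_left hpq, tw_hh_left hpr, tw_hh_left hqr, tw_hh_right hpq,
    tw_hh_right hpr, tw_hh_right hqr, tw_hh_ne hpq hpr, tw_hh_ne hpq.symm hqr,
    tw_hh_ne hpr.symm hqr.symm] at rp rq rr
  have e0 := congrArg dg r0
  have ep := congrArg (fun d => dg d * opT p q) rp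
  have eq := congrArg (fun d => dg d * opT q r) rq
  have er := congrArg (fun d => dg d * opT p r) rr
  simp only [map_add, map_mul, map_neg, add_mul, neg_mul, mul_neg, neg_neg] at e0 ep eq er
  simp only [opU, add_mul, mul_add, dg_T_mul, dg_mul_T, t1, t2, t3, tw_neg, tw_hh_right hqr,
    tw_hh_ne hpq hpr, tw_hh_ne hpr.symm hqr.symm, tw_hh_ne hpq.symm hqr, tw_hh_left hpq,
    tw_hc_right hpq, tw_hc_left hpq, tw_hc_ne hpq.symm hqr, tw_hc_ne hpr.symm hqr.symm,
    tw_hc_left hpr, tw_hc_right hqr, tw_hh_left hpr, tw_hc_ne hpq hpr, tw_hh_right hpq]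
  simp only [map_mul, map_neg, neg_mul, mul_neg, neg_neg, ← mul_assoc]
  linear_combination (norm := abel) e0 + ep + eq - er

end Twist

theorem opP_opU (a : Adj (ht β)) (p q : Fin (ht β)) :
    (opP a * opU p q : Module.End k (D.FunM β)) = opU (a.s p) (a.s q) * opP a := by
  have e : (opP a * opT p q : Module.End k (D.FunM β)) = opT (a.s p) (a.s q) * opP a := by
    rw [opT, ← mul_assoc, opP_opC, mul_assoc, opP_opC, ← mul_assoc, opT]
  rw [opU, mul_add, opP_dg, ← mul_assoc, opP_dg, mul_assoc, e, ← mul_assoc, ← add_mul]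
  rfl

theorem braid_formal {R : Type*} [Ring R] {p q u v w n m : R} (hpu : p * u = -(u * p))
    (hqv : q * v = -(v * q)) (hpw : p * w = v * p) (hpv : p * v = w * p) (hqw : q * w = u * q)
    (hqu : q * u = w * q) (hpp : p * p = n) (hqq : q * q = m) (hb : q * p * q = p * q * p)
    (h1 : u * w + w * v = v * u) (h2 : v * w + w * u = u * v) (hc : u * u * w = w * (u * u)) :
    (q + v) * (p + u) * (q + v) - (p + u) * (q + v) * (p + u) =
      w * ((m + v * v) - (n + u * u)) := by
  have t2 : q * p * v = u * q * p := by rw [mul_assoc, hpv, ← mul_assoc, hqw]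
  have t3 : q * u * q = w * m := by rw [hqu, mul_assoc, hqq]
  have t4 : q * u * v = -(w * v * q) := by rw [hqu, mul_assoc, hqv, mul_neg, mul_assoc]
  have t6 : v * p * v = v * w * p := by rw [mul_assoc, hpv, mul_assoc]
  have t7 : v * u * q = u * w * q + w * v * q := by rw [← h1, add_mul]
  have t8 : v * u * v = u * w * v + w * v * v := by rw [← h1, add_mul]
  have s2 : p * q * u = v * p * q := by rw [mul_assoc, hqu, ← mul_assoc, hpw]
  have s3 : p * v * p = w * n := by rw [hpv, mul_assoc, hpp]
  have s4 : p * v * u = -(w * u * p) := by rw [hpv, mul_assoc, hpu, mul_neg, mul_assoc]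
  have s6 : u * q * u = u * w * q := by rw [mul_assoc, hqu, mul_assoc]
  have s7 : u * v * p = v * w * p + w * u * p := by rw [← h2, add_mul]
  have s8 : u * v * u = w * u * u + u * w * v := by
    rw [mul_assoc, ← h1, mul_add, ← mul_assoc, hc, ← mul_assoc, ← mul_assoc]
  simp only [add_mul, mul_add, mul_sub, t2, t3, t4, t6, t7, t8, s2, s3, s4, s6, s7, s8, hb]
  rw [← mul_assoc w v v, ← mul_assoc w u u]
  abel

/-- The action of `σ_a`. -/
def opS (a : Adj (ht β)) : Module.End k (D.FunM β) := opP a + opU a.lo a.hi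

/-- The function `Q̃` of two positions. -/
def qt (p q : Fin (ht β)) : D.Fun β := fun ω => D.Qt (ω.ν.1 p) (ω.ν.1 q) (ω.x p) (ω.x q)

theorem opP_sq_add_opU_sq (a : Adj (ht β)) :
    (opP a * opP a + opU a.lo a.hi * opU a.lo a.hi : Module.End k (D.FunM β)) =
      dg (qt a.lo a.hi) := by
  rw [opP_sq, opU_sq a.lo_ne_hi, ← map_add]
  congr 1
  funext ω
  simp only [Pi.add_apply, Pi.pow_apply, Strand.N, hh, hc, qt]
  rw [sub_sub, sub_add_cancel]
  rfl

theorem opP_opU_self (a : Adj (ht β)) :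
    (opP a * opU a.lo a.hi : Module.End k (D.FunM β)) = -(opU a.lo a.hi * opP a) := by
  rw [opP_opU, a.s_lo, a.s_hi, opU_swap a.lo_ne_hi, neg_mul]

theorem opS_sq (a : Adj (ht β)) :
    (opS a * opS a : Module.End k (D.FunM β)) = dg (qt a.lo a.hi) := by
  rw [opS, add_mul, mul_add, mul_add, opP_opU_self, ← opP_sq_add_opU_sq]
  abel

theorem dg_comm (d d' : D.Fun β) : dg d * dg d' = dg d' * dg d := by
  rw [← map_mul, mul_comm, map_mul]

theorem tw_sq {p q : Fin (ht β)} (h : p ≠ q) (r : Fin (ht β)) :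
    tw r (hh p q ^ 2 + hc p q ^ 2 : D.Fun β) = hh p q ^ 2 + hc p q ^ 2 := by
  have e : tw r (hh p q ^ 2 + hc p q ^ 2 : D.Fun β) = tw r (hh p q) ^ 2 + tw r (hc p q) ^ 2 := rfl
  rw [e]
  by_cases h1 : r = p
  · subst h1; rw [tw_hh_left h, tw_hc_left h, add_comm]
  · by_cases h2 : r = q
    · subst h2; rw [tw_hh_right h, tw_hc_right h, neg_sq, neg_sq, add_comm]
    · rw [tw_hh_ne h1 h2, tw_hc_ne h1 h2]

theorem opS_braid (a b : Adj (ht β)) (h : b.1 = a.1 + 1) :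
    (opS b * opS a * opS b - opS a * opS b * opS a : Module.End k (D.FunM β)) =
      opU a.lo b.hi * dg (qt a.hi b.hi - qt a.lo a.hi) := by
  obtain ⟨h1, h2, h3⟩ := Adj.s_adj h
  have h4 : b.s a.hi = b.hi := by rw [← h1, b.s_lo]
  have h5 : b.s b.hi = a.hi := by rw [b.s_hi, h1]
  have n1 := a.lo_ne_hi
  have n2 : a.hi ≠ b.hi := h1 ▸ b.lo_ne_hi
  have n3 : a.lo ≠ b.hi := by simp [Adj.lo, Adj.hi, h]; omega
  have q1 := opP_sq_add_opU_sq (D := D) a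
  have q2 := opP_sq_add_opU_sq (D := D) b
  rw [h1] at q2
  rw [map_sub, ← q1, ← q2, opS, opS, h1]
  refine braid_formal (opP_opU_self a) ?_ ?_ ?_ ?_ ?_ rfl rfl (opP_braid a b h)
    (opU_mul n1 n3 n2) ?_ ?_
  · rw [opP_opU, h4, h5, opU_swap n2, neg_mul]
  · rw [opP_opU, a.s_lo, h2]
  · rw [opP_opU, a.s_hi, h2]
  · rw [opP_opU, h3, h5]
  · rw [opP_opU, h3, h4]
  · have := opU_mul (D := D) n2.symm n3.symm n1.symm
    rwa [opU_swap n2, opU_swap n3, opU_swap n1, neg_mul_neg, neg_mul_neg, neg_mul_neg] at this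
  · rw [opU_sq n1]
    conv_lhs => rw [opU]
    rw [mul_add, ← mul_assoc, dg_comm, dg_comm _ (hc a.lo b.hi), opU, add_mul, mul_assoc, mul_assoc,
      opT_dg, tw_sq n1, tw_sq n1]

theorem opU_opC (a : Adj (ht β)) (p : Fin (ht β)) :
    (opU a.lo a.hi * opC p : Module.End k (D.FunM β)) = opC (a.s p) * opU a.lo a.hi := by
  have n := a.lo_ne_hi
  rw [opU, mul_add, opC_dg', ← mul_assoc, opC_dg', add_mul, opT]
  by_cases h1 : p = a.lo
  · subst h1
    rw [a.s_lo, tw_hh_right n, tw_hc_right n, mul_assoc, mul_assoc, opC_opC n.symm,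
      mul_neg, ← mul_assoc (opC a.lo), opC_sq, one_mul, mul_assoc]
    have : (opC a.hi * (opC a.lo * opC a.hi) : Module.End k (D.FunM β)) = -opC a.lo := by
      rw [opC_opC n, mul_neg, ← mul_assoc, opC_sq, one_mul]
    rw [this, map_neg, map_neg]
    simp only [mul_neg, neg_mul, neg_neg]
    abel
  · by_cases h2 : p = a.hi
    · subst h2
      rw [a.s_hi, tw_hh_left n, tw_hc_left n, mul_assoc, mul_assoc, opC_sq, mul_one,
        mul_assoc, ← mul_assoc (opC a.lo), opC_sq, one_mul]
      abel
    · rw [a.s_of_ne h1 h2, tw_hh_ne h1 h2, tw_hc_ne h1 h2, mul_assoc, mul_assoc,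
        opC_opC (Ne.symm h2), mul_neg, ← mul_assoc (opC a.lo), opC_opC (Ne.symm h1), neg_mul, neg_neg,
        mul_assoc, mul_assoc]

theorem opS_opC (a : Adj (ht β)) (p : Fin (ht β)) :
    (opS a * opC p : Module.End k (D.FunM β)) = opC (a.s p) * opS a := by
  rw [opS, add_mul, opP_opC, opU_opC, mul_add]

theorem opT_opT_far {p q r s : Fin (ht β)} (h1 : p ≠ r) (h2 : p ≠ s) (h3 : q ≠ r) (h4 : q ≠ s) :
    (opT p q * opT r s : Module.End k (D.FunM β)) = opT r s * opT p q := by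
  have c : ∀ x : Fin (ht β), x ≠ r → x ≠ s →
      (opC x * opT r s : Module.End k (D.FunM β)) = opT r s * opC x := fun x h h' => by
    rw [opT, ← mul_assoc, opC_opC h, neg_mul, mul_assoc, opC_opC h', mul_neg, neg_neg, mul_assoc]
  have e : (opT p q : Module.End k (D.FunM β)) = opC p * opC q := rfl
  rw [e, mul_assoc, c q h3 h4, ← mul_assoc, c p h1 h2, mul_assoc]

theorem opU_opU_far {p q r s : Fin (ht β)} (h1 : p ≠ r) (h2 : p ≠ s) (h3 : q ≠ r) (h4 : q ≠ s) :
    (opU p q * opU r s : Module.End k (D.FunM β)) = opU r s * opU p q := by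
  simp only [opU, add_mul, mul_add, dg_T_mul, dg_mul_T]
  simp only [← mul_assoc, ← map_mul]
  rw [tw_hh_ne h3 h4, tw_hh_ne h1 h2, tw_hc_ne h3 h4, tw_hc_ne h1 h2, tw_hh_ne h2.symm h4.symm,
    tw_hh_ne h1.symm h3.symm, tw_hc_ne h2.symm h4.symm, tw_hc_ne h1.symm h3.symm,
    mul_assoc _ (opT p q), opT_opT_far h1 h2 h3 h4, ← mul_assoc, mul_comm (hh r s), mul_comm (hc r s), mul_comm (hh r s),
    mul_comm (hc r s)]
  abel

theorem opS_comm (a b : Adj (ht β)) (h : a.1 + 1 < b.1) :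
    (opS a * opS b : Module.End k (D.FunM β)) = opS b * opS a := by
  obtain ⟨⟨h1, h2⟩, h3, h4⟩ := Adj.s_far h
  have e := opP_opU (D := D) a b.lo b.hi
  have e' := opP_opU (D := D) b a.lo a.hi
  rw [h1, h2] at e
  rw [h3, h4] at e'
  rw [opS, opS, add_mul, mul_add, mul_add, add_mul, mul_add, mul_add, opP_comm a b h, e, e',
    opU_opU_far (by simp [Adj.lo]; omega) (by simp [Adj.lo, Adj.hi]; omega)
      (by simp [Adj.lo, Adj.hi]; omega) (by simp [Adj.hi]; omega)]
  abel

/-- The indicator function of a sequence of colours. -/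
def ind (ν : D.Seq β) : D.Fun β := fun ω => if ω.ν = ν then 1 else 0

/-- The variable at a position. -/
def xx (p : Fin (ht β)) : D.Fun β := fun ω => ω.x p

theorem mul_ind (d : D.Fun β) (ν : D.Seq β) :
    d * ind ν = fun ω => if ω.ν = ν then d ω else 0 := by
  funext ω
  simp [ind]

theorem map_Qt_fun (i j : D.J) (u v : D.Fun β) (ω : D.Config β) :
    D.Qt i j u v ω = D.Qt i j (u ω) (v ω) := map_Qt (Pi.evalAlgHom k _ ω) i j u v

theorem map_divQt_fun (i j : D.J) (u' u v : D.Fun β) (ω : D.Config β) :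
    D.divQt i j u' u v ω = D.divQt i j (u' ω) (u ω) (v ω) := map_divQt (Pi.evalAlgHom k _ ω) i j u' u v

theorem opC_ind (p : Fin (ht β)) (ν : D.Seq β) :
    (opC p * dg (ind ν) : Module.End k (D.FunM β)) = dg (ind (ν.c p)) * opC p := by
  rw [opC_dg]
  congr 2
  funext ω
  refine if_congr ?_ rfl rfl
  rw [c_ν]
  exact ⟨fun h => by rw [← h, Seq.c_c], fun h => by rw [h, Seq.c_c]⟩

theorem opT_ind (p q : Fin (ht β)) (ν : D.Seq β) :
    (opT p q * dg (ind ν) : Module.End k (D.FunM β)) = dg (ind ((ν.c q).c p)) * opT p q := by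
  rw [opT, mul_assoc, opC_ind, ← mul_assoc, opC_ind, mul_assoc]

theorem opP_ind (a : Adj (ht β)) (ν : D.Seq β) :
    (opP a * dg (ind ν) : Module.End k (D.FunM β)) = dg (ind (ν.s a)) * opP a := by
  rw [opP_dg]
  congr 2
  funext ω
  refine if_congr ?_ rfl rfl
  rw [sw_ν]
  exact ⟨fun h => by rw [← h, Seq.s_s], fun h => by rw [h, Seq.s_s]⟩

theorem c_hi_c_lo (a : Adj (ht β)) (ν : D.Seq β) (h : ν.1 a.lo = (ν.1 a.hi).c) :
    (ν.c a.hi).c a.lo = ν.s a := by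
  rw [← Seq.c_c_eq (ν := ν.s a) (μ := ν) a.lo_ne_hi]
  · rw [Seq.s_apply, Seq.s_apply, a.s_lo, a.s_hi, h, J.c_c]
  · rw [Seq.s_apply, a.s_hi]
  · rw [Seq.s_apply, a.s_lo]
  · intro r h1 h2
    rw [Seq.s_apply, a.s_of_ne h1 h2]

theorem opU_ind (a : Adj (ht β)) (ν : D.Seq β) :
    (opU a.lo a.hi * dg (ind ν) : Module.End k (D.FunM β)) =
      dg (ind (ν.s a)) * opU a.lo a.hi := by
  have n := a.lo_ne_hi
  rw [opU, add_mul, mul_add, ← map_mul, ← map_mul, mul_assoc, opT_ind, ← mul_assoc, ← mul_assoc,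
    ← map_mul, ← map_mul]
  congr 2
  · rw [mul_ind, mul_comm, mul_ind]
    funext ω
    by_cases h : ω.ν.1 a.lo = ω.ν.1 a.hi
    · refine if_congr ?_ rfl rfl
      have := Seq.s_eq h
      exact ⟨fun e => by rw [← e, this], fun e => by rw [← this, e, Seq.s_s]⟩
    · have : hh a.lo a.hi ω = 0 := if_neg h
      rw [this, ite_self, ite_self]
  · congr 1
    rw [mul_ind, mul_comm, mul_ind]
    funext ω
    by_cases h : (ω.ν.1 a.lo).c = ω.ν.1 a.hi
    · refine if_congr ?_ rfl rfl
      have h' : ω.ν.1 a.lo = (ω.ν.1 a.hi).c := J.c_eq_iff.1 h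
      have := c_hi_c_lo a _ h'
      have cc : ∀ μ : D.Seq β, (((μ.c a.hi).c a.lo).c a.hi).c a.lo = μ := fun μ => by
        rw [Seq.c_comm a.hi a.lo μ, Seq.c_c, Seq.c_c]
      exact ⟨fun e => by rw [← Seq.s_s a ω.ν, ← this, e, cc],
        fun e => by rw [← cc ω.ν, this, e, Seq.s_s]⟩
    · have : hc a.lo a.hi ω = 0 := if_neg h
      rw [this, ite_self, ite_self]

theorem dg_mul_ind {d d' : D.Fun β} {ν : D.Seq β} (h : ∀ ω : D.Config β, ω.ν = ν → d ω = d' ω) :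
    dg d * dg (ind ν) = dg d' * dg (ind ν) := by
  rw [← map_mul, ← map_mul, mul_ind, mul_ind]
  congr 1
  funext ω
  by_cases e : ω.ν = ν
  · rw [if_pos e, if_pos e, h ω e]
  · rw [if_neg e, if_neg e]

theorem dg_mul_ind_ite {d d' : D.Fun β} {ν : D.Seq β} {P : Prop} [Decidable P]
    (h : ∀ ω : D.Config β, ω.ν = ν → d ω = if P then d' ω else 0) :
    dg d * dg (ind ν) = if P then dg d' * dg (ind ν) else 0 := by
  by_cases hP : P
  · rw [if_pos hP]
    exact dg_mul_ind fun ω e => by rw [h ω e, if_pos hP]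
  · rw [if_neg hP, dg_mul_ind (d' := 0) (fun ω e => by rw [h ω e, if_neg hP]; rfl), map_zero, zero_mul]

theorem tw_xx_same (p : Fin (ht β)) : tw p (xx p : D.Fun β) = -xx p :=
  funext fun ω => congrArg Prod.snd (ω.st_c_same p)

theorem tw_xx_ne {p q : Fin (ht β)} (h : q ≠ p) : tw p (xx q : D.Fun β) = xx q :=
  funext fun ω => congrArg Prod.snd (ω.st_c_ne h)

theorem qt_eq (p q : Fin (ht β)) (ω : D.Config β) :
    qt p q ω = D.Qt (ω.st p).1 (ω.st q).1 (ω.st p).2 (ω.st q).2 := rfl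

theorem tw_qt {p q : Fin (ht β)} (h : p ≠ q) (r : Fin (ht β)) : tw r (qt p q : D.Fun β) = qt p q := by
  funext ω
  simp only [tw, qt_eq]
  by_cases h1 : r = p
  · subst h1
    rw [st_c_same, st_c_ne _ h.symm]
    exact Qt_c _ _ _ _
  · rw [st_c_ne _ (Ne.symm h1)]
    by_cases h2 : r = q
    · subst h2
      rw [st_c_same, Qt_symm, Qt_symm (ω.st p).1]
      exact Qt_c _ _ _ _
    · rw [st_c_ne _ (Ne.symm h2)]

theorem inv_mul_Qt_sub {F : Type*} [Field F] [Algebra k F] (i j : D.J) {u' u : F} (h : u' ≠ u) (v : F) :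
    (u' - u)⁻¹ * (D.Qt i j u' v - D.Qt i j u v) = D.divQt i j u' u v := by
  rw [← D.sub_mul_divQt i j u' u v (Commute.all _ _), inv_mul_cancel_left₀ (sub_ne_zero.2 h)]

theorem opU_mul_qt {p q r : Fin (ht β)} (hpq : p ≠ q) (hqr : q ≠ r) (hpr : p ≠ r) (ν : D.Seq β) :
    (opU p r * dg (qt q r - qt p q) * dg (ind ν) : Module.End k (D.FunM β)) =
      (if ν.1 p = ν.1 r then
        D.divQt (ν.1 p) (ν.1 q) (dg (xx r)) (dg (xx p)) (dg (xx q)) * dg (ind ν) else 0) +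
      (if ν.1 p = (ν.1 r).c then
        D.divQt (ν.1 p) (ν.1 q) (dg (xx r)) (-dg (xx p)) (dg (xx q)) * opC p * opC r * dg (ind ν)
        else 0) := by
  have e1 : tw p (tw r (qt q r - qt p q : D.Fun β)) = qt q r - qt p q := by
    have : tw p (tw r (qt q r - qt p q : D.Fun β)) =
      tw p (tw r (qt q r)) - tw p (tw r (qt p q)) := rfl
    rw [this, tw_qt hqr, tw_qt hqr, tw_qt hpq, tw_qt hpq]
  rw [opU, add_mul, add_mul, dg_mul_T, e1, mul_assoc (dg _) (opT p r), opT_ind, ← mul_assoc,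
    ← map_mul]
  congr 1
  · rw [← map_divQt]
    refine dg_mul_ind_ite fun ω e => ?_
    rw [map_divQt_fun]
    subst e
    simp only [Pi.mul_apply, Pi.sub_apply, hh, Strand.h]
    change (if ω.ν.1 p = ω.ν.1 r then (ω.x r - ω.x p)⁻¹ else 0) *
      (D.Qt (ω.ν.1 q) (ω.ν.1 r) (ω.x q) (ω.x r) - D.Qt (ω.ν.1 p) (ω.ν.1 q) (ω.x p) (ω.x q)) = _
    split_ifs with h
    · rw [← h, Qt_symm (ω.ν.1 q), inv_mul_Qt_sub _ _ (ω.x_ne hpr.symm)]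
      rfl
    · rw [zero_mul]
  · rw [← map_neg, ← map_divQt]
    have e2 : (dg (D.divQt (ν.1 p) (ν.1 q) (xx r) (-xx p) (xx q)) * opC p * opC r * dg (ind ν) :
        Module.End k (D.FunM β)) = dg (D.divQt (ν.1 p) (ν.1 q) (xx r) (-xx p) (xx q)) *
          dg (ind ((ν.c r).c p)) * opT p r := by
      rw [mul_assoc (dg (D.divQt _ _ _ _ _)) (dg (ind _)), ← opT_ind, opT]
      simp only [mul_assoc]
    rw [e2, ← zero_mul (opT p r), ← ite_mul]
    congr 1
    refine dg_mul_ind_ite fun ω e => ?_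
    rw [map_divQt_fun]
    have ep : ω.ν.1 p = (ν.1 p).c := by rw [e, Seq.c_same, Seq.c_ne hpr]
    have er : ω.ν.1 r = (ν.1 r).c := by rw [e, Seq.c_ne hpr.symm, Seq.c_same]
    have eq : ω.ν.1 q = ν.1 q := by rw [e, Seq.c_ne hpq.symm, Seq.c_ne hqr]
    simp only [Pi.mul_apply, Pi.sub_apply, hc, Strand.h]
    change (if (ω.ν.1 p).c = ω.ν.1 r then (ω.x r - -ω.x p)⁻¹ else 0) *
      (D.Qt (ω.ν.1 q) (ω.ν.1 r) (ω.x q) (ω.x r) - D.Qt (ω.ν.1 p) (ω.ν.1 q) (ω.x p) (ω.x q)) = _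
    rw [ep, er, eq, J.c_c]
    split_ifs with h
    · rw [← h, Qt_symm (ν.1 q), ← Qt_c (ν.1 p).c, J.c_c, inv_mul_Qt_sub _ _ (ω.x_ne_neg hpr.symm)]
      rfl
    · rw [zero_mul]

/-- The colour condition of the first error term. -/
def dlt (p q : Fin (ht β)) : D.Fun β := fun ω => if ω.ν.1 p = ω.ν.1 q then 1 else 0

/-- The colour condition of the second error term. -/
def dlt' (p q : Fin (ht β)) : D.Fun β := fun ω => if ω.ν.1 p = (ω.ν.1 q).c then 1 else 0

theorem dlt_ind (p q : Fin (ht β)) (ν : D.Seq β) :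
    dg (dlt p q) * dg (ind ν) = if ν.1 p = ν.1 q then dg (ind ν) else 0 := by
  conv_rhs => rw [← one_mul (dg (ind ν)), ← map_one dg]
  exact dg_mul_ind_ite fun ω e => by rw [dlt, e]; rfl

theorem dlt'_ind {p q : Fin (ht β)} (h : p ≠ q) (ν : D.Seq β) :
    dg (dlt' p q) * opT p q * dg (ind ν) =
      if ν.1 p = (ν.1 q).c then opC p * opC q * dg (ind ν) else 0 := by
  rw [← opT, opT_ind, mul_assoc, opT_ind, ← mul_assoc, ← zero_mul (opT p q), ← ite_mul]
  congr 1
  conv_rhs => rw [← one_mul (dg (ind ((ν.c q).c p))), ← map_one dg]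
  refine dg_mul_ind_ite fun ω e => ?_
  rw [dlt', e, Seq.c_same, Seq.c_ne h, Seq.c_ne h.symm, Seq.c_same]
  exact if_congr J.c_inj rfl rfl

theorem xx_mul_hh {p q : Fin (ht β)} (h : p ≠ q) : (xx q - xx p) * hh p q = (dlt p q : D.Fun β) := by
  funext ω
  simp only [Pi.mul_apply, Pi.sub_apply, hh, Strand.h, dlt, xx]
  change _ * (if ω.ν.1 p = ω.ν.1 q then (ω.x q - ω.x p)⁻¹ else 0) = _
  rw [mul_ite, mul_zero, mul_inv_cancel₀ (sub_ne_zero.2 (ω.x_ne h.symm))]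

theorem xx_mul_hc {p q : Fin (ht β)} (h : p ≠ q) : (xx q + xx p) * hc p q = (dlt' p q : D.Fun β) := by
  funext ω
  simp only [Pi.mul_apply, Pi.add_apply, hc, Strand.h, dlt', xx]
  change _ * (if (ω.ν.1 p).c = ω.ν.1 q then (ω.x q - -ω.x p)⁻¹ else 0) = _
  rw [sub_neg_eq_add, mul_ite, mul_zero, mul_inv_cancel₀]
  · simp only [J.c_eq_iff]
  · rw [← sub_neg_eq_add]
    exact sub_ne_zero.2 (ω.x_ne_neg h.symm)

theorem opU_xx_hi {p q : Fin (ht β)} (h : p ≠ q) :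
    (opU p q * dg (xx q) - dg (xx p) * opU p q : Module.End k (D.FunM β)) =
      dg (dlt p q) - dg (dlt' p q) * opT p q := by
  rw [opU, add_mul, dg_mul_T, tw_xx_same, tw_neg, tw_xx_ne h.symm, mul_add, ← map_mul, ← mul_assoc,
    ← map_mul, ← xx_mul_hh h, ← xx_mul_hc h]
  simp only [map_mul, map_sub, map_add, map_neg, sub_mul, add_mul, mul_neg, neg_mul]
  rw [dg_comm (hh p q) (xx q), dg_comm (hc p q) (xx q)]
  abel

theorem opU_xx_lo {p q : Fin (ht β)} (h : p ≠ q) :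
    (dg (xx q) * opU p q - opU p q * dg (xx p) : Module.End k (D.FunM β)) =
      dg (dlt p q) + dg (dlt' p q) * opT p q := by
  rw [opU, add_mul, dg_mul_T, tw_xx_ne h, tw_xx_same, mul_add, ← map_mul, ← mul_assoc,
    ← map_mul, ← xx_mul_hh h, ← xx_mul_hc h]
  simp only [map_mul, map_sub, map_add, map_neg, sub_mul, add_mul, mul_neg, neg_mul]
  rw [dg_comm (hh p q) (xx p), dg_comm (hc p q) (xx p)]
  abel

theorem opP_xx (a : Adj (ht β)) (p : Fin (ht β)) :
    (opP a * dg (xx p) : Module.End k (D.FunM β)) = dg (xx (a.s p)) * opP a := opP_dg _ _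

variable (D β) in
/-- The operators of the generators. -/
def genOp : Gen D β → Module.End k (D.FunM β)
  | .e ν => dg (ind ν)
  | .x p => dg (xx p)
  | .s a => opS a
  | .c p => opC p

theorem genOp_rel (y z : Module.End k (D.FunM β))
    (h : Rel (fun ν => genOp D β (.e ν)) (fun p => genOp D β (.x p)) (fun a => genOp D β (.s a))
      (fun p => genOp D β (.c p)) y z) : y = z := by
  cases h with
  | e_e μ ν =>
    simp only [genOp]
    rw [← map_mul, mul_ind]
    split_ifs with h
    · subst h
      congr 1
      funext ω
      simp [ind]
    · rw [← map_zero dg]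
      congr 1
      funext ω
      simp only [ind]
      split_ifs with h1 h2
      · exact absurd (h2.symm.trans h1) h
      · rfl
      · rfl
  | e_sum =>
    simp only [genOp]
    rw [← map_sum, ← map_one dg]
    congr 1
    funext ω
    simp [ind, Finset.sum_apply]
  | x_e p ν => exact dg_comm _ _
  | c_e p ν => exact opC_ind p ν
  | x_x p q ν => simp only [genOp]; rw [dg_comm (xx p)]
  | c_c p q =>
    simp only [genOp]
    split_ifs with h
    · rw [h, opC_sq, one_add_one_eq_two]
    · rw [opC_opC h, neg_add_cancel]
  | c_x p q =>
    simp only [genOp]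
    rw [opC_dg']
    split_ifs with h
    · rw [h, tw_xx_same, map_neg, neg_mul, neg_mul, one_mul]
    · rw [tw_xx_ne (Ne.symm h), one_mul]
  | s_e a ν =>
    simp only [genOp]
    rw [opS, add_mul, opP_ind, opU_ind, mul_add]
  | s_c a p => exact opS_opC a p
  | s_x a p ν h h' =>
    simp only [genOp]
    congr 1
    rw [opS, add_mul, mul_add, opP_xx, a.s_of_ne h h', opU, add_mul, mul_add, dg_comm, dg_mul_T,
      tw_xx_ne h', tw_xx_ne h, mul_comm, map_mul, mul_assoc]
  | s_x_hi a ν =>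
    simp only [genOp]
    have : (opS a * dg (xx a.hi) - dg (xx a.lo) * opS a : Module.End k (D.FunM β)) =
        opU a.lo a.hi * dg (xx a.hi) - dg (xx a.lo) * opU a.lo a.hi := by
      rw [opS, add_mul, mul_add, opP_xx, a.s_hi, add_sub_add_left_eq_sub]
    rw [this, opU_xx_hi a.lo_ne_hi, sub_mul, dlt_ind, dlt'_ind a.lo_ne_hi]
  | s_x_lo a ν =>
    simp only [genOp]
    have : (dg (xx a.hi) * opS a - opS a * dg (xx a.lo) : Module.End k (D.FunM β)) =
        dg (xx a.hi) * opU a.lo a.hi - opU a.lo a.hi * dg (xx a.lo) := by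
      rw [opS, add_mul, mul_add, opP_xx, a.s_lo, add_sub_add_left_eq_sub]
    rw [this, opU_xx_lo a.lo_ne_hi, add_mul, dlt_ind, dlt'_ind a.lo_ne_hi]
  | s_s a ν =>
    simp only [genOp]
    rw [opS_sq, ← map_Qt]
    refine dg_mul_ind fun ω e => ?_
    rw [map_Qt_fun, ← e]
    rfl
  | s_comm a b h => exact opS_comm a b h
  | braid a b h ν =>
    simp only [genOp]
    rw [opS_braid a b h, opU_mul_qt a.lo_ne_hi]
    · exact (Adj.s_adj h).1 ▸ b.lo_ne_hi
    · simp [Adj.lo, Adj.hi, h]; omega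

variable (D β) in
/-- The representation on the functions of configurations. -/
def rep : D.RC β →ₐ[k] Module.End k (D.FunM β) := liftRC (genOp D β) genOp_rel

theorem rep_e (ν : D.Seq β) : rep D β (eRC ν) = dg (ind ν) := liftRC_val _ _ _

theorem rep_x (p : Fin (ht β)) : rep D β (xRC p) = dg (xx p) := liftRC_val _ _ _

theorem rep_s (a : Adj (ht β)) : rep D β (sRC a) = opS a := liftRC_val _ _ _

theorem rep_c (p : Fin (ht β)) : rep D β (cRC p) = opC p := liftRC_val _ _ _

end Datum

end

end QuiverHeckeClifford

namespace QuiverHeckeClifford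

set_option linter.unusedSectionVars false

noncomputable section

namespace Datum

variable {k I : Type*} [Field k] [DecidableEq I] {D : Datum k I} {β' β : I →₀ ℕ}

/-! ### Commutation of two blocks -/

section OneBlock

variable {s : ℕ} (hs : s + ht β' ≤ ht β)

/-- The homomorphism of a block as a linear map. -/
def blkMap : D.RC β' →ₗ[k] D.RC β where
  toFun y := (blockHom hs y).1
  map_add' := blockHom_coe_add hs
  map_smul' := blockHom_coe_smul hs

theorem blkMap_mul (y z : D.RC β') : blkMap hs (y * z) = blkMap hs y * blkMap hs z :=
  blockHom_coe_mul hs y z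

theorem blkMap_one : blkMap hs (1 : D.RC β') = D.blockIdem hs := blockHom_coe_one hs

theorem blkMap_mul_idem (y : D.RC β') : blkMap hs y * D.blockIdem hs = blkMap hs y :=
  blockHom_mul_idem hs y

theorem idem_mul_blkMap (y : D.RC β') : D.blockIdem hs * blkMap hs y = blkMap hs y :=
  ((Subsemigroup.mem_corner_iff (blockIdem_idem (D := D) hs)).1 (blockHom hs y).2).1

/-- The element that acts on the block as a given generator. -/
def blkVal (g : Gen D β') : D.RC β := (blockGen hs g).1

theorem blkMap_val (g : Gen D β') : blkMap hs g.val = blkVal hs g * D.blockIdem hs := by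
  change (blockHom hs g.val).1 = _
  rw [blockHom, liftRC_val]
  rfl

theorem idem_mul_blkVal (g : Gen D β') :
    D.blockIdem hs * blkVal hs g = blkVal hs g * D.blockIdem hs :=
  (Subalgebra.mem_centralizer_iff k).1 (blockGen hs g).2 _ rfl

/-- The parity of a generator. -/
def Gen.par : Gen D β → ZMod 2
  | .c _ => 1
  | _ => 0

theorem Gen.deg_snd (g : Gen D β) (ν : D.Seq β) : (g.deg ν).2 = g.par := by cases g <;> rfl

theorem mul_sum_e_comm {z : D.RC β} {f : D.Seq β → D.Seq β} (hz : ∀ μ, z * eRC μ = eRC (f μ) * z)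
    (c : D.Seq β → Prop) [DecidablePred c] (hc : ∀ μ, c (f μ) ↔ c μ) :
    z * (∑ μ, if c μ then eRC μ else 0) = (∑ μ, if c μ then eRC μ else 0) * z := by
  refine eq_of_mul_e fun μ => ?_
  rw [mul_assoc, mul_assoc, sum_ite_mul_e, hz, ← mul_assoc, sum_ite_mul_e]
  by_cases h : c μ
  · rw [if_pos h, if_pos ((hc μ).2 h), hz]
  · rw [if_neg h, if_neg (fun h' => h ((hc μ).1 h')), mul_zero, zero_mul]

end OneBlock

section TwoBlocks

variable {β₁ β₂ : I →₀ ℕ} (h : β₁ + β₂ = β)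

theorem blk_ne (p : Fin (ht β₁)) (q : Fin (ht β₂)) : blk (left_le h) p ≠ blk (right_le h) q := by
  have := p.2
  simp only [ne_eq, Fin.ext_iff, blk]
  omega

theorem blkA_right_s_left (a : Adj (ht β₂)) (p : Fin (ht β₁)) :
    (blkA (right_le h) a).s (blk (left_le h) p) = blk (left_le h) p :=
  Adj.s_of_ne _ (by rw [blkA_lo]; exact blk_ne h _ _) (by rw [blkA_hi]; exact blk_ne h _ _)

theorem blkA_left_s_right (a : Adj (ht β₁)) (p : Fin (ht β₂)) :
    (blkA (left_le h) a).s (blk (right_le h) p) = blk (right_le h) p :=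
  Adj.s_of_ne _ (by rw [blkA_lo]; exact (blk_ne h _ _).symm)
    (by rw [blkA_hi]; exact (blk_ne h _ _).symm)

theorem res_right_c_left (p : Fin (ht β₁)) (μ : D.Seq β) :
    res (right_le h) (μ.c (blk (left_le h) p)) = res (right_le h) μ :=
  funext fun _ => Seq.c_ne (blk_ne h _ _).symm μ

theorem res_left_c_right (p : Fin (ht β₂)) (μ : D.Seq β) :
    res (left_le h) (μ.c (blk (right_le h) p)) = res (left_le h) μ :=
  funext fun _ => Seq.c_ne (blk_ne h _ _) μ

theorem res_right_s_left (a : Adj (ht β₁)) (μ : D.Seq β) :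
    res (right_le h) (μ.s (blkA (left_le h) a)) = res (right_le h) μ :=
  funext fun _ => congrArg μ.1 (blkA_left_s_right h _ _)

theorem res_left_s_right (a : Adj (ht β₂)) (μ : D.Seq β) :
    res (left_le h) (μ.s (blkA (right_le h) a)) = res (left_le h) μ :=
  funext fun _ => congrArg μ.1 (blkA_right_s_left h _ _)

theorem blkVal_comm (g₁ : Gen D β₁) (g₂ : Gen D β₂) :
    blkVal (right_le h) g₂ * blkVal (left_le h) g₁ =
      sgn k (g₂.par * g₁.par) • (blkVal (left_le h) g₁ * blkVal (right_le h) g₂) := by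
  have key : ∀ y z : D.RC β, y * z = z * y → y * z = sgn k 0 • (z * y) := fun y z e => by
    rw [sgn_zero, one_smul, e]
  cases g₁ with
  | e ν =>
    rw [show (Gen.e ν : Gen D β₁).par = 0 from rfl, mul_zero]
    refine key _ _ ?_
    cases g₂ with
    | e μ =>
      refine eq_of_mul_e fun ρ => ?_
      change blockE _ μ * blockE _ ν * _ = blockE _ ν * blockE _ μ * _
      rw [mul_assoc, mul_assoc, blockE_mul_e, blockE_mul_e]
      by_cases h1 : res (left_le h) ρ = ν.1
      · by_cases h2 : res (right_le h) ρ = μ.1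
        · rw [if_pos h1, if_pos h2, blockE_mul_e, blockE_mul_e, if_pos h1, if_pos h2]
        · rw [if_pos h1, if_neg h2, blockE_mul_e, if_neg h2, mul_zero]
      · by_cases h2 : res (right_le h) ρ = μ.1
        · rw [if_neg h1, if_pos h2, blockE_mul_e, if_neg h1, mul_zero]
        · rw [if_neg h1, if_neg h2, mul_zero, mul_zero]
    | x p => exact mul_sum_e_comm (f := id) (fun μ => x_e _ _) _ fun μ => Iff.rfl
    | s a =>
      exact mul_sum_e_comm (f := fun μ => μ.s _) (fun μ => s_e _ _) _ fun μ => by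
        rw [res_left_s_right h]
    | c p =>
      exact mul_sum_e_comm (f := fun μ => μ.c _) (fun μ => c_e _ _) _ fun μ => by
        rw [res_left_c_right h]
  | x p =>
    rw [show (Gen.x p : Gen D β₁).par = 0 from rfl, mul_zero]
    refine key _ _ ?_
    cases g₂ with
    | e μ => exact (mul_sum_e_comm (f := id) (fun μ => x_e _ _) _ fun μ => Iff.rfl).symm
    | x q => exact x_x _ _
    | s a => exact s_x _ _ (by rw [blkA_lo]; exact blk_ne h _ _) (by rw [blkA_hi]; exact blk_ne h _ _)
    | c q => exact c_x_ne (blk_ne h _ _).symm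
  | s a =>
    rw [show (Gen.s a : Gen D β₁).par = 0 from rfl, mul_zero]
    refine key _ _ ?_
    cases g₂ with
    | e μ =>
      exact (mul_sum_e_comm (f := fun μ => μ.s _) (fun μ => s_e _ _) _ fun μ => by
        rw [res_right_s_left h]).symm
    | x q =>
      exact (s_x _ _ (by rw [blkA_lo]; exact (blk_ne h _ _).symm)
        (by rw [blkA_hi]; exact (blk_ne h _ _).symm)).symm
    | s b =>
      refine (s_comm _ _ ?_).symm
      have := a.2
      change 0 + a.1 + 1 < ht β₁ + b.1
      omega
    | c q =>
      have := s_c (D := D) (blkA (left_le h) a) (blk (right_le h) q)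
      rw [blkA_left_s_right h] at this
      exact this.symm
  | c p =>
    cases g₂ with
    | e μ =>
      refine key _ _ ?_
      exact (mul_sum_e_comm (f := fun μ => μ.c _) (fun μ => c_e _ _) _ fun μ => by
        rw [res_right_c_left h]).symm
    | x q => exact key _ _ (c_x_ne (blk_ne h _ _)).symm
    | s b =>
      refine key _ _ ?_
      have := s_c (D := D) (blkA (right_le h) b) (blk (left_le h) p)
      rw [blkA_right_s_left h] at this
      exact this
    | c q =>
      change cRC _ * cRC _ = sgn k 1 • (cRC _ * cRC _)
      rw [c_c_ne (blk_ne h _ _).symm, sgn_one, neg_one_smul]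

variable (D) in
/-- The homomorphism of the first block. -/
abbrev lMap : D.RC β₁ →ₗ[k] D.RC β := blkMap (left_le h)

variable (D) in
/-- The homomorphism of the second block. -/
abbrev rMap : D.RC β₂ →ₗ[k] D.RC β := blkMap (right_le h)

theorem phi_eq (a : D.RC β₁) (b : D.RC β₂) : phi h a b = D.lMap h a * D.rMap h b := rfl

theorem parE_idem : D.parE h * D.parE h = D.parE h := (blockIdem_idem (D := D) (left_le h)).eq

theorem lMap_mul_parE (a : D.RC β₁) : D.lMap h a * D.parE h = D.lMap h a :=
  blkMap_mul_idem (left_le h) a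

theorem parE_mul_lMap (a : D.RC β₁) : D.parE h * D.lMap h a = D.lMap h a :=
  idem_mul_blkMap (left_le h) a

theorem rMap_mul_parE (b : D.RC β₂) : D.rMap h b * D.parE h = D.rMap h b := by
  rw [← blockIdem_right h]
  exact blkMap_mul_idem (right_le h) b

theorem parE_mul_rMap (b : D.RC β₂) : D.parE h * D.rMap h b = D.rMap h b := by
  rw [← blockIdem_right h]
  exact idem_mul_blkMap (right_le h) b

theorem lMap_one : D.lMap h 1 = D.parE h := blkMap_one (left_le h)

theorem rMap_one : D.rMap h 1 = D.parE h := (blkMap_one (right_le h)).trans (blockIdem_right h)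

theorem lMap_val (g : Gen D β₁) : D.lMap h g.val = blkVal (left_le h) g * D.parE h :=
  blkMap_val (left_le h) g

theorem rMap_val (g : Gen D β₂) : D.rMap h g.val = blkVal (right_le h) g * D.parE h := by
  rw [← blockIdem_right h]
  exact blkMap_val (right_le h) g

theorem parE_mul_left (g : Gen D β₁) :
    D.parE h * blkVal (left_le h) g = blkVal (left_le h) g * D.parE h :=
  idem_mul_blkVal (left_le h) g

theorem parE_mul_right (g : Gen D β₂) :
    D.parE h * blkVal (right_le h) g = blkVal (right_le h) g * D.parE h := by
  rw [← blockIdem_right h]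
  exact idem_mul_blkVal (right_le h) g

theorem rMap_lMap_val (g₁ : Gen D β₁) (g₂ : Gen D β₂) :
    D.rMap h g₂.val * D.lMap h g₁.val =
      sgn k (g₂.par * g₁.par) • (D.lMap h g₁.val * D.rMap h g₂.val) := by
  rw [lMap_val, rMap_val, mul_assoc, ← mul_assoc (D.parE h), parE_mul_left, mul_assoc, parE_idem,
    ← mul_assoc, blkVal_comm h, smul_mul_assoc, mul_assoc _ (D.parE h), ← mul_assoc (D.parE h),
    parE_mul_right, mul_assoc, mul_assoc, parE_idem]

theorem rMap_lMap_of_par_eq_zero (g₂ : Gen D β₂) (hg : g₂.par = 0) (a : D.RC β₁) :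
    D.rMap h g₂.val * D.lMap h a = D.lMap h a * D.rMap h g₂.val := by
  induction a using RC_induction with
  | hgen g => rw [rMap_lMap_val, hg, zero_mul, sgn_zero, one_smul]
  | hmap r =>
    rw [Algebra.algebraMap_eq_smul_one, map_smul, mul_smul_comm, smul_mul_assoc, lMap_one,
      rMap_mul_parE, parE_mul_rMap]
  | hadd a b ha hb => rw [map_add, mul_add, add_mul, ha, hb]
  | hmul a b ha hb => rw [blkMap_mul, ← mul_assoc, ha, mul_assoc, hb, mul_assoc]

theorem rMap_monomial_lMap_val (g₁ : Gen D β₁) (l : List (Gen D β₂ × D.Seq β₂)) :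
    D.rMap h (monomial l) * D.lMap h g₁.val =
      sgn k ((monDeg l).2 * g₁.par) • (D.lMap h g₁.val * D.rMap h (monomial l)) := by
  induction l with
  | nil =>
    rw [show monomial [] = (1 : D.RC β₂) from rfl, rMap_one, parE_mul_lMap, lMap_mul_parE,
      show monDeg ([] : List (Gen D β₂ × D.Seq β₂)) = 0 from rfl, Prod.snd_zero, zero_mul, sgn_zero,
      one_smul]
  | cons y l ih =>
    rw [show monomial (y :: l) = y.1.val * eRC y.2 * monomial l by simp [monomial],
      show monDeg (y :: l) = y.1.deg y.2 + monDeg l by simp [monDeg], blkMap_mul, blkMap_mul,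
      mul_assoc, ih, mul_smul_comm, ← mul_assoc, mul_assoc (D.rMap h y.1.val),
      rMap_lMap_val h g₁ (.e y.2), show (Gen.e y.2 : Gen D β₂).par = 0 from rfl, zero_mul, sgn_zero,
      one_smul, ← mul_assoc, rMap_lMap_val, smul_mul_assoc, smul_mul_assoc, smul_smul, ← sgn_add,
      Prod.snd_add, Gen.deg_snd, add_mul, add_comm]
    simp only [mul_assoc]

theorem rMap_monomial_lMap_monomial (l₁ : List (Gen D β₁ × D.Seq β₁))
    (l : List (Gen D β₂ × D.Seq β₂)) :
    D.rMap h (monomial l) * D.lMap h (monomial l₁) =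
      sgn k ((monDeg l).2 * (monDeg l₁).2) •
        (D.lMap h (monomial l₁) * D.rMap h (monomial l)) := by
  induction l₁ with
  | nil =>
    rw [show monomial [] = (1 : D.RC β₁) from rfl, lMap_one, parE_mul_rMap, rMap_mul_parE,
      show monDeg ([] : List (Gen D β₁ × D.Seq β₁)) = 0 from rfl, Prod.snd_zero, mul_zero, sgn_zero,
      one_smul]
  | cons y l₁ ih =>
    rw [show monomial (y :: l₁) = y.1.val * eRC y.2 * monomial l₁ by simp [monomial],
      show monDeg (y :: l₁) = y.1.deg y.2 + monDeg l₁ by simp [monDeg], blkMap_mul, blkMap_mul,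
      ← mul_assoc, ← mul_assoc, rMap_monomial_lMap_val, smul_mul_assoc, smul_mul_assoc,
      mul_assoc (D.lMap h y.1.val), rMap_monomial_lMap_val h (.e y.2),
      show (Gen.e y.2 : Gen D β₁).par = 0 from rfl, mul_zero, sgn_zero, one_smul, mul_assoc,
      mul_assoc, ih, mul_smul_comm, mul_smul_comm, smul_smul, ← sgn_add, Prod.snd_add, Gen.deg_snd,
      mul_add]
    simp only [mul_assoc]

/-- Homogeneous elements of the two blocks commute up to sign. -/
theorem rMap_lMap {a : D.RC β₁} {b : D.RC β₂} {g g' : ℤ × ZMod 2} (ha : a ∈ D.piece β₁ g)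
    (hb : b ∈ D.piece β₂ g') :
    D.rMap h b * D.lMap h a = sgn k (g'.2 * g.2) • (D.lMap h a * D.rMap h b) := by
  induction ha using Submodule.span_induction with
  | mem a ha =>
    obtain ⟨l₁, rfl, rfl⟩ := ha
    induction hb using Submodule.span_induction with
    | mem b hb =>
      obtain ⟨l, rfl, rfl⟩ := hb
      exact rMap_monomial_lMap_monomial h l₁ l
    | zero => simp
    | add b b' _ _ hb hb' => rw [map_add, add_mul, mul_add, smul_add, hb, hb']
    | smul r b _ hb => rw [map_smul, smul_mul_assoc, mul_smul_comm, hb, smul_comm]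
  | zero => simp
  | add b b' _ _ hb hb' => rw [map_add, add_mul, mul_add, smul_add, hb, hb']
  | smul r b _ hb => rw [map_smul, smul_mul_assoc, mul_smul_comm, hb, smul_comm]

/-- The product of the images of two tensors. -/
theorem phi_mul_phi {a a' : D.RC β₁} {b b' : D.RC β₂} {g g' : ℤ × ZMod 2} (ha : a' ∈ D.piece β₁ g)
    (hb : b ∈ D.piece β₂ g') :
    phi h a b * phi h a' b' = sgn k (g'.2 * g.2) • phi h (a * a') (b * b') := by
  rw [phi_eq, phi_eq, phi_eq, mul_assoc, ← mul_assoc (D.rMap h b), rMap_lMap h ha hb, blkMap_mul,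
    blkMap_mul, smul_mul_assoc, mul_smul_comm]
  simp only [mul_assoc]

end TwoBlocks

end Datum

end

end QuiverHeckeClifford

namespace QuiverHeckeClifford

set_option linter.unusedSectionVars false

noncomputable section

namespace Datum

variable {k I : Type*} [Field k] [DecidableEq I] {D : Datum k I} {β : I →₀ ℕ}

open Config

/-! ### Monomials -/

section Span

theorem c_sq (hchar : (2 : k) ≠ 0) (p : Fin (ht β)) : (cRC p * cRC p : D.RC β) = 1 := by
  have h := c_c (D := D) p p
  rw [if_pos rfl, ← two_smul k, ← one_add_one_eq_two (R := D.RC β), ← two_smul k (1 : D.RC β)] at h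
  exact smul_right_injective _ hchar h

/-- The product of the `c_p`, for `p` in a list. -/
def cWord (l : List (Fin (ht β))) : D.RC β := (l.map cRC).prod

/-- The product of the `x_p`, for `p` in a list. -/
def xWord (l : List (Fin (ht β))) : D.RC β := (l.map xRC).prod

theorem cWord_cons (p : Fin (ht β)) (l : List (Fin (ht β))) :
    (cWord (p :: l) : D.RC β) = cRC p * cWord l := by
  rw [cWord, List.map_cons, List.prod_cons]; rfl

theorem xWord_cons (p : Fin (ht β)) (l : List (Fin (ht β))) :
    (xWord (p :: l) : D.RC β) = xRC p * xWord l := by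
  rw [xWord, List.map_cons, List.prod_cons]; rfl

/-- The elements of a finite set of positions in increasing order. -/
def lst {n : ℕ} (S : Finset (Fin n)) : List (Fin n) := (List.finRange n).filter (· ∈ S)

/-- The positions listed with the multiplicities given by an exponent. -/
def xlst {n : ℕ} (a : Fin n →₀ ℕ) : List (Fin n) := (Finsupp.toMultiset a).toList

variable (D β) in
/-- The indices of the monomials in the `e(ν)`, `x_p` and `c_p`. -/
abbrev PIdx : Type _ := D.Seq β × Finset (Fin (ht β)) × (Fin (ht β) →₀ ℕ)

/-- The monomials in the `c_p`, the `x_p` and the `e(ν)`. -/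
def pmon (b : D.PIdx β) : D.RC β := cWord (lst b.2.1) * xWord (xlst b.2.2) * eRC b.1

theorem xWord_perm {l l' : List (Fin (ht β))} (h : l.Perm l') : (xWord l : D.RC β) = xWord l' :=
  (h.map _).prod_eq' (by
    rw [List.pairwise_map]
    exact List.pairwise_of_forall fun p q => x_x p q)

theorem x_mul_xWord (p : Fin (ht β)) (a : Fin (ht β) →₀ ℕ) :
    (xRC p * xWord (xlst a) : D.RC β) = xWord (xlst (a + Finsupp.single p 1)) := by
  rw [← xWord_cons]
  refine xWord_perm ?_
  rw [← Multiset.coe_eq_coe]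
  simp [xlst, ← Multiset.cons_coe, Multiset.add_comm _ {p}]

theorem x_mul_cWord (p : Fin (ht β)) (l : List (Fin (ht β))) :
    ∃ r : k, (xRC p * cWord l : D.RC β) = r • (cWord l * xRC p) := by
  induction l with
  | nil => exact ⟨1, by simp [cWord]⟩
  | cons q l ih =>
    obtain ⟨r, ih⟩ := ih
    rw [cWord_cons, ← mul_assoc]
    by_cases h : q = p
    · subst h
      refine ⟨-r, ?_⟩
      rw [← neg_neg (xRC q * cRC q), ← c_x_self, neg_mul, mul_assoc, ih, mul_smul_comm, neg_smul,
        mul_assoc]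
    · refine ⟨r, ?_⟩
      rw [← c_x_ne h, mul_assoc, ih, mul_smul_comm, mul_assoc]

theorem c_mul_cWord (hchar : (2 : k) ≠ 0) (p : Fin (ht β)) (S : Finset (Fin (ht β)))
    (l : List (Fin (ht β))) (hl : l.Nodup) (hp : p ∈ l) :
    ∃ r : k, (cRC p * cWord (l.filter (· ∈ S)) : D.RC β) =
      r • cWord (l.filter (· ∈ symmDiff S {p})) := by
  induction l with
  | nil => simp at hp
  | cons q l ih =>
    rw [List.nodup_cons] at hl
    by_cases h : q = p
    · subst h
      have e : l.filter (· ∈ symmDiff S {q}) = l.filter (· ∈ S) := by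
        refine List.filter_congr fun r hr => ?_
        have : r ≠ q := fun h => hl.1 (h ▸ hr)
        simp [Finset.mem_symmDiff, this]
      refine ⟨1, ?_⟩
      by_cases hS : q ∈ S
      · rw [List.filter_cons_of_pos (by simpa using hS),
          List.filter_cons_of_neg (by simp [Finset.mem_symmDiff, hS]), e, cWord_cons, ← mul_assoc,
          c_sq hchar, one_mul, one_smul]
      · rw [List.filter_cons_of_neg (by simpa using hS),
          List.filter_cons_of_pos (by simp [Finset.mem_symmDiff, hS]), e, cWord_cons, one_smul]
    · obtain ⟨r, ih⟩ := ih hl.2 ((List.mem_cons.1 hp).resolve_left (Ne.symm h))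
      have hq : q ∈ symmDiff S {p} ↔ q ∈ S := by simp [Finset.mem_symmDiff, h]
      by_cases hS : q ∈ S
      · refine ⟨-r, ?_⟩
        rw [List.filter_cons_of_pos (by simpa using hS),
          List.filter_cons_of_pos (by simpa using hq.2 hS), cWord_cons, cWord_cons, ← mul_assoc,
          c_c_ne (Ne.symm h), neg_mul, mul_assoc, ih, mul_smul_comm, neg_smul]
      · refine ⟨r, ?_⟩
        rw [List.filter_cons_of_neg (by simpa using hS),
          List.filter_cons_of_neg (by simpa using fun h' => hS (hq.1 h')), ih]

theorem cWord_mul_e (l : List (Fin (ht β))) (ν : D.Seq β) :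
    ∃ μ : D.Seq β, eRC ν * cWord l = cWord l * eRC μ := by
  induction l generalizing ν with
  | nil => exact ⟨ν, by simp [cWord]⟩
  | cons p l ih =>
    obtain ⟨μ, h⟩ := ih (ν.c p)
    refine ⟨μ, ?_⟩
    rw [cWord_cons, mul_assoc, ← h, ← mul_assoc, ← mul_assoc, c_e, Seq.c_c]

theorem xWord_mul_e (l : List (Fin (ht β))) (ν : D.Seq β) :
    eRC ν * xWord l = xWord l * eRC ν := by
  induction l with
  | nil => simp [xWord]
  | cons p l ih => rw [xWord_cons, mul_assoc, ← ih, ← mul_assoc, ← mul_assoc, x_e]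

theorem polyCliff_le_span (hchar : (2 : k) ≠ 0) {y : D.RC β} (hy : y ∈ D.polyCliff β) :
    y ∈ Submodule.span k (Set.range (pmon (D := D) (β := β))) := by
  suffices H : ∀ z ∈ Submodule.span k (Set.range (pmon (D := D) (β := β))),
      y * z ∈ Submodule.span k (Set.range (pmon (D := D) (β := β))) by
    rw [← mul_one y]
    refine H 1 ?_
    rw [← e_sum]
    refine Submodule.sum_mem _ fun ν _ => Submodule.subset_span ⟨(ν, ∅, 0), ?_⟩
    simp [pmon, lst, xlst, cWord, xWord]
  induction hy using Algebra.adjoin_induction with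
  | algebraMap r => intro z hz; rw [← Algebra.smul_def]; exact Submodule.smul_mem _ _ hz
  | add y y' _ _ h h' => intro z hz; rw [add_mul]; exact add_mem (h z hz) (h' z hz)
  | mul y y' _ _ h h' => intro z hz; rw [mul_assoc]; exact h _ (h' z hz)
  | mem y hy =>
    intro z hz
    induction hz using Submodule.span_induction with
    | zero => rw [mul_zero]; exact zero_mem _
    | add z z' _ _ h h' => rw [mul_add]; exact add_mem h h'
    | smul r z _ h => rw [mul_smul_comm]; exact Submodule.smul_mem _ _ h
    | mem z hz =>
      obtain ⟨⟨ν, S, a⟩, rfl⟩ := hz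
      simp only [pmon]
      rcases hy with ⟨μ, rfl⟩ | ⟨p, rfl⟩ | ⟨p, rfl⟩
      · obtain ⟨ρ, h⟩ := cWord_mul_e (lst S) μ
        rw [← mul_assoc, ← mul_assoc, h, mul_assoc (cWord _), xWord_mul_e, mul_assoc, mul_assoc, e_e]
        split_ifs with h'
        · subst h'
          exact Submodule.subset_span ⟨(ρ, S, a), by simp only [pmon, mul_assoc]⟩
        · simp
      · obtain ⟨r, h⟩ := x_mul_cWord (D := D) p (lst S)
        rw [← mul_assoc, ← mul_assoc, h, smul_mul_assoc, smul_mul_assoc, mul_assoc (cWord _),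
          x_mul_xWord]
        exact Submodule.smul_mem _ _ (Submodule.subset_span ⟨(ν, S, _), rfl⟩)
      · obtain ⟨r, h⟩ := c_mul_cWord (D := D) hchar p S _ (List.nodup_finRange _)
          (List.mem_finRange p)
        change _ * (cWord (List.filter _ _) * _ * _) ∈ _
        rw [← mul_assoc, ← mul_assoc, h, smul_mul_assoc, smul_mul_assoc]
        exact Submodule.smul_mem _ _ (Submodule.subset_span ⟨(ν, symmDiff S {p}, a), rfl⟩)

/-- A reduced word of a permutation. -/
def redWord {n : ℕ} (π : Equiv.Perm (Fin n)) : List (Adj n) :=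
  (exists_red (ω₀ := (id : Fin n → Fin n)) monotone_id π).choose

theorem red_redWord {n : ℕ} (π : Equiv.Perm (Fin n)) : Red (id : Fin n → Fin n) (redWord π) :=
  (exists_red (ω₀ := (id : Fin n → Fin n)) monotone_id π).choose_spec.1

theorem wordPerm_redWord {n : ℕ} (π : Equiv.Perm (Fin n)) : wordPerm (redWord π) = π :=
  Equiv.ext fun p => congrFun
    (exists_red (ω₀ := (id : Fin n → Fin n)) monotone_id π).choose_spec.2 p

variable (D β) in
/-- The indices of the monomials in all generators. -/
abbrev BIdx : Type _ := Equiv.Perm (Fin (ht β)) × D.PIdx β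

/-- The monomials in all generators. -/
def bmon (b : D.BIdx β) : D.RC β := sWord (redWord b.1) * pmon b.2

theorem mem_span_bmon (hchar : (2 : k) ≠ 0) (y : D.RC β) :
    y ∈ Submodule.span k (Set.range (bmon (D := D) (β := β))) := by
  set V : Submodule k (D.RC β) := Subalgebra.toSubmodule (D.polyCliff β) with hV
  have hω : Monotone (id : Fin (ht β) → Fin (ht β)) := monotone_id
  have stab : D.IsStable (id : Fin (ht β) → Fin (ht β)) V :=
    ⟨fun y hy v hv => MulMemClass.mul_mem (s := D.polyCliff β) hy hv,
      fun b hb => absurd hb b.lo_ne_hi⟩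
  have key : ∀ m : ℕ, D.fil (id : Fin (ht β) → Fin (ht β)) V m ≤
      Submodule.span k (Set.range (bmon (D := D) (β := β))) := by
    intro m
    induction m with
    | zero => rw [fil_nonpos (by simp)]; exact bot_le
    | succ m ih =>
      refine Submodule.span_le.2 ?_
      rintro _ ⟨l, v, hl, hm, hv, rfl⟩
      have hr := red_redWord (wordPerm l)
      have h1 := (red_unique (D := D) (V := V) hω l.length (fun j _ => filGood hω stab j) l _ hl hr
        (by rw [wordPerm_redWord]) rfl).2 v hv
      rw [SetLike.mem_coe, ← sub_add_cancel ((sWord l : D.RC β) • v)]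
      refine add_mem (ih (fil_mono (by push_cast at hm; omega) h1)) ?_
      have h2 := polyCliff_le_span hchar hv
      have h3 := Submodule.mem_map_of_mem (f := LinearMap.mulLeft k
        (sWord (redWord (wordPerm l)) : D.RC β)) h2
      rw [Submodule.map_span] at h3
      refine Submodule.span_mono ?_ h3
      rintro _ ⟨_, ⟨b, rfl⟩, rfl⟩
      exact ⟨(wordPerm l, b), rfl⟩
  have h1 : (1 : D.RC β) ∈ ⨆ m, D.fil (id : Fin (ht β) → Fin (ht β)) V m := by
    refine Submodule.mem_iSup_of_mem 1 ?_
    have := sWord_mem_fil (D := D) (ω₀ := (id : Fin (ht β) → Fin (ht β))) (V := V) (l := []) trivial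
      (m := 1) (by simp) (D.polyCliff β).one_mem
    rwa [sWord_nil, one_smul] at this
  have h2 := polyCliff_smul_mem_iSup hω stab y h1
  rw [smul_eq_mul, mul_one] at h2
  refine (iSup_le fun m => ?_ : (⨆ m, D.fil (id : Fin (ht β) → Fin (ht β)) V m) ≤ _) h2
  exact (fil_mono (Int.self_le_toNat m)).trans (key m.toNat)

end Span

/-! ### Leading terms -/

section Leading

variable {Λ : Type*} [LinearOrder Λ]

/-- The permuted sequence. -/
def Seq.perm (ν : D.Seq β) (π : Equiv.Perm (Fin (ht β))) : D.Seq β :=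
  ⟨ν.1 ∘ π, by
    conv_rhs => rw [← ν.2]
    exact Equiv.sum_comp π fun i => Finsupp.single (ν.1 i).fst 1⟩

/-- The permuted configuration. -/
def Config.act (ω : D.Config β) (π : Equiv.Perm (Fin (ht β))) : D.Config β :=
  ⟨ω.w * π, ω.ν.perm π, ω.ε ∘ π⟩

theorem Config.act_mul (ω : D.Config β) (π π' : Equiv.Perm (Fin (ht β))) :
    ω.act (π * π') = (ω.act π).act π' := rfl

theorem Config.act_one (ω : D.Config β) : ω.act 1 = ω := rfl

theorem Config.act_act_inv (ω : D.Config β) (π : Equiv.Perm (Fin (ht β))) :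
    (ω.act π).act π⁻¹ = ω := by
  rw [← act_mul, mul_inv_cancel, act_one]

/-- The number of inversions between the labels of a configuration. -/
def Config.inv (ω₀ : Fin (ht β) → Λ) (ω : D.Config β) : ℤ := winv (ω₀ ∘ ω.w) (fun _ _ => 1)

theorem opS_apply (a : Adj (ht β)) (f : D.FunM β) (ω : D.Config β) :
    opS a f ω = ω.g a * f (ω.sw a) + (hh a.lo a.hi ω * f ω +
      hc a.lo a.hi ω * (ω.κ a.lo * ((ω.c a.lo).κ a.hi * f ((ω.c a.lo).c a.hi)))) := rfl

theorem Config.inv_sw (ω₀ : Fin (ht β) → Λ) (ω : D.Config β) (a : Adj (ht β)) :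
    (ω₀ (ω.w a.hi) < ω₀ (ω.w a.lo) ∧ ω.inv ω₀ = (ω.sw a).inv ω₀ + 1) ∨
      (ω₀ (ω.w a.lo) ≤ ω₀ (ω.w a.hi) ∧ ω.inv ω₀ ≤ (ω.sw a).inv ω₀) := by
  have e : (ω.sw a).inv ω₀ = winv ((ω₀ ∘ ω.w) ∘ a.s) (fun _ _ => 1) := rfl
  rcases lt_trichotomy (ω₀ (ω.w a.lo)) (ω₀ (ω.w a.hi)) with h | h | h
  · have := winv_swap (ω₀ ∘ ω.w) (fun _ _ => 1) (fun _ _ => rfl) a h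
    right
    rw [e, this]
    exact ⟨h.le, by rw [Config.inv]; omega⟩
  · right
    have : (ω₀ ∘ ω.w) ∘ a.s = ω₀ ∘ ω.w := by
      funext p
      by_cases h1 : p = a.lo
      · subst h1; simp only [Function.comp_apply, a.s_lo, h]
      · by_cases h2 : p = a.hi
        · subst h2; simp only [Function.comp_apply, a.s_hi, h]
        · simp only [Function.comp_apply, a.s_of_ne h1 h2]
    rw [e, this]
    exact ⟨h.le, le_rfl⟩
  · left
    refine ⟨h, ?_⟩
    have := winv_swap ((ω₀ ∘ ω.w) ∘ a.s) (fun _ _ => 1) (fun _ _ => rfl) a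
      (by simpa [a.s_lo, a.s_hi] using h)
    have h1 : ((ω₀ ∘ ω.w) ∘ a.s) ∘ a.s = ω₀ ∘ ω.w := by
      funext p
      simp [a.s_s]
    rw [h1] at this
    exact this

theorem rep_sWord_apply {ω₀ : Fin (ht β) → Λ} (hω : Monotone ω₀) {f : D.FunM β}
    (hf : ∀ ω : D.Config β, ω₀ ∘ ω.w ≠ ω₀ → f ω = 0) (l : List (Adj (ht β))) (hl : Red ω₀ l)
    (ω : D.Config β) :
    (l.length < ω.inv ω₀ → rep D β (sWord l) f ω = 0) ∧
      (ω.inv ω₀ = l.length → rep D β (sWord l) f ω =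
        if ω₀ ∘ ω.w = ω₀ ∘ wordPerm l then f (ω.act (wordPerm l)⁻¹) else 0) := by
  induction l generalizing ω with
  | nil =>
    rw [sWord_nil, map_one]
    refine ⟨fun h => hf ω fun e => ?_, fun _ => ?_⟩
    · rw [Config.inv, e, winv_of_monotone hω] at h
      simp at h
    · split_ifs with h
      · rfl
      · exact hf ω h
  | cons a l ih =>
    have e1 : rep D β (sWord (a :: l)) f ω = opS a (rep D β (sWord l) f) ω := by
      rw [sWord_cons, map_mul, rep_s]; rfl
    have inv_c : ∀ (ω : D.Config β) p, (ω.c p).inv ω₀ = ω.inv ω₀ := fun _ _ => rfl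
    have big : (l.length : ℤ) < ω.inv ω₀ → rep D β (sWord (a :: l)) f ω =
        ω.g a * rep D β (sWord l) f (ω.sw a) := fun h => by
      rw [e1, opS_apply, (ih hl.1 ω).1 h, (ih hl.1 ((ω.c a.lo).c a.hi)).1 h]
      ring
    constructor
    · intro h
      rw [List.length_cons] at h
      push_cast at h
      rw [big (by omega), (ih hl.1 (ω.sw a)).1, mul_zero]
      rcases Config.inv_sw ω₀ ω a with ⟨-, h'⟩ | ⟨-, h'⟩ <;> omega
    · intro h
      rw [List.length_cons] at h
      push_cast at h
      rw [big (by omega)]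
      rcases Config.inv_sw ω₀ ω a with ⟨h1, h'⟩ | ⟨h1, h'⟩
      · have hg : ω.g a = 1 := if_pos (lt_of_not_ge fun h2 => h1.not_ge (hω h2))
        rw [hg, one_mul, (ih hl.1 (ω.sw a)).2 (by omega)]
        have e2 : ω₀ ∘ (ω.sw a).w = ω₀ ∘ wordPerm l ↔ ω₀ ∘ ω.w = ω₀ ∘ wordPerm (a :: l) := by
          constructor
          · intro h2
            funext p
            have := congrFun h2 (a.s p)
            simpa [Config.sw_w, a.s_s, wordPerm_cons] using this
          · intro h2
            funext p
            have := congrFun h2 (a.s p)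
            simpa [Config.sw_w, a.s_s, wordPerm_cons] using this
        have e3 : (ω.sw a).act (wordPerm l)⁻¹ = ω.act (wordPerm (a :: l))⁻¹ := by
          change ω.act (a.s * (wordPerm l)⁻¹) = ω.act (wordPerm l * a.s)⁻¹
          rw [mul_inv_rev]
          congr 2
        rw [e3]
        exact if_congr e2 rfl rfl
      · rw [(ih hl.1 (ω.sw a)).1 (by omega), mul_zero, if_neg]
        intro h2
        have h3 := congrFun h2 a.lo
        have h4 := congrFun h2 a.hi
        simp only [Function.comp_apply, wordPerm_cons, a.s_lo, a.s_hi] at h3 h4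
        exact hl.2.not_ge (by rw [← h3, ← h4]; exact h1)

variable (D) in
/-- The subalgebra generated by the generators that exchange only equal entries. -/
def flatAlg (ω₀ : Fin (ht β) → Λ) : Subalgebra k (D.RC β) :=
  Algebra.adjoin k {y | y ∈ D.polyCliff β ∨ ∃ a : Adj (ht β), ω₀ a.lo = ω₀ a.hi ∧ y = sRC a}

theorem polyCliff_le_flatAlg (ω₀ : Fin (ht β) → Λ) {y : D.RC β} (hy : y ∈ D.polyCliff β) :
    y ∈ D.flatAlg ω₀ := Algebra.subset_adjoin (Or.inl hy)

theorem s_mem_flatAlg {ω₀ : Fin (ht β) → Λ} {a : Adj (ht β)} (h : ω₀ a.lo = ω₀ a.hi) :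
    (sRC a : D.RC β) ∈ D.flatAlg ω₀ := Algebra.subset_adjoin (Or.inr ⟨a, h, rfl⟩)

theorem rep_flat_apply {ω₀ : Fin (ht β) → Λ} {y : D.RC β} (hy : y ∈ D.flatAlg ω₀) {f : D.FunM β}
    (hf : ∀ ω : D.Config β, ω₀ ∘ ω.w ≠ ω₀ → f ω = 0) (ω : D.Config β) (hω : ω₀ ∘ ω.w ≠ ω₀) :
    rep D β y f ω = 0 := by
  have hadj : ∀ (S : Set (D.RC β)), (∀ z ∈ S, ∀ f : D.FunM β,
      (∀ ω : D.Config β, ω₀ ∘ ω.w ≠ ω₀ → f ω = 0) →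
        ∀ ω : D.Config β, ω₀ ∘ ω.w ≠ ω₀ → rep D β z f ω = 0) →
      ∀ y ∈ Algebra.adjoin k S, ∀ f : D.FunM β, (∀ ω : D.Config β, ω₀ ∘ ω.w ≠ ω₀ → f ω = 0) →
        ∀ ω : D.Config β, ω₀ ∘ ω.w ≠ ω₀ → rep D β y f ω = 0 := by
    intro S hS y hy
    induction hy using Algebra.adjoin_induction with
    | mem y hy => exact hS y hy
    | algebraMap r =>
      intro f hf ω hω
      rw [AlgHom.commutes, Module.algebraMap_end_apply]
      change r • f ω = 0
      rw [hf ω hω, smul_zero]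
    | add y z _ _ hy hz =>
      intro f hf ω hω
      rw [map_add, LinearMap.add_apply, add_app, hy f hf ω hω, hz f hf ω hω, add_zero]
    | mul y z _ _ hy hz =>
      intro f hf ω hω
      rw [map_mul]
      exact hy _ (fun ω hω => hz f hf ω hω) ω hω
  refine hadj _ ?_ y hy f hf ω hω
  rintro z (hz | ⟨a, ha, rfl⟩)
  · refine hadj _ ?_ z hz
    rintro z (⟨ν, rfl⟩ | ⟨p, rfl⟩ | ⟨p, rfl⟩) f hf ω hω
    · rw [rep_e, dg_apply, hf ω hω, mul_zero]
    · rw [rep_x, dg_apply, hf ω hω, mul_zero]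
    · rw [rep_c, opC_apply, hf (ω.c p) hω, mul_zero]
  · intro f hf ω hω
    have h1 : ω₀ ∘ (ω.sw a).w ≠ ω₀ := fun h => hω (by
      funext p
      have h2 := congrFun h (a.s p)
      rw [Function.comp_apply, Config.sw_w, a.s_s] at h2
      rw [Function.comp_apply, h2]
      by_cases h3 : p = a.lo
      · subst h3; rw [a.s_lo, ha]
      · by_cases h4 : p = a.hi
        · subst h4; rw [a.s_hi, ha]
        · rw [a.s_of_ne h3 h4])
    rw [rep_s, opS_apply, hf _ h1, hf ω hω, hf ((ω.c a.lo).c a.hi) hω]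
    ring

/-- The leading coefficient with respect to the number of inversions is detected by the
representation. -/
theorem rep_eq_zero_of_mem_fil {ω₀ : Fin (ht β) → Λ} (hω : Monotone ω₀) {l : List (Adj (ht β))}
    (hl : Red ω₀ l) {y : D.RC β} (hy : y ∈ D.flatAlg ω₀)
    (h : sWord l * y ∈ D.fil ω₀ (Subalgebra.toSubmodule (D.flatAlg ω₀)) l.length) {f : D.FunM β}
    (hf : ∀ ω : D.Config β, ω₀ ∘ ω.w ≠ ω₀ → f ω = 0) : rep D β y f = 0 := by
  have key : ∀ z ∈ D.fil ω₀ (Subalgebra.toSubmodule (D.flatAlg ω₀)) l.length,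
      ∀ ω : D.Config β, ω.inv ω₀ = l.length → rep D β z f ω = 0 := by
    intro z hz ω hω'
    induction hz using Submodule.span_induction with
    | zero => rw [map_zero]; rfl
    | add z z' _ _ h h' => rw [map_add, LinearMap.add_apply, add_app, h, h', add_zero]
    | smul r z _ h =>
      rw [map_smul]
      change r • rep D β z f ω = 0
      rw [h, smul_zero]
    | mem z hz =>
      obtain ⟨l', v, hl', hlen, hv, rfl⟩ := hz
      rw [smul_eq_mul, map_mul]
      refine (rep_sWord_apply hω (f := rep D β v f) ?_ l' hl' ω).1 (by omega)
      exact fun ω hω => rep_flat_apply hv hf ω hω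
  funext ω
  by_cases hw : ω₀ ∘ ω.w = ω₀
  · have h1 : ω₀ ∘ (ω.act (wordPerm l)).w = ω₀ ∘ wordPerm l := by
      conv_rhs => rw [← hw]
      rfl
    have h2 : (ω.act (wordPerm l)).inv ω₀ = l.length := by
      rw [Config.inv, h1, winv_one hω hl]
    have h3 := key _ h _ h2
    rw [map_mul] at h3
    have h4 := (rep_sWord_apply hω (f := rep D β y f) (fun ω hω => rep_flat_apply hy hf ω hω) l hl
      (ω.act (wordPerm l))).2 h2
    rw [if_pos h1, Config.act_act_inv] at h4
    exact h4.symm.trans h3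
  · exact rep_flat_apply hy hf ω hw

end Leading

end Datum

end

end QuiverHeckeClifford

namespace QuiverHeckeClifford

set_option linter.unusedSectionVars false

noncomputable section

namespace Datum

variable {k I : Type*} [Field k] [DecidableEq I] {D : Datum k I} {β' β : I →₀ ℕ}

open Config

/-! ### Independence of the monomials of two blocks -/

section Single

/-- The function with a single value. -/
def sgl (ω : D.Config β) (r : Fr k β) : D.FunM β := fun ω' => open Classical in if ω' = ω then r else 0

theorem sgl_self (ω : D.Config β) (r : Fr k β) : sgl ω r ω = r := if_pos rfl

theorem sgl_ne {ω ω' : D.Config β} (h : ω' ≠ ω) (r : Fr k β) : sgl ω r ω' = 0 := if_neg h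

theorem sgl_zero (ω : D.Config β) : sgl ω (0 : Fr k β) = 0 := funext fun _ => ite_self _

theorem dg_sgl (d : D.Fun β) (ω : D.Config β) (r : Fr k β) : dg d (sgl ω r) = sgl ω (d ω * r) := by
  funext ω'
  rw [dg_apply]
  by_cases h : ω' = ω
  · rw [h, sgl_self, sgl_self]
  · rw [sgl_ne h, sgl_ne h, mul_zero]

theorem opC_sgl (p : Fin (ht β)) (ω : D.Config β) (r : Fr k β) :
    opC p (sgl ω r) = sgl (ω.c p) (ω.κ p * r) := by
  funext ω'
  rw [opC_apply]
  by_cases h : ω' = ω.c p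
  · rw [h, Config.c_c, sgl_self, sgl_self, κ_c_same]
  · rw [sgl_ne h, sgl_ne (fun h' => h (by rw [← h', Config.c_c])), mul_zero]

/-- The effect of a product of the `c_p`. -/
def Config.cs (ω : D.Config β) (l : List (Fin (ht β))) : D.Config β := l.foldr (fun p ω => ω.c p) ω

/-- The sign of a product of the `c_p`. -/
def Config.κs (ω : D.Config β) : List (Fin (ht β)) → Fr k β
  | [] => 1
  | p :: l => (ω.cs l).κ p * ω.κs l

theorem Config.κs_mul_self (ω : D.Config β) (l : List (Fin (ht β))) : ω.κs l * ω.κs l = 1 := by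
  induction l with
  | nil => exact one_mul 1
  | cons p l ih => rw [κs, mul_mul_mul_comm, ih, κ_mul_self, one_mul]

theorem Config.κs_ne_zero (ω : D.Config β) (l : List (Fin (ht β))) : ω.κs l ≠ 0 := fun h => by
  have := ω.κs_mul_self l
  rw [h, zero_mul] at this
  exact zero_ne_one this

theorem Config.cs_w (ω : D.Config β) (l : List (Fin (ht β))) : (ω.cs l).w = ω.w := by
  induction l with
  | nil => rfl
  | cons p l ih => exact ih

theorem Config.cs_append (ω : D.Config β) (l l' : List (Fin (ht β))) :
    ω.cs (l ++ l') = (ω.cs l').cs l := List.foldr_append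

theorem Config.cs_ε (ω : D.Config β) (l : List (Fin (ht β))) (hl : l.Nodup) (q : Fin (ht β)) :
    (ω.cs l).ε q = ω.ε q + if q ∈ l then 1 else 0 := by
  induction l with
  | nil => simp [cs]
  | cons p l ih =>
    rw [List.nodup_cons] at hl
    change ((ω.cs l).c p).ε q = _
    rw [c_ε, ih hl.2, Pi.single_apply]
    by_cases h : q = p
    · subst h; simp [hl.1]
    · simp [h]

variable {s : ℕ} (hs : s + ht β' ≤ ht β)

theorem Config.cs_st_ne (ω : D.Config β) (l : List (Fin (ht β))) {q : Fin (ht β)} (h : q ∉ l) :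
    (ω.cs l).st q = ω.st q := by
  induction l with
  | nil => rfl
  | cons p l ih =>
    rw [List.mem_cons, not_or] at h
    change ((ω.cs l).c p).st q = _
    rw [st_c_ne _ h.1, ih h.2]

/-- The representation restricted to a block. -/
def blkRep (y : D.RC β') : Module.End k (D.FunM β) := rep D β (blkMap hs y)

theorem blkRep_mul (y z : D.RC β') (f : D.FunM β) :
    blkRep hs (y * z) f = blkRep hs y (blkRep hs z f) := by
  rw [blkRep, blkMap_mul, map_mul]; rfl

theorem rep_idem_sgl {ω : D.Config β} (h : D.wt (res hs ω.ν) = β') (r : Fr k β) :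
    rep D β (D.blockIdem hs) (sgl ω r) = sgl ω r := by
  rw [blockIdem, map_sum]
  have : ∀ μ : D.Seq β, rep D β (if D.wt (res hs μ) = β' then eRC μ else 0) =
      dg (if D.wt (res hs μ) = β' then ind μ else 0) := fun μ => by
    split_ifs
    · exact rep_e μ
    · rw [map_zero, map_zero]
  simp only [this]
  rw [← map_sum, dg_sgl, Finset.sum_apply, Finset.sum_eq_single ω.ν]
  · rw [if_pos h, ind, if_pos rfl, one_mul]
  · intro μ _ hμ
    split_ifs
    · exact if_neg hμ.symm
    · rfl
  · simp

theorem blkRep_e {ω : D.Config β} (ν : D.Seq β') (r : Fr k β) :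
    blkRep hs (eRC ν) (sgl ω r) = open Classical in if res hs ω.ν = ν.1 then sgl ω r else 0 := by
  rw [blkRep]
  change rep D β (blockHom hs (eRC ν)).1 _ = _
  rw [blockHom_e, blockE, map_sum]
  have : ∀ μ : D.Seq β, rep D β (if res hs μ = ν.1 then eRC μ else 0) =
      dg (if res hs μ = ν.1 then ind μ else 0) := fun μ => by
    split_ifs
    · exact rep_e μ
    · rw [map_zero, map_zero]
  simp only [this]
  rw [← map_sum, dg_sgl, Finset.sum_apply, Finset.sum_eq_single ω.ν]
  · split_ifs with h
    · rw [ind, if_pos rfl, one_mul]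
    · rw [Pi.zero_apply, zero_mul, sgl_zero]
  · intro μ _ hμ
    split_ifs
    · exact if_neg hμ.symm
    · rfl
  · simp

theorem blkRep_x {ω : D.Config β} (h : D.wt (res hs ω.ν) = β') (p : Fin (ht β')) (r : Fr k β) :
    blkRep hs (xRC p) (sgl ω r) = sgl ω (ω.x (blk hs p) * r) := by
  rw [blkRep]
  change rep D β (blockHom hs (xRC p)).1 _ = _
  rw [blockHom_x, map_mul, Module.End.mul_apply, rep_idem_sgl hs h, rep_x, dg_sgl]
  rfl

theorem blkRep_c {ω : D.Config β} (h : D.wt (res hs ω.ν) = β') (p : Fin (ht β')) (r : Fr k β) :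
    blkRep hs (cRC p) (sgl ω r) = sgl (ω.c (blk hs p)) (ω.κ (blk hs p) * r) := by
  rw [blkRep]
  change rep D β (blockHom hs (cRC p)).1 _ = _
  rw [blockHom_c, map_mul, Module.End.mul_apply, rep_idem_sgl hs h, rep_c, opC_sgl]

theorem blkRep_one {ω : D.Config β} (h : D.wt (res hs ω.ν) = β') (r : Fr k β) :
    blkRep hs 1 (sgl ω r) = sgl ω r := by
  rw [blkRep, blkMap_one, rep_idem_sgl hs h]

theorem blkRep_xWord {ω : D.Config β} (h : D.wt (res hs ω.ν) = β') (l : List (Fin (ht β')))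
    (r : Fr k β) :
    blkRep hs (xWord l) (sgl ω r) = sgl ω ((l.map fun p => ω.x (blk hs p)).prod * r) := by
  induction l with
  | nil =>
    rw [show xWord [] = (1 : D.RC β') from rfl, blkRep_one hs h, List.map_nil, List.prod_nil, one_mul]
  | cons p l ih =>
    rw [xWord_cons, blkRep_mul, ih, blkRep_x hs h, List.map_cons, List.prod_cons, mul_assoc]

theorem wt_res_cs (ω : D.Config β) (l : List (Fin (ht β'))) :
    D.wt (res hs (ω.cs (l.map (blk hs))).ν) = D.wt (res hs ω.ν) := by
  induction l with
  | nil => rfl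
  | cons p l ih => exact (wt_res_c hs p _).trans ih

theorem blkRep_cWord {ω : D.Config β} (h : D.wt (res hs ω.ν) = β') (l : List (Fin (ht β')))
    (r : Fr k β) :
    blkRep hs (cWord l) (sgl ω r) =
      sgl (ω.cs (l.map (blk hs))) (ω.κs (l.map (blk hs)) * r) := by
  induction l with
  | nil =>
    rw [show cWord [] = (1 : D.RC β') from rfl, blkRep_one hs h, List.map_nil, κs, one_mul]; rfl
  | cons p l ih =>
    rw [cWord_cons, blkRep_mul, ih, blkRep_c hs (by rw [wt_res_cs, h]), List.map_cons, κs, mul_assoc]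
    rfl

theorem blkRep_pmon {ω : D.Config β} (h : D.wt (res hs ω.ν) = β') (b : D.PIdx β')
    (r : Fr k β) :
    blkRep hs (pmon b) (sgl ω r) = open Classical in if res hs ω.ν = b.1.1 then
      sgl (ω.cs ((lst b.2.1).map (blk hs))) (ω.κs ((lst b.2.1).map (blk hs)) *
        (((xlst b.2.2).map fun p => ω.x (blk hs p)).prod * r)) else 0 := by
  rw [pmon, blkRep_mul, blkRep_mul, blkRep_e]
  split_ifs
  · rw [blkRep_xWord hs h, blkRep_cWord hs h]
  · rw [map_zero, map_zero]

theorem prod_xlst {ω : D.Config β} (hw : ω.w = 1) (hε : ω.ε = 0) (a : Fin (ht β') →₀ ℕ) :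
    ((xlst a).map fun p => ω.x (blk hs p)).prod =
      toFr k β (MvPolynomial.monomial (a.mapDomain (blk hs)) 1) := by
  have h1 : (fun p => ω.x (blk hs p)) = fun p => toFr k β (MvPolynomial.X (blk hs p)) := by
    funext p
    rw [Config.x, hw, hε, Pi.zero_apply, sgn_zero, one_mul]
    rfl
  rw [h1, xlst, ← Multiset.prod_coe, ← Multiset.map_coe, Multiset.coe_toList]
  induction a using Finsupp.induction_linear with
  | zero => simp
  | add a b ha hb =>
    rw [map_add, Multiset.map_add, Multiset.prod_add, ha, hb, Finsupp.mapDomain_add, ← map_mul,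
      MvPolynomial.monomial_mul, one_mul]
  | single p n =>
    rw [Finsupp.toMultiset_single, Multiset.map_nsmul, Multiset.prod_nsmul, Multiset.map_singleton,
      Multiset.prod_singleton, Finsupp.mapDomain_single, ← map_pow, MvPolynomial.X_pow_eq_monomial]

end Single

end Datum

end

end QuiverHeckeClifford

namespace QuiverHeckeClifford

set_option linter.unusedSectionVars false

noncomputable section

namespace Datum

variable {k I : Type*} [Field k] [DecidableEq I] {D : Datum k I} {β' β : I →₀ ℕ}

open Config

section Words

variable {s : ℕ} (hs : s + ht β' ≤ ht β)

theorem wordPerm_map_blk (l : List (Adj (ht β'))) (p : Fin (ht β')) :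
    wordPerm (l.map (blkA hs)) (blk hs p) = blk hs (wordPerm l p) := by
  induction l generalizing p with
  | nil => rfl
  | cons a l ih => rw [List.map_cons, wordPerm_cons, blkA_s, ih, wordPerm_cons]

theorem idem_mul_sWord (l : List (Adj (ht β'))) :
    D.blockIdem hs * sWord (l.map (blkA hs)) = sWord (l.map (blkA hs)) * D.blockIdem hs := by
  induction l with
  | nil => rw [List.map_nil, sWord_nil, one_mul, mul_one]
  | cons a l ih => rw [List.map_cons, sWord_cons, ← mul_assoc, s_blockIdem, mul_assoc, ih, mul_assoc]

theorem blkMap_sWord (l : List (Adj (ht β'))) :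
    blkMap hs (sWord l : D.RC β') = sWord (l.map (blkA hs)) * D.blockIdem hs := by
  induction l with
  | nil => rw [sWord_nil, blkMap_one, List.map_nil, sWord_nil, one_mul]
  | cons a l ih =>
    rw [sWord_cons, blkMap_mul, ih, blkMap_val, List.map_cons, sWord_cons, mul_assoc, mul_assoc,
      ← mul_assoc (D.blockIdem hs), idem_mul_sWord, mul_assoc, (blockIdem_idem (D := D) hs).eq]
    rfl

theorem red_map_blk {l : List (Adj (ht β'))} (hl : Red (id : Fin (ht β') → Fin (ht β')) l) :
    Red (id : Fin (ht β) → Fin (ht β)) (l.map (blkA hs)) := by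
  induction l with
  | nil => trivial
  | cons a l ih =>
    refine ⟨ih hl.1, ?_⟩
    rw [blkA_lo, blkA_hi, wordPerm_map_blk, wordPerm_map_blk]
    have := hl.2
    simp only [id, Fin.lt_def, blk] at this ⊢
    omega

end Words

section TwoBlocks

variable {β₁ β₂ : I →₀ ℕ} (h : β₁ + β₂ = β)

theorem wordPerm_left_right (l : List (Adj (ht β₁))) (q : Fin (ht β₂)) :
    wordPerm (l.map (blkA (left_le h))) (blk (right_le h) q) = blk (right_le h) q := by
  induction l with
  | nil => rfl
  | cons a l ih => rw [List.map_cons, wordPerm_cons, blkA_left_s_right h, ih]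

theorem wordPerm_right_left (l : List (Adj (ht β₂))) (p : Fin (ht β₁)) :
    wordPerm (l.map (blkA (right_le h))) (blk (left_le h) p) = blk (left_le h) p := by
  induction l with
  | nil => rfl
  | cons a l ih => rw [List.map_cons, wordPerm_cons, blkA_right_s_left h, ih]

/-- The word composed of a word in each block. -/
def parWord (l₁ : List (Adj (ht β₁))) (l₂ : List (Adj (ht β₂))) : List (Adj (ht β)) :=
  l₁.map (blkA (left_le h)) ++ l₂.map (blkA (right_le h))

theorem wordPerm_parWord_left (l₁ : List (Adj (ht β₁))) (l₂ : List (Adj (ht β₂))) (p : Fin (ht β₁)) :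
    wordPerm (parWord h l₁ l₂) (blk (left_le h) p) = blk (left_le h) (wordPerm l₁ p) := by
  rw [parWord, wordPerm_append, Equiv.Perm.mul_apply, wordPerm_map_blk, wordPerm_right_left h]

theorem wordPerm_parWord_right (l₁ : List (Adj (ht β₁))) (l₂ : List (Adj (ht β₂)))
    (p : Fin (ht β₂)) :
    wordPerm (parWord h l₁ l₂) (blk (right_le h) p) = blk (right_le h) (wordPerm l₂ p) := by
  rw [parWord, wordPerm_append, Equiv.Perm.mul_apply, wordPerm_left_right h, wordPerm_map_blk]

theorem red_parWord {l₁ : List (Adj (ht β₁))} {l₂ : List (Adj (ht β₂))}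
    (h₁ : Red (id : Fin (ht β₁) → Fin (ht β₁)) l₁) (h₂ : Red (id : Fin (ht β₂) → Fin (ht β₂)) l₂) :
    Red (id : Fin (ht β) → Fin (ht β)) (parWord h l₁ l₂) := by
  induction l₁ with
  | nil => exact red_map_blk (right_le h) h₂
  | cons a l₁ ih =>
    refine ⟨ih h₁.1, ?_⟩
    change id (wordPerm (parWord h l₁ l₂) _) < id (wordPerm (parWord h l₁ l₂) _)
    rw [blkA_lo, blkA_hi, wordPerm_parWord_left, wordPerm_parWord_left]
    have := h₁.2
    simp only [id, Fin.lt_def, blk] at this ⊢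
    omega

theorem lMap_sWord_mul_rMap_sWord (l₁ : List (Adj (ht β₁))) (l₂ : List (Adj (ht β₂))) :
    D.lMap h (sWord l₁) * D.rMap h (sWord l₂) = sWord (parWord h l₁ l₂) * D.parE h := by
  have h1 := idem_mul_sWord (D := D) (right_le h) l₂
  rw [blockIdem_right h] at h1
  rw [lMap, rMap, blkMap_sWord, blkMap_sWord, blockIdem_right h, parWord, sWord_append, mul_assoc]
  change _ * (D.parE h * _) = _
  rw [← mul_assoc (D.parE h), h1, mul_assoc (sWord _) (D.parE h), parE_idem, mul_assoc]

theorem rMap_sWord_lMap (l : List (Adj (ht β₂))) (a : D.RC β₁) :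
    D.rMap h (sWord l) * D.lMap h a = D.lMap h a * D.rMap h (sWord l) := by
  induction l with
  | nil => rw [sWord_nil, rMap_one, parE_mul_lMap, lMap_mul_parE]
  | cons b l ih =>
    rw [sWord_cons, blkMap_mul, mul_assoc, ih, ← mul_assoc, rMap_lMap_of_par_eq_zero h (.s b) rfl,
      mul_assoc]

theorem phi_bmon (b₁ : D.BIdx β₁) (b₂ : D.BIdx β₂) :
    phi h (bmon b₁) (bmon b₂) = sWord (parWord h (redWord b₁.1) (redWord b₂.1)) *
      (D.lMap h (pmon b₁.2) * D.rMap h (pmon b₂.2)) := by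
  rw [phi_eq, bmon, bmon, blkMap_mul, blkMap_mul, mul_assoc, ← mul_assoc (D.lMap h (pmon _)),
    ← rMap_sWord_lMap, mul_assoc, ← mul_assoc, lMap_sWord_mul_rMap_sWord, mul_assoc,
    ← mul_assoc (D.parE h), parE_mul_lMap]

theorem exists_res_eq (ν₁ : D.Seq β₁) (ν₂ : D.Seq β₂) :
    ∃ μ : D.Seq β, res (left_le h) μ = ν₁.1 ∧ res (right_le h) μ = ν₂.1 := by
  have el : ∀ p : Fin (ht β₁), blk (left_le h) p = finCongr (ht_add h) (Fin.castAdd _ p) := fun p => by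
    ext; simp [blk]
  have er : ∀ p : Fin (ht β₂), blk (right_le h) p = finCongr (ht_add h) (Fin.natAdd _ p) := fun p => by
    ext; simp [blk]
  refine ⟨⟨Fin.append ν₁.1 ν₂.1 ∘ (finCongr (ht_add h)).symm, ?_⟩, ?_, ?_⟩
  · rw [wt, ← (finCongr (ht_add h)).sum_comp, Fin.sum_univ_add]
    refine Eq.trans ?_ h
    congr 1
    · conv_rhs => rw [← ν₁.2]
      simp [wt]
    · conv_rhs => rw [← ν₂.2]
      simp [wt]
  · funext p
    simp [res, el]
  · funext p
    simp [res, er]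

/-- The exponent of a monomial in the variables of both blocks. -/
def parExp (a₁ : Fin (ht β₁) →₀ ℕ) (a₂ : Fin (ht β₂) →₀ ℕ) : Fin (ht β) →₀ ℕ :=
  a₁.mapDomain (blk (left_le h)) + a₂.mapDomain (blk (right_le h))

theorem parExp_left (a₁ : Fin (ht β₁) →₀ ℕ) (a₂ : Fin (ht β₂) →₀ ℕ) (p : Fin (ht β₁)) :
    parExp h a₁ a₂ (blk (left_le h) p) = a₁ p := by
  rw [parExp, Finsupp.add_apply, Finsupp.mapDomain_apply fun _ _ => (blk_inj _).1,
    Finsupp.mapDomain_of_notMem_range, add_zero]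
  rintro ⟨q, hq⟩
  exact blk_ne h p q hq.symm

theorem parExp_right (a₁ : Fin (ht β₁) →₀ ℕ) (a₂ : Fin (ht β₂) →₀ ℕ) (p : Fin (ht β₂)) :
    parExp h a₁ a₂ (blk (right_le h) p) = a₂ p := by
  rw [parExp, Finsupp.add_apply, Finsupp.mapDomain_apply fun _ _ => (blk_inj _).1,
    Finsupp.mapDomain_of_notMem_range, zero_add]
  rintro ⟨q, hq⟩
  exact blk_ne h q p hq

/-- The pairs of indices that agree up to the exponents of the variables. -/
def Match (b b₀ : D.BIdx β₁ × D.BIdx β₂) : Prop :=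
  b.1.1 = b₀.1.1 ∧ b.2.1 = b₀.2.1 ∧ b.1.2.1 = b₀.1.2.1 ∧ b.2.2.1 = b₀.2.2.1 ∧
    b.1.2.2.1 = b₀.1.2.2.1 ∧ b.2.2.2.1 = b₀.2.2.2.1

theorem match_eq {b b₀ : D.BIdx β₁ × D.BIdx β₂} (hm : Match b b₀)
    (he : parExp h b.1.2.2.2 b.2.2.2.2 = parExp h b₀.1.2.2.2 b₀.2.2.2.2) : b = b₀ := by
  obtain ⟨h1, h2, h3, h4, h5, h6⟩ := hm
  have h7 : b.1.2.2.2 = b₀.1.2.2.2 := Finsupp.ext fun p => by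
    rw [← parExp_left h _ b.2.2.2.2, he, parExp_left]
  have h8 : b.2.2.2.2 = b₀.2.2.2.2 := Finsupp.ext fun p => by
    rw [← parExp_right h b.1.2.2.2, he, parExp_right]
  exact Prod.ext (Prod.ext h1 (Prod.ext h3 (Prod.ext h5 h7)))
    (Prod.ext h2 (Prod.ext h4 (Prod.ext h6 h8)))

/-- The list of the positions in two subsets of the blocks. -/
def parLst (S₁ : Finset (Fin (ht β₁))) (S₂ : Finset (Fin (ht β₂))) : List (Fin (ht β)) :=
  (lst S₁).map (blk (left_le h)) ++ (lst S₂).map (blk (right_le h))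

theorem mem_lst {n : ℕ} {S : Finset (Fin n)} {p : Fin n} : p ∈ lst S ↔ p ∈ S := by simp [lst]

theorem nodup_parLst (S₁ : Finset (Fin (ht β₁))) (S₂ : Finset (Fin (ht β₂))) :
    (parLst h S₁ S₂).Nodup := by
  refine List.Nodup.append
    (((List.nodup_finRange _).filter _).map fun _ _ => (blk_inj _).1)
    (((List.nodup_finRange _).filter _).map fun _ _ => (blk_inj _).1) ?_
  intro p hp hq
  obtain ⟨p', -, rfl⟩ := List.mem_map.1 hp
  obtain ⟨q', -, e⟩ := List.mem_map.1 hq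
  exact blk_ne h p' q' e.symm

theorem left_mem_parLst {S₁ : Finset (Fin (ht β₁))} {S₂ : Finset (Fin (ht β₂))} {p : Fin (ht β₁)} :
    blk (left_le h) p ∈ parLst h S₁ S₂ ↔ p ∈ S₁ := by
  rw [parLst, List.mem_append, List.mem_map, List.mem_map]
  constructor
  · rintro (⟨q, hq, e⟩ | ⟨q, hq, e⟩)
    · rw [← (blk_inj _).1 e]; exact mem_lst.1 hq
    · exact absurd e.symm (blk_ne h _ _)
  · exact fun hp => Or.inl ⟨p, mem_lst.2 hp, rfl⟩

theorem right_mem_parLst {S₁ : Finset (Fin (ht β₁))} {S₂ : Finset (Fin (ht β₂))}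
    {p : Fin (ht β₂)} : blk (right_le h) p ∈ parLst h S₁ S₂ ↔ p ∈ S₂ := by
  rw [parLst, List.mem_append, List.mem_map, List.mem_map]
  constructor
  · rintro (⟨q, hq, e⟩ | ⟨q, hq, e⟩)
    · exact absurd e (blk_ne h _ _)
    · rw [← (blk_inj _).1 e]; exact mem_lst.1 hq
  · exact fun hp => Or.inr ⟨p, mem_lst.2 hp, rfl⟩

theorem parLst_inj (ω : D.Config β) {S₁ T₁ : Finset (Fin (ht β₁))} {S₂ T₂ : Finset (Fin (ht β₂))}
    (e : ω.cs (parLst h S₁ S₂) = ω.cs (parLst h T₁ T₂)) : S₁ = T₁ ∧ S₂ = T₂ := by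
  have h1 : ∀ q, q ∈ parLst h S₁ S₂ ↔ q ∈ parLst h T₁ T₂ := by
    intro q
    have := congrArg (fun ω : D.Config β => ω.ε q) e
    simp only [cs_ε _ _ (nodup_parLst h _ _), add_right_inj] at this
    by_cases h2 : q ∈ parLst h S₁ S₂ <;> by_cases h3 : q ∈ parLst h T₁ T₂ <;> simp_all
  exact ⟨Finset.ext fun p => by rw [← left_mem_parLst h, h1, left_mem_parLst],
    Finset.ext fun p => by rw [← right_mem_parLst h, h1, right_mem_parLst]⟩

theorem rep_pmon_pmon {ω : D.Config β} (hw : ω.w = 1) (hε : ω.ε = 0)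
    (hE : D.wt (res (left_le h) ω.ν) = β₁) (b₁ : D.PIdx β₁) (b₂ : D.PIdx β₂) :
    rep D β (D.lMap h (pmon b₁) * D.rMap h (pmon b₂)) (sgl ω 1) = open Classical in
      if res (left_le h) ω.ν = b₁.1.1 ∧ res (right_le h) ω.ν = b₂.1.1 then
        sgl (ω.cs (parLst h b₁.2.1 b₂.2.1))
          ((ω.cs ((lst b₂.2.1).map (blk (right_le h)))).κs ((lst b₁.2.1).map (blk (left_le h))) *
            ω.κs ((lst b₂.2.1).map (blk (right_le h))) *
              toFr k β (MvPolynomial.monomial (parExp h b₁.2.2 b₂.2.2) 1)) else 0 := by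
  have hE' : D.wt (res (right_le h) ω.ν) = β₂ := by
    have h1 := wt_left_add_right h ω.ν
    rw [hE] at h1
    exact add_left_cancel (h1.trans h.symm)
  have hne : ∀ p : Fin (ht β₁), blk (left_le h) p ∉ (lst b₂.2.1).map (blk (right_le h)) := by
    intro p hp
    obtain ⟨q, -, e⟩ := List.mem_map.1 hp
    exact blk_ne h p q e.symm
  have hst := fun p => ω.cs_st_ne _ (hne p)
  have hres : res (left_le h) (ω.cs ((lst b₂.2.1).map (blk (right_le h)))).ν =
      res (left_le h) ω.ν := funext fun p => congrArg Prod.fst (hst p)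
  have e1 := blkRep_pmon (right_le h) hE' b₂ 1
  have e2 := fun r => blkRep_pmon (left_le h)
    (ω := ω.cs ((lst b₂.2.1).map (blk (right_le h)))) (by rw [hres, hE]) b₁ r
  rw [map_mul]
  change blkRep (left_le h) (pmon b₁) (blkRep (right_le h) (pmon b₂) (sgl ω 1)) = _
  rw [e1]
  by_cases h2 : res (right_le h) ω.ν = b₂.1.1
  · rw [if_pos h2, e2, hres]
    by_cases h1 : res (left_le h) ω.ν = b₁.1.1
    · rw [if_pos h1, if_pos ⟨h1, h2⟩, parLst, cs_append]
      congr 1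
      have h3 : ((xlst b₁.2.2).map fun p => (ω.cs ((lst b₂.2.1).map (blk (right_le h)))).x
          (blk (left_le h) p)) = (xlst b₁.2.2).map fun p => ω.x (blk (left_le h) p) :=
        List.map_congr_left fun p _ => congrArg Prod.snd (hst p)
      have h4 : MvPolynomial.monomial (parExp h b₁.2.2 b₂.2.2) (1 : k) =
          MvPolynomial.monomial (b₁.2.2.mapDomain (blk (left_le h))) 1 *
            MvPolynomial.monomial (b₂.2.2.mapDomain (blk (right_le h))) 1 := by
        rw [parExp, MvPolynomial.monomial_mul, one_mul]
      rw [h3, prod_xlst _ hw hε, prod_xlst _ hw hε, mul_one, h4, map_mul]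
      ring
    · rw [if_neg h1, if_neg fun h' => h1 h'.1]
  · rw [if_neg h2, map_zero, if_neg fun h' => h2 h'.2]

theorem wordPerm_parWord_inj {u₁ v₁ : Equiv.Perm (Fin (ht β₁))} {u₂ v₂ : Equiv.Perm (Fin (ht β₂))}
    (e : wordPerm (parWord h (redWord u₁) (redWord u₂)) =
      wordPerm (parWord h (redWord v₁) (redWord v₂))) : u₁ = v₁ ∧ u₂ = v₂ := by
  constructor
  · refine Equiv.ext fun p => (blk_inj (left_le h)).1 ?_
    have := DFunLike.congr_fun e (blk (left_le h) p)
    rwa [wordPerm_parWord_left, wordPerm_parWord_left, wordPerm_redWord, wordPerm_redWord] at this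
  · refine Equiv.ext fun p => (blk_inj (right_le h)).1 ?_
    have := DFunLike.congr_fun e (blk (right_le h) p)
    rwa [wordPerm_parWord_right, wordPerm_parWord_right, wordPerm_redWord, wordPerm_redWord] at this

theorem rep_sWord_sgl_act {ω ω' : D.Config β} (hw : ω.w = 1) (hw' : ω'.w = 1)
    {l l₀ : List (Adj (ht β))} (hl : Red (id : Fin (ht β) → Fin (ht β)) l)
    (hl₀ : Red (id : Fin (ht β) → Fin (ht β)) l₀) (hlen : l.length ≤ l₀.length) (r : Fr k β) :
    rep D β (sWord l) (sgl ω' r) (ω.act (wordPerm l₀)) = open Classical in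
      if wordPerm l₀ = wordPerm l ∧ ω = ω' then r else 0 := by
  have hf : ∀ ω'' : D.Config β, (id : Fin (ht β) → Fin (ht β)) ∘ ω''.w ≠ id →
      sgl ω' r ω'' = 0 := fun ω'' h' => by
    refine sgl_ne (fun e => h' ?_) r
    rw [e, hw']
    rfl
  have hc : (ω.act (wordPerm l₀)).w = wordPerm l₀ := by
    change ω.w * wordPerm l₀ = _
    rw [hw, one_mul]
  have hi : (ω.act (wordPerm l₀)).inv (id : Fin (ht β) → Fin (ht β)) = l₀.length := by
    rw [Config.inv, hc, winv_one monotone_id hl₀]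
  obtain ⟨k1, k2⟩ := rep_sWord_apply monotone_id hf l hl (ω.act (wordPerm l₀))
  rw [hi] at k1 k2
  rcases hlen.lt_or_eq with h1 | h1
  · rw [k1 (by exact_mod_cast h1), if_neg]
    rintro ⟨e, -⟩
    have := winv_one monotone_id hl
    rw [← e, winv_one monotone_id hl₀] at this
    omega
  · rw [k2 (by exact_mod_cast h1.symm), hc]
    by_cases e : wordPerm l₀ = wordPerm l
    · rw [if_pos (by rw [e]), e, act_act_inv]
      by_cases e' : ω = ω'
      · rw [if_pos ⟨rfl, e'⟩, e', sgl_self]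
      · rw [if_neg fun h' => e' h'.2, sgl_ne e']
    · rw [if_neg, if_neg fun h' => e h'.1]
      exact fun h' => e (DFunLike.coe_injective h')

theorem rep_phi_bmon_apply {ω : D.Config β} (hw : ω.w = 1) (hε : ω.ε = 0)
    (b b₀ : D.BIdx β₁ × D.BIdx β₂) (h₁ : res (left_le h) ω.ν = b₀.1.2.1.1)
    (h₂ : res (right_le h) ω.ν = b₀.2.2.1.1)
    (hlen : (parWord h (redWord b.1.1) (redWord b.2.1)).length ≤
      (parWord h (redWord b₀.1.1) (redWord b₀.2.1)).length) :
    rep D β (phi h (bmon b.1) (bmon b.2)) (sgl ω 1) ((ω.cs (parLst h b₀.1.2.2.1 b₀.2.2.2.1)).act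
      (wordPerm (parWord h (redWord b₀.1.1) (redWord b₀.2.1)))) = open Classical in
      if Match b b₀ then (ω.cs ((lst b₀.2.2.2.1).map (blk (right_le h)))).κs
          ((lst b₀.1.2.2.1).map (blk (left_le h))) *
            ω.κs ((lst b₀.2.2.2.1).map (blk (right_le h))) *
              toFr k β (MvPolynomial.monomial (parExp h b.1.2.2.2 b.2.2.2.2) 1) else 0 := by
  have hE : D.wt (res (left_le h) ω.ν) = β₁ := by rw [h₁, b₀.1.2.1.2]
  rw [phi_bmon, map_mul, Module.End.mul_apply, rep_pmon_pmon h hw hε hE]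
  rw [apply_ite (rep D β _), map_zero]
  have e1 := rep_sWord_sgl_act (ω := ω.cs (parLst h b₀.1.2.2.1 b₀.2.2.2.1))
    (ω' := ω.cs (parLst h b.1.2.2.1 b.2.2.2.1)) (by rw [cs_w, hw]) (by rw [cs_w, hw])
    (red_parWord h (red_redWord b.1.1) (red_redWord b.2.1))
    (red_parWord h (red_redWord b₀.1.1) (red_redWord b₀.2.1)) hlen
  by_cases hm : Match b b₀
  · obtain ⟨h3, h4, h5, h6, h7, h8⟩ := id hm
    rw [if_pos hm, if_pos (by rw [h₁, h₂, h5, h6]; exact ⟨rfl, rfl⟩), e1, if_pos, h7, h8]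
    rw [h3, h4, h7, h8]
    exact ⟨rfl, rfl⟩
  · rw [if_neg hm]
    split_ifs with hν
    · rw [e1, if_neg]
      rintro ⟨e, e'⟩
      have h3 := wordPerm_parWord_inj h e
      have h4 := parLst_inj h ω e'
      exact hm ⟨h3.1.symm, h3.2.symm, Subtype.ext (hν.1.symm.trans h₁),
        Subtype.ext (hν.2.symm.trans h₂), h4.1.symm, h4.2.symm⟩
    · rfl

/-- The products of the monomials of the two blocks are independent. -/
theorem bmon_independent (c : (D.BIdx β₁ × D.BIdx β₂) →₀ k)
    (hc : ∀ f : D.FunM β, (∀ ω : D.Config β, ω.w ≠ 1 → f ω = 0) →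
      rep D β (c.sum fun b r => r • phi h (bmon b.1) (bmon b.2)) f = 0) : c = 0 := by
  by_contra hc0
  obtain ⟨b₀, hb₀, hmax⟩ := c.support.exists_max_image
    (fun b => (parWord h (redWord b.1.1) (redWord b.2.1)).length) (Finsupp.support_nonempty_iff.2 hc0)
  obtain ⟨μ, h₁, h₂⟩ := exists_res_eq h b₀.1.2.1 b₀.2.2.1
  let ω : D.Config β := ⟨1, μ, 0⟩
  have h3 := congrFun (hc (sgl ω 1) fun ω' hω' => sgl_ne (fun e => hω' (by rw [e])) _)
    ((ω.cs (parLst h b₀.1.2.2.1 b₀.2.2.2.1)).act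
      (wordPerm (parWord h (redWord b₀.1.1) (redWord b₀.2.1))))
  let L : D.RC β →ₗ[k] Fr k β :=
    { toFun := fun y => rep D β y (sgl ω 1) ((ω.cs (parLst h b₀.1.2.2.1 b₀.2.2.2.1)).act
        (wordPerm (parWord h (redWord b₀.1.1) (redWord b₀.2.1))))
      map_add' := fun y z => by rw [map_add]; rfl
      map_smul' := fun r y => by rw [map_smul]; rfl }
  have h3' : ∑ b ∈ c.support, c b • L (phi h (bmon b.1) (bmon b.2)) = 0 := by
    simp only [← map_smul, ← map_sum]
    exact h3
  have h4 : toFr k β (∑ b ∈ c.support, c b • open Classical in if Match b b₀ then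
      MvPolynomial.monomial (parExp h b.1.2.2.2 b.2.2.2.2) 1 else 0) = 0 := by
    refine (mul_eq_zero.1 (?_ : (ω.cs ((lst b₀.2.2.2.1).map (blk (right_le h)))).κs
          ((lst b₀.1.2.2.1).map (blk (left_le h))) *
            ω.κs ((lst b₀.2.2.2.1).map (blk (right_le h))) * _ = 0)).resolve_left
      (mul_ne_zero (κs_ne_zero _ _) (κs_ne_zero _ _))
    rw [map_sum, Finset.mul_sum]
    refine (Finset.sum_congr rfl fun b hb => ?_).trans h3'
    change _ = c b • rep D β _ _ _
    rw [rep_phi_bmon_apply h rfl rfl b b₀ h₁ h₂ (hmax b hb), map_smul, mul_smul_comm]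
    split_ifs
    · rfl
    · rw [map_zero, mul_zero]
  have h5 := toFr_injective (h4.trans (map_zero _).symm)
  have h6 := congrArg (MvPolynomial.coeff (parExp h b₀.1.2.2.2 b₀.2.2.2.2)) h5
  rw [MvPolynomial.coeff_sum, Finset.sum_eq_single b₀, if_pos ⟨rfl, rfl, rfl, rfl, rfl, rfl⟩,
    MvPolynomial.coeff_smul, MvPolynomial.coeff_monomial, if_pos rfl, smul_eq_mul, mul_one,
    MvPolynomial.coeff_zero] at h6
  · exact Finsupp.mem_support_iff.1 hb₀ h6
  · intro b _ hb
    rw [MvPolynomial.coeff_smul]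
    split_ifs with hm
    · rw [MvPolynomial.coeff_monomial, if_neg fun e => hb (match_eq h hm e), smul_zero]
    · rw [MvPolynomial.coeff_zero, smul_zero]
  · exact fun h' => absurd hb₀ h'

end TwoBlocks

end Datum

end

end QuiverHeckeClifford

namespace QuiverHeckeClifford

set_option linter.unusedSectionVars false

noncomputable section

open TensorProduct

namespace Datum

variable {k I : Type*} [Field k] [DecidableEq I] {D : Datum k I} {β₁ β₂ β : I →₀ ℕ}
  (h : β₁ + β₂ = β)

/-- The block of a position. -/
def side (_ : β₁ + β₂ = β) (p : Fin (ht β)) : Bool := decide (ht β₁ ≤ p.1)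

theorem monotone_side : Monotone (side h) := fun p q hpq => by
  rw [Bool.le_iff_imp]
  simp only [side, decide_eq_true_eq]
  exact fun h' => h'.trans hpq

theorem side_left (p : Fin (ht β₁)) : side h (blk (left_le h) p) = false := by
  have := p.2
  simp [side, blk]

theorem side_right (p : Fin (ht β₂)) : side h (blk (right_le h) p) = true := by
  simp [side, blk]

theorem exists_blk (p : Fin (ht β)) :
    (∃ q, p = blk (left_le h) q) ∨ ∃ q, p = blk (right_le h) q := by
  have h1 := ht_add h
  have h2 := p.2
  by_cases h3 : p.1 < ht β₁
  · exact Or.inl ⟨⟨p.1, h3⟩, Fin.ext (by simp [blk])⟩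
  · exact Or.inr ⟨⟨p.1 - ht β₁, by omega⟩, Fin.ext (by simp [blk]; omega)⟩

theorem exists_blkA {a : Adj (ht β)} (ha : side h a.lo = side h a.hi) :
    (∃ b, a = blkA (left_le h) b) ∨ ∃ b, a = blkA (right_le h) b := by
  have h1 := ht_add h
  have h2 := a.2
  have h3 : ht β₁ ≤ a.1 ↔ ht β₁ ≤ a.1 + 1 := by
    exact decide_eq_decide.1 ha
  by_cases h4 : a.1 < ht β₁
  · exact Or.inl ⟨⟨a.1, by omega⟩, Subtype.ext (by simp [blkA])⟩
  · exact Or.inr ⟨⟨a.1 - ht β₁, by omega⟩, Subtype.ext (by simp [blkA]; omega)⟩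

/-- The homomorphism from the tensor product of two algebras, as a linear map. -/
def phiT : D.RC β₁ ⊗[k] D.RC β₂ →ₗ[k] D.RC β :=
  TensorProduct.lift ((LinearMap.mul k (D.RC β)).compl₁₂ (D.lMap h) (D.rMap h))

theorem phiT_tmul (a : D.RC β₁) (b : D.RC β₂) : phiT h (a ⊗ₜ b) = phi h a b := rfl

theorem phi_one_right (a : D.RC β₁) : phi h a (1 : D.RC β₂) = D.lMap h a := by
  rw [phi_eq, rMap_one, lMap_mul_parE]

theorem phi_one_left (b : D.RC β₂) : phi h (1 : D.RC β₁) b = D.rMap h b := by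
  rw [phi_eq, lMap_one, parE_mul_rMap]

theorem parE_mul_phiT (t : D.RC β₁ ⊗[k] D.RC β₂) : D.parE h * phiT h t = phiT h t := by
  induction t with
  | zero => rw [map_zero, mul_zero]
  | add t u ht hu => rw [map_add, mul_add, ht, hu]
  | tmul a b => rw [phiT_tmul, phi_eq, ← mul_assoc, parE_mul_lMap]

section Flat

variable {β' : I →₀ ℕ} {s : ℕ} (hs : s + ht β' ≤ ht β)

theorem blkVal_mem_flatAlg {Λ : Type*} [LinearOrder Λ] {ω₀ : Fin (ht β) → Λ}
    (hω : ∀ p q, ω₀ (blk hs p) = ω₀ (blk hs q)) (g : Gen D β') : blkVal hs g ∈ D.flatAlg ω₀ := by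
  cases g with
  | e ν =>
    refine sum_mem fun μ _ => ?_
    split_ifs
    · exact polyCliff_le_flatAlg _ (e_mem_polyCliff _)
    · exact zero_mem _
  | x p => exact polyCliff_le_flatAlg _ (x_mem_polyCliff _)
  | s a => exact s_mem_flatAlg (hω a.lo a.hi)
  | c p => exact polyCliff_le_flatAlg _ (c_mem_polyCliff _)

theorem blockIdem_mem_flatAlg {Λ : Type*} [LinearOrder Λ] (ω₀ : Fin (ht β) → Λ) :
    D.blockIdem hs ∈ D.flatAlg ω₀ := by
  refine sum_mem fun μ _ => ?_
  split_ifs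
  · exact polyCliff_le_flatAlg _ (e_mem_polyCliff _)
  · exact zero_mem _

theorem blkMap_mem_flatAlg {Λ : Type*} [LinearOrder Λ] {ω₀ : Fin (ht β) → Λ}
    (hω : ∀ p q, ω₀ (blk hs p) = ω₀ (blk hs q)) (y : D.RC β') : blkMap hs y ∈ D.flatAlg ω₀ := by
  induction y using RC_induction with
  | hgen g =>
    rw [blkMap_val]
    exact MulMemClass.mul_mem (blkVal_mem_flatAlg hs hω g) (blockIdem_mem_flatAlg hs ω₀)
  | hmap r =>
    rw [Algebra.algebraMap_eq_smul_one, map_smul, blkMap_one]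
    exact Subalgebra.smul_mem _ (blockIdem_mem_flatAlg hs ω₀) r
  | hadd a b ha hb => rw [map_add]; exact add_mem ha hb
  | hmul a b ha hb => rw [blkMap_mul]; exact MulMemClass.mul_mem ha hb

end Flat

theorem phiT_mem_flatAlg (t : D.RC β₁ ⊗[k] D.RC β₂) : phiT h t ∈ D.flatAlg (side h) := by
  induction t with
  | zero => rw [map_zero]; exact zero_mem _
  | add t u ht hu => rw [map_add]; exact add_mem ht hu
  | tmul a b =>
    exact MulMemClass.mul_mem
      (blkMap_mem_flatAlg _ (fun p q => by rw [side_left h, side_left h]) a)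
      (blkMap_mem_flatAlg _ (fun p q => by rw [side_right h, side_right h]) b)

theorem fil_le_of_le {Λ : Type*} [LinearOrder Λ] {Z : Type*} [AddCommGroup Z] [Module k Z]
    [Module (D.RC β) Z] (ω₀ : Fin (ht β) → Λ) {V W : Submodule k Z} (hVW : V ≤ W) (m : ℤ) :
    D.fil ω₀ V m ≤ D.fil ω₀ W m :=
  Submodule.span_mono fun _ ⟨l, v, hl, hm, hv, e⟩ => ⟨l, v, hl, hm, hVW hv, e⟩

theorem mem_span_bmon_tmul (hchar : (2 : k) ≠ 0) (t : D.RC β₁ ⊗[k] D.RC β₂) :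
    t ∈ Submodule.span k
      (Set.range fun b : D.BIdx β₁ × D.BIdx β₂ => (bmon b.1 : D.RC β₁) ⊗ₜ[k] (bmon b.2 : D.RC β₂)) := by
  induction t with
  | zero => exact zero_mem _
  | add t u ht hu => exact add_mem ht hu
  | tmul a b =>
    have := Submodule.apply_mem_map₂ (TensorProduct.mk k (D.RC β₁) (D.RC β₂)) (mem_span_bmon hchar a)
      (mem_span_bmon hchar b)
    rwa [Submodule.map₂_span_span, Set.image2_range] at this

/-- The coset of the shorter words determines the coefficient of a reduced word. -/
theorem eq_zero_of_mem_fil (hchar : (2 : k) ≠ 0) {l : List (Adj (ht β))} (hl : Red (side h) l)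
    {t : D.RC β₁ ⊗[k] D.RC β₂}
    (ht' : sWord l * phiT h t ∈ D.fil (side h) (LinearMap.range (phiT (D := D) h)) l.length) :
    t = 0 := by
  obtain ⟨c, rfl⟩ := Finsupp.mem_span_range_iff_exists_finsupp.1 (mem_span_bmon_tmul hchar t)
  have h2 : D.fil (side h) (LinearMap.range (phiT (D := D) h)) l.length ≤
      D.fil (side h) (Subalgebra.toSubmodule (D.flatAlg (side h))) l.length := by
    refine fil_le_of_le _ ?_ _
    rintro _ ⟨t, rfl⟩
    exact phiT_mem_flatAlg h t
  have h3 : c = 0 := by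
    refine bmon_independent h c fun f hf => ?_
    have := rep_eq_zero_of_mem_fil (monotone_side h) hl (phiT_mem_flatAlg h _) (h2 ht') (f := f)
      fun ω hω => hf ω fun e => hω (by rw [e]; rfl)
    rw [← this, Finsupp.sum, Finsupp.sum, map_sum (phiT h)]
    refine congrArg (fun y => rep D β y f) (Finset.sum_congr rfl fun b _ => ?_)
    rw [map_smul, phiT_tmul]
  rw [h3, Finsupp.sum_zero_index]

theorem e_mul_parE (ν : D.Seq β) : ∃ t : D.RC β₁ ⊗[k] D.RC β₂, eRC ν * D.parE h = phiT h t := by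
  by_cases hν : D.wt (res (left_le h) ν) = β₁
  · have hν' : D.wt (res (right_le h) ν) = β₂ := by
      have h1 := wt_left_add_right h ν
      rw [hν] at h1
      exact add_left_cancel (h1.trans h.symm)
    refine ⟨eRC ⟨_, hν⟩ ⊗ₜ eRC ⟨_, hν'⟩, eq_of_mul_e fun μ => ?_⟩
    rw [phiT_tmul, phi]
    rw [blockHom_e, blockHom_e, mul_assoc, mul_assoc, blockE_mul_e, parE, blockIdem_mul_e, mul_ite,
      mul_ite, mul_zero, mul_zero, blockE_mul_e, e_e]
    by_cases e : ν = μ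
    · subst e
      simp [hν]
    · have : ¬(res (right_le h) μ = res (right_le h) ν ∧ res (left_le h) μ = res (left_le h) ν) := by
        rintro ⟨h1, h2⟩
        refine e (Subtype.ext (funext fun p => ?_))
        rcases exists_blk h p with ⟨q, rfl⟩ | ⟨q, rfl⟩
        · exact (congrFun h2 q).symm
        · exact (congrFun h1 q).symm
      rw [if_neg e, ite_self, ← ite_and, if_neg this]
  · refine ⟨0, ?_⟩
    rw [map_zero, parE, blockIdem, Finset.mul_sum]
    refine Finset.sum_eq_zero fun μ _ => ?_
    by_cases e : ν = μ
    · subst e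
      rw [if_neg hν, mul_zero]
    · split_ifs
      · rw [e_e, if_neg e]
      · rw [mul_zero]

/-- The generators that preserve the blocks. -/
def FlatGen (h : β₁ + β₂ = β) : Gen D β → Prop
  | .s a => side h a.lo = side h a.hi
  | _ => True

theorem flatGen_mul_parE {g : Gen D β} (hg : FlatGen h g) :
    ∃ t : D.RC β₁ ⊗[k] D.RC β₂, g.val * D.parE h = phiT h t := by
  have hl : ∀ g' : Gen D β₁, ∃ t : D.RC β₁ ⊗[k] D.RC β₂,
      blkVal (left_le h) g' * D.parE h = phiT h t := fun g' =>
    ⟨g'.val ⊗ₜ 1, by rw [phiT_tmul, phi_one_right, lMap_val]⟩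
  have hr : ∀ g' : Gen D β₂, ∃ t : D.RC β₁ ⊗[k] D.RC β₂,
      blkVal (right_le h) g' * D.parE h = phiT h t := fun g' =>
    ⟨1 ⊗ₜ g'.val, by rw [phiT_tmul, phi_one_left, rMap_val]⟩
  cases g with
  | e ν => exact e_mul_parE h ν
  | x p =>
    rcases exists_blk h p with ⟨q, rfl⟩ | ⟨q, rfl⟩
    · exact hl (.x q)
    · exact hr (.x q)
  | s a =>
    rcases exists_blkA h hg with ⟨b, rfl⟩ | ⟨b, rfl⟩
    · exact hl (.s b)
    · exact hr (.s b)
  | c p =>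
    rcases exists_blk h p with ⟨q, rfl⟩ | ⟨q, rfl⟩
    · exact hl (.c q)
    · exact hr (.c q)

end Datum

namespace SGMod

open Datum

variable {k I : Type*} [Field k] [DecidableEq I] {D : Datum k I} {β₁ β₂ β : I →₀ ℕ}
  (h : β₁ + β₂ = β) (M₁ : SGMod D β₁) (M₂ : SGMod D β₂)

/-- The parity involution. -/
def inv (M : SGMod D β) : M.carrier →ₗ[k] M.carrier :=
  parComp M.internal 0 - parComp M.internal 1

theorem inv_of_mem (M : SGMod D β) {g : ℤ × ZMod 2} {m : M.carrier} (hm : m ∈ M.piece g) :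
    M.inv m = sgn k g.2 • m := by
  have h2 : ∀ p : ZMod 2, p = 0 ∨ p = 1 := by decide
  rw [inv, LinearMap.sub_apply, parComp_of_mem _ _ hm, parComp_of_mem _ _ hm]
  rcases h2 g.2 with h3 | h3 <;> simp [h3, sgn_zero, sgn_one]

/-- The action of the first algebra on the tensor product. -/
def actL : D.RC β₁ →ₗ[k] Module.End k (M₁.carrier ⊗[k] M₂.carrier) :=
  LinearMap.rTensorHom M₂.carrier ∘ₗ (Algebra.lsmul k k M₁.carrier).toLinearMap

/-- The action of the second algebra on the tensor product. -/
def actR : D.RC β₂ →ₗ[k] Module.End k (M₁.carrier ⊗[k] M₂.carrier) :=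
  LinearMap.lTensorHom M₁.carrier ∘ₗ (Algebra.lsmul k k M₂.carrier).toLinearMap ∘ₗ
      parComp isInternal_RC 0 +
    LinearMap.mulLeft k (LinearMap.rTensor M₂.carrier M₁.inv : Module.End k _) ∘ₗ
      LinearMap.lTensorHom M₁.carrier ∘ₗ (Algebra.lsmul k k M₂.carrier).toLinearMap ∘ₗ
        parComp isInternal_RC 1

/-- The action of the tensor product of two algebras. -/
def act : D.RC β₁ ⊗[k] D.RC β₂ →ₗ[k] Module.End k (M₁.carrier ⊗[k] M₂.carrier) :=
  TensorProduct.lift ((LinearMap.mul k (Module.End k (M₁.carrier ⊗[k] M₂.carrier))).compl₁₂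
    (actL M₁ M₂) (actR M₁ M₂))

variable {M₁ M₂}

theorem actL_tmul (a : D.RC β₁) (m₁ : M₁.carrier) (m₂ : M₂.carrier) :
    actL M₁ M₂ a (m₁ ⊗ₜ m₂) = (a • m₁) ⊗ₜ m₂ := rfl

theorem actR_tmul {b : D.RC β₂} {g g' : ℤ × ZMod 2} (hb : b ∈ D.piece β₂ g) {m₁ : M₁.carrier}
    (hm : m₁ ∈ M₁.piece g') (m₂ : M₂.carrier) :
    actR M₁ M₂ b (m₁ ⊗ₜ m₂) = sgn k (g.2 * g'.2) • (m₁ ⊗ₜ (b • m₂)) := by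
  have h2 : ∀ p : ZMod 2, p = 0 ∨ p = 1 := by decide
  have e : actR M₁ M₂ b (m₁ ⊗ₜ m₂) = m₁ ⊗ₜ (parComp isInternal_RC 0 b • m₂) +
    (M₁.inv m₁) ⊗ₜ (parComp isInternal_RC 1 b • m₂) := rfl
  rw [e, inv_of_mem _ hm, parComp_of_mem _ _ hb, parComp_of_mem _ _ hb]
  rcases h2 g.2 with h3 | h3 <;> simp [h3, sgn_zero, TensorProduct.smul_tmul']

theorem act_tmul (a : D.RC β₁) (b : D.RC β₂) : act M₁ M₂ (a ⊗ₜ b) = actL M₁ M₂ a * actR M₁ M₂ b := rfl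

theorem act_tmul_tmul (a : D.RC β₁) {b : D.RC β₂} {g g' : ℤ × ZMod 2} (hb : b ∈ D.piece β₂ g)
    {m₁ : M₁.carrier} (hm : m₁ ∈ M₁.piece g') (m₂ : M₂.carrier) :
    act M₁ M₂ (a ⊗ₜ b) (m₁ ⊗ₜ m₂) = sgn k (g.2 * g'.2) • ((a • m₁) ⊗ₜ (b • m₂)) := by
  rw [act_tmul, Module.End.mul_apply, actR_tmul hb hm, map_smul, actL_tmul]

theorem tensor_ext {N : Type*} [AddCommGroup N] [Module k N]
    {f f' : M₁.carrier ⊗[k] M₂.carrier →ₗ[k] N}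
    (H : ∀ g g' : ℤ × ZMod 2, ∀ m₁ ∈ M₁.piece g, ∀ m₂ ∈ M₂.piece g', f (m₁ ⊗ₜ m₂) = f' (m₁ ⊗ₜ m₂)) :
    f = f' := by
  refine TensorProduct.ext' fun m₁ m₂ => ?_
  induction m₁ using graded_induction M₁.internal with
  | h0 => rw [TensorProduct.zero_tmul, map_zero, map_zero]
  | hadd m m' hm hm' => rw [TensorProduct.add_tmul, map_add, map_add, hm, hm']
  | hV g m₁ hm₁ =>
  induction m₂ using graded_induction M₂.internal with
  | h0 => rw [TensorProduct.tmul_zero, map_zero, map_zero]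
  | hadd m m' hm hm' => rw [TensorProduct.tmul_add, map_add, map_add, hm, hm']
  | hV g' m₂ hm₂ => exact H g g' m₁ hm₁ m₂ hm₂

theorem actL_one : actL M₁ M₂ 1 = 1 := tensor_ext fun _ _ _ _ _ _ => by
  rw [actL_tmul, one_smul, Module.End.one_apply]

theorem actR_one : actR M₁ M₂ 1 = 1 := tensor_ext fun _ _ _ hm _ _ => by
  rw [actR_tmul Datum.one_mem hm, one_smul, Module.End.one_apply, Prod.snd_zero, zero_mul, sgn_zero,
    one_smul]

theorem actL_mul (a a' : D.RC β₁) : actL M₁ M₂ (a * a') = actL M₁ M₂ a * actL M₁ M₂ a' :=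
  tensor_ext fun _ _ _ _ _ _ => by rw [Module.End.mul_apply, actL_tmul, actL_tmul, actL_tmul, mul_smul]

theorem actR_mul (b b' : D.RC β₂) : actR M₁ M₂ (b * b') = actR M₁ M₂ b * actR M₁ M₂ b' := by
  induction b using graded_induction isInternal_RC with
  | h0 => rw [zero_mul, map_zero, zero_mul]
  | hadd b c hb hc => rw [add_mul, map_add, hb, hc, map_add, add_mul]
  | hV g b hb =>
  induction b' using graded_induction isInternal_RC with
  | h0 => rw [mul_zero, map_zero, mul_zero]
  | hadd b c hb hc => rw [mul_add, map_add, hb, hc, map_add, mul_add]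
  | hV g' b' hb' =>
  refine tensor_ext fun g₁ _ m₁ hm _ _ => ?_
  rw [Module.End.mul_apply, actR_tmul (Datum.mul_mem hb hb') hm, actR_tmul hb' hm, map_smul,
    actR_tmul hb hm, smul_smul, ← sgn_add, mul_smul, Prod.snd_add, add_mul, add_comm]

theorem actR_actL (a : D.RC β₁) (b : D.RC β₂) {g g' : ℤ × ZMod 2} (ha : a ∈ D.piece β₁ g)
    (hb : b ∈ D.piece β₂ g') :
    actR M₁ M₂ b * actL M₁ M₂ a = sgn k (g'.2 * g.2) • (actL M₁ M₂ a * actR M₁ M₂ b) :=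
  tensor_ext fun g₁ _ m₁ hm _ _ => by
    rw [LinearMap.smul_apply, Module.End.mul_apply, Module.End.mul_apply, actL_tmul,
      actR_tmul hb (M₁.smul_mem _ _ _ ha _ hm), actR_tmul hb hm, map_smul, actL_tmul, smul_smul,
      ← sgn_add, Prod.snd_add, mul_add]

theorem act_one : act M₁ M₂ (1 ⊗ₜ 1) = 1 := by rw [act_tmul, actL_one, actR_one, one_mul]

theorem exists_phiT_mul (t u : D.RC β₁ ⊗[k] D.RC β₂) :
    ∃ t', phiT h t' = phiT h t * phiT h u ∧ act M₁ M₂ t' = act M₁ M₂ t * act M₁ M₂ u := by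
  induction t with
  | zero => exact ⟨0, by rw [map_zero, zero_mul], by rw [map_zero, zero_mul]⟩
  | add t₁ t₂ h₁ h₂ =>
    obtain ⟨t₁', e₁, f₁⟩ := h₁
    obtain ⟨t₂', e₂, f₂⟩ := h₂
    exact ⟨t₁' + t₂', by rw [map_add, map_add, add_mul, e₁, e₂],
      by rw [map_add, map_add, add_mul, f₁, f₂]⟩
  | tmul a b =>
  induction u with
  | zero => exact ⟨0, by rw [map_zero, mul_zero], by rw [map_zero, mul_zero]⟩
  | add t₁ t₂ h₁ h₂ =>
    obtain ⟨t₁', e₁, f₁⟩ := h₁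
    obtain ⟨t₂', e₂, f₂⟩ := h₂
    exact ⟨t₁' + t₂', by rw [map_add, map_add, mul_add, e₁, e₂],
      by rw [map_add, map_add, mul_add, f₁, f₂]⟩
  | tmul a' b' =>
  induction b using graded_induction isInternal_RC with
  | h0 => exact ⟨0, by simp, by simp⟩
  | hadd b c hb hc =>
    obtain ⟨t₁', e₁, f₁⟩ := hb
    obtain ⟨t₂', e₂, f₂⟩ := hc
    exact ⟨t₁' + t₂', by rw [map_add, TensorProduct.tmul_add, map_add, add_mul, e₁, e₂],
      by rw [map_add, TensorProduct.tmul_add, map_add, add_mul, f₁, f₂]⟩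
  | hV g b hb =>
  induction a' using graded_induction isInternal_RC with
  | h0 => exact ⟨0, by simp, by simp⟩
  | hadd b c hb hc =>
    obtain ⟨t₁', e₁, f₁⟩ := hb
    obtain ⟨t₂', e₂, f₂⟩ := hc
    exact ⟨t₁' + t₂', by rw [map_add, TensorProduct.add_tmul, map_add, mul_add, e₁, e₂],
      by rw [map_add, TensorProduct.add_tmul, map_add, mul_add, f₁, f₂]⟩
  | hV g' a' ha' =>
    refine ⟨sgn k (g.2 * g'.2) • ((a * a') ⊗ₜ (b * b')), ?_, ?_⟩
    · rw [map_smul, phiT_tmul, phiT_tmul, phiT_tmul, phi_mul_phi h ha' hb]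
    · rw [map_smul, act_tmul, act_tmul, act_tmul, actL_mul, actR_mul, mul_assoc, mul_assoc,
        ← mul_assoc (actR M₁ M₂ b), actR_actL a' b ha' hb, smul_mul_assoc, mul_smul_comm, mul_assoc]

/-- The top of the convolution product. -/
def iota (h : β₁ + β₂ = β) (M₁ : SGMod D β₁) (M₂ : SGMod D β₂) :
    M₁.carrier ⊗[k] M₂.carrier →ₗ[k] Conv h M₁ M₂ := convBil h M₁ M₂ 1

theorem smul_iota (y : D.RC β) (v : M₁.carrier ⊗[k] M₂.carrier) :
    y • iota h M₁ M₂ v = convBil h M₁ M₂ y v := by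
  rw [iota, convBil_apply, convBil_apply, ← map_smul, TensorProduct.smul_tmul', ← map_smul, smul_eq_mul,
    mul_one]

theorem smul_phi_iota (y : D.RC β) (a : D.RC β₁) (b : D.RC β₂) (v : M₁.carrier ⊗[k] M₂.carrier) :
    (y * phi h a b) • iota h M₁ M₂ v = y • iota h M₁ M₂ (act M₁ M₂ (a ⊗ₜ b) v) := by
  rw [mul_smul]
  congr 1
  induction b using graded_induction isInternal_RC with
  | h0 => simp [phi_eq]
  | hadd b c hb hc =>
    rw [TensorProduct.tmul_add, map_add, LinearMap.add_apply, map_add, ← hb, ← hc, ← add_smul, phi_eq,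
      phi_eq, phi_eq, map_add, mul_add]
  | hV g b hb =>
  refine LinearMap.congr_fun (f := Algebra.lsmul k k (Conv h M₁ M₂) (phi h a b) ∘ₗ iota h M₁ M₂)
    (g := iota h M₁ M₂ ∘ₗ act M₁ M₂ (a ⊗ₜ b)) (tensor_ext fun g₁ _ m₁ hm m₂ _ => ?_) v
  rw [LinearMap.comp_apply, LinearMap.comp_apply]
  change phi h a b • iota h M₁ M₂ (m₁ ⊗ₜ m₂) = _
  rw [smul_iota, act_tmul_tmul a hb hm, iota, convBil_apply, convBil_apply, ← mkConv_phi h _ a m₂ hb hm]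
  congr 2
  refine Subtype.ext ?_
  change phi h a b * D.parE h = 1 * D.parE h * phi h a b
  rw [phi_mul_parE, one_mul, phi_eq, ← mul_assoc, parE_mul_lMap]

theorem phiT_smul_iota (t : D.RC β₁ ⊗[k] D.RC β₂) (v : M₁.carrier ⊗[k] M₂.carrier) :
    phiT h t • iota h M₁ M₂ v = iota h M₁ M₂ (act M₁ M₂ t v) := by
  induction t with
  | zero => rw [map_zero, zero_smul, map_zero, LinearMap.zero_apply, map_zero]
  | add t u ht hu => rw [map_add, add_smul, ht, hu, map_add, LinearMap.add_apply, map_add]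
  | tmul a b =>
    rw [phiT_tmul, ← one_mul (phi h a b), smul_phi_iota, one_smul]

theorem parE_smul_iota (v : M₁.carrier ⊗[k] M₂.carrier) :
    D.parE h • iota h M₁ M₂ v = iota h M₁ M₂ v := by
  have := phiT_smul_iota h (1 ⊗ₜ 1) v
  rwa [phiT_tmul, phi_one_left, rMap_one, act_one] at this

theorem lMap_smul_iota (a : D.RC β₁) (v : M₁.carrier ⊗[k] M₂.carrier) :
    D.lMap h a • iota h M₁ M₂ v = iota h M₁ M₂ (actL M₁ M₂ a v) := by
  rw [← phi_one_right, ← phiT_tmul, phiT_smul_iota, act_tmul, actR_one, mul_one]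

theorem rMap_smul_iota (b : D.RC β₂) (v : M₁.carrier ⊗[k] M₂.carrier) :
    D.rMap h b • iota h M₁ M₂ v = iota h M₁ M₂ (actR M₁ M₂ b v) := by
  rw [← phi_one_left, ← phiT_tmul, phiT_smul_iota, act_tmul, actL_one, one_mul]

end SGMod

namespace Datum

variable {k I : Type*} [Field k] [DecidableEq I] {D : Datum k I} {β₁ β₂ β : I →₀ ℕ}
  (h : β₁ + β₂ = β)

theorem isStable_of_flatGen {Z : Type*} [AddCommGroup Z] [Module k Z] [Module (D.RC β) Z]
    [IsScalarTower k (D.RC β) Z] {V : Submodule k Z}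
    (H : ∀ g : Gen D β, FlatGen h g → ∀ v ∈ V, g.val • v ∈ V) : D.IsStable (side h) V where
  smul_mem y hy := by
    induction hy using Algebra.adjoin_induction with
    | mem y hy =>
      obtain ⟨ν, rfl⟩ | ⟨p, rfl⟩ | ⟨p, rfl⟩ := hy
      · exact H (.e ν) trivial
      · exact H (.x p) trivial
      · exact H (.c p) trivial
    | algebraMap r => exact fun v hv => by rw [algebraMap_smul]; exact V.smul_mem r hv
    | add y z _ _ hy hz => exact fun v hv => by rw [add_smul]; exact add_mem (hy v hv) (hz v hv)
    | mul y z _ _ hy hz => exact fun v hv => by rw [mul_smul]; exact hy _ (hz v hv)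
  s_smul_mem a ha v hv := H (.s a) ha v hv

end Datum

namespace SGMod

open Datum

variable {k I : Type*} [Field k] [DecidableEq I] {D : Datum k I} {β₁ β₂ β : I →₀ ℕ}
  (h : β₁ + β₂ = β) (M₁ : SGMod D β₁) (M₂ : SGMod D β₂)

theorem isStable_range_phiT (M₁ : SGMod D β₁) (M₂ : SGMod D β₂) : D.IsStable (side h) (LinearMap.range (phiT (D := D) h)) := by
  refine isStable_of_flatGen h fun g hg v hv => ?_
  obtain ⟨t, rfl⟩ := hv
  obtain ⟨u, hu⟩ := flatGen_mul_parE h hg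
  obtain ⟨t', e, -⟩ := exists_phiT_mul (M₁ := M₁) (M₂ := M₂) h u t
  refine ⟨t', ?_⟩
  rw [e, ← hu, mul_assoc, parE_mul_phiT, smul_eq_mul]

theorem isStable_range_iota : D.IsStable (side h) (LinearMap.range (iota h M₁ M₂)) := by
  refine isStable_of_flatGen h fun g hg v hv => ?_
  obtain ⟨v, rfl⟩ := hv
  obtain ⟨u, hu⟩ := flatGen_mul_parE h hg
  refine ⟨act M₁ M₂ u v, ?_⟩
  rw [← phiT_smul_iota, ← hu, mul_smul, parE_smul_iota]

end SGMod

end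

end QuiverHeckeClifford

namespace QuiverHeckeClifford

set_option linter.unusedSectionVars false

noncomputable section

open TensorProduct

theorem Red.lt_of_eq {n : ℕ} {Λ : Type*} [LinearOrder Λ] {ω₀ : Fin n → Λ} {l : List (Adj n)}
    (hl : Red ω₀ l) {p q : Fin n} (hpq : p < q) (h : ω₀ (wordPerm l p) = ω₀ (wordPerm l q)) :
    wordPerm l p < wordPerm l q := by
  induction l generalizing p q with
  | nil => exact hpq
  | cons a l ih =>
    rw [wordPerm_cons] at h ⊢
    rw [wordPerm_cons] at h ⊢
    by_cases h1 : a.s p < a.s q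
    · exact ih hl.1 h1 h
    · exfalso
      have h2 : p = a.lo ∧ q = a.hi := by
        have e1 := a.s_val p
        have e2 := a.s_val q
        rw [Fin.lt_def] at h1 hpq
        simp only [Fin.ext_iff, Adj.lo, Adj.hi]
        split_ifs at e1 e2 <;> omega
      obtain ⟨rfl, rfl⟩ := h2
      rw [a.s_lo, a.s_hi] at h
      exact hl.2.ne' h

namespace Datum

variable {k I : Type*} [Field k] [DecidableEq I] {D : Datum k I} {β₁ β₂ β : I →₀ ℕ}
  (h : β₁ + β₂ = β) (h' : β₂ + β₁ = β)

/-- The permutation that interchanges the two blocks. -/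
def flip : Equiv.Perm (Fin (ht β)) :=
  ((finCongr (ht_add h')).symm.trans finAddFlip).trans (finCongr (ht_add h))

theorem flip_left (q : Fin (ht β₂)) : flip h h' (blk (left_le h') q) = blk (right_le h) q := by
  have e : blk (left_le h') q = finCongr (ht_add h') (Fin.castAdd _ q) := by ext; simp [blk]
  rw [e]
  ext
  simp [flip, blk]

theorem flip_right (p : Fin (ht β₁)) : flip h h' (blk (right_le h') p) = blk (left_le h) p := by
  have e : blk (right_le h') p = finCongr (ht_add h') (Fin.natAdd _ p) := by ext; simp [blk]
  rw [e]
  ext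
  simp [flip, blk]

theorem side_flip (p : Fin (ht β)) : side h (flip h h' p) = !side h' p := by
  rcases exists_blk h' p with ⟨q, rfl⟩ | ⟨q, rfl⟩
  · rw [flip_left, side_right, side_left]; rfl
  · rw [flip_right, side_left, side_right]; rfl

/-- The reduced words that interchange the two blocks. -/
structure IsTop (l : List (Adj (ht β))) : Prop where
  red : Red (side h) l
  side_eq : ∀ p, side h (wordPerm l p) = !side h' p

theorem exists_isTop : ∃ l, IsTop h h' l := by
  obtain ⟨l, hl, e⟩ := exists_red (monotone_side h) (flip h h')
  exact ⟨l, hl, fun p => (congrFun e p).trans (side_flip h h' p)⟩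

theorem IsTop.length_eq {l l' : List (Adj (ht β))} (hl : IsTop h h' l) (hl' : IsTop h h' l') :
    l.length = l'.length :=
  length_eq_of_red (monotone_side h) hl.red hl'.red
    (funext fun p => (hl.side_eq p).trans (hl'.side_eq p).symm)

theorem IsTop.wordPerm_left {l : List (Adj (ht β))} (hl : IsTop h h' l) (q : Fin (ht β₂)) :
    wordPerm l (blk (left_le h') q) = blk (right_le h) q := by
  have hs : ∀ q, side h (wordPerm l (blk (left_le h') q)) = true := fun q => by
    rw [hl.side_eq, side_left]; rfl
  have hf : StrictMono fun q => wordPerm l (blk (left_le h') q) := fun p q hpq =>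
    hl.red.lt_of_eq (by simpa [blk] using hpq) (by rw [hs, hs])
  have hg : StrictMono fun q : Fin (ht β₂) => blk (right_le h) q := fun p q hpq => by
    simpa [blk] using hpq
  refine congrFun ((hf.range_inj hg).1 ?_) q
  ext x
  constructor
  · rintro ⟨q, rfl⟩
    rcases exists_blk h (wordPerm l (blk (left_le h') q)) with ⟨r, e⟩ | ⟨r, e⟩
    · have := hs q
      rw [e, side_left] at this
      exact absurd this (by decide)
    · exact ⟨r, e.symm⟩
  · rintro ⟨q, rfl⟩
    obtain ⟨y, hy⟩ := (wordPerm l).surjective (blk (right_le h) q)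
    rcases exists_blk h' y with ⟨r, rfl⟩ | ⟨r, rfl⟩
    · exact ⟨r, hy⟩
    · have := hl.side_eq (blk (right_le h') r)
      rw [hy, side_right, side_right] at this
      exact absurd this (by decide)

theorem IsTop.wordPerm_right {l : List (Adj (ht β))} (hl : IsTop h h' l) (q : Fin (ht β₁)) :
    wordPerm l (blk (right_le h') q) = blk (left_le h) q := by
  have hs : ∀ q, side h (wordPerm l (blk (right_le h') q)) = false := fun q => by
    rw [hl.side_eq, side_right]; rfl
  have hf : StrictMono fun q => wordPerm l (blk (right_le h') q) := fun p q hpq =>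
    hl.red.lt_of_eq (by simpa [blk] using hpq) (by rw [hs, hs])
  have hg : StrictMono fun q : Fin (ht β₁) => blk (left_le h) q := fun p q hpq => by
    simpa [blk] using hpq
  refine congrFun ((hf.range_inj hg).1 ?_) q
  ext x
  constructor
  · rintro ⟨q, rfl⟩
    rcases exists_blk h (wordPerm l (blk (right_le h') q)) with ⟨r, e⟩ | ⟨r, e⟩
    · exact ⟨r, e.symm⟩
    · have := hs q
      rw [e, side_right] at this
      exact absurd this (by decide)
  · rintro ⟨q, rfl⟩
    obtain ⟨y, hy⟩ := (wordPerm l).surjective (blk (left_le h) q)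
    rcases exists_blk h' y with ⟨r, rfl⟩ | ⟨r, rfl⟩
    · have := hl.side_eq (blk (left_le h') r)
      rw [hy, side_left, side_left] at this
      exact absurd this (by decide)
    · exact ⟨r, hy⟩

/-- Words with complementary results compose to a word that interchanges the blocks. -/
theorem isTop_reverse_append {l l' : List (Adj (ht β))} (hl : Red (side h) l)
    (hl' : Red (side h') l') (e : ∀ p, side h (wordPerm l p) = !side h' (wordPerm l' p)) :
    IsTop h h' (l'.reverse ++ l) := by
  induction l' generalizing l with
  | nil => exact ⟨hl, e⟩
  | cons a l' ih =>
    rw [List.reverse_cons, List.append_assoc]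
    change IsTop h h' (l'.reverse ++ (a :: l))
    refine ih ⟨hl, ?_⟩ hl'.1 fun p => ?_
    · have h1 := e a.lo
      have h2 := e a.hi
      have h3 := hl'.2
      rw [wordPerm_cons, a.s_lo] at h1
      rw [wordPerm_cons, a.s_hi] at h2
      rw [Bool.lt_iff] at h3 ⊢
      rw [h1, h2, h3.1, h3.2]
      exact ⟨rfl, rfl⟩
    · rw [wordPerm_cons, e, wordPerm_cons, a.s_s]

theorem exists_complement (l : List (Adj (ht β))) :
    ∃ l', Red (side h') l' ∧ ∀ p, side h (wordPerm l p) = !side h' (wordPerm l' p) := by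
  obtain ⟨l', hl', e⟩ := exists_red (monotone_side h') (flip h' h * wordPerm l)
  refine ⟨l', hl', fun p => ?_⟩
  have := congrFun e p
  simp only [Function.comp_apply, Equiv.Perm.mul_apply] at this
  rw [this, side_flip, Bool.not_not]

theorem length_le_of_isTop {l₀ l : List (Adj (ht β))} (h₀ : IsTop h h' l₀) (hl : Red (side h) l) :
    l.length ≤ l₀.length ∧ (l.length = l₀.length → IsTop h h' l) := by
  obtain ⟨l', hl', e⟩ := exists_complement h h' l
  have h1 := (isTop_reverse_append h h' hl hl' e).length_eq h h' h₀
  rw [List.length_append, List.length_reverse] at h1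
  refine ⟨by omega, fun h2 => ?_⟩
  have h3 : l' = [] := List.eq_nil_of_length_eq_zero (by omega)
  subst h3
  exact ⟨hl, e⟩

end Datum

end

end QuiverHeckeClifford

namespace QuiverHeckeClifford

set_option linter.unusedSectionVars false

noncomputable section

open TensorProduct

namespace Datum

variable {k I : Type*} [Field k] [DecidableEq I] {D : Datum k I} {β₁ β₂ β : I →₀ ℕ}
  {h : β₁ + β₂ = β} {h' : β₂ + β₁ = β} {l₀ : List (Adj (ht β))}

section

variable {Z : Type*} [AddCommGroup Z] [Module k Z] [Module (D.RC β) Z] [IsScalarTower k (D.RC β) Z]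
  {V : Submodule k Z}

theorem smul_mem_fil_top (h₀ : IsTop h h' l₀) (hV : D.IsStable (side h) V) (y : D.RC β) {v : Z}
    (hv : v ∈ V) : y • v ∈ D.fil (side h) V (l₀.length + 1) := by
  have h1 : ⨆ m, D.fil (side h) V m ≤ D.fil (side h) V (l₀.length + 1) := by
    refine iSup_le fun m => Submodule.span_mono ?_
    rintro _ ⟨l, v, hl, -, hv, rfl⟩
    have := (length_le_of_isTop h h' h₀ hl).1
    exact ⟨l, v, hl, by omega, hv, rfl⟩
  refine h1 (polyCliff_smul_mem_iSup (monotone_side h) hV y (Submodule.mem_iSup_of_mem 1 ?_))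
  have := sWord_mem_fil (D := D) (ω₀ := side h) (l := []) trivial (m := 1) (by simp) hv
  rwa [sWord_nil, one_smul] at this

theorem exists_sub_mem_fil (h₀ : IsTop h h' l₀) (hV : D.IsStable (side h) V) {z : Z}
    (hz : z ∈ D.fil (side h) V (l₀.length + 1)) :
    ∃ v ∈ V, z - (sWord l₀ : D.RC β) • v ∈ D.fil (side h) V l₀.length := by
  induction hz using Submodule.span_induction with
  | zero => exact ⟨0, zero_mem _, by rw [smul_zero, sub_zero]; exact zero_mem _⟩
  | add z w _ _ hz hw =>
    obtain ⟨v, hv, e⟩ := hz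
    obtain ⟨v', hv', e'⟩ := hw
    exact ⟨v + v', add_mem hv hv', by rw [smul_add, add_sub_add_comm]; exact add_mem e e'⟩
  | smul r z _ hz =>
    obtain ⟨v, hv, e⟩ := hz
    exact ⟨r • v, V.smul_mem r hv, by
      rw [smul_algebra_smul_comm, ← smul_sub]; exact Submodule.smul_mem _ _ e⟩
  | mem z hz =>
    obtain ⟨l, v, hl, hlen, hv, rfl⟩ := hz
    by_cases e : l.length = l₀.length
    · have hl' := (length_le_of_isTop h h' h₀ hl).2 e
      refine ⟨v, hv, fil_mono (by omega) ((red_unique (monotone_side h) l.length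
        (fun j _ => filGood (monotone_side h) hV j) l l₀ hl h₀.red ?_ rfl).2 v hv)⟩
      exact funext fun p => (hl'.side_eq p).trans (h₀.side_eq p).symm
    · refine ⟨0, zero_mem _, ?_⟩
      rw [smul_zero, sub_zero]
      exact sWord_mem_fil hl (by omega) hv

end

theorem exists_topCoeff (hchar : (2 : k) ≠ 0) (h₀ : IsTop h h' l₀) :
    ∃ T : D.RC β →ₗ[k] D.RC β₁ ⊗[k] D.RC β₂, (∀ t, T (sWord l₀ * phiT h t) = t) ∧
      ∀ z ∈ D.fil (side h) (LinearMap.range (phiT (D := D) h)) l₀.length, T z = 0 := by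
  let F := D.fil (side h) (LinearMap.range (phiT (D := D) h)) l₀.length
  let S : D.RC β₁ ⊗[k] D.RC β₂ →ₗ[k] D.RC β ⧸ F :=
    F.mkQ ∘ₗ LinearMap.mulLeft k (sWord l₀) ∘ₗ phiT h
  have hS : LinearMap.ker S = ⊥ := LinearMap.ker_eq_bot'.2 fun t ht' =>
    eq_zero_of_mem_fil h hchar h₀.red ((Submodule.Quotient.mk_eq_zero F).1 ht')
  obtain ⟨G, hG⟩ := S.exists_leftInverse_of_injective hS
  refine ⟨G ∘ₗ F.mkQ, fun t => LinearMap.congr_fun hG t, fun z hz => ?_⟩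
  rw [LinearMap.comp_apply, Submodule.mkQ_apply, (Submodule.Quotient.mk_eq_zero F).2 hz, map_zero]

end Datum

namespace SGMod

open Datum

variable {k I : Type*} [Field k] [DecidableEq I] {D : Datum k I} {β₁ β₂ β : I →₀ ℕ}
  {h : β₁ + β₂ = β} {h' : β₂ + β₁ = β} {l₀ : List (Adj (ht β))}

theorem fil_mul_phiT (M₁ : SGMod D β₁) (M₂ : SGMod D β₂) {m : ℤ} {z : D.RC β}
    (hz : z ∈ D.fil (side h) (LinearMap.range (phiT (D := D) h)) m) (u : D.RC β₁ ⊗[k] D.RC β₂) :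
    z * phiT h u ∈ D.fil (side h) (LinearMap.range (phiT (D := D) h)) m := by
  induction hz using Submodule.span_induction with
  | zero => rw [zero_mul]; exact zero_mem _
  | add z w _ _ hz hw => rw [add_mul]; exact add_mem hz hw
  | smul r z _ hz => rw [smul_mul_assoc]; exact Submodule.smul_mem _ _ hz
  | mem z hz =>
    obtain ⟨l, _, hl, hm, ⟨t, rfl⟩, rfl⟩ := hz
    obtain ⟨t', e, -⟩ := exists_phiT_mul (M₁ := M₁) (M₂ := M₂) h t u
    rw [smul_eq_mul, mul_assoc, ← e]
    exact sWord_mem_fil hl hm ⟨t', rfl⟩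

theorem exists_topProj (hchar : (2 : k) ≠ 0) (h₀ : IsTop h h' l₀) (M₁ : SGMod D β₁)
    (M₂ : SGMod D β₂) : ∃ P : Conv h M₁ M₂ →ₗ[k] M₁.carrier ⊗[k] M₂.carrier,
      (∀ v, P ((sWord l₀ : D.RC β) • iota h M₁ M₂ v) = v) ∧
        ∀ z ∈ D.fil (side h) (LinearMap.range (iota h M₁ M₂)) l₀.length, P z = 0 := by
  obtain ⟨T, hT, hT₀⟩ := exists_topCoeff (D := D) hchar h₀
  let P₀ : ConvPre h M₁ M₂ →ₗ[k] M₁.carrier ⊗[k] M₂.carrier :=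
    TensorProduct.lift (act M₁ M₂ ∘ₗ T ∘ₗ (D.parIdeal h).subtype.restrictScalars k)
  have hP₀ : ∀ r v, P₀ (r ⊗ₜ v) = act M₁ M₂ (T r.1) v := fun r v => rfl
  have hE : D.parE h = phiT h (1 ⊗ₜ 1) := by rw [phiT_tmul, phi_one_left, rMap_one]
  have hr : ∀ (r : D.parIdeal h) (a : D.RC β₁) (b : D.RC β₂),
      act M₁ M₂ (T (r.1 * phi h a b)) = act M₁ M₂ (T r.1) * act M₁ M₂ (a ⊗ₜ b) := by
    intro r a b
    obtain ⟨y, hy⟩ := Ideal.mem_span_singleton'.1 r.2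
    have h1 := smul_mem_fil_top h₀ (isStable_range_phiT h M₁ M₂) y (v := D.parE h)
      ⟨1 ⊗ₜ 1, hE.symm⟩
    rw [smul_eq_mul, hy] at h1
    obtain ⟨_, ⟨t, rfl⟩, h2⟩ := exists_sub_mem_fil h₀ (isStable_range_phiT h M₁ M₂) h1
    obtain ⟨t', e, e'⟩ := exists_phiT_mul (M₁ := M₁) (M₂ := M₂) h t (a ⊗ₜ b)
    have h3 := hT₀ _ h2
    have h4 := hT₀ _ (fil_mul_phiT M₁ M₂ h2 (a ⊗ₜ b))
    rw [smul_eq_mul, map_sub, hT, sub_eq_zero] at h3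
    rw [smul_eq_mul, sub_mul, mul_assoc, ← e, map_sub, hT, sub_eq_zero, phiT_tmul] at h4
    rw [h3, h4, e']
  have key : ∀ z ∈ convRel h M₁ M₂, ∀ y : D.RC β, P₀ (y • z) = 0 := by
    intro z hz
    induction hz using Submodule.span_induction with
    | mem z hz =>
      obtain ⟨r, a, b, m₁, m₂, g, g', hb, hm, rfl⟩ := hz
      intro y
      rw [smul_sub, TensorProduct.smul_tmul', TensorProduct.smul_tmul', map_sub, hP₀, hP₀,
        ← act_tmul_tmul a hb hm, sub_eq_zero]
      have h1 : (y • parMul h r a b).1 = (y • r).1 * phi h a b := (mul_assoc _ _ _).symm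
      rw [h1, hr]
      rfl
    | zero => intro y; rw [smul_zero, map_zero]
    | add z w _ _ hz hw => intro y; rw [smul_add, map_add, hz, hw, add_zero]
    | smul r z _ hz => intro y; rw [← mul_smul]; exact hz _
  let P : Conv h M₁ M₂ →ₗ[k] M₁.carrier ⊗[k] M₂.carrier :=
    ((convRel h M₁ M₂).restrictScalars k).liftQ P₀ fun z hz => by
      have := key z hz 1
      rwa [one_smul] at this
  have hP : ∀ y v, P (y • iota h M₁ M₂ v) = act M₁ M₂ (T (y * D.parE h)) v := fun y v => by
    rw [smul_iota]; rfl
  refine ⟨P, fun v => ?_, fun z hz => ?_⟩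
  · rw [hP, hE, hT, act_one, Module.End.one_apply]
  · induction hz using Submodule.span_induction with
    | zero => rw [map_zero]
    | add z w _ _ hz hw => rw [map_add, hz, hw, add_zero]
    | smul r z _ hz => rw [map_smul, hz, smul_zero]
    | mem z hz =>
      obtain ⟨l, _, hl, hm, ⟨v, rfl⟩, rfl⟩ := hz
      rw [hP, ← smul_eq_mul, hT₀ _ (sWord_mem_fil hl hm ⟨1 ⊗ₜ 1, hE.symm⟩), map_zero, LinearMap.zero_apply]

end SGMod

end

end QuiverHeckeClifford

namespace QuiverHeckeClifford

set_option linter.unusedSectionVars false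

noncomputable section

open TensorProduct

namespace Datum

variable {k I : Type*} [Field k] [DecidableEq I] {D : Datum k I} {β₁ β₂ β' β : I →₀ ℕ}

theorem c_mul_sWord (l : List (Adj (ht β))) (p : Fin (ht β)) :
    (cRC p * sWord l : D.RC β) = sWord l * cRC (wordPerm l p) := by
  induction l generalizing p with
  | nil => rw [sWord_nil, mul_one, one_mul]; rfl
  | cons a l ih => rw [sWord_cons, ← mul_assoc, c_mul_s, mul_assoc, ih, mul_assoc, wordPerm_cons]

theorem sWord_mul_e (l : List (Adj (ht β))) (ν : D.Seq β) :
    sWord l * eRC ν = eRC (ν.perm (wordPerm l)) * sWord l := by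
  induction l with
  | nil => rw [sWord_nil, mul_one, one_mul]; rfl
  | cons a l ih =>
    rw [sWord_cons, mul_assoc, ih, ← mul_assoc, s_e, mul_assoc]
    rfl

section

variable {Λ : Type*} [LinearOrder Λ] {Z : Type*} [AddCommGroup Z] [Module k Z] [Module (D.RC β) Z]
  [IsScalarTower k (D.RC β) Z] {V : Submodule k Z} {ω₀ : Fin (ht β) → Λ}

theorem x_smul_sWord (hω : Monotone ω₀) (hV : D.IsStable ω₀ V) {l : List (Adj (ht β))}
    (hl : Red ω₀ l) (p : Fin (ht β)) {v : Z} (hv : v ∈ V) :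
    (xRC p : D.RC β) • (sWord l : D.RC β) • v - (sWord l : D.RC β) • (xRC (wordPerm l p) : D.RC β) • v
      ∈ D.fil ω₀ V l.length := by
  induction l generalizing p with
  | nil => rw [sWord_nil, one_smul, one_smul, wordPerm, Equiv.Perm.one_apply, sub_self]; exact zero_mem _
  | cons a l ih =>
    obtain ⟨y, hy, e⟩ : ∃ y ∈ D.polyCliff β, (xRC p * sRC a : D.RC β) = sRC a * xRC (a.s p) + y :=
      ⟨_, x_mul_s a p, (add_sub_cancel _ _).symm⟩
    have h1 := (filGood hω hV _).s_smul_mem a _ (ih hl.1 (a.s p))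
    have h2 := (filGood hω hV _).smul_mem y hy _ (sWord_mem_fil hl.1 (lt_add_one (l.length : ℤ)) hv)
    have h3 := add_mem h1 h2
    rw [List.length_cons, Nat.cast_succ]
    convert h3 using 1
    rw [sWord_cons, wordPerm_cons, mul_smul, mul_smul, ← mul_smul (xRC p), e, add_smul, mul_smul,
      smul_sub]
    abel

end

section Blocks

variable {h : β₁ + β₂ = β} {h' : β₂ + β₁ = β} {l₀ : List (Adj (ht β))} {s s' : ℕ}
  {hs : s + ht β' ≤ ht β} {hs' : s' + ht β' ≤ ht β}

theorem blockE_mul_sWord (hw : ∀ q, wordPerm l₀ (blk hs' q) = blk hs q) (ν : D.Seq β') :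
    blockE hs' ν * sWord l₀ = sWord l₀ * blockE hs ν := by
  refine eq_of_mul_e fun μ => ?_
  have e : res hs' (μ.perm (wordPerm l₀)) = res hs μ := funext fun q => congrArg μ.1 (hw q)
  rw [mul_assoc, mul_assoc, sWord_mul_e, ← mul_assoc, blockE_mul_e, blockE_mul_e, e]
  split_ifs
  · rw [sWord_mul_e]
  · rw [zero_mul, mul_zero]

theorem blockIdem_mul_sWord (hw : ∀ q, wordPerm l₀ (blk hs' q) = blk hs q) :
    D.blockIdem hs' * sWord l₀ = sWord l₀ * D.blockIdem hs := by
  rw [← sum_blockE, ← sum_blockE, Finset.sum_mul, Finset.mul_sum]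
  exact Finset.sum_congr rfl fun ν _ => blockE_mul_sWord hw ν

variable {Z : Type*} [AddCommGroup Z] [Module k Z] [Module (D.RC β) Z] [IsScalarTower k (D.RC β) Z]
  {V : Submodule k Z}

theorem blkVal_smul_sWord (h₀ : IsTop h h' l₀) (hV : D.IsStable (side h) V)
    (hw : ∀ q, wordPerm l₀ (blk hs' q) = blk hs q) (hc : ∀ p q, side h (blk hs p) = side h (blk hs q))
    (g : Gen D β') {v : Z} (hv : v ∈ V) :
    blkVal hs' g • (sWord l₀ : D.RC β) • v - (sWord l₀ : D.RC β) • blkVal hs g • v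
      ∈ D.fil (side h) V l₀.length := by
  have key : ∀ y z : D.RC β, y * sWord l₀ = sWord l₀ * z →
      y • (sWord l₀ : D.RC β) • v - (sWord l₀ : D.RC β) • z • v ∈ D.fil (side h) V l₀.length :=
    fun y z e => by rw [← mul_smul, ← mul_smul, e, sub_self]; exact zero_mem _
  cases g with
  | e ν => exact key _ _ (blockE_mul_sWord hw ν)
  | x p =>
    have := x_smul_sWord (monotone_side h) hV h₀.red (blk hs' p) hv
    rwa [hw] at this
  | s a =>
    obtain ⟨b, h1, -, h2⟩ := red_flat (monotone_side h) hV l₀.length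
      (fun j _ => filGood (monotone_side h) hV j) l₀ (blkA hs' a) h₀.red
      (by rw [blkA_lo, blkA_hi, hw, hw, hc]) rfl
    have h3 : b = blkA hs a := by
      rw [blkA_lo, hw] at h1
      exact Subtype.ext (congrArg Fin.val h1)
    rw [h3] at h2
    exact h2 v hv
  | c p =>
    refine key _ _ ?_
    change cRC _ * _ = _ * cRC _
    rw [c_mul_sWord, hw]

theorem blkVal_smul_fil (h₀ : IsTop h h' l₀) (hV : D.IsStable (side h) V)
    (hc : ∀ p q, side h' (blk hs' p) = side h' (blk hs' q)) (g : Gen D β') {z : Z}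
    (hz : z ∈ D.fil (side h) V l₀.length) : blkVal hs' g • z ∈ D.fil (side h) V l₀.length := by
  have hG := filGood (D := D) (monotone_side h) hV
  cases g with
  | e ν =>
    refine (hG _).smul_mem _ (sum_mem fun μ _ => ?_) _ hz
    exact ite_mem_polyCliff (e_mem_polyCliff μ)
  | x p => exact (hG _).smul_mem _ (x_mem_polyCliff _) _ hz
  | c p => exact (hG _).smul_mem _ (c_mem_polyCliff _) _ hz
  | s a =>
    change (sRC (blkA hs' a) : D.RC β) • z ∈ _
    induction hz using Submodule.span_induction with
    | zero => rw [smul_zero]; exact zero_mem _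
    | add z w _ _ hz hw => rw [smul_add]; exact add_mem hz hw
    | smul r z _ hz => rw [smul_algebra_smul_comm]; exact Submodule.smul_mem _ _ hz
    | mem z hz =>
      obtain ⟨l, v, hl, hlen, hv, rfl⟩ := hz
      by_cases h1 : side h (wordPerm l (blkA hs' a).lo) < side h (wordPerm l (blkA hs' a).hi)
      · have h2 : Red (side h) (blkA hs' a :: l) := ⟨hl, h1⟩
        obtain ⟨h3, h4⟩ := length_le_of_isTop h h' h₀ h2
        rw [List.length_cons] at h3 h4
        rcases h3.lt_or_eq with h3 | h3
        · have := sWord_mem_fil (D := D) h2 (m := l₀.length) (by rw [List.length_cons]; omega) hv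
          rwa [sWord_cons, mul_smul] at this
        · exfalso
          have h5 := (h4 h3).side_eq
          have h6 := h5 (blkA hs' a).lo
          have h7 := h5 (blkA hs' a).hi
          rw [wordPerm_cons, Adj.s_lo] at h6
          rw [wordPerm_cons, Adj.s_hi, blkA_hi, hc _ a.lo, ← blkA_lo, ← h6] at h7
          exact h1.ne h7
      · exact fil_mono (by omega) (red_nonup (monotone_side h) hV l.length (fun j _ => hG j) l _ hl h1
          rfl hv)

theorem blockIdem_mem_polyCliff : D.blockIdem hs ∈ D.polyCliff β :=
  sum_mem fun μ _ => ite_mem_polyCliff (e_mem_polyCliff μ)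

end Blocks

end Datum

namespace SGMod

open Datum

variable {k I : Type*} [Field k] [DecidableEq I] {D : Datum k I} {β₁ β₂ β' β : I →₀ ℕ}
  {h : β₁ + β₂ = β} {h' : β₂ + β₁ = β} {l₀ : List (Adj (ht β))} {M₁ : SGMod D β₁} {M₂ : SGMod D β₂}

/-- A projection of the convolution to the coefficient of the longest word. -/
structure IsTopProj (l₀ : List (Adj (ht β))) (P : Conv h M₁ M₂ →ₗ[k] M₁.carrier ⊗[k] M₂.carrier) :
    Prop where
  top : ∀ v, P ((sWord l₀ : D.RC β) • iota h M₁ M₂ v) = v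
  fil : ∀ z ∈ D.fil (side h) (LinearMap.range (iota h M₁ M₂)) l₀.length, P z = 0

theorem exists_isTopProj (hchar : (2 : k) ≠ 0) (h₀ : IsTop h h' l₀) (M₁ : SGMod D β₁)
    (M₂ : SGMod D β₂) : ∃ P, IsTopProj (h := h) (M₁ := M₁) (M₂ := M₂) l₀ P :=
  let ⟨P, h1, h2⟩ := exists_topProj hchar h₀ M₁ M₂
  ⟨P, h1, h2⟩

variable {P : Conv h M₁ M₂ →ₗ[k] M₁.carrier ⊗[k] M₂.carrier}

theorem conv_mem_fil (h₀ : IsTop h h' l₀) (z : Conv h M₁ M₂) :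
    z ∈ D.fil (side h) (LinearMap.range (iota h M₁ M₂)) (l₀.length + 1) := by
  obtain ⟨z, rfl⟩ := mkConv_surjective h M₁ M₂ z
  induction z using TensorProduct.induction_on with
  | zero => rw [map_zero]; exact zero_mem _
  | add z w hz hw => rw [map_add]; exact add_mem hz hw
  | tmul r v =>
    have := smul_mem_fil_top h₀ (isStable_range_iota h M₁ M₂) r.1 ⟨v, rfl⟩
    rwa [smul_iota, convBil_apply, toParIdeal_coe] at this

theorem exists_sub_iota_mem_fil (h₀ : IsTop h h' l₀) (z : Conv h M₁ M₂) :
    ∃ v, z - (sWord l₀ : D.RC β) • iota h M₁ M₂ v ∈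
      D.fil (side h) (LinearMap.range (iota h M₁ M₂)) l₀.length := by
  obtain ⟨_, ⟨v, rfl⟩, e⟩ := exists_sub_mem_fil h₀ (isStable_range_iota h M₁ M₂) (conv_mem_fil h₀ z)
  exact ⟨v, e⟩

theorem IsTopProj.eq_of_sub_mem (hP : IsTopProj l₀ P) {z : Conv h M₁ M₂}
    {v : M₁.carrier ⊗[k] M₂.carrier} (hz : z - (sWord l₀ : D.RC β) • iota h M₁ M₂ v ∈
      D.fil (side h) (LinearMap.range (iota h M₁ M₂)) l₀.length) : P z = v := by
  have := hP.fil _ hz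
  rwa [map_sub, hP.top, sub_eq_zero] at this

/-- A linear map that agrees with a given one on words of maximal length and preserves the
combinations of shorter words. -/
theorem IsTopProj.map_eq (hP : IsTopProj l₀ P) (h₀ : IsTop h h' l₀) (y : D.RC β)
    (A : Module.End k (M₁.carrier ⊗[k] M₂.carrier))
    (h1 : ∀ v, y • (sWord l₀ : D.RC β) • iota h M₁ M₂ v - (sWord l₀ : D.RC β) • iota h M₁ M₂ (A v) ∈
      D.fil (side h) (LinearMap.range (iota h M₁ M₂)) l₀.length)
    (h2 : ∀ z ∈ D.fil (side h) (LinearMap.range (iota h M₁ M₂)) l₀.length,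
      y • z ∈ D.fil (side h) (LinearMap.range (iota h M₁ M₂)) l₀.length) (z : Conv h M₁ M₂) :
    P (y • z) = A (P z) := by
  obtain ⟨v, hv⟩ := exists_sub_iota_mem_fil h₀ z
  rw [hP.eq_of_sub_mem hv]
  refine hP.eq_of_sub_mem ?_
  have := add_mem (h2 _ hv) (h1 v)
  rwa [smul_sub, sub_add_sub_cancel] at this

theorem IsTopProj.blkMap_smul (hP : IsTopProj l₀ P) (h₀ : IsTop h h' l₀) {s s' : ℕ}
    {hs : s + ht β' ≤ ht β} {hs' : s' + ht β' ≤ ht β} (hw : ∀ q, wordPerm l₀ (blk hs' q) = blk hs q)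
    (hc : ∀ p q, side h (blk hs p) = side h (blk hs q))
    (hc' : ∀ p q, side h' (blk hs' p) = side h' (blk hs' q)) (hE : D.blockIdem hs = D.parE h)
    (A : D.RC β' →ₗ[k] Module.End k (M₁.carrier ⊗[k] M₂.carrier)) (h1 : A 1 = 1)
    (hmul : ∀ a b, A (a * b) = A a * A b)
    (hA : ∀ b v, blkMap hs b • iota h M₁ M₂ v = iota h M₁ M₂ (A b v)) (b : D.RC β')
    (z : Conv h M₁ M₂) : P (blkMap hs' b • z) = A b (P z) := by
  have hV := isStable_range_iota h M₁ M₂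
  have hI : ∀ z : Conv h M₁ M₂, P (D.blockIdem hs' • z) = P z := fun z => by
    refine hP.map_eq h₀ (D.blockIdem hs') 1 (fun v => ?_)
      ((filGood (monotone_side h) hV _).smul_mem _ blockIdem_mem_polyCliff) z
    rw [← mul_smul, blockIdem_mul_sWord hw, mul_smul, hE, parE_smul_iota, Module.End.one_apply, sub_self]
    exact zero_mem _
  induction b using RC_induction generalizing z with
  | hgen g =>
    rw [blkMap_val, mul_smul]
    refine (hP.map_eq h₀ (blkVal hs' g) (A g.val) (fun v => ?_)
      (fun z hz => blkVal_smul_fil h₀ hV hc' g hz) _).trans (by rw [hI])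
    have h2 := blkVal_smul_sWord h₀ hV hw hc g (v := iota h M₁ M₂ v) ⟨v, rfl⟩
    rwa [← hA, blkMap_val, mul_smul (blkVal hs g), hE, parE_smul_iota]
  | hmap r => rw [Algebra.algebraMap_eq_smul_one, (blkMap hs').map_smul, A.map_smul, blkMap_one, smul_assoc,
      P.map_smul, hI, h1, LinearMap.smul_apply, Module.End.one_apply]
  | hadd a b ha hb => rw [map_add, map_add, add_smul, map_add, ha, hb, LinearMap.add_apply]
  | hmul a b ha hb => rw [blkMap_mul, mul_smul, ha, hb, hmul, Module.End.mul_apply]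

theorem IsTopProj.lMap_smul (hP : IsTopProj l₀ P) (h₀ : IsTop h h' l₀) (b : D.RC β₂)
    (z : Conv h M₁ M₂) : P (D.lMap h' b • z) = actR M₁ M₂ b (P z) :=
  hP.blkMap_smul h₀ (h₀.wordPerm_left h h') (fun p q => by rw [side_right, side_right])
    (fun p q => by rw [side_left, side_left]) (blockIdem_right h) (actR M₁ M₂) actR_one actR_mul
    (rMap_smul_iota h) b z

theorem IsTopProj.rMap_smul (hP : IsTopProj l₀ P) (h₀ : IsTop h h' l₀) (a : D.RC β₁)
    (z : Conv h M₁ M₂) : P (D.rMap h' a • z) = actL M₁ M₂ a (P z) :=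
  hP.blkMap_smul h₀ (h₀.wordPerm_right h h') (fun p q => by rw [side_left, side_left])
    (fun p q => by rw [side_right, side_right]) rfl (actL M₁ M₂) actL_one actL_mul
    (lMap_smul_iota h) a z

end SGMod

end

end QuiverHeckeClifford

namespace QuiverHeckeClifford

set_option linter.unusedSectionVars false

noncomputable section

open TensorProduct

namespace Datum

variable {k I : Type*} [Field k] [DecidableEq I] {D : Datum k I} {β : I →₀ ℕ}

theorem parComp_val (g : Gen D β) (p : ZMod 2) :
    parComp isInternal_RC p g.val = if g.par = p then g.val else 0 := by
  have h1 : g.val = ∑ ν : D.Seq β, g.val * eRC ν := by rw [← Finset.mul_sum, e_sum, mul_one]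
  rw [h1, map_sum]
  split_ifs with h2
  · exact Finset.sum_congr rfl fun ν _ => by
      rw [parComp_of_mem _ _ (gen_e_mem g ν), if_pos (by rw [Gen.deg_snd, h2])]
  · exact Finset.sum_eq_zero fun ν _ => by
      rw [parComp_of_mem _ _ (gen_e_mem g ν), if_neg (by rw [Gen.deg_snd]; exact h2)]

end Datum

namespace SGMod

open Datum

variable {k I : Type*} [Field k] [DecidableEq I] {D : Datum k I} {β₁ β₂ β : I →₀ ℕ}

section

variable (im : k) (M : SGMod D β)

theorem sum_zmod_two {A : Type*} [AddCommMonoid A] (f : ZMod 2 → A) : ∑ p, f p = f 0 + f 1 :=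
  Fin.sum_univ_two f

theorem inv_val_smul (g : Gen D β) (m : M.carrier) :
    M.inv (g.val • m) = sgn k g.par • g.val • M.inv m := by
  induction m using graded_induction M.internal with
  | h0 => simp
  | hadd m m' hm hm' => rw [smul_add, map_add, hm, hm', map_add, smul_add, smul_add]
  | hV i m hm =>
    have h1 : g.val = ∑ ν : D.Seq β, g.val * eRC ν := by rw [← Finset.mul_sum, e_sum, mul_one]
    rw [h1, Finset.sum_smul, map_sum, Finset.sum_smul, Finset.smul_sum]
    refine Finset.sum_congr rfl fun ν _ => ?_
    rw [inv_of_mem M (M.smul_mem _ _ _ (gen_e_mem g ν) _ hm), inv_of_mem M hm, Prod.snd_add,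
      Gen.deg_snd, sgn_add, mul_smul,
      smul_algebra_smul_comm (sgn k i.2) (g.val * eRC ν) m, smul_comm]

theorem inv_inv (m : M.carrier) : M.inv (M.inv m) = m := by
  induction m using graded_induction M.internal with
  | h0 => simp
  | hadd m m' hm hm' => rw [map_add, map_add, hm, hm']
  | hV i m hm => rw [inv_of_mem M hm, map_smul, inv_of_mem M hm, smul_smul, sgn_mul_self, one_smul]

theorem psi_val_of_par {g : Gen D β} (hg : g.par = 0) : psi im g.val = g.val := by
  cases g with
  | e ν => exact psi_e im ν
  | x p => exact psi_x im p
  | s a => exact psi_s im a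
  | c p => exact absurd hg (by simp [Gen.par])

theorem dualAct_of_par {g : Gen D β} (hg : g.par = 0) (f : Module.Dual k M.carrier) (m : M.carrier) :
    M.dualAct im g.val f m = f (g.val • m) := by
  have h01 : ¬(0 : ZMod 2) = 1 := by decide
  rw [dualAct, sum_zmod_two, sum_zmod_two, sum_zmod_two, parComp_val, parComp_val, hg, if_pos rfl,
    if_neg h01, map_zero, map_zero, psi_val_of_par im hg]
  simp only [zero_mul, sgn_zero, one_smul, LinearMap.comp_zero, smul_zero, add_zero]
  change f (parComp M.internal 0 (g.val • m)) + f (parComp M.internal 1 (g.val • m)) = _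
  rw [← map_add, parComp_sum]

theorem dualAct_c (p : Fin (ht β)) (f : Module.Dual k M.carrier) (m : M.carrier) :
    M.dualAct im (cRC p) f m = -im * f (M.inv ((cRC p : D.RC β) • m)) := by
  have h10 : ¬(1 : ZMod 2) = 0 := by decide
  rw [dualAct, sum_zmod_two, sum_zmod_two, sum_zmod_two, parComp_val, parComp_val]
  change (_ • (f ∘ₗ _) ∘ₗ Algebra.lsmul k k M.carrier (psi im (if (1 : ZMod 2) = 0 then _ else _)) +
    _ • (f ∘ₗ _) ∘ₗ Algebra.lsmul k k M.carrier (psi im (if (1 : ZMod 2) = 0 then _ else _)) +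
    (_ • (f ∘ₗ _) ∘ₗ Algebra.lsmul k k M.carrier (psi im (if (1 : ZMod 2) = 1 then _ else _)) +
    _ • (f ∘ₗ _) ∘ₗ Algebra.lsmul k k M.carrier (psi im (if (1 : ZMod 2) = 1 then _ else _)))) m = _
  rw [if_neg h10, if_pos rfl, map_zero, map_zero, psi_c]
  simp only [LinearMap.comp_zero, smul_zero, zero_add, mul_one, mul_zero, sgn_zero, sgn_one,
    one_smul, map_smul, LinearMap.comp_smul]
  change -im * f (parComp M.internal 0 ((cRC p : D.RC β) • m)) +
    -1 * (-im * f (parComp M.internal 1 ((cRC p : D.RC β) • m))) = _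
  rw [inv, LinearMap.sub_apply, map_sub]
  ring

variable {im} (him : im * im = -1)

theorem dual_smul_form (a : D.RC β) (f : (M.dual him).carrier) :
    GDual.form (M := M) (a • f) = M.dualAct im a (GDual.form (M := M) f) := rfl

theorem dual_inv_form (f : (M.dual him).carrier) (m : M.carrier) :
    GDual.form (M := M) ((M.dual him).inv f) m = GDual.form (M := M) f (M.inv m) := by
  have h2 : ∀ p : ZMod 2, -p = p := by decide
  induction f using graded_induction (M.dual him).internal with
  | h0 => rw [map_zero]; rfl
  | hadd f f' hf hf' =>
    rw [map_add]
    change GDual.form (M := M) ((M.dual him).inv f) m + GDual.form (M := M) ((M.dual him).inv f') m =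
      GDual.form (M := M) f (M.inv m) + GDual.form (M := M) f' (M.inv m)
    rw [hf, hf']
  | hV i f hf =>
    rw [inv_of_mem _ hf]
    change sgn k i.2 • GDual.form (M := M) f m = _
    induction m using graded_induction M.internal with
    | h0 => rw [map_zero, map_zero, map_zero, smul_zero]
    | hadd m m' hm hm' => rw [map_add, map_add, map_add, smul_add, hm, hm']
    | hV j m hm =>
      rw [inv_of_mem _ hm, map_smul]
      by_cases hj : j = -i
      · rw [hj, Prod.snd_neg, h2]
      · rw [show GDual.form (M := M) f m = 0 from hf j hj m hm, smul_zero, smul_zero]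

end

section Pairing

variable {im : k} (him : im * im = -1) (M₁ : SGMod D β₁) (M₂ : SGMod D β₂)

/-- The pairing of the tensor product of the duals with the tensor product in the opposite order. -/
def pairing : (M₂.dual him).carrier ⊗[k] (M₁.dual him).carrier →ₗ[k]
    Module.Dual k (M₁.carrier ⊗[k] M₂.carrier) :=
  TensorProduct.dualDistrib k M₁.carrier M₂.carrier ∘ₗ
    TensorProduct.map (GDual.form (M := M₁)) (GDual.form (M := M₂)) ∘ₗ
      (TensorProduct.comm k (M₂.dual him).carrier (M₁.dual him).carrier).toLinearMap

theorem pairing_tmul (n₂ : (M₂.dual him).carrier) (n₁ : (M₁.dual him).carrier) (m₁ : M₁.carrier)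
    (m₂ : M₂.carrier) : pairing him M₁ M₂ (n₂ ⊗ₜ n₁) (m₁ ⊗ₜ m₂) =
      GDual.form (M := M₁) n₁ m₁ * GDual.form (M := M₂) n₂ m₂ := rfl

variable {him M₁ M₂}

theorem pairing_injective : Function.Injective (pairing him M₁ M₂) := by
  classical
  refine (injective_iff_map_eq_zero _).2 fun u hu => ?_
  let b := Module.Basis.ofVectorSpace k (M₁.dual him).carrier
  let c := TensorProduct.equivFinsuppOfBasisRight (M := (M₂.dual him).carrier) b
  have h1 : u = ∑ i ∈ (c u).support, (c u i) ⊗ₜ b i := by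
    conv_lhs => rw [← c.symm_apply_apply u]
    rw [TensorProduct.equivFinsuppOfBasisRight_symm_apply]
    rfl
  have h2 : ∀ m₂, ∑ i ∈ (c u).support, GDual.form (M := M₂) (c u i) m₂ • b i = 0 := fun m₂ => by
    refine GDual.ext (M := M₁) (LinearMap.ext fun m₁ => ?_)
    have h4 := LinearMap.congr_fun hu (m₁ ⊗ₜ m₂)
    rw [h1, map_sum, LinearMap.sum_apply] at h4
    refine Eq.trans ?_ h4
    refine ((LinearMap.congr_fun (map_sum (GDual.form (M := M₁)) _ _) m₁).trans
      (LinearMap.sum_apply _ _ _)).trans (Finset.sum_congr rfl fun i _ => ?_)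
    rw [pairing_tmul, mul_comm]
    rfl
  have h3 : c u = 0 := by
    ext i
    by_cases hi : i ∈ (c u).support
    · exact GDual.ext (M := M₂) (LinearMap.ext fun m₂ =>
        linearIndependent_iff'.1 b.linearIndependent _ _ (h2 m₂) i hi)
    · exact Finsupp.notMem_support_iff.1 hi
  rwa [LinearEquiv.map_eq_zero_iff] at h3

/-- The linear form that is given on one homogeneous component. -/
def pieceForm (M : SGMod D β) (g : ℤ × ZMod 2) (μ : M.piece g →ₗ[k] k) : (M.dual him).carrier :=
  (⟨μ ∘ₗ LinearMap.codRestrict (M.piece g) (comp M.internal g) (comp_mem M.internal g), by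
    refine (Set.finite_singleton g).subset ?_
    rintro h ⟨m, hm, hne⟩
    by_contra hh
    refine hne ?_
    rw [LinearMap.comp_apply, (_ : LinearMap.codRestrict (M.piece g) _ _ m = 0), map_zero]
    exact Subtype.ext (comp_of_ne M.internal (Ne.symm hh) hm)⟩ : M.gdual)

theorem pieceForm_form (M : SGMod D β) (g : ℤ × ZMod 2) (μ : M.piece g →ₗ[k] k) (m : M.carrier) :
    GDual.form (M := M) (pieceForm (him := him) M g μ) m =
      μ ⟨comp M.internal g m, comp_mem M.internal g m⟩ := rfl

theorem exists_pairing_piece (f : Module.Dual k (M₁.carrier ⊗[k] M₂.carrier)) (g g' : ℤ × ZMod 2)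
    [FiniteDimensional k (M₁.piece g)] : ∃ u, ∀ m₁ m₂,
      pairing him M₁ M₂ u (m₁ ⊗ₜ m₂) = f (comp M₁.internal g m₁ ⊗ₜ comp M₂.internal g' m₂) := by
  let b := Module.finBasis k (M₁.piece g)
  refine ⟨∑ i, pieceForm M₂ g' (f ∘ₗ TensorProduct.mk k _ _ (b i).1 ∘ₗ (M₂.piece g').subtype) ⊗ₜ
    pieceForm M₁ g (b.coord i), fun m₁ m₂ => ?_⟩
  have h1 := congrArg Subtype.val
    (b.sum_repr ⟨comp M₁.internal g m₁, comp_mem M₁.internal g m₁⟩)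
  rw [AddSubmonoidClass.coe_finsetSum] at h1
  change _ = comp M₁.internal g m₁ at h1
  rw [map_sum, LinearMap.sum_apply]
  conv_rhs => rw [← h1, TensorProduct.sum_tmul, map_sum]
  refine Finset.sum_congr rfl fun i _ => ?_
  rw [pairing_tmul, pieceForm_form, pieceForm_form, Submodule.coe_smul, ← TensorProduct.smul_tmul',
    map_smul, smul_eq_mul]
  rfl

theorem exists_pairing_eq (hfd : ∀ g, FiniteDimensional k (M₁.piece g))
    (f : Module.Dual k (M₁.carrier ⊗[k] M₂.carrier))
    (hf : {g : (ℤ × ZMod 2) × (ℤ × ZMod 2) | ∃ m₁ ∈ M₁.piece g.1, ∃ m₂ ∈ M₂.piece g.2,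
      f (m₁ ⊗ₜ m₂) ≠ 0}.Finite) : ∃ u, pairing him M₁ M₂ u = f := by
  choose u hu using fun g : (ℤ × ZMod 2) × (ℤ × ZMod 2) =>
    have := hfd g.1
    exists_pairing_piece (him := him) f g.1 g.2
  refine ⟨∑ g ∈ hf.toFinset, u g, tensor_ext fun g g' m₁ h₁ m₂ h₂ => ?_⟩
  rw [map_sum, LinearMap.sum_apply]
  have h3 : ∀ i : (ℤ × ZMod 2) × (ℤ × ZMod 2), i ≠ (g, g') →
      pairing him M₁ M₂ (u i) (m₁ ⊗ₜ m₂) = 0 := by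
    intro i hi
    rw [hu]
    by_cases h4 : g = i.1
    · rw [comp_of_ne M₂.internal (fun h5 => hi (Prod.ext h4.symm h5)) h₂, TensorProduct.tmul_zero,
        map_zero]
    · rw [comp_of_ne M₁.internal (Ne.symm h4) h₁, TensorProduct.zero_tmul, map_zero]
  by_cases hg : (g, g') ∈ hf.toFinset
  · rw [Finset.sum_eq_single_of_mem _ hg fun i _ hi => h3 i hi, hu, comp_of_mem M₁.internal h₁,
      comp_of_mem M₂.internal h₂]
  · rw [Finset.sum_eq_zero fun i hi => h3 i fun h => hg (h ▸ hi)]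
    by_contra h0
    exact hg (hf.mem_toFinset.2 ⟨m₁, h₁, m₂, h₂, fun h => h0 h.symm⟩)

end Pairing

theorem IsL.finiteDimensional {M : SGMod D β} (hM : M.IsL) (g : ℤ × ZMod 2) :
    FiniteDimensional k (M.piece g) := by
  have h2 : ∀ p : ZMod 2, p = 0 ∨ p = 1 := by decide
  have := hM.1 g.1
  refine Submodule.finiteDimensional_of_le (S₂ := M.degPiece g.1) ?_
  obtain ⟨d, p⟩ := g
  rcases h2 p with rfl | rfl
  · exact le_sup_left
  · exact le_sup_right

theorem IsL.exists_bound {M : SGMod D β} (hM : M.IsL) :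
    ∃ N : ℤ, ∀ g : ℤ × ZMod 2, ∀ m ∈ M.piece g, m ≠ 0 → N ≤ g.1 := by
  have h2 : ∀ p : ZMod 2, p = 0 ∨ p = 1 := by decide
  obtain ⟨N, hN⟩ := hM.2
  refine ⟨N, fun g m hm h0 => ?_⟩
  by_contra hg
  have h3 : m ∈ M.degPiece g.1 := by
    obtain ⟨d, p⟩ := g
    rcases h2 p with rfl | rfl
    · exact Submodule.mem_sup_left hm
    · exact Submodule.mem_sup_right hm
  rw [hN _ (not_le.1 hg), Submodule.mem_bot] at h3
  exact h0 h3

/-- For modules whose degrees are bounded below there are only finitely many pairs of degrees with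
given sum. -/
theorem finite_degrees {M₁ : SGMod D β₁} {M₂ : SGMod D β₂} (h₁ : M₁.IsL) (h₂ : M₂.IsL)
    {E : Set (ℤ × ZMod 2)} (hE : E.Finite) :
    {g : (ℤ × ZMod 2) × (ℤ × ZMod 2) | (∃ m ∈ M₁.piece g.1, m ≠ 0) ∧ (∃ m ∈ M₂.piece g.2, m ≠ 0) ∧
      g.1 + g.2 ∈ E}.Finite := by
  obtain ⟨N₁, hN₁⟩ := h₁.exists_bound
  obtain ⟨N₂, hN₂⟩ := h₂.exists_bound
  refine (hE.biUnion fun e _ => ((Set.finite_Icc N₁ (e.1 - N₂)).prod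
    (Set.finite_univ (α := ZMod 2))).image fun g => (g, e - g)).subset ?_
  rintro ⟨g, g'⟩ ⟨⟨m, hm, h0⟩, ⟨m', hm', h0'⟩, he⟩
  have h3 := hN₁ _ m hm h0
  have h4 := hN₂ _ m' hm' h0'
  refine Set.mem_biUnion he ⟨g, ⟨⟨h3, ?_⟩, trivial⟩, ?_⟩
  · simp only [Prod.fst_add] at h4 ⊢
    omega
  · rw [Prod.mk.injEq]
    exact ⟨rfl, by simp⟩

end SGMod

end

end QuiverHeckeClifford

namespace QuiverHeckeClifford

set_option linter.unusedSectionVars false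

noncomputable section

open TensorProduct

namespace Datum

variable {k I : Type*} [Field k] [DecidableEq I] {D : Datum k I} {β₁ β₂ β : I →₀ ℕ}
  {h : β₁ + β₂ = β} {h' : β₂ + β₁ = β}

variable (D) in
theorem form_sum {ι κ : Type*} [Fintype ι] [Fintype κ] (a : ι → I) (b : κ → I) :
    D.form (∑ i, Finsupp.single (a i) 1) (∑ j, Finsupp.single (b j) 1) =
      ∑ i, ∑ j, D.d (a i) * D.A (a i) (b j) := by
  classical
  have hl : ∀ (m n γ : I →₀ ℕ), D.form (m + n) γ = D.form m γ + D.form n γ := fun m n γ =>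
    Finsupp.sum_add_index' (fun i => by simp) fun i x y => by
      rw [← Finsupp.sum_add]
      exact Finsupp.sum_congr fun j _ => by push_cast; ring
  have hr : ∀ (γ m n : I →₀ ℕ), D.form γ (m + n) = D.form γ m + D.form γ n := fun γ m n => by
    rw [form, form, form, ← Finsupp.sum_add]
    exact Finsupp.sum_congr fun i _ =>
      Finsupp.sum_add_index' (fun i => by simp) fun i x y => by push_cast; ring
  let F : (I →₀ ℕ) →+ (I →₀ ℕ) →+ ℤ := AddMonoidHom.mk' (fun m => AddMonoidHom.mk' (D.form m) (hr m))
    fun m n => AddMonoidHom.ext (hl m n)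
  change F _ _ = _
  rw [map_sum F, AddMonoidHom.finsetSum_apply]
  refine Finset.sum_congr rfl fun i _ => ?_
  rw [map_sum]
  refine Finset.sum_congr rfl fun j _ => ?_
  change D.form _ _ = _
  rw [form, Finsupp.sum_single_index (by simp), Finsupp.sum_single_index (by simp)]
  simp

/-- The value of the form at the simple roots of two positions. -/
def pairDeg (ν : D.Seq β) (p q : Fin (ht β)) : ℤ := D.d (ν.1 p).fst * D.A (ν.1 p).fst (ν.1 q).fst

theorem pairDeg_comm (ν : D.Seq β) (p q : Fin (ht β)) : D.pairDeg ν p q = D.pairDeg ν q p :=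
  D.symm _ _

theorem sWord_mul_e_mem (l : List (Adj (ht β))) (ν : D.Seq β) :
    sWord l * eRC ν ∈ D.piece β (-wordSum (D.pairDeg ν) l, 0) := by
  induction l with
  | nil =>
    have := gen_e_mem (.e ν) ν
    rw [e_e_self] at this
    rw [sWord_nil, one_mul]
    exact this
  | cons a l ih =>
    have h1 := mul_mem (gen_e_mem (.s a) (ν.perm (wordPerm l))) ih
    rw [mul_assoc, ← mul_assoc (eRC _), ← sWord_mul_e, mul_assoc (sWord l), e_e_self, ← mul_assoc] at h1
    rw [sWord_cons]
    convert h1 using 1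
    refine congrArg (D.piece β) (Prod.ext ?_ rfl)
    change -(wordSum _ l + _) = -_ + -_
    rw [neg_add, add_comm]
    rfl

theorem sum_blk (h : β₁ + β₂ = β) {A : Type*} [AddCommMonoid A] (f : Fin (ht β) → A) :
    ∑ p, f p = ∑ q, f (blk (left_le h) q) + ∑ q, f (blk (right_le h) q) := by
  rw [← (finCongr (ht_add h)).sum_comp, Fin.sum_univ_add]
  exact congrArg₂ (· + ·) (Finset.sum_congr rfl fun q _ => congrArg f (by ext; simp [blk]))
    (Finset.sum_congr rfl fun q _ => congrArg f (by ext; simp [blk]))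

theorem IsTop.wordSum_eq {l₀ : List (Adj (ht β))} (h₀ : IsTop h h' l₀) {ν : D.Seq β}
    (hν : D.wt (res (left_le h) ν) = β₁) : wordSum (D.pairDeg ν) l₀ = D.form β₁ β₂ := by
  have hν' : D.wt (res (right_le h) ν) = β₂ := by
    have h1 := wt_left_add_right h ν
    rw [hν] at h1
    exact add_left_cancel (h1.trans h.symm)
  rw [← winv_word (monotone_side h) (pairDeg_comm ν) h₀.red, winv, sum_blk h']
  have e : ∀ p, (side h ∘ wordPerm l₀) p = !side h' p := h₀.side_eq
  have hlt : ∀ (p : Fin (ht β₂)) (q : Fin (ht β₁)), blk (left_le h') p < blk (right_le h') q := by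
    intro p q
    have := p.2
    simp only [Fin.lt_def, blk]
    omega
  simp only [e, sum_blk h', side_left, side_right, h₀.wordPerm_left, h₀.wordPerm_right, hlt]
  simp only [lt_irrefl, and_false, if_false, Finset.sum_const_zero, zero_add, Bool.not_true,
    Bool.not_false, and_true, Bool.false_lt_true, if_true]
  have h3 : ¬(true < false) := by decide
  simp only [h3, and_false, if_false, Finset.sum_const_zero, add_zero]
  rw [Finset.sum_comm]
  simp only [pairDeg_comm ν (blk (right_le h) _)]
  have h4 := form_sum D (fun p => (res (left_le h) ν p).fst) fun q => (res (right_le h) ν q).fst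
  refine h4.symm.trans ?_
  exact congrArg₂ D.form hν hν'

end Datum

namespace SGMod

open Datum

variable {k I : Type*} [Field k] [DecidableEq I] {D : Datum k I} {β₁ β₂ β : I →₀ ℕ}
  {h : β₁ + β₂ = β} {h' : β₂ + β₁ = β} {l₀ : List (Adj (ht β))} {M₁ : SGMod D β₁} {M₂ : SGMod D β₂}

theorem smul_iota_eq_sum (y : D.RC β) (v : M₁.carrier ⊗[k] M₂.carrier) :
    y • iota h M₁ M₂ v = ∑ ν : D.Seq β, (y * eRC ν) • iota h M₁ M₂ v := by
  rw [← Finset.sum_smul, ← Finset.mul_sum, e_sum, mul_one]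

theorem smul_iota_mem {y : D.RC β} {g g₁ g₂ : ℤ × ZMod 2} (hy : y ∈ D.piece β g) {m₁ : M₁.carrier}
    (h₁ : m₁ ∈ M₁.piece g₁) {m₂ : M₂.carrier} (h₂ : m₂ ∈ M₂.piece g₂) :
    y • iota h M₁ M₂ (m₁ ⊗ₜ m₂) ∈ convPiece h M₁ M₂ (g + (g₁ + g₂)) := by
  rw [smul_iota, convBil_apply]
  exact Submodule.subset_span ⟨_, m₁, m₂, g, g₁, g₂, toParIdeal_mem h hy, h₁, h₂, rfl, rfl⟩

theorem top_iota_mem (h₀ : IsTop h h' l₀) {g₁ g₂ : ℤ × ZMod 2} {m₁ : M₁.carrier}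
    (h₁ : m₁ ∈ M₁.piece g₁) {m₂ : M₂.carrier} (h₂ : m₂ ∈ M₂.piece g₂) :
    (sWord l₀ : D.RC β) • iota h M₁ M₂ (m₁ ⊗ₜ m₂) ∈
      convPiece h M₁ M₂ ((-D.form β₁ β₂, 0) + (g₁ + g₂)) := by
  rw [← parE_smul_iota, ← mul_smul, parE, blockIdem, Finset.mul_sum, Finset.sum_smul]
  refine Submodule.sum_mem _ fun ν _ => ?_
  split_ifs with hν
  · rw [← h₀.wordSum_eq hν]
    exact smul_iota_mem (sWord_mul_e_mem l₀ ν) h₁ h₂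
  · rw [mul_zero, zero_smul]
    exact zero_mem _

theorem comp_sWord_iota (l : List (Adj (ht β))) (v : M₁.carrier ⊗[k] M₂.carrier) (g : ℤ × ZMod 2) :
    ∃ w, comp (conv_internal h M₁ M₂) g ((sWord l : D.RC β) • iota h M₁ M₂ v) =
      (sWord l : D.RC β) • iota h M₁ M₂ w := by
  induction v with
  | zero => exact ⟨0, by rw [map_zero, smul_zero, map_zero]⟩
  | add v v' hv hv' =>
    obtain ⟨w, e⟩ := hv
    obtain ⟨w', e'⟩ := hv'
    exact ⟨w + w', by rw [map_add, smul_add, map_add, e, e', map_add, smul_add]⟩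
  | tmul m₁ m₂ =>
  induction m₁ using graded_induction M₁.internal with
  | h0 => exact ⟨0, by rw [TensorProduct.zero_tmul, map_zero, smul_zero, map_zero]⟩
  | hadd v v' hv hv' =>
    obtain ⟨w, e⟩ := hv
    obtain ⟨w', e'⟩ := hv'
    exact ⟨w + w', by rw [TensorProduct.add_tmul, map_add, smul_add, map_add, e, e', map_add, smul_add]⟩
  | hV g₁ m₁ h₁ =>
  induction m₂ using graded_induction M₂.internal with
  | h0 => exact ⟨0, by rw [TensorProduct.tmul_zero, map_zero, smul_zero, map_zero]⟩
  | hadd v v' hv hv' =>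
    obtain ⟨w, e⟩ := hv
    obtain ⟨w', e'⟩ := hv'
    exact ⟨w + w', by rw [TensorProduct.tmul_add, map_add, smul_add, map_add, e, e', map_add, smul_add]⟩
  | hV g₂ m₂ h₂ =>
    rw [smul_iota_eq_sum, map_sum]
    have h3 : ∀ ν : D.Seq β, ∃ w, comp (conv_internal h M₁ M₂) g
        ((sWord l * eRC ν : D.RC β) • iota h M₁ M₂ (m₁ ⊗ₜ m₂)) =
          (sWord l : D.RC β) • iota h M₁ M₂ w := fun ν => by
      obtain ⟨w, hw⟩ := (isStable_range_iota h M₁ M₂).smul_mem _ (e_mem_polyCliff ν) _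
        ⟨m₁ ⊗ₜ m₂, rfl⟩
      have h4 := smul_iota_mem (h := h) (sWord_mul_e_mem l ν) h₁ h₂
      by_cases hg : (-wordSum (D.pairDeg ν) l, (0 : ZMod 2)) + (g₁ + g₂) = g
      · rw [hg] at h4
        exact ⟨w, by rw [comp_of_mem _ h4, mul_smul, hw]⟩
      · exact ⟨0, by rw [comp_of_ne _ (Ne.symm hg) h4, map_zero, smul_zero]⟩
    choose w hw using h3
    exact ⟨∑ ν, w ν, by rw [Finset.sum_congr rfl fun ν _ => hw ν, map_sum, Finset.smul_sum]⟩

end SGMod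

end

end QuiverHeckeClifford

namespace QuiverHeckeClifford

set_option linter.unusedSectionVars false

noncomputable section

open TensorProduct

namespace SGMod

open Datum

variable {k I : Type*} [Field k] [DecidableEq I] {D : Datum k I} {β₁ β₂ β' β : I →₀ ℕ}
  {h : β₁ + β₂ = β} {h' : β₂ + β₁ = β} {l₀ : List (Adj (ht β))} {M₁ : SGMod D β₁} {M₂ : SGMod D β₂}
  {P : Conv h M₁ M₂ →ₗ[k] M₁.carrier ⊗[k] M₂.carrier} {im : k} {him : im * im = -1}

theorem actR_apply (b : D.RC β₂) (m₁ : M₁.carrier) (m₂ : M₂.carrier) :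
    actR M₁ M₂ b (m₁ ⊗ₜ m₂) = m₁ ⊗ₜ (parComp isInternal_RC 0 b • m₂) +
      M₁.inv m₁ ⊗ₜ (parComp isInternal_RC 1 b • m₂) := rfl

theorem actR_of_par {g : Gen D β₂} (hg : g.par = 0) (m₁ : M₁.carrier) (m₂ : M₂.carrier) :
    actR M₁ M₂ g.val (m₁ ⊗ₜ m₂) = m₁ ⊗ₜ (g.val • m₂) := by
  have h01 : ¬(0 : ZMod 2) = 1 := by decide
  rw [actR_apply, parComp_val, parComp_val, hg, if_pos rfl, if_neg h01, zero_smul,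
    TensorProduct.tmul_zero, add_zero]

theorem actR_of_par_one {g : Gen D β₂} (hg : g.par = 1) (m₁ : M₁.carrier) (m₂ : M₂.carrier) :
    actR M₁ M₂ g.val (m₁ ⊗ₜ m₂) = M₁.inv m₁ ⊗ₜ (g.val • m₂) := by
  have h10 : ¬(1 : ZMod 2) = 0 := by decide
  rw [actR_apply, parComp_val, parComp_val, hg, if_pos rfl, if_neg h10, zero_smul,
    TensorProduct.tmul_zero, zero_add]

variable (M₁ M₂) in
/-- The parity involution of the tensor product. -/
def invT : Module.End k (M₁.carrier ⊗[k] M₂.carrier) := TensorProduct.map M₁.inv M₂.inv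

theorem par_eq_zero_or (g : Gen D β) : g.par = 0 ∨ ∃ p, g = .c p := by
  cases g with
  | c p => exact Or.inr ⟨p, rfl⟩
  | _ => exact Or.inl rfl

variable (h M₁ M₂) in
/-- The parity involution of the convolution product. -/
def convInv : Conv h M₁ M₂ →ₗ[k] Conv h M₁ M₂ := (conv h M₁ M₂).inv

theorem convInv_of_mem {g : ℤ × ZMod 2} {z : Conv h M₁ M₂} (hz : z ∈ convPiece h M₁ M₂ g) :
    convInv h M₁ M₂ z = sgn k g.2 • z := inv_of_mem (conv h M₁ M₂) hz

theorem inv_iota (v : M₁.carrier ⊗[k] M₂.carrier) :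
    convInv h M₁ M₂ (iota h M₁ M₂ v) = iota h M₁ M₂ (invT M₁ M₂ v) := by
  refine LinearMap.congr_fun (f := convInv h M₁ M₂ ∘ₗ iota h M₁ M₂)
    (g := iota h M₁ M₂ ∘ₗ invT M₁ M₂) (tensor_ext fun g g' m₁ h₁ m₂ h₂ => ?_) v
  have h3 := smul_iota_mem (h := h) Datum.one_mem h₁ h₂
  rw [one_smul, zero_add] at h3
  rw [LinearMap.comp_apply, LinearMap.comp_apply, convInv_of_mem h3, invT,
    TensorProduct.map_tmul, inv_of_mem _ h₁, inv_of_mem _ h₂, TensorProduct.smul_tmul_smul, map_smul,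
    ← sgn_add, Prod.snd_add]

theorem inv_sWord_smul (M : SGMod D β) (l : List (Adj (ht β))) (m : M.carrier) :
    M.inv ((sWord l : D.RC β) • m) = (sWord l : D.RC β) • M.inv m := by
  induction l with
  | nil => rw [sWord_nil, one_smul, one_smul]
  | cons a l ih =>
    rw [sWord_cons, mul_smul, inv_val_smul, mul_smul, ih]
    exact one_smul _ _

theorem convInv_sWord_smul (l : List (Adj (ht β))) (z : Conv h M₁ M₂) :
    convInv h M₁ M₂ ((sWord l : D.RC β) • z) = (sWord l : D.RC β) • convInv h M₁ M₂ z :=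
  inv_sWord_smul (conv h M₁ M₂) l z

theorem IsTopProj.map_inv (hP : IsTopProj l₀ P) (h₀ : IsTop h h' l₀) (z : Conv h M₁ M₂) :
    P (convInv h M₁ M₂ z) = invT M₁ M₂ (P z) := by
  obtain ⟨v, hv⟩ := exists_sub_iota_mem_fil h₀ z
  rw [hP.eq_of_sub_mem hv]
  refine hP.eq_of_sub_mem ?_
  rw [← inv_iota, ← convInv_sWord_smul, ← map_sub]
  generalize z - (sWord l₀ : D.RC β) • iota h M₁ M₂ v = y at hv
  refine (Submodule.span_le (p := Submodule.comap (convInv h M₁ M₂)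
    (D.fil (side h) (LinearMap.range (iota h M₁ M₂)) l₀.length))).2 ?_ hv
  rintro _ ⟨l, _, hl, hm, ⟨v, rfl⟩, rfl⟩
  change convInv h M₁ M₂ ((sWord l : D.RC β) • iota h M₁ M₂ v) ∈
    D.fil (side h) (LinearMap.range (iota h M₁ M₂)) l₀.length
  rw [convInv_sWord_smul, inv_iota]
  exact sWord_mem_fil hl hm ⟨_, rfl⟩

theorem pairing_actL (g : Gen D β₂) (v' : (M₂.dual him).carrier ⊗[k] (M₁.dual him).carrier)
    (v : M₁.carrier ⊗[k] M₂.carrier) :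
    pairing him M₁ M₂ (actL (M₂.dual him) (M₁.dual him) g.val v') v =
      if g.par = 0 then pairing him M₁ M₂ v' (actR M₁ M₂ g.val v)
      else -im * pairing him M₁ M₂ v' (invT M₁ M₂ (actR M₁ M₂ g.val v)) := by
  induction v' with
  | zero => simp
  | add v' w' hv hw =>
    rw [map_add, map_add, LinearMap.add_apply, hv, hw, map_add, LinearMap.add_apply,
      LinearMap.add_apply]
    split_ifs
    · rfl
    · ring
  | tmul n₂ n₁ =>
  induction v with
  | zero => simp
  | add v w hv hw =>
    rw [map_add, hv, hw, map_add, map_add, map_add, map_add]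
    split_ifs
    · rfl
    · ring
  | tmul m₁ m₂ =>
    rw [actL_tmul, pairing_tmul, dual_smul_form]
    rcases par_eq_zero_or g with hg | ⟨p, rfl⟩
    · rw [if_pos hg, actR_of_par hg, pairing_tmul, dualAct_of_par im M₂ hg]
    · rw [if_neg (show ¬(Gen.c p : Gen D β₂).par = 0 by simp [Gen.par]), actR_of_par_one rfl, invT,
        TensorProduct.map_tmul, pairing_tmul, inv_inv, dualAct_c]
      ring

theorem pairing_actR (g : Gen D β₁) (v' : (M₂.dual him).carrier ⊗[k] (M₁.dual him).carrier)
    (v : M₁.carrier ⊗[k] M₂.carrier) :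
    pairing him M₁ M₂ (actR (M₂.dual him) (M₁.dual him) g.val v') v =
      if g.par = 0 then pairing him M₁ M₂ v' (actL M₁ M₂ g.val v)
      else -im * pairing him M₁ M₂ v' (invT M₁ M₂ (actL M₁ M₂ g.val v)) := by
  induction v' with
  | zero => simp
  | add v' w' hv hw =>
    rw [map_add, map_add, LinearMap.add_apply, hv, hw, map_add, LinearMap.add_apply,
      LinearMap.add_apply]
    split_ifs
    · rfl
    · ring
  | tmul n₂ n₁ =>
  induction v with
  | zero => simp
  | add v w hv hw =>
    rw [map_add, hv, hw, map_add, map_add, map_add, map_add]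
    split_ifs
    · rfl
    · ring
  | tmul m₁ m₂ =>
    rcases par_eq_zero_or g with hg | ⟨p, rfl⟩
    · rw [if_pos hg, actR_of_par hg, actL_tmul, pairing_tmul, pairing_tmul, dual_smul_form,
        dualAct_of_par im M₁ hg]
    · rw [if_neg (show ¬(Gen.c p : Gen D β₁).par = 0 by simp [Gen.par]), actR_of_par_one rfl, invT,
        actL_tmul, TensorProduct.map_tmul, pairing_tmul, pairing_tmul, dual_inv_form, dual_smul_form,
        dualAct_c]
      ring

section Blocks

variable (M : SGMod D β) {s : ℕ} (hs : s + ht β' ≤ ht β)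

theorem sum_e_smul_form (c : D.Seq β → Prop) [DecidablePred c] (f : (M.dual him).carrier)
    (m : M.carrier) :
    GDual.form (M := M) ((∑ μ, if c μ then (eRC μ : D.RC β) else 0) • f) m =
      GDual.form (M := M) f ((∑ μ, if c μ then (eRC μ : D.RC β) else 0) • m) := by
  rw [Finset.sum_smul, Finset.sum_smul, map_sum (GDual.form (M := M) f)]
  refine ((LinearMap.congr_fun (map_sum (GDual.form (M := M)) _ _) m).trans
      (LinearMap.sum_apply _ _ _)).trans (Finset.sum_congr rfl fun μ _ => ?_)
  split_ifs
  · exact dualAct_of_par im M (g := .e μ) rfl _ m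
  · rw [zero_smul, zero_smul, map_zero]
    rfl

theorem inv_sum_e_smul (c : D.Seq β → Prop) [DecidablePred c] (m : M.carrier) :
    M.inv ((∑ μ, if c μ then (eRC μ : D.RC β) else 0) • m) =
      (∑ μ, if c μ then (eRC μ : D.RC β) else 0) • M.inv m := by
  rw [Finset.sum_smul, Finset.sum_smul, map_sum]
  refine Finset.sum_congr rfl fun μ _ => ?_
  split_ifs
  · rw [inv_val_smul]
    exact one_smul _ _
  · rw [zero_smul, zero_smul, map_zero]

theorem blkMap_val_smul_form (g : Gen D β') (f : (M.dual him).carrier) (m : M.carrier) :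
    GDual.form (M := M) (blkMap hs g.val • f) m =
      if g.par = 0 then GDual.form (M := M) f (blkMap hs g.val • m)
      else -im * GDual.form (M := M) f (M.inv (blkMap hs g.val • m)) := by
  have h1 := fun m => sum_e_smul_form (him := him) M (fun μ => D.wt (res hs μ) = β') f m
  have h2 : ∀ m : M.carrier, D.blockIdem hs • blkVal hs g • m = blkMap hs g.val • m := fun m => by
    rw [← mul_smul, idem_mul_blkVal, blkMap_val]
  rw [← h2, blkMap_val, mul_smul]
  cases g with
  | c p =>
    rw [if_neg (show ¬(Gen.c p : Gen D β').par = 0 by simp [Gen.par])]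
    refine (dualAct_c im M (blk hs p) _ m).trans ?_
    congr 1
    refine (h1 _).trans ?_
    rw [← inv_sum_e_smul]
    rfl
  | e ν =>
    refine Eq.trans ?_ (if_pos (rfl : (Gen.e ν : Gen D β').par = 0)).symm
    exact (sum_e_smul_form M (fun μ => res hs μ = ν.1) _ m).trans (h1 _)
  | x p =>
    refine Eq.trans ?_ (if_pos (rfl : (Gen.x p : Gen D β').par = 0)).symm
    exact (dualAct_of_par im M (g := .x (blk hs p)) rfl _ m).trans (h1 _)
  | s a =>
    refine Eq.trans ?_ (if_pos (rfl : (Gen.s a : Gen D β').par = 0)).symm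
    exact (dualAct_of_par im M (g := .s (blkA hs a)) rfl _ m).trans (h1 _)

end Blocks

theorem pairing_eq_zero {g₁ g₂ j₁ j₂ : ℤ × ZMod 2} {n₁ : (M₁.dual him).carrier}
    (hn₁ : n₁ ∈ (M₁.dual him).piece g₁) {n₂ : (M₂.dual him).carrier}
    (hn₂ : n₂ ∈ (M₂.dual him).piece g₂) {m₁ : M₁.carrier} (h₁ : m₁ ∈ M₁.piece j₁) {m₂ : M₂.carrier}
    (h₂ : m₂ ∈ M₂.piece j₂) (e : ¬(j₁ = -g₁ ∧ j₂ = -g₂)) :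
    pairing him M₁ M₂ (n₂ ⊗ₜ n₁) (m₁ ⊗ₜ m₂) = 0 := by
  rw [pairing_tmul]
  by_cases e₁ : j₁ = -g₁
  · have e₂ : j₂ ≠ -g₂ := fun e₂ => e ⟨e₁, e₂⟩
    exact mul_eq_zero_of_right _ (hn₂ _ e₂ _ h₂)
  · exact mul_eq_zero_of_left (hn₁ _ e₁ _ h₁) _

theorem IsTopProj.pairing_comp (hP : IsTopProj l₀ P) (h₀ : IsTop h h' l₀) {g₁ g₂ g : ℤ × ZMod 2}
    {n₁ : (M₁.dual him).carrier} (hn₁ : n₁ ∈ (M₁.dual him).piece g₁) {n₂ : (M₂.dual him).carrier}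
    (hn₂ : n₂ ∈ (M₂.dual him).piece g₂) (hg : g ≠ -((D.form β₁ β₂, 0) + (g₂ + g₁)))
    {z : Conv h M₁ M₂} (hz : z ∈ convPiece h M₁ M₂ g) :
    pairing him M₁ M₂ (n₂ ⊗ₜ n₁) (P z) = 0 := by
  rw [← comp_of_mem (conv_internal h M₁ M₂) hz]
  obtain ⟨v, hv⟩ := exists_sub_iota_mem_fil h₀ z
  have h1 : P (comp (conv_internal h M₁ M₂) g (z - (sWord l₀ : D.RC β) • iota h M₁ M₂ v)) = 0 := by
    generalize z - (sWord l₀ : D.RC β) • iota h M₁ M₂ v = y at hv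
    refine (Submodule.span_le
      (p := LinearMap.ker (P ∘ₗ comp (conv_internal h M₁ M₂) g))).2 ?_ hv
    rintro _ ⟨l, _, hl, hm, ⟨v, rfl⟩, rfl⟩
    obtain ⟨w, hw⟩ := comp_sWord_iota (h := h) l v g
    change P _ = 0
    rw [hw]
    exact hP.fil _ (sWord_mem_fil hl hm ⟨w, rfl⟩)
  rw [map_sub, map_sub, sub_eq_zero] at h1
  rw [h1]
  clear hv h1
  induction v with
  | zero => rw [map_zero, smul_zero, map_zero, map_zero, map_zero]
  | add v w hv hw => rw [map_add, smul_add, map_add, map_add, map_add, hv, hw, add_zero]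
  | tmul m₁ m₂ =>
  induction m₁ using graded_induction M₁.internal with
  | h0 => rw [TensorProduct.zero_tmul, map_zero, smul_zero, map_zero, map_zero, map_zero]
  | hadd v w hv hw =>
    rw [TensorProduct.add_tmul, map_add, smul_add, map_add, map_add, map_add, hv, hw, add_zero]
  | hV j₁ m₁ h₁ =>
  induction m₂ using graded_induction M₂.internal with
  | h0 => rw [TensorProduct.tmul_zero, map_zero, smul_zero, map_zero, map_zero, map_zero]
  | hadd v w hv hw =>
    rw [TensorProduct.tmul_add, map_add, smul_add, map_add, map_add, map_add, hv, hw, add_zero]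
  | hV j₂ m₂ h₂ =>
  have h3 := top_iota_mem h₀ h₁ h₂
  by_cases hj : g = (-D.form β₁ β₂, 0) + (j₁ + j₂)
  · rw [hj, comp_of_mem _ h3, hP.top]
    refine pairing_eq_zero hn₁ hn₂ h₁ h₂ fun e => hg ?_
    rw [hj, e.1, e.2, neg_add, neg_add, add_comm (-g₁)]
    congr 1
    exact Prod.ext rfl neg_zero.symm
  · rw [comp_of_ne _ hj h3, map_zero, map_zero]

end SGMod

end

end QuiverHeckeClifford

namespace QuiverHeckeClifford

set_option linter.unusedSectionVars false

noncomputable section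

open TensorProduct

namespace SGMod

open Datum

variable {k I : Type*} [Field k] [DecidableEq I] {D : Datum k I} {β₁ β₂ β' β : I →₀ ℕ}
  {h : β₁ + β₂ = β} {h' : β₂ + β₁ = β} {l₀ : List (Adj (ht β))} {M₁ : SGMod D β₁} {M₂ : SGMod D β₂}
  {P : Conv h M₁ M₂ →ₗ[k] M₁.carrier ⊗[k] M₂.carrier} {im : k} {him : im * im = -1}

theorem IsTopProj.mem_gdual (hP : IsTopProj l₀ P) (h₀ : IsTop h h' l₀)
    (v' : (M₂.dual him).carrier ⊗[k] (M₁.dual him).carrier) :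
    (LinearMap.lcomp k k P ∘ₗ pairing him M₁ M₂) v' ∈ (conv h M₁ M₂).gdual := by
  induction v' with
  | zero => rw [map_zero]; exact zero_mem _
  | add v w hv hw => rw [map_add]; exact add_mem hv hw
  | tmul n₂ n₁ =>
  induction n₂ using graded_induction (M₂.dual him).internal with
  | h0 => rw [TensorProduct.zero_tmul, map_zero]; exact zero_mem _
  | hadd v w hv hw => rw [TensorProduct.add_tmul, map_add]; exact add_mem hv hw
  | hV g₂ n₂ hn₂ =>
  induction n₁ using graded_induction (M₁.dual him).internal with
  | h0 => rw [TensorProduct.tmul_zero, map_zero]; exact zero_mem _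
  | hadd v w hv hw => rw [TensorProduct.tmul_add, map_add]; exact add_mem hv hw
  | hV g₁ n₁ hn₁ =>
  refine (Set.finite_singleton (-((D.form β₁ β₂, (0 : ZMod 2)) + (g₂ + g₁)))).subset ?_
  rintro g ⟨z, hz, hne⟩
  by_contra hg
  exact hne (hP.pairing_comp h₀ hn₁ hn₂ hg hz)

theorem conv_dual_ext {f f' : ((conv h M₁ M₂).dual him).carrier}
    (H : ∀ z : Conv h M₁ M₂, GDual.form (M := conv h M₁ M₂) f z = GDual.form (M := conv h M₁ M₂) f' z) :
    f = f' := GDual.ext (LinearMap.ext H)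

variable (him) in
/-- The form on the convolution product that is given by the coefficient of the longest word. -/
def topForm (hP : IsTopProj l₀ P) (h₀ : IsTop h h' l₀) :
    (M₂.dual him).carrier ⊗[k] (M₁.dual him).carrier →ₗ[k] ((conv h M₁ M₂).dual him).carrier :=
  LinearMap.codRestrict (conv h M₁ M₂).gdual (LinearMap.lcomp k k P ∘ₗ pairing him M₁ M₂)
    (hP.mem_gdual h₀)

variable (hP : IsTopProj l₀ P) (h₀ : IsTop h h' l₀)

theorem topForm_form (v' : (M₂.dual him).carrier ⊗[k] (M₁.dual him).carrier) (z : Conv h M₁ M₂) :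
    GDual.form (M := conv h M₁ M₂) (topForm him hP h₀ v') z = pairing him M₁ M₂ v' (P z) := rfl

theorem topForm_mem {g₁ g₂ : ℤ × ZMod 2} {n₁ : (M₁.dual him).carrier}
    (hn₁ : n₁ ∈ (M₁.dual him).piece g₁) {n₂ : (M₂.dual him).carrier}
    (hn₂ : n₂ ∈ (M₂.dual him).piece g₂) :
    topForm him hP h₀ (n₂ ⊗ₜ n₁) ∈
      ((conv h M₁ M₂).dual him).piece ((D.form β₁ β₂, 0) + (g₂ + g₁)) :=
  fun _ hg _ hz => hP.pairing_comp h₀ hn₁ hn₂ hg hz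

include h₀ in
theorem parE_smul_topForm (v' : (M₂.dual him).carrier ⊗[k] (M₁.dual him).carrier) :
    D.parE h' • topForm him hP h₀ v' = topForm him hP h₀ v' := by
  refine conv_dual_ext fun z => ?_
  refine (sum_e_smul_form (conv h M₁ M₂) (fun μ => D.wt (res (left_le h') μ) = β₂) _ z).trans ?_
  refine (topForm_form hP h₀ v' _).trans ((congrArg _ ?_).trans (topForm_form hP h₀ v' z).symm)
  have := hP.lMap_smul h₀ 1 z
  rw [lMap_one, actR_one] at this
  exact this

theorem lMap_smul_topForm (b : D.RC β₂) (v' : (M₂.dual him).carrier ⊗[k] (M₁.dual him).carrier) :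
    D.lMap h' b • topForm him hP h₀ v' = topForm him hP h₀ (actL _ _ b v') := by
  induction b using RC_induction generalizing v' with
  | hgen g =>
    refine conv_dual_ext fun z => ?_
    refine (blkMap_val_smul_form (conv h M₁ M₂) (left_le h') g _ z).trans ?_
    refine Eq.trans ?_ ((topForm_form hP h₀ _ z).trans (pairing_actL g v' (P z))).symm
    rw [← hP.lMap_smul h₀, ← hP.map_inv h₀]
    rfl
  | hmap r =>
    rw [Algebra.algebraMap_eq_smul_one, map_smul, map_smul, actL_one, lMap_one, smul_assoc,
      parE_smul_topForm, LinearMap.smul_apply, map_smul]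
    rfl
  | hadd a b ha hb => rw [map_add, add_smul, ha, hb, map_add, LinearMap.add_apply, map_add]
  | hmul a b ha hb => rw [show D.lMap h' (a * b) = D.lMap h' a * D.lMap h' b from blkMap_mul _ a b, mul_smul, hb, ha, actL_mul]; rfl

theorem rMap_smul_topForm (a : D.RC β₁) (v' : (M₂.dual him).carrier ⊗[k] (M₁.dual him).carrier) :
    D.rMap h' a • topForm him hP h₀ v' = topForm him hP h₀ (actR _ _ a v') := by
  induction a using RC_induction generalizing v' with
  | hgen g =>
    refine conv_dual_ext fun z => ?_
    refine (blkMap_val_smul_form (conv h M₁ M₂) (right_le h') g _ z).trans ?_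
    refine Eq.trans ?_ ((topForm_form hP h₀ _ z).trans (pairing_actR g v' (P z))).symm
    rw [← hP.rMap_smul h₀, ← hP.map_inv h₀]
    rfl
  | hmap r =>
    rw [Algebra.algebraMap_eq_smul_one, map_smul, map_smul, actR_one, rMap_one, smul_assoc,
      parE_smul_topForm, LinearMap.smul_apply, map_smul]
    rfl
  | hadd a b ha hb => rw [map_add, add_smul, ha, hb, map_add, LinearMap.add_apply, map_add]
  | hmul a b ha hb => rw [show D.rMap h' (a * b) = D.rMap h' a * D.rMap h' b from blkMap_mul _ a b, mul_smul, hb, ha, actR_mul]; rfl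

/-- The homomorphism to the dual before passing to the quotient. -/
def toDualPre : ConvPre h' (M₂.dual him) (M₁.dual him) →ₗ[D.RC β] ((conv h M₁ M₂).dual him).carrier :=
  TensorProduct.AlgebraTensorModule.lift
    (LinearMap.toSpanSingleton (D.RC β) _ (topForm him hP h₀) ∘ₗ (D.parIdeal h').subtype)

theorem toDualPre_tmul (r : D.parIdeal h') (v' : (M₂.dual him).carrier ⊗[k] (M₁.dual him).carrier) :
    toDualPre hP h₀ (r ⊗ₜ v') = r.1 • topForm him hP h₀ v' := rfl

theorem toDualPre_rel (r : D.parIdeal h') (b : D.RC β₂) {a : D.RC β₁} {g g' : ℤ × ZMod 2}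
    (ha : a ∈ D.piece β₁ g) {n₂ : (M₂.dual him).carrier} (hn : n₂ ∈ (M₂.dual him).piece g')
    (n₁ : (M₁.dual him).carrier) :
    toDualPre hP h₀ (parMul h' r b a ⊗ₜ (n₂ ⊗ₜ n₁)) =
      toDualPre hP h₀ (r ⊗ₜ (sgn k (g.2 * g'.2) • (b • n₂) ⊗ₜ[k] (a • n₁))) := by
  have h1 : sgn k (g.2 * g'.2) • (b • n₂) ⊗ₜ[k] (a • n₁) =
      actL (M₂.dual him) (M₁.dual him) b (actR (M₂.dual him) (M₁.dual him) a (n₂ ⊗ₜ n₁)) := by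
    rw [actR_tmul ha hn, map_smul, actL_tmul, TensorProduct.smul_tmul']
  refine (toDualPre_tmul hP h₀ _ _).trans (Eq.trans ?_ (toDualPre_tmul hP h₀ _ _).symm)
  rw [h1, ← lMap_smul_topForm, ← rMap_smul_topForm, ← mul_smul, ← mul_smul, mul_assoc]
  rfl

variable (him) in
/-- The homomorphism from the convolution product of the duals to the dual. -/
def toDual : Conv h' (M₂.dual him) (M₁.dual him) →ₗ[D.RC β] ((conv h M₁ M₂).dual him).carrier :=
  (convRel h' (M₂.dual him) (M₁.dual him)).liftQ (toDualPre hP h₀) (by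
    refine Submodule.span_le.2 ?_
    rintro _ ⟨r, b, a, n₂, n₁, g, g', ha, hn, rfl⟩
    exact ((toDualPre hP h₀).map_sub _ _).trans (sub_eq_zero.2 (toDualPre_rel hP h₀ r b ha hn n₁)))

theorem toDual_smul_iota (y : D.RC β) (v' : (M₂.dual him).carrier ⊗[k] (M₁.dual him).carrier) :
    toDual him hP h₀ (y • iota h' _ _ v') = y • topForm him hP h₀ v' := by
  rw [map_smul]
  congr 1
  refine (toDualPre_tmul hP h₀ (toParIdeal D h' 1) v').trans ?_
  change ((1 : D.RC β) * D.parE h') • _ = _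
  rw [one_mul, parE_smul_topForm]

theorem sWord_smul_form {M : SGMod D β} (l : List (Adj (ht β))) (f : (M.dual him).carrier)
    (m : M.carrier) :
    GDual.form (M := M) ((sWord l : D.RC β) • f) m =
      GDual.form (M := M) f ((sWord l.reverse : D.RC β) • m) := by
  induction l generalizing m with
  | nil => rw [List.reverse_nil, sWord_nil, one_smul, one_smul]
  | cons a l ih =>
    rw [sWord_cons, mul_smul, List.reverse_cons, sWord_append, sWord_cons, sWord_nil, mul_one,
      mul_smul]
    exact (dualAct_of_par im M (g := .s a) rfl _ m).trans (ih _)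

theorem toDual_sWord_form (l l' : List (Adj (ht β)))
    (v' : (M₂.dual him).carrier ⊗[k] (M₁.dual him).carrier) (v : M₁.carrier ⊗[k] M₂.carrier) :
    GDual.form (M := conv h M₁ M₂) (toDual him hP h₀ ((sWord l' : D.RC β) • iota h' _ _ v'))
        ((sWord l : D.RC β) • iota h M₁ M₂ v) =
      pairing him M₁ M₂ v' (P ((sWord (l'.reverse ++ l) : D.RC β) • iota h M₁ M₂ v)) := by
  rw [toDual_smul_iota, sWord_append, mul_smul]
  exact (sWord_smul_form l' _ _).trans (topForm_form hP h₀ v' _)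

end SGMod

end

end QuiverHeckeClifford

namespace QuiverHeckeClifford

set_option linter.unusedSectionVars false

noncomputable section

open TensorProduct

theorem Datum.wordPerm_reverse {n : ℕ} (l : List (Adj n)) (p : Fin n) :
    wordPerm l.reverse (wordPerm l p) = p := by
  induction l generalizing p with
  | nil => rfl
  | cons a l ih =>
    rw [List.reverse_cons, wordPerm_append, Equiv.Perm.mul_apply, wordPerm_cons, wordPerm_cons, ih]
    exact Equiv.swap_apply_self _ _ _

namespace SGMod

open Datum

variable {k I : Type*} [Field k] [DecidableEq I] {D : Datum k I} {β₁ β₂ β' β : I →₀ ℕ}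
  {h : β₁ + β₂ = β} {h' : β₂ + β₁ = β} {l₀ : List (Adj (ht β))} {M₁ : SGMod D β₁} {M₂ : SGMod D β₂}
  {P : Conv h M₁ M₂ →ₗ[k] M₁.carrier ⊗[k] M₂.carrier} {im : k} {him : im * im = -1}

theorem sub_iota_mem_fil {l l' : List (Adj (ht β))} (hl : Red (side h) l) (hl' : Red (side h) l')
    (e : side h ∘ wordPerm l = side h ∘ wordPerm l') (v : M₁.carrier ⊗[k] M₂.carrier) :
    (sWord l : D.RC β) • iota h M₁ M₂ v - (sWord l' : D.RC β) • iota h M₁ M₂ v ∈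
      D.fil (side h) (LinearMap.range (iota h M₁ M₂)) l.length :=
  fil_mono (by omega) ((red_unique (monotone_side h) l.length
    (fun _ _ => filGood (monotone_side h) (isStable_range_iota h M₁ M₂) _) l l' hl hl' e rfl).2 _
      ⟨v, rfl⟩)

theorem IsTopProj.apply_of_isTop (hP : IsTopProj l₀ P) (h₀ : IsTop h h' l₀) {l : List (Adj (ht β))}
    (hl : IsTop h h' l) (v : M₁.carrier ⊗[k] M₂.carrier) :
    P ((sWord l : D.RC β) • iota h M₁ M₂ v) = v := by
  refine hP.eq_of_sub_mem ?_
  rw [← hl.length_eq h h' h₀]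
  exact sub_iota_mem_fil hl.red h₀.red (funext fun p => (hl.side_eq p).trans (h₀.side_eq p).symm) v

variable (h h') in
/-- Words whose permutations send the blocks to complementary sets of positions. -/
def Complementary (l l' : List (Adj (ht β))) : Prop :=
  ∀ p, side h (wordPerm l p) = !side h' (wordPerm l' p)

theorem IsTopProj.apply_append (hP : IsTopProj l₀ P) (h₀ : IsTop h h' l₀) {l l' : List (Adj (ht β))}
    (hl : Red (side h) l) (hl' : Red (side h') l') (e : Complementary h h' l l')
    (v : M₁.carrier ⊗[k] M₂.carrier) :
    P ((sWord (l'.reverse ++ l) : D.RC β) • iota h M₁ M₂ v) = v :=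
  hP.apply_of_isTop h₀ (isTop_reverse_append h h' hl hl' e) v

theorem length_add_length (h₀ : IsTop h h' l₀) {l l' : List (Adj (ht β))}
    (hl : Red (side h) l) (hl' : Red (side h') l') (e : Complementary h h' l l') :
    l'.length + l.length = l₀.length := by
  have := (isTop_reverse_append h h' hl hl' e).length_eq h h' h₀
  rwa [List.length_append, List.length_reverse] at this

theorem IsTopProj.apply_append_eq_zero (hP : IsTopProj l₀ P) (h₀ : IsTop h h' l₀)
    {l l' : List (Adj (ht β))} (hl : Red (side h) l) (e : ¬Complementary h h' l l')
    (hlen : l'.length + l.length ≤ l₀.length) (v : M₁.carrier ⊗[k] M₂.carrier) :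
    P ((sWord (l'.reverse ++ l) : D.RC β) • iota h M₁ M₂ v) = 0 := by
  refine hP.fil _ ?_
  have hlen' : (l'.reverse ++ l).length ≤ l₀.length := by
    rwa [List.length_append, List.length_reverse]
  rcases sWord_append_mem_fil (monotone_side h) (isStable_range_iota h M₁ M₂) hl l'.reverse with
    hr | hr
  · refine sWord_mem_fil hr ?_ ⟨v, rfl⟩
    refine Nat.cast_lt.2 (lt_of_le_of_ne hlen' fun e' => e fun q => ?_)
    have := ((length_le_of_isTop h h' h₀ hr).2 e').side_eq (wordPerm l' q)
    rw [wordPerm_append, Equiv.Perm.mul_apply, wordPerm_reverse] at this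
    exact this
  · refine fil_mono ?_ (hr _ ⟨v, rfl⟩)
    rw [List.length_reverse]
    exact_mod_cast hlen

variable (h) in
/-- The sets of positions that are images of the blocks under shuffles. -/
def State : Type := {s : Fin (ht β) → Bool // ∃ l, Red (side h) l ∧ side h ∘ wordPerm l = s}

instance : Fintype (State h) := Fintype.ofFinite {s // ∃ l, Red (side h) l ∧ side h ∘ wordPerm l = s}

/-- A reduced word for a state. -/
def State.word (s : State h) : List (Adj (ht β)) := s.2.choose

theorem State.red (s : State h) : Red (side h) s.word := s.2.choose_spec.1

theorem State.side_word (s : State h) : side h ∘ wordPerm s.word = s.1 := s.2.choose_spec.2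

/-- The state of a reduced word. -/
def State.of {l : List (Adj (ht β))} (hl : Red (side h) l) : State h := ⟨_, l, hl, rfl⟩

theorem State.length_of {l : List (Adj (ht β))} (hl : Red (side h) l) :
    (State.of hl).word.length = l.length :=
  length_eq_of_red (monotone_side h) (State.red _) hl (State.side_word _)

theorem exists_sub_sum_mem_fil (j : ℕ) {z : Conv h M₁ M₂}
    (hz : z ∈ D.fil (side h) (LinearMap.range (iota h M₁ M₂)) (j + 1)) :
    ∃ u : State h → M₁.carrier ⊗[k] M₂.carrier, (∀ s, s.word.length ≠ j → u s = 0) ∧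
      z - ∑ s, (sWord s.word : D.RC β) • iota h M₁ M₂ (u s) ∈
        D.fil (side h) (LinearMap.range (iota h M₁ M₂)) j := by
  classical
  induction hz using Submodule.span_induction with
  | mem z hz =>
    obtain ⟨l, _, hl, hm, ⟨v, rfl⟩, rfl⟩ := hz
    rcases lt_or_eq_of_le (show l.length ≤ j by omega) with hj | hj
    · refine ⟨0, fun _ _ => rfl, ?_⟩
      simp only [Pi.zero_apply, map_zero, smul_zero, Finset.sum_const_zero, sub_zero]
      exact sWord_mem_fil hl (by exact_mod_cast hj) ⟨v, rfl⟩
    · refine ⟨Pi.single (State.of hl) v, fun s hs => Pi.single_eq_of_ne (fun e => hs ?_) _, ?_⟩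
      · rw [e, State.length_of, hj]
      · rw [Finset.sum_eq_single_of_mem (State.of hl) (Finset.mem_univ _), Pi.single_eq_same, ← hj]
        · exact sub_iota_mem_fil hl (State.red _) (State.side_word (State.of hl)).symm v
        · intro s _ hs
          rw [Pi.single_eq_of_ne hs, map_zero, smul_zero]
  | zero =>
    refine ⟨0, fun _ _ => rfl, ?_⟩
    simp only [Pi.zero_apply, map_zero, smul_zero, Finset.sum_const_zero, sub_zero]
    exact zero_mem _
  | add z w _ _ hz hw =>
    obtain ⟨u, hu, hz⟩ := hz
    obtain ⟨u', hu', hw⟩ := hw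
    refine ⟨u + u', fun s hs => by rw [Pi.add_apply, hu s hs, hu' s hs, add_zero], ?_⟩
    simp only [Pi.add_apply, map_add, smul_add, Finset.sum_add_distrib]
    rw [add_sub_add_comm]
    exact add_mem hz hw
  | smul r z _ hz =>
    obtain ⟨u, hu, hz⟩ := hz
    refine ⟨r • u, fun s hs => by rw [Pi.smul_apply, hu s hs, smul_zero], ?_⟩
    have := Submodule.smul_mem _ r hz
    rw [smul_sub, Finset.smul_sum] at this
    simp only [Pi.smul_apply, map_smul, smul_algebra_smul_comm]
    exact this

variable (hP : IsTopProj l₀ P) (h₀ : IsTop h h' l₀)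

/-- The evaluation of elements of the dual at a vector. -/
def dualEval (him : im * im = -1) (M : SGMod D β) (m : M.carrier) : (M.dual him).carrier →ₗ[k] k :=
  LinearMap.applyₗ m ∘ₗ GDual.form (M := M)

variable (him) in
/-- The pairing of the convolution products. -/
def toDualEval (z : Conv h M₁ M₂) : Conv h' (M₂.dual him) (M₁.dual him) →ₗ[k] k :=
  dualEval him (conv h M₁ M₂) z ∘ₗ (toDual him hP h₀).restrictScalars k

theorem toDualEval_sWord (l l' : List (Adj (ht β)))
    (v' : (M₂.dual him).carrier ⊗[k] (M₁.dual him).carrier) (v : M₁.carrier ⊗[k] M₂.carrier) :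
    toDualEval him hP h₀ ((sWord l : D.RC β) • iota h M₁ M₂ v)
        ((sWord l' : D.RC β) • iota h' (M₂.dual him) (M₁.dual him) v') =
      pairing him M₁ M₂ v' (P ((sWord (l'.reverse ++ l) : D.RC β) • iota h M₁ M₂ v)) :=
  toDual_sWord_form hP h₀ l l' v' v

theorem toDualEval_eq_zero {j : ℕ} {z : Conv h' (M₂.dual him) (M₁.dual him)}
    (hz : z ∈ D.fil (side h') (LinearMap.range (iota h' (M₂.dual him) (M₁.dual him))) j)
    {l : List (Adj (ht β))} (hl : Red (side h) l) (hlen : j + l.length ≤ l₀.length)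
    (v : M₁.carrier ⊗[k] M₂.carrier) :
    toDualEval him hP h₀ ((sWord l : D.RC β) • iota h M₁ M₂ v) z = 0 := by
  refine (Submodule.span_le (p := LinearMap.ker (toDualEval him hP h₀
    ((sWord l : D.RC β) • iota h M₁ M₂ v)))).2 ?_ hz
  rintro _ ⟨l', _, hl', hm, ⟨v', rfl⟩, rfl⟩
  refine (toDualEval_sWord hP h₀ l l' v' v).trans ?_
  have hlt : l'.length + l.length < l₀.length := by omega
  rw [hP.apply_append_eq_zero h₀ hl (fun e => hlt.ne (length_add_length h₀ hl hl' e)) hlt.le, map_zero]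

include h₀ in
theorem exists_isTop_of_isTop : ∃ l, IsTop h' h l ∧ l.length = l₀.length := by
  obtain ⟨l, hl, e⟩ := exists_complement h' h []
  refine ⟨_, isTop_reverse_append h' h (l := []) trivial hl e, ?_⟩
  have := length_add_length h₀ (l' := []) hl trivial fun p => by rw [e p, Bool.not_not]
  simpa using this

theorem toDual_injective : Function.Injective (toDual him hP h₀) := by
  rw [← LinearMap.ker_eq_bot, Submodule.eq_bot_iff]
  intro z hz
  have h0 : ∀ w, toDualEval him hP h₀ w z = 0 := fun w =>
    (congrArg (dualEval him (conv h M₁ M₂) w) hz).trans (map_zero _)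
  obtain ⟨l₁, h₁, hlen⟩ := exists_isTop_of_isTop h₀
  have key : ∀ i, ∀ j : ℕ, i + j = l₀.length + 1 →
      z ∈ D.fil (side h') (LinearMap.range (iota h' (M₂.dual him) (M₁.dual him))) j := by
    intro i
    induction i with
    | zero =>
      intro j hj
      have := conv_mem_fil h₁ z
      rwa [hlen, ← Nat.cast_succ, ← (show j = l₀.length.succ by omega)] at this
    | succ i ih =>
      intro j hj
      obtain ⟨u, hu, hz'⟩ := exists_sub_sum_mem_fil j (ih (j + 1) (by omega))
      suffices hu0 : ∀ s, u s = 0 by simpa [hu0] using hz'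
      intro s
      by_cases hs : s.word.length = j
      swap
      · exact hu s hs
      obtain ⟨l, hl, e⟩ := exists_complement h' h s.word
      have e : Complementary h h' l s.word := fun p => by rw [e p, Bool.not_not]
      have hll := length_add_length h₀ hl s.red e
      refine (injective_iff_map_eq_zero (pairing him M₁ M₂)).1 pairing_injective _
        (LinearMap.ext fun v => ?_)
      have h1 := toDualEval_eq_zero hP h₀ hz' hl (by omega) v
      rw [map_sub, h0, zero_sub, neg_eq_zero, map_sum, Finset.sum_eq_single_of_mem s (Finset.mem_univ _),
        toDualEval_sWord, hP.apply_append h₀ hl s.red e] at h1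
      · exact h1
      · intro t _ ht
        by_cases ht' : t.word.length = j
        · rw [toDualEval_sWord, hP.apply_append_eq_zero h₀ hl _ (by omega), map_zero]
          refine fun e' => ht (Subtype.ext ?_)
          rw [← s.side_word, ← t.side_word]
          exact funext fun p => Bool.not_inj ((e' p).symm.trans (e p))
        · rw [hu t ht', map_zero, smul_zero, map_zero]
  have := key (l₀.length + 1) 0 (by omega)
  rw [fil_nonpos (by simp)] at this
  exact this

variable (h M₁ M₂ him) in
/-- The restriction of a form to the translate of the tensor product by a word. -/
def wordForm (l : List (Adj (ht β))) :
    ((conv h M₁ M₂).dual him).carrier →ₗ[k] Module.Dual k (M₁.carrier ⊗[k] M₂.carrier) :=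
  LinearMap.lcomp k k ((Algebra.lsmul k k (Conv h M₁ M₂) (sWord l : D.RC β)) ∘ₗ iota h M₁ M₂) ∘ₗ
    GDual.form (M := conv h M₁ M₂)

theorem wordForm_apply (l : List (Adj (ht β))) (f : ((conv h M₁ M₂).dual him).carrier)
    (v : M₁.carrier ⊗[k] M₂.carrier) : wordForm h M₁ M₂ him l f v =
      dualEval him (conv h M₁ M₂) ((sWord l : D.RC β) • iota h M₁ M₂ v) f := rfl

theorem exists_pairing_eq_wordForm (h₁ : M₁.IsL) (h₂ : M₂.IsL) (l : List (Adj (ht β)))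
    (f : ((conv h M₁ M₂).dual him).carrier) :
    ∃ u, pairing him M₁ M₂ u = wordForm h M₁ M₂ him l f := by
  refine exists_pairing_eq h₁.finiteDimensional _ ?_
  have hfin : {g | ∃ z ∈ convPiece h M₁ M₂ g, GDual.form (M := conv h M₁ M₂) f z ≠ 0}.Finite := f.2
  refine (finite_degrees h₁ h₂ (E := ⋃ ν : D.Seq β,
    (fun g => (-wordSum (D.pairDeg ν) l, (0 : ZMod 2)) + g) ⁻¹'
      {g | ∃ z ∈ convPiece h M₁ M₂ g, GDual.form (M := conv h M₁ M₂) f z ≠ 0})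
    (Set.finite_iUnion fun ν => hfin.preimage (add_right_injective _).injOn)).subset ?_
  rintro ⟨g₁, g₂⟩ ⟨m₁, hm₁, m₂, hm₂, hne⟩
  refine ⟨⟨m₁, hm₁, ?_⟩, ⟨m₂, hm₂, ?_⟩, ?_⟩
  · rintro rfl
    exact hne (by rw [TensorProduct.zero_tmul, map_zero])
  · rintro rfl
    exact hne (by rw [TensorProduct.tmul_zero, map_zero])
  · by_contra hE
    refine hne ?_
    change GDual.form (M := conv h M₁ M₂) f ((sWord l : D.RC β) • iota h M₁ M₂ (m₁ ⊗ₜ m₂)) = 0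
    rw [smul_iota_eq_sum]
    refine (map_sum (GDual.form (M := conv h M₁ M₂) f) _ _).trans (Finset.sum_eq_zero fun ν _ => ?_)
    by_contra hν
    exact hE (Set.mem_iUnion.2 ⟨ν, _, smul_iota_mem (sWord_mul_e_mem l ν) hm₁ hm₂, hν⟩)

theorem form_eq_zero_of_mem_fil {j : ℕ} {f : ((conv h M₁ M₂).dual him).carrier}
    (hf : ∀ l, Red (side h) l → l.length < j → wordForm h M₁ M₂ him l f = 0) {z : Conv h M₁ M₂}
    (hz : z ∈ D.fil (side h) (LinearMap.range (iota h M₁ M₂)) j) :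
    GDual.form (M := conv h M₁ M₂) f z = 0 := by
  refine (Submodule.span_le (p := LinearMap.ker (GDual.form (M := conv h M₁ M₂) f))).2 ?_ hz
  rintro _ ⟨l, _, hl, hm, ⟨v, rfl⟩, rfl⟩
  exact LinearMap.congr_fun (hf l hl (by exact_mod_cast hm)) v

theorem exists_wordForm_sub_eq_zero (h₁ : M₁.IsL) (h₂ : M₂.IsL)
    (f : ((conv h M₁ M₂).dual him).carrier) (j : ℕ) (hj : j ≤ l₀.length + 1) :
    ∃ z, ∀ l, Red (side h) l → l.length < j →
      wordForm h M₁ M₂ him l (f - toDual him hP h₀ z) = 0 := by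
  classical
  induction j with
  | zero => exact ⟨0, fun l _ hl => absurd hl (Nat.not_lt_zero _)⟩
  | succ j ih =>
    obtain ⟨z, hz⟩ := ih (by omega)
    choose u hu using fun s : State h =>
      exists_pairing_eq_wordForm h₁ h₂ s.word (f - toDual him hP h₀ z)
    choose l' hl' e using fun s : State h => exists_complement h h' s.word
    refine ⟨z + ∑ s, if s.word.length = j then
      (sWord (l' s) : D.RC β) • iota h' (M₂.dual him) (M₁.dual him) (u s) else 0, fun l hl hlj => ?_⟩
    have hlen := fun s => length_add_length h₀ s.red (hl' s) (e s)
    refine LinearMap.ext fun v => ?_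
    rw [map_add, ← sub_sub, map_sub, LinearMap.sub_apply, wordForm_apply _ (toDual him hP h₀ _),
      LinearMap.zero_apply, sub_eq_zero]
    change _ = toDualEval him hP h₀ ((sWord l : D.RC β) • iota h M₁ M₂ v) _
    rw [map_sum]
    rcases lt_or_eq_of_le (Nat.lt_succ_iff.1 hlj) with hlt | heq
    · rw [hz l hl hlt, LinearMap.zero_apply, Finset.sum_eq_zero]
      intro s _
      split_ifs with hs
      · have := hlen s
        rw [toDualEval_sWord, hP.apply_append_eq_zero h₀ hl
          (fun e' => by have := length_add_length h₀ hl (hl' s) e'; omega) (by omega), map_zero]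
      · exact map_zero _
    · have h1 := State.length_of hl
      have h2 : side h ∘ wordPerm (State.of hl).word = side h ∘ wordPerm l := State.side_word _
      rw [Finset.sum_eq_single_of_mem (State.of hl) (Finset.mem_univ _), if_pos (h1.trans heq),
        toDualEval_sWord, hP.apply_append h₀ hl (hl' _)
          (fun p => (congrFun h2 p).symm.trans (e (State.of hl) p)), hu]
      · refine (sub_eq_zero.1 ((map_sub (GDual.form (M := conv h M₁ M₂) _) _ _).symm.trans
          (form_eq_zero_of_mem_fil hz ?_)))
        rw [← heq]
        exact sub_iota_mem_fil hl (State.red _) h2.symm v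
      · intro s _ hs
        split_ifs with hsj
        · have := hlen s
          rw [toDualEval_sWord, hP.apply_append_eq_zero h₀ hl _ (by omega), map_zero]
          refine fun e' => hs (Subtype.ext ?_)
          rw [← s.side_word]
          exact funext fun p => (e s p).trans (e' p).symm
        · exact map_zero _

theorem toDual_surjective (h₁ : M₁.IsL) (h₂ : M₂.IsL) : Function.Surjective (toDual him hP h₀) := by
  intro f
  obtain ⟨z, hz⟩ := exists_wordForm_sub_eq_zero hP h₀ h₁ h₂ f _ le_rfl
  refine ⟨z, (sub_eq_zero.1 (conv_dual_ext fun w => ?_)).symm⟩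
  refine (form_eq_zero_of_mem_fil hz ?_).trans ?_
  · exact_mod_cast conv_mem_fil h₀ w
  · rfl

end SGMod

end

end QuiverHeckeClifford

namespace QuiverHeckeClifford

set_option linter.unusedSectionVars false

noncomputable section

open TensorProduct

namespace SGMod

open Datum

variable {k I : Type*} [Field k] [DecidableEq I] {D : Datum k I} {β₁ β₂ β : I →₀ ℕ}
  {h : β₁ + β₂ = β} {h' : β₂ + β₁ = β} {l₀ : List (Adj (ht β))} {M₁ : SGMod D β₁} {M₂ : SGMod D β₂}
  {P : Conv h M₁ M₂ →ₗ[k] M₁.carrier ⊗[k] M₂.carrier} {im : k} {him : im * im = -1}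
  (hP : IsTopProj l₀ P) (h₀ : IsTop h h' l₀)

theorem toDual_mem {g : ℤ × ZMod 2} {z : Conv h' (M₂.dual him) (M₁.dual him)}
    (hz : z ∈ convPiece h' (M₂.dual him) (M₁.dual him) g) :
    toDual him hP h₀ z ∈ ((conv h M₁ M₂).dual him).piece ((D.form β₁ β₂, 0) + g) := by
  refine (Submodule.span_le (p := Submodule.comap ((toDual him hP h₀).restrictScalars k)
    (((conv h M₁ M₂).dual him).piece ((D.form β₁ β₂, 0) + g)))).2 ?_ hz
  rintro _ ⟨r, n₂, n₁, g₀, g₂, g₁, hr, h₂, h₁, rfl, rfl⟩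
  rw [add_left_comm]
  exact ((conv h M₁ M₂).dual him).smul_mem _ _ _ hr _ (topForm_mem hP h₀ h₁ h₂)

theorem toDual_comp (g : ℤ × ZMod 2) (z : Conv h' (M₂.dual him) (M₁.dual him)) :
    toDual him hP h₀ (comp (conv_internal h' (M₂.dual him) (M₁.dual him)) g z) =
      comp ((conv h M₁ M₂).dual him).internal ((D.form β₁ β₂, 0) + g) (toDual him hP h₀ z) := by
  induction z using graded_induction (conv_internal h' (M₂.dual him) (M₁.dual him)) with
  | h0 => simp only [map_zero]
  | hadd z w hz hw => simp only [map_add, hz, hw]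
  | hV j z hz =>
    have h1 := toDual_mem hP h₀ hz
    by_cases hg : g = j
    · subst hg
      rw [comp_of_mem _ hz, comp_of_mem _ h1]
    · rw [comp_of_ne _ hg hz, comp_of_ne _ (fun e => hg (add_left_cancel e)) h1, map_zero]

theorem mem_of_toDual_mem {g : ℤ × ZMod 2} {z : Conv h' (M₂.dual him) (M₁.dual him)}
    (hz : toDual him hP h₀ z ∈ ((conv h M₁ M₂).dual him).piece g) :
    z ∈ convPiece h' (M₂.dual him) (M₁.dual him) (g.1 - D.form β₁ β₂, g.2) := by
  have hg : g = (D.form β₁ β₂, 0) + (g.1 - D.form β₁ β₂, g.2) :=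
    Prod.ext (add_sub_cancel _ _).symm (zero_add _).symm
  have h1 : comp (conv_internal h' (M₂.dual him) (M₁.dual him)) (g.1 - D.form β₁ β₂, g.2) z = z := by
    refine toDual_injective hP h₀ ?_
    rw [toDual_comp, ← hg, comp_of_mem _ hz]
  rw [← h1]
  exact comp_mem _ _ _

/-- The dual of a convolution product is the shifted convolution product of the duals. -/
def dualConvIso (h₁ : M₁.IsL) (h₂ : M₂.IsL) :
    ((conv h M₁ M₂).dual him).Iso
      ((conv h' (M₂.dual him) (M₁.dual him)).shift (D.form β₁ β₂)) where
  toEquiv := (LinearEquiv.ofBijective (toDual him hP h₀)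
    ⟨toDual_injective hP h₀, toDual_surjective hP h₀ h₁ h₂⟩).symm
  map_mem g f hf := by
    refine mem_of_toDual_mem hP h₀ ?_
    rwa [← LinearEquiv.apply_symm_apply (LinearEquiv.ofBijective (toDual him hP h₀)
      ⟨toDual_injective hP h₀, toDual_surjective hP h₀ h₁ h₂⟩) f] at hf

end SGMod

end

end QuiverHeckeClifford

theorem mainTheorem10 {k I : Type*} [Field k] [DecidableEq I] (hchar : (2 : k) ≠ 0)
    (im : k) (him : im * im = -1) (D : QuiverHeckeClifford.Datum k I) (β₁ β₂ : I →₀ ℕ)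
    (M₁ : QuiverHeckeClifford.SGMod D β₁) (M₂ : QuiverHeckeClifford.SGMod D β₂)
    (h₁ : M₁.IsL) (h₂ : M₂.IsL) :
    Nonempty
      (((QuiverHeckeClifford.SGMod.conv rfl M₁ M₂).dual him).Iso
        ((QuiverHeckeClifford.SGMod.conv (add_comm β₂ β₁) (M₂.dual him) (M₁.dual him)).shift
          (D.form β₁ β₂))) := by
  obtain ⟨l₀, h₀⟩ := QuiverHeckeClifford.Datum.exists_isTop (β₁ := β₁) (β₂ := β₂) rfl (add_comm β₂ β₁)
  obtain ⟨P, hP⟩ := QuiverHeckeClifford.SGMod.exists_isTopProj hchar h₀ M₁ M₂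
  exact ⟨QuiverHeckeClifford.SGMod.dualConvIso hP h₀ h₁ h₂⟩
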